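/- Let $\mathcal M$ be a smooth, oriented, compact $n$-dimensional manifold, with or without boundary. Let $k\ge 1$, $\ell\ge 0$, $\ell_1,\dots,\ell_k\ge 1$ be integers with $\ell+\ell_1+\dots+\ell_k=n$. For a space $X$ of functions, $\Omega^mX(\mathcal M)$ denotes the $m$-forms whose coefficients belong to $X$ in every good coordinate system, i.e. every smooth coordinate system onto a ball or half-ball that extends smoothly past the closure of its domain. The norm $\|\cdot\|_X$ is the sum of the $X$-norms of the coefficients over a fixed finite covering of $\mathcal M$ by good coordinate systems. For $0<\alpha\le 1$ the norm of $C_{\rm b}^{0,\alpha}$ is $\|f\|_\infty+\sup_{x\ne y}|f(x)-f(y)|/|x-y|^\alpha$, and $\mathrm{Lip}=C_{\rm b}^{0,1}$. For $0<s<1$, $1<p<\infty$ the norm of the fractional Sobolev space $W^{s,p}$ is $\|f\|_p+\big(\iint |f(x)-f(y)|^p|x-y|^{-n-sp}\,dx\,dy\big)^{1/p}$. For a Lipschitz form $\gamma$, $d\gamma$ is defined almost everywhere. (1) Let $\alpha,\beta_1,\dots,\beta_k\in(0,1]$ with $\alpha+\beta_1+\dots+\beta_k>k$, and let $\lambda\in\Omega^\ell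 C_{\rm b}^{0,\alpha}(\mathcal M)$, $\gamma_i\in\Omega^{\ell_i-1}C_{\rm b}^{0,\beta_i}(\mathcal M)$. Then there is exactly one real number, denoted $\int_{\mathcal M}\lambda\wedge d\gamma_1\wedge\dots\wedge d\gamma_k$, such that $$\lim_{\varepsilon\to0^+}\int_{\mathcal M}\lambda^\varepsilon\wedge d\gamma_1^\varepsilon\wedge\dots\wedge d\gamma_k^\varepsilon=\int_{\mathcal M}\lambda\wedge d\gamma_1\wedge\dots\wedge d\gamma_k$$ for all $0<\alpha'\le\alpha$, $0<\beta_i'\le\beta_i$ with $\alpha'+\beta_1'+\dots+\beta_k'>k$ and all families $\lambda^\varepsilon\in\Omega^\ell C_{\rm b}^{0,\alpha'}(\mathcal M)$, $\gamma_i^\varepsilon\in\Omega^{\ell_i-1}\mathrm{Lip}(\mathcal M)$ ($\varepsilon>0$) such that $\lambda^\varepsilon\to\lambda$ in $C_{\rm b}^{0,\alpha'}$ and $\gamma_i^\varepsilon\to\gamma_i$ in $C_{\rm b}^{0,\beta_i'}$ as $\varepsilon\to0^+$. (2) Let $\alpha,\beta\in(0,1]$ with $\alpha+k\beta>k$. There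 is a constant $C$, independent of the forms, such that for all $\lambda,\tilde\lambda\in\Omega^\ell C_{\rm b}^{0,\alpha}(\mathcal M)$ and $\gamma_i,\tilde\gamma_i\in\Omega^{\ell_i-1}C_{\rm b}^{0,\beta}(\mathcal M)$, the integrals from (1) (with $\beta_i=\beta$) satisfy $$\Big|\int_{\mathcal M}\lambda\wedge d\gamma_1\wedge\dots\wedge d\gamma_k-\int_{\mathcal M}\tilde\lambda\wedge d\tilde\gamma_1\wedge\dots\wedge d\tilde\gamma_k\Big|\le C\big(\|\lambda-\tilde\lambda\|_{C^{0,\alpha}}\|\gamma\|_{C^{0,\beta}}+\|\tilde\lambda\|_{C^{0,\alpha}}\|\gamma-\tilde\gamma\|_{C^{0,\beta}}\big)\big(\|\gamma\|_{C^{0,\beta}}+\|\tilde\gamma\|_{C^{0,\beta}}\big)^{k-1},$$ where $\|\gamma\|_{C^{0,\beta}}=\sum_i\|\gamma_i\|_{C^{0,\beta}}$. (3) Suppose in addition that $\mathcal M$ has no boundary. Let $1<q,p_1,\dots,p_k<\infty$ with $\frac1q+\frac1{p_1}+\dots+\frac1{p_k}=1$, and let $\lambda\in\Omega^\ell W^{1-\frac1q,q}(\mathcal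 M)$, $\gamma_i\in\Omega^{\ell_i-1}W^{1-\frac1{p_i},p_i}(\mathcal M)$. Then there is exactly one real number $\int_{\mathcal M}\lambda\wedge d\gamma_1\wedge\dots\wedge d\gamma_k$ that equals $\lim_{\varepsilon\to0^+}\int_{\mathcal M}\lambda^\varepsilon\wedge d\gamma_1^\varepsilon\wedge\dots\wedge d\gamma_k^\varepsilon$ for all families $\lambda^\varepsilon\in\Omega^\ell W^{1-\frac1q,q}(\mathcal M)$, $\gamma_i^\varepsilon\in\Omega^{\ell_i-1}\mathrm{Lip}(\mathcal M)$ ($\varepsilon>0$) such that $\lambda^\varepsilon\to\lambda$ in $W^{1-\frac1q,q}$ and $\gamma_i^\varepsilon\to\gamma_i$ in $W^{1-\frac1{p_i},p_i}$ as $\varepsilon\to0^+$. -/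

import Mathlib

open Set Filter MeasureTheory
open scoped Manifold ContDiff Topology

noncomputable section

namespace DistJacobian

/-! ### Exterior algebra -/

section

variable {V : Type*} [AddCommGroup V] [Module ℝ V] [TopologicalSpace V]

/-- The tensor product `(v, w) ↦ η₀ (v_0, v_1, …) * ∏ i, η i (w_{i,0}, w_{i,1}, …)` of alternating
forms. -/
def tensorProd {k ℓ : ℕ} {deg : Fin k → ℕ} (η₀ : V [⋀^Fin ℓ]→L[ℝ] ℝ)
    (η : ∀ i, V [⋀^Fin (deg i)]→L[ℝ] ℝ) :
    ContinuousMultilinearMap ℝ (fun _ : Fin ℓ ⊕ ((i : Fin k) × Fin (deg i)) => V) ℝ where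
  toMultilinearMap := (LinearMap.mul' ℝ ℝ).compMultilinearMap
    (MultilinearMap.domCoprod η₀.toContinuousMultilinearMap.toMultilinearMap
      (MultilinearMap.compMultilinearMap (N := fun i (_ : Fin (deg i)) => V)
        (MultilinearMap.mkPiAlgebra ℝ (Fin k) ℝ)
        (fun i => (η i).toContinuousMultilinearMap.toMultilinearMap)))
  cont := by
    change Continuous fun v : Fin ℓ ⊕ ((i : Fin k) × Fin (deg i)) → V =>
      η₀ (fun j => v (Sum.inl j)) * ∏ i, η i (fun j => v (Sum.inr ⟨i, j⟩))
    exact (η₀.cont.comp (continuous_pi fun j => continuous_apply _)).mul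
      (continuous_finsetProd _ fun i _ =>
        (η i).cont.comp (continuous_pi fun j => continuous_apply _))

theorem tensorProd_apply {k ℓ : ℕ} {deg : Fin k → ℕ} (η₀ : V [⋀^Fin ℓ]→L[ℝ] ℝ)
    (η : ∀ i, V [⋀^Fin (deg i)]→L[ℝ] ℝ) (v : Fin ℓ ⊕ ((i : Fin k) × Fin (deg i)) → V) :
    tensorProd η₀ η v =
      η₀ (fun j => v (Sum.inl j)) * ∏ i, η i (fun j => v (Sum.inr ⟨i, j⟩)) :=
  rfl

/-- The positions `0, …, n - 1` grouped in consecutive blocks of lengths `ℓ, deg 0, deg 1, …`. -/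
def blockEquiv {k ℓ n : ℕ} {deg : Fin k → ℕ} (hdeg : ℓ + ∑ i, deg i = n) :
    Fin ℓ ⊕ ((i : Fin k) × Fin (deg i)) ≃ Fin n :=
  ((Equiv.sumCongr (Equiv.refl _) finSigmaFinEquiv).trans finSumFinEquiv).trans (finCongr hdeg)

/-- The wedge product `η₀ ∧ η 0 ∧ η 1 ∧ ⋯ ∧ η (k - 1)` of alternating forms of degrees `ℓ` and
`deg i`, of total degree `n`, normalised so that for `1`-forms it is the determinant:
`(η₀ ∧ η 0 ∧ ⋯)(v) = (ℓ! ∏ i, (deg i)!)⁻¹ ∑ σ, sign σ * (η₀ ⊗ η 0 ⊗ ⋯)(v ∘ σ)`. -/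
def wedgeProd {k ℓ n : ℕ} {deg : Fin k → ℕ} (hdeg : ℓ + ∑ i, deg i = n)
    (η₀ : V [⋀^Fin ℓ]→L[ℝ] ℝ) (η : ∀ i, V [⋀^Fin (deg i)]→L[ℝ] ℝ) : V [⋀^Fin n]→L[ℝ] ℝ :=
  ((ℓ.factorial : ℝ) * ∏ i, ((deg i).factorial : ℝ))⁻¹ •
    ContinuousMultilinearMap.alternatization
      ((tensorProd η₀ η).domDomCongr (blockEquiv hdeg))

end

/-! ### Manifolds, forms, and the exterior derivative

Manifolds are modelled on `EuclideanSpace ℝ (Fin n)` through a model with corners `I` whose range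
is the whole space or a closed coordinate half-space. -/

/-- `I` is the model of `n`-manifolds without boundary, or of `n`-manifolds with boundary: its
range is the whole Euclidean space or a half-space `{x | 0 ≤ x i}`. -/
def IsBoundaryModel {n : ℕ} {H : Type*} [TopologicalSpace H]
    (I : ModelWithCorners ℝ (EuclideanSpace ℝ (Fin n)) H) : Prop :=
  range I = univ ∨ ∃ i : Fin n, range I = {x | 0 ≤ x i}

section

variable {n : ℕ} {H : Type*} [TopologicalSpace H]
  (I : ModelWithCorners ℝ (EuclideanSpace ℝ (Fin n)) H)
  (M : Type*) [TopologicalSpace M] [ChartedSpace H M]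

/-- Differential forms of degree `k` on `M`, without any regularity. -/
abbrev Form (k : ℕ) : Type _ := ∀ x : M, TangentSpace I x [⋀^Fin k]→L[ℝ] ℝ

variable {M}

/-- The differential at `y` of the parametrization inverse to the coordinate system `c`. -/
def paramDeriv (c : OpenPartialHomeomorph M H) (y : EuclideanSpace ℝ (Fin n)) :
    EuclideanSpace ℝ (Fin n) →L[ℝ] TangentSpace I ((c.extend I).symm y) :=
  mfderivWithin 𝓘(ℝ, EuclideanSpace ℝ (Fin n)) I (c.extend I).symm (range I) y

/-- The coordinate frame `∂/∂x_1, …, ∂/∂x_n` of the coordinate system `c` at the point with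
coordinates `y`. -/
def coordFrame (c : OpenPartialHomeomorph M H) (y : EuclideanSpace ℝ (Fin n)) (j : Fin n) :
    TangentSpace I ((c.extend I).symm y) :=
  paramDeriv I c y (EuclideanSpace.single j 1)

variable {I}

/-- The form `γ` in the coordinate system `c`, that is, its pullback by the inverse of `c`. -/
def Form.inChart {k : ℕ} (γ : Form I M k) (c : OpenPartialHomeomorph M H)
    (y : EuclideanSpace ℝ (Fin n)) : EuclideanSpace ℝ (Fin n) [⋀^Fin k]→L[ℝ] ℝ :=
  (γ ((c.extend I).symm y)).compContinuousLinearMap (paramDeriv I c y)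

/-- The coefficient `γ_s` of `γ = ∑ γ_s dx_s` in the coordinate system `c`, where
`s = (s_1 < ⋯ < s_k)` is a multi-index. -/
def Form.coeff {k : ℕ} (γ : Form I M k) (c : OpenPartialHomeomorph M H) (s : Fin k ↪o Fin n)
    (y : EuclideanSpace ℝ (Fin n)) : ℝ :=
  γ.inChart c y (fun j => EuclideanSpace.single (s j) 1)

/-- The exterior derivative, computed in local coordinates. (At points where the coefficients are
differentiable it does not depend on the coordinate system; if they are Lipschitz this is the case
almost everywhere.) -/
def Form.d {k : ℕ} (γ : Form I M k) : Form I M (k + 1) := fun x =>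
  (extDerivWithin (γ.inChart (chartAt H x)) (range I) (extChartAt I x x)).compContinuousLinearMap
    (mfderiv I 𝓘(ℝ, EuclideanSpace ℝ (Fin n)) (extChartAt I x) x)

/-- The form `lam ∧ dγ_1 ∧ ⋯ ∧ dγ_k` of degree `n`, where `lam` has degree `ℓ` and `γ_i` has
degree `d i`. -/
def wedgeD {k ℓ : ℕ} {d : Fin k → ℕ} (hdeg : ℓ + ∑ i, (d i + 1) = n)
    (lam : Form I M ℓ) (γ : ∀ i, Form I M (d i)) : Form I M n := fun x =>
  wedgeProd hdeg (lam x) fun i => (γ i).d x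

/-! ### Orientations and integration -/

/-- The sign (`1`, `-1`, or `0` if it is not a basis) of a family `v` of `n` vectors with respect
to an orientation. -/
def frameSign {V : Type*} [AddCommGroup V] [Module ℝ V] (o : Orientation ℝ V (Fin n))
    (v : Fin n → V) : ℝ :=
  SignType.sign (o.someVector v)

variable (I M)

/-- An orientation of the manifold `M`: an orientation of every tangent space that is locally
constant with respect to coordinate frames. -/
structure ManifoldOrientation where
  /-- the orientation of the tangent space at `x` -/
  at' : ∀ x : M, Orientation ℝ (TangentSpace I x) (Fin n)
  /-- every coordinate frame has locally constant sign -/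
  locallyConst : ∀ x : M, ∀ᶠ y in 𝓝[range I] (extChartAt I x x),
    frameSign (at' ((extChartAt I x).symm y)) (coordFrame I (chartAt H x) y) =
      frameSign (at' ((extChartAt I x).symm (extChartAt I x x)))
        (coordFrame I (chartAt H x) (extChartAt I x x))

/-- A smooth partition of unity subordinate to the domains of the preferred charts. -/
def chartPartition [CompactSpace M] [T2Space M] [IsManifold I ∞ M] :
    SmoothPartitionOfUnity M I M univ :=
  (SmoothPartitionOfUnity.exists_isSubordinate_chartAt_source I M).choose

variable {I M}

/-- The integral of an `n`-form `η` over the compact oriented `n`-manifold `M`: with a partition of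
unity `ρ`, the sum over `p` of the integrals of `ρ_p η (∂/∂x_1, …, ∂/∂x_n)` over the image of the
chart around `p`, with the sign that says whether this chart preserves the orientation. -/
def formIntegral [CompactSpace M] [T2Space M] [IsManifold I ∞ M] (o : ManifoldOrientation I M)
    (η : Form I M n) : ℝ :=
  ∑ᶠ p : M, ∫ y in (extChartAt I p).target,
    chartPartition I M p ((extChartAt I p).symm y) *
      (frameSign (o.at' ((extChartAt I p).symm y)) (coordFrame I (chartAt H p) y) *
        η ((extChartAt I p).symm y) (coordFrame I (chartAt H p) y))

/-! ### Good coordinate systems and spaces of forms -/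

variable (I M)

/-- A good coordinate system: a smooth coordinate system `chart` together with a closed ball (inside
the interior of the model, or centred at a boundary point of the model, where it is a half-ball)
that is contained in the image of `chart`. Up to translation and scaling, the coordinate system is
its restriction to the open (half-)ball, so that it extends smoothly past the closure of its
domain. -/
structure GoodChart where
  /-- the larger coordinate system -/
  chart : OpenPartialHomeomorph M H
  chart_mem : chart ∈ IsManifold.maximalAtlas I ∞ M
  /-- the centre of the ball -/
  center : EuclideanSpace ℝ (Fin n)
  /-- the radius of the ball -/
  radius : ℝ
  radius_pos : 0 < radius
  ball_or_halfBall : Metric.closedBall center radius ⊆ interior (range I) ∨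
    center ∈ frontier (range I)
  subset_target : Metric.closedBall center radius ∩ range I ⊆ (chart.extend I).target

variable {I M}

/-- The open ball or half-ball that a good coordinate system maps onto. -/
def GoodChart.image (c : GoodChart I M) : Set (EuclideanSpace ℝ (Fin n)) :=
  Metric.ball c.center c.radius ∩ range I

/-- The domain in `M` of a good coordinate system. -/
def GoodChart.domain (c : GoodChart I M) : Set M := (c.chart.extend I).symm '' c.image

variable (I M)

/-- A finite covering of `M` by good coordinate systems. -/
structure GoodCover where
  /-- the number of coordinate systems -/
  card : ℕ
  /-- the coordinate systems -/
  chart : Fin card → GoodChart I M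
  covers : ⋃ i, (chart i).domain = univ

variable {I M}

/-- The norm on forms that a norm `N` on functions on (half-)balls induces through a finite covering
by good coordinate systems: the sum of the norms of all coefficients. -/
def GoodCover.norm (A : GoodCover I M)
    (N : Set (EuclideanSpace ℝ (Fin n)) → (EuclideanSpace ℝ (Fin n) → ℝ) → ENNReal)
    {k : ℕ} (γ : Form I M k) : ENNReal :=
  ∑ i, ∑ s : Fin k ↪o Fin n, N (A.chart i).image (γ.coeff (A.chart i).chart s)

/-- All coefficients of `γ`, in all good coordinate systems, satisfy `P`. -/
def Form.HasCoeffs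
    (P : Set (EuclideanSpace ℝ (Fin n)) → (EuclideanSpace ℝ (Fin n) → ℝ) → Prop)
    {k : ℕ} (γ : Form I M k) : Prop :=
  ∀ (c : GoodChart I M) (s : Fin k ↪o Fin n), P c.image (γ.coeff c.chart s)

end

/-! ### Function spaces on subsets of Euclidean space -/

section

variable {n : ℕ}

/-- The norm `‖f‖_∞ + [f]_α` of `C_b^{0,α}(D)`. -/
def holderNorm (α : NNReal) (D : Set (EuclideanSpace ℝ (Fin n)))
    (f : EuclideanSpace ℝ (Fin n) → ℝ) : ENNReal :=
  (⨆ y : D, ‖f y‖ₑ) + eHolderNorm α (D.domRestrict f)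

/-- The function `f` belongs to `C_b^{0,α}(D)`. -/
def MemHolderSpace (α : NNReal) (D : Set (EuclideanSpace ℝ (Fin n)))
    (f : EuclideanSpace ℝ (Fin n) → ℝ) : Prop :=
  holderNorm α D f < ⊤

/-- The norm `‖f‖_p + [f]_{s,p}` of the fractional Sobolev space `W^{s,p}(D)`. -/
def sobolevNorm (s p : ℝ) (D : Set (EuclideanSpace ℝ (Fin n)))
    (f : EuclideanSpace ℝ (Fin n) → ℝ) : ENNReal :=
  eLpNorm f (ENNReal.ofReal p) (volume.restrict D) +
    (∫⁻ x in D, ∫⁻ y in D, ‖f x - f y‖ₑ ^ p / ‖x - y‖ₑ ^ (n + s * p)) ^ (1 / p)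

/-- The function `f` belongs to the fractional Sobolev space `W^{s,p}(D)`. -/
def MemSobolevSpace (s p : ℝ) (D : Set (EuclideanSpace ℝ (Fin n)))
    (f : EuclideanSpace ℝ (Fin n) → ℝ) : Prop :=
  AEStronglyMeasurable f (volume.restrict D) ∧ sobolevNorm s p D f < ⊤

end

/-! ### The generalized integrals -/

section

variable {n : ℕ} {H : Type*} [TopologicalSpace H]
  {I : ModelWithCorners ℝ (EuclideanSpace ℝ (Fin n)) H}
  {M : Type*} [TopologicalSpace M] [ChartedSpace H M]
  [CompactSpace M] [T2Space M] [IsManifold I ∞ M]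

/-- `L` is the value of `∫_M lam ∧ dγ_1 ∧ ⋯ ∧ dγ_k` for Hölder forms `lam ∈ C^{0,α}` and
`γ_i ∈ C^{0,β_i}`: for all admissible smaller exponents `α'`, `β_i'`, the integrals of
`lam^ε ∧ dγ_1^ε ∧ ⋯ ∧ dγ_k^ε` converge to `L` for all approximations `lam^ε → lam` in `C^{0,α'}` and
all Lipschitz approximations `γ_i^ε → γ_i` in `C^{0,β_i'}`. -/
def IsHolderIntegral (o : ManifoldOrientation I M) (A : GoodCover I M) {k ℓ : ℕ} {d : Fin k → ℕ}
    (hdeg : ℓ + ∑ i, (d i + 1) = n) (α : NNReal) (β : Fin k → NNReal)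
    (lam : Form I M ℓ) (γ : ∀ i, Form I M (d i)) (L : ℝ) : Prop :=
  ∀ (α' : NNReal) (β' : Fin k → NNReal), 0 < α' → α' ≤ α → (∀ i, 0 < β' i ∧ β' i ≤ β i) →
    (k : NNReal) < α' + ∑ i, β' i →
  ∀ (lamε : ℝ → Form I M ℓ) (γε : ℝ → ∀ i, Form I M (d i)),
    (∀ ε > 0, (lamε ε).HasCoeffs (MemHolderSpace α')) →
    (∀ ε > 0, ∀ i, (γε ε i).HasCoeffs (MemHolderSpace 1)) →
    Tendsto (fun ε => A.norm (holderNorm α') (lamε ε - lam)) (𝓝[>] 0) (𝓝 0) →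
    (∀ i, Tendsto (fun ε => A.norm (holderNorm (β' i)) (γε ε i - γ i)) (𝓝[>] 0) (𝓝 0)) →
    Tendsto (fun ε => formIntegral o (wedgeD hdeg (lamε ε) (γε ε))) (𝓝[>] 0) (𝓝 L)

/-- `L` is the value of `∫_M lam ∧ dγ_1 ∧ ⋯ ∧ dγ_k` for fractional Sobolev forms
`lam ∈ W^{1-1/q,q}` and `γ_i ∈ W^{1-1/p_i,p_i}`: the integrals of `lam^ε ∧ dγ_1^ε ∧ ⋯ ∧ dγ_k^ε`
converge to `L` for all approximations `lam^ε → lam` in `W^{1-1/q,q}` and all Lipschitz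
approximations `γ_i^ε → γ_i` in `W^{1-1/p_i,p_i}`. -/
def IsSobolevIntegral (o : ManifoldOrientation I M) (A : GoodCover I M) {k ℓ : ℕ} {d : Fin k → ℕ}
    (hdeg : ℓ + ∑ i, (d i + 1) = n) (q : ℝ) (p : Fin k → ℝ)
    (lam : Form I M ℓ) (γ : ∀ i, Form I M (d i)) (L : ℝ) : Prop :=
  ∀ (lamε : ℝ → Form I M ℓ) (γε : ℝ → ∀ i, Form I M (d i)),
    (∀ ε > 0, (lamε ε).HasCoeffs (MemSobolevSpace (1 - 1 / q) q)) →
    (∀ ε > 0, ∀ i, (γε ε i).HasCoeffs (MemHolderSpace 1)) →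
    Tendsto (fun ε => A.norm (sobolevNorm (1 - 1 / q) q) (lamε ε - lam)) (𝓝[>] 0) (𝓝 0) →
    (∀ i, Tendsto (fun ε => A.norm (sobolevNorm (1 - 1 / p i) (p i)) (γε ε i - γ i))
      (𝓝[>] 0) (𝓝 0)) →
    Tendsto (fun ε => formIntegral o (wedgeD hdeg (lamε ε) (γε ε))) (𝓝[>] 0) (𝓝 L)

end

end DistJacobian

end

/-! Everything rests on one multilinear estimate: for Lipschitz `γ i`, the integral of `lam ∧ dγ_1 ∧
⋯ ∧ dγ_k` is at most a constant times the product of the weak norms (Hölder or fractional Sobolev)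
of `lam` and the `γ i`. By multilinearity it controls differences, so integrals along any
approximating family are Cauchy and families with the same limit give the same value.

In coordinates the integral is a combination of integrals of `u_0 det (∂u_i)`. Determinants are
divergences (`integral_jac_eq_zero`), so integration by parts exchanges `u_0` with any `u_i`
(`integral_mul_jac_swap`): each of the `k + 1` functions can be the one that is not differentiated.
Replace all `u_s` by their averages at scale `2 ^ (-m)` and pass from one scale to the next,
exchanging one function at a time. A function of regularity `σ s` changes by about `2 ^ (-(m * σ
s))`, and the derivative of its average has size about `2 ^ (m * (1 - σ s))`. If the changing
function is left undifferentiated, each step costs `2 ^ (-(m * (∑ σ - k)))` times a product of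
normalized sizes, whichever slot changes (`enorm_jacIntegral_le_sum`). For Hölder functions `∑ σ >
k` and the series is geometric (`enorm_integral_mul_jac_le_holder`). For Sobolev functions `σ s = 1
- 1 / p s`, so `∑ σ = k` and nothing decays; but the normalized sizes of `u_s` form a sequence in
`ℓ^{p s}`, which is what the Gagliardo seminorm measures (`tsum_modulus_le`), and Hölder's
inequality for sums applies because `∑ 1 / p s = 1` (`enorm_integral_mul_jac_le_sobolev`).

A boundary creates no boundary terms. On a half-space `R` the `u_i` are averaged with a kernel that
looks into `R`, while `u_0`, extended by zero, is averaged with the reflected kernel and stays zero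
outside `R`. The jump of `u_0` at the boundary only matters in `L^1`, where it costs one full power
of the scale; hence `u_0` is measured in `L^1` and the others in the supremum norm.

To pass to the manifold, a `FormLocalization` splits the forms into pieces in small (half-)balls:
`lam` is multiplied by cutoffs that sum to one, the `γ i` by bumps that equal one near the supports
of the cutoffs, so no cutoff is ever differentiated. The norms of the pieces are comparable with the
norms of the forms because both kinds of norms are compatible with Lipschitz factors and
bi-Lipschitz coordinate changes (`IsGauge`). This gives the estimates `exists_enorm_formIntegral_le`
and `exists_enorm_formIntegral_sub_le`.

Finally, averaging the pieces yields Lipschitz reference approximations of the `γ i`. They converge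
in the Sobolev norm, but in the Hölder case only with smaller exponents; since the condition on the
exponents is open, they can be lowered slightly. The integral is the limit along the reference
family, and every admissible family is compared with it. -/

namespace DistJacobian

/-! ### Jacobian determinants of smooth functions -/

section Jacobian

variable {n k : ℕ}

/-- The partial derivative `∂f/∂x_j`. -/
noncomputable def pd (j : Fin n) (f : EuclideanSpace ℝ (Fin n) → ℝ)
    (x : EuclideanSpace ℝ (Fin n)) : ℝ :=
  fderiv ℝ f x (EuclideanSpace.single j 1)

/-- The minor `det (∂u_i/∂x_{c j})` of the Jacobian matrix of `u`. -/
noncomputable def jac (c : Fin k → Fin n) (u : Fin k → EuclideanSpace ℝ (Fin n) → ℝ)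
    (x : EuclideanSpace ℝ (Fin n)) : ℝ :=
  Matrix.det (Matrix.of fun i j => pd (c j) (u i) x)

theorem contDiff_pd {f : EuclideanSpace ℝ (Fin n) → ℝ} (hf : ContDiff ℝ ∞ f) (j : Fin n) :
    ContDiff ℝ ∞ (pd j f) :=
  (hf.fderiv_right (m := ∞) le_rfl).clm_apply contDiff_const

theorem HasCompactSupport.pd {f : EuclideanSpace ℝ (Fin n) → ℝ} (hf : HasCompactSupport f)
    (j : Fin n) : HasCompactSupport (pd j f) :=
  hf.fderiv_apply (𝕜 := ℝ) _

theorem pd_comm {f : EuclideanSpace ℝ (Fin n) → ℝ} (hf : ContDiff ℝ ∞ f) (i j : Fin n)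
    (x : EuclideanSpace ℝ (Fin n)) : pd i (pd j f) x = pd j (pd i f) x := by
  have h1 : DifferentiableAt ℝ (fderiv ℝ f) x :=
    ((hf.fderiv_right (m := ∞) le_rfl).differentiable (by simp)).differentiableAt
  have key : ∀ a b : Fin n, DistJacobian.pd a (DistJacobian.pd b f) x =
      fderiv ℝ (fderiv ℝ f) x (EuclideanSpace.single a 1) (EuclideanSpace.single b 1) := by
    intro a b
    unfold DistJacobian.pd
    rw [fderiv_clm_apply h1 (by fun_prop)]
    simp
  rw [key, key]
  exact (hf.contDiffAt.isSymmSndFDerivAt (by simpa using ENat.LEInfty.out)).eq _ _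

theorem pd_mul {f g : EuclideanSpace ℝ (Fin n) → ℝ} {x : EuclideanSpace ℝ (Fin n)}
    (hf : DifferentiableAt ℝ f x) (hg : DifferentiableAt ℝ g x) (j : Fin n) :
    pd j (fun y => f y * g y) x = f x * pd j g x + g x * pd j f x := by
  unfold pd
  rw [fderiv_fun_mul hf hg]
  simp

theorem pd_finset_prod {ι : Type*} [DecidableEq ι] {s : Finset ι}
    {f : ι → EuclideanSpace ℝ (Fin n) → ℝ}
    {x : EuclideanSpace ℝ (Fin n)} (hf : ∀ i, DifferentiableAt ℝ (f i) x) (j : Fin n) :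
    pd j (fun y => ∏ i ∈ s, f i y) x = ∑ i ∈ s, pd j (f i) x * ∏ l ∈ s.erase i, f l x := by
  unfold pd
  rw [fderiv_finsetProd (fun i _ => hf i)]
  simp only [FunLike.coe_sum, Finset.sum_apply, FunLike.coe_smul, Pi.smul_apply, smul_eq_mul]
  exact Finset.sum_congr rfl fun i _ => mul_comm _ _

/-- After transposing, the permutation acts on the directions, so every factor carries exactly one
function, as Hölder's inequality requires. -/
theorem jac_eq_sum (c : Fin k → Fin n) (u : Fin k → EuclideanSpace ℝ (Fin n) → ℝ)
    (x : EuclideanSpace ℝ (Fin n)) :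
    jac c u x = ∑ σ : Equiv.Perm (Fin k), ((Equiv.Perm.sign σ : ℤ) : ℝ) *
      ∏ i, pd (c (σ i)) (u i) x := by
  rw [jac, ← Matrix.det_transpose, Matrix.det_apply']
  rfl

theorem contDiff_jac (c : Fin k → Fin n) {u : Fin k → EuclideanSpace ℝ (Fin n) → ℝ}
    (hu : ∀ i, ContDiff ℝ ∞ (u i)) : ContDiff ℝ ∞ (jac c u) := by
  have : jac c u = fun x => ∑ σ : Equiv.Perm (Fin k), ((Equiv.Perm.sign σ : ℤ) : ℝ) *
      ∏ i, pd (c (σ i)) (u i) x := funext fun x => jac_eq_sum c u x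
  rw [this]
  refine ContDiff.sum fun σ _ => contDiff_const.mul (contDiff_prod fun i _ => contDiff_pd (hu i) _)

/-- Jacobian determinants are divergences. -/
theorem integral_jac_eq_zero (c : Fin k → Fin n) {w : Fin k → EuclideanSpace ℝ (Fin n) → ℝ}
    (hw : ∀ i, ContDiff ℝ ∞ (w i)) (i : Fin k) (hi : HasCompactSupport (w i)) :
    ∫ x, jac c w x = 0 := by
  classical
  -- Only the `i`-th factor has compact support; one integration by parts moves its derivative onto
  -- the product `h σ` of the others.
  set h : Equiv.Perm (Fin k) → EuclideanSpace ℝ (Fin n) → ℝ := fun σ x =>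
    ∏ l ∈ Finset.univ.erase i, pd (c (σ l)) (w l) x with hh
  have hsm : ∀ σ, ContDiff ℝ ∞ (h σ) := fun σ => contDiff_prod fun l _ => contDiff_pd (hw l) _
  have e1 : ∀ x, jac c w x = ∑ σ : Equiv.Perm (Fin k), ((Equiv.Perm.sign σ : ℤ) : ℝ) *
      (pd (c (σ i)) (w i) x * h σ x) := by
    intro x
    rw [jac_eq_sum]
    refine Finset.sum_congr rfl fun σ _ => ?_
    rw [hh, Finset.mul_prod_erase _ (fun l => pd (c (σ l)) (w l) x) (Finset.mem_univ i)]
  have i1 : ∀ σ, Integrable (fun x => pd (c (σ i)) (w i) x * h σ x) := fun σ =>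
    ((contDiff_pd (hw i) _).mul (hsm σ)).continuous.integrable_of_hasCompactSupport
      ((HasCompactSupport.pd hi _).mul_right)
  have i2 : ∀ σ, Integrable (fun x => w i x * pd (c (σ i)) (h σ) x) := fun σ =>
    ((hw i).mul (contDiff_pd (hsm σ) _)).continuous.integrable_of_hasCompactSupport
      (hi.mul_right)
  have i3 : ∀ σ, Integrable (fun x => w i x * h σ x) := fun σ =>
    ((hw i).mul (hsm σ)).continuous.integrable_of_hasCompactSupport (hi.mul_right)
  have parts : ∀ σ, ∫ x, pd (c (σ i)) (w i) x * h σ x = -∫ x, w i x * pd (c (σ i)) (h σ) x := by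
    intro σ
    have := integral_mul_fderiv_eq_neg_fderiv_mul_of_integrable (μ := volume) (i1 σ) (i2 σ) (i3 σ)
      (fun x _ => ((hw i).differentiable (by simp)).differentiableAt)
      (fun x _ => ((hsm σ).differentiable (by simp)).differentiableAt)
    unfold pd at *
    rw [this, neg_neg]
  -- The cofactors are divergence free: in the term where the new derivative falls on `w l`,
  -- composing `σ` with the transposition of `i` and `l` exchanges the two derivatives of `w l` and
  -- changes the sign, so the signed sum equals its negative.
  have pt : ∀ x, ∑ σ : Equiv.Perm (Fin k), ((Equiv.Perm.sign σ : ℤ) : ℝ) *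
      pd (c (σ i)) (h σ) x = 0 := by
    intro x
    have e2 : ∀ σ : Equiv.Perm (Fin k), pd (c (σ i)) (h σ) x =
        ∑ l ∈ Finset.univ.erase i, pd (c (σ i)) (pd (c (σ l)) (w l)) x *
          ∏ m ∈ (Finset.univ.erase i).erase l, pd (c (σ m)) (w m) x := fun σ =>
      pd_finset_prod (fun l => ((contDiff_pd (hw l) _).differentiable (by simp)).differentiableAt) _
    simp_rw [e2, Finset.mul_sum]
    rw [Finset.sum_comm]
    refine Finset.sum_eq_zero fun l hl => ?_
    have hli : l ≠ i := Finset.ne_of_mem_erase hl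
    set F : Equiv.Perm (Fin k) → ℝ := fun σ => ((Equiv.Perm.sign σ : ℤ) : ℝ) *
      (pd (c (σ i)) (pd (c (σ l)) (w l)) x *
          ∏ m ∈ (Finset.univ.erase i).erase l, pd (c (σ m)) (w m) x) with hF
    have hneg : ∀ σ, F (σ * Equiv.swap i l) = - F σ := by
      intro σ
      have hprod : ∏ m ∈ (Finset.univ.erase i).erase l,
            pd (c ((σ * Equiv.swap i l) m)) (w m) x =
          ∏ m ∈ (Finset.univ.erase i).erase l, pd (c (σ m)) (w m) x := by
        refine Finset.prod_congr rfl fun m hm => ?_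
        have h1 := Finset.ne_of_mem_erase hm
        have h2 := Finset.ne_of_mem_erase (Finset.mem_of_mem_erase hm)
        rw [Equiv.Perm.mul_apply, Equiv.swap_apply_of_ne_of_ne h2 h1]
      simp only [hF]
      rw [hprod]
      simp only [Equiv.Perm.sign_mul, Equiv.Perm.sign_swap hli.symm, Equiv.Perm.mul_apply,
        Equiv.swap_apply_left, Equiv.swap_apply_right]
      rw [pd_comm (hw l)]
      push_cast
      ring
    have hS : ∑ σ, F σ = ∑ σ, F (σ * Equiv.swap i l) :=
      (Equiv.sum_comp (Equiv.mulRight (Equiv.swap i l)) F).symm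
    simp_rw [hneg, Finset.sum_neg_distrib] at hS
    linarith
  simp_rw [e1]
  rw [integral_finsetSum _ fun σ _ => (i1 σ).const_mul _]
  simp_rw [integral_const_mul, parts, mul_neg, ← integral_const_mul, Finset.sum_neg_distrib]
  rw [← integral_finsetSum _ fun σ _ => (i2 σ).const_mul _]
  rw [integral_congr_ae (g := fun _ => (0 : ℝ)), integral_zero, neg_zero]
  refine Eventually.of_forall fun x => ?_
  dsimp only
  rw [← mul_zero (w i x), ← pt x, Finset.mul_sum]
  exact Finset.sum_congr rfl fun σ _ => by ring

/-- The product rule splits row `i` into two summands, and the determinant is linear in that row. -/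
theorem jac_update_mul (c : Fin k → Fin n) {u : Fin k → EuclideanSpace ℝ (Fin n) → ℝ}
    {g : EuclideanSpace ℝ (Fin n) → ℝ} (i : Fin k) (x : EuclideanSpace ℝ (Fin n))
    (hu : DifferentiableAt ℝ (u i) x) (hg : DifferentiableAt ℝ g x) :
    jac c (Function.update u i fun y => g y * u i y) x =
      g x * jac c u x + u i x * jac c (Function.update u i g) x := by
  have row : ∀ v : EuclideanSpace ℝ (Fin n) → ℝ,
      (Matrix.of fun l j => pd (c j) (Function.update u i v l) x) =
        (Matrix.of fun l j => pd (c j) (u l) x).updateRow i fun j => pd (c j) v x := by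
    intro v
    ext l j
    by_cases hl : l = i
    · subst hl; simp
    · simp [Function.update_of_ne hl, Matrix.updateRow_ne hl]
  simp only [jac]
  rw [row, row]
  have : (fun j => pd (c j) (fun y => g y * u i y) x) =
      g x • (fun j => pd (c j) (u i) x) + u i x • fun j => pd (c j) g x := by
    ext j
    simp [pd_mul hg hu]
  rw [this, Matrix.det_updateRow_add, Matrix.det_updateRow_smul, Matrix.det_updateRow_smul]
  congr 3
  have h2 := Matrix.updateRow_eq_self (Matrix.of fun l j => pd (c j) (u l) x) i
  exact h2

/-- Antisymmetry of the integral of `g det (∂u)`. -/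
theorem integral_mul_jac_swap (c : Fin k → Fin n) {u : Fin k → EuclideanSpace ℝ (Fin n) → ℝ}
    {g : EuclideanSpace ℝ (Fin n) → ℝ} (hu : ∀ i, ContDiff ℝ ∞ (u i)) (hg : ContDiff ℝ ∞ g)
    (hgc : HasCompactSupport g) (i : Fin k) :
    ∫ x, g x * jac c u x = -∫ x, u i x * jac c (Function.update u i g) x := by
  have hup : ∀ v, ContDiff ℝ ∞ v → ∀ l, ContDiff ℝ ∞ (Function.update u i v l) := by
    intro v hv l
    by_cases hl : l = i
    · subst hl; simpa using hv
    · simpa [Function.update_of_ne hl] using hu l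
  -- With `g * u i` in row `i` that row has compact support, so the integral vanishes; the product
  -- rule splits it into the two integrals to be compared.
  have h0 := integral_jac_eq_zero c (w := Function.update u i fun y => g y * u i y)
    (hup _ (hg.mul (hu i))) i (by rw [Function.update_self]; exact hgc.mul_right)
  have i1 : Integrable fun x => g x * jac c u x :=
    (hg.mul (contDiff_jac c hu)).continuous.integrable_of_hasCompactSupport hgc.mul_right
  have hc : HasCompactSupport (jac c (Function.update u i g)) := by
    refine hgc.mono' fun x hx => ?_
    by_contra hx'
    refine hx (Matrix.det_eq_zero_of_row_eq_zero i fun j => ?_)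
    have : fderiv ℝ g x = 0 := by
      have := notMem_tsupport_iff_eventuallyEq.1 hx'
      rw [this.fderiv_eq]; simp
    simp [pd, this]
  have i2 : Integrable fun x => u i x * jac c (Function.update u i g) x :=
    ((hu i).mul (contDiff_jac c (hup g hg))).continuous.integrable_of_hasCompactSupport
      hc.mul_left
  have e : ∀ x, jac c (Function.update u i fun y => g y * u i y) x =
      g x * jac c u x + u i x * jac c (Function.update u i g) x := fun x =>
    jac_update_mul c i x ((hu i).differentiable (by simp)).differentiableAt
      (hg.differentiable (by simp)).differentiableAt
  simp_rw [e] at h0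
  rw [integral_add i1 i2] at h0
  linarith

/-- The integral of `f_0 det (∂f_i/∂x_{c j})`. -/
noncomputable def jacIntegral (c : Fin k → Fin n) (f : Fin (k + 1) → EuclideanSpace ℝ (Fin n) → ℝ) :
    ℝ :=
  ∫ x, f 0 x * jac c (fun i => f i.succ) x

theorem pd_eq_zero_of_notMem {R : Set (EuclideanSpace ℝ (Fin n))} (hR : IsClosed R)
    {f : EuclideanSpace ℝ (Fin n) → ℝ} (hf : ∀ x ∉ R, f x = 0) (j : Fin n)
    {x : EuclideanSpace ℝ (Fin n)} (hx : x ∉ R) : pd j f x = 0 := by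
  have : f =ᶠ[𝓝 x] fun _ => 0 := by
    filter_upwards [hR.isOpen_compl.mem_nhds hx] with y hy using hf y hy
  simp [pd, this.fderiv_eq]

theorem enorm_finsetProd {ι : Type*} (S : Finset ι) (f : ι → ℝ) :
    ‖∏ i ∈ S, f i‖ₑ = ∏ i ∈ S, ‖f i‖ₑ := by
  classical
  induction S using Finset.induction_on with
  | empty => simp
  | insert i S hi ih => rw [Finset.prod_insert hi, Finset.prod_insert hi, enorm_mul, ih]

/-- Here `hG` plays the role of Hölder's inequality for unspecified gauges. It is applied to each of
the `k!` terms of the determinant, all of which have the same bound. -/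
theorem enorm_integral_le_of_sum_prod {R : Set (EuclideanSpace ℝ (Fin n))}
    {G : Fin (k + 1) → (EuclideanSpace ℝ (Fin n) → ℝ) → ENNReal}
    (hG : ∀ h : Fin (k + 1) → EuclideanSpace ℝ (Fin n) → ℝ, (∀ i, Continuous (h i)) →
      ∫⁻ x in R, ∏ i, ‖h i x‖ₑ ≤ ∏ i, G i (h i))
    {F : EuclideanSpace ℝ (Fin n) → ℝ} (hF : ∀ x ∉ R, F x = 0)
    {h : Equiv.Perm (Fin k) → Fin (k + 1) → EuclideanSpace ℝ (Fin n) → ℝ}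
    (hh : ∀ σ i, Continuous (h σ i))
    (hFh : ∀ x, F x = ∑ σ : Equiv.Perm (Fin k), ((Equiv.Perm.sign σ : ℤ) : ℝ) * ∏ i, h σ i x)
    {D : Fin (k + 1) → ENNReal} (hD : ∀ σ i, G i (h σ i) ≤ D i) :
    ‖∫ x, F x‖ₑ ≤ k.factorial * ∏ i, D i := by
  have h1 : ∫ x, F x = ∫ x in R, F x :=
    (setIntegral_eq_integral_of_forall_compl_eq_zero fun x hx => hF x hx).symm
  rw [h1]
  calc ‖∫ x in R, F x‖ₑ ≤ ∫⁻ x in R, ‖F x‖ₑ := enorm_integral_le_lintegral_enorm _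
    _ ≤ ∫⁻ x in R, ∑ σ : Equiv.Perm (Fin k), ∏ i, ‖h σ i x‖ₑ := by
        refine lintegral_mono fun x => ?_
        rw [hFh]
        refine (enorm_sum_le _ _).trans (Finset.sum_le_sum fun σ _ => ?_)
        rw [enorm_mul, enorm_finsetProd]
        rcases Int.units_eq_one_or (Equiv.Perm.sign σ) with hs | hs <;> simp [hs]
    _ = ∑ σ : Equiv.Perm (Fin k), ∫⁻ x in R, ∏ i, ‖h σ i x‖ₑ := by
        refine lintegral_finsetSum _ fun σ _ => ?_
        exact Finset.measurable_prod _ fun i _ => (hh σ i).enorm.measurable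
    _ ≤ ∑ σ : Equiv.Perm (Fin k), ∏ i, D i :=
        Finset.sum_le_sum fun σ _ => (hG _ (hh σ)).trans
          (Finset.prod_le_prod' fun i _ => hD σ i)
    _ = k.factorial * ∏ i, D i := by
        rw [Finset.sum_const, Finset.card_univ, Fintype.card_perm, Fintype.card_fin, nsmul_eq_mul]

/-- The integral of `f_0 det (∂f_i)` is bounded by a gauge of any one of the functions and
gauges of the first derivatives of the others. -/
theorem enorm_jacIntegral_le (c : Fin k → Fin n) {R : Set (EuclideanSpace ℝ (Fin n))}
    (hR : IsClosed R) {G : Fin (k + 1) → (EuclideanSpace ℝ (Fin n) → ℝ) → ENNReal}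
    (hG : ∀ h : Fin (k + 1) → EuclideanSpace ℝ (Fin n) → ℝ, (∀ i, Continuous (h i)) →
      ∫⁻ x in R, ∏ i, ‖h i x‖ₑ ≤ ∏ i, G i (h i))
    {f : Fin (k + 1) → EuclideanSpace ℝ (Fin n) → ℝ} (hf : ∀ i, ContDiff ℝ ∞ (f i))
    (hc : HasCompactSupport (f 0)) (h0 : ∀ x ∉ R, f 0 x = 0) (s : Fin (k + 1)) {A : ENNReal}
    {B : Fin (k + 1) → ENNReal} (hA : G s (f s) ≤ A) (hB : ∀ i ≠ s, ∀ j, G i (pd j (f i)) ≤ B i) :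
    ‖jacIntegral c f‖ₑ ≤ k.factorial * (A * ∏ i ∈ Finset.univ.erase s, B i) := by
  have hprod : A * ∏ i ∈ Finset.univ.erase s, B i = ∏ i, Function.update B s A i := by
    rw [← Finset.mul_prod_erase _ _ (Finset.mem_univ s), Function.update_self]
    congr 1
    refine Finset.prod_congr rfl fun i hi => ?_
    rw [Function.update_of_ne (Finset.ne_of_mem_erase hi)]
  rw [hprod]
  induction s using Fin.cases with
  | zero =>
    refine enorm_integral_le_of_sum_prod hG (fun x hx => by simp [h0 x hx])
      (h := fun σ => Fin.cons (f 0) fun i => pd (c (σ i)) (f i.succ)) ?_ ?_ ?_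
    · intro σ i
      induction i using Fin.cases with
      | zero => exact (hf 0).continuous
      | succ i => exact (contDiff_pd (hf _) _).continuous
    · intro x
      rw [jac_eq_sum, Finset.mul_sum]
      refine Finset.sum_congr rfl fun σ _ => ?_
      rw [Fin.prod_univ_succ]
      simp only [Fin.cons_zero, Fin.cons_succ]
      ring
    · intro σ i
      induction i using Fin.cases with
      | zero => simpa using hA
      | succ i =>
        rw [Function.update_of_ne (Fin.succ_ne_zero i)]
        exact hB _ (Fin.succ_ne_zero i) _
  | succ i =>
    -- To leave `f i.succ` undifferentiated, it trades places with `f 0`, which moves into row `i`.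
    -- The determinant still vanishes outside `R` because that row does.
    rw [jacIntegral, integral_mul_jac_swap c (fun i => hf i.succ) (hf 0) hc i, enorm_neg]
    refine enorm_integral_le_of_sum_prod hG (fun x hx => ?_)
      (h := fun σ => Function.update
        (Fin.cons (pd (c (σ i)) (f 0)) fun l => pd (c (σ l)) (f l.succ)) i.succ (f i.succ)) ?_ ?_ ?_
    · rw [jac, Matrix.det_eq_zero_of_row_eq_zero i, mul_zero]
      intro j
      simp [pd_eq_zero_of_notMem hR h0 _ hx]
    · intro σ t
      by_cases ht : t = i.succ
      · subst ht; simpa using (hf _).continuous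
      rw [Function.update_of_ne ht]
      induction t using Fin.cases with
      | zero => exact (contDiff_pd (hf _) _).continuous
      | succ t => exact (contDiff_pd (hf _) _).continuous
    · intro x
      rw [jac_eq_sum, Finset.mul_sum]
      refine Finset.sum_congr rfl fun σ _ => ?_
      rw [Fin.prod_univ_succ, ← Finset.mul_prod_erase _ _ (Finset.mem_univ i),
        ← Finset.mul_prod_erase Finset.univ
          (fun l : Fin k => Function.update (β := fun _ => EuclideanSpace ℝ (Fin n) → ℝ)
            (Fin.cons (pd (c (σ i)) (f 0)) fun l => pd (c (σ l)) (f l.succ)) i.succ (f i.succ)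
              l.succ x) (Finset.mem_univ i),
        Function.update_self, Function.update_self,
        Function.update_of_ne (Fin.succ_ne_zero i).symm]
      have : ∀ l ∈ Finset.univ.erase i,
          Function.update (β := fun _ => EuclideanSpace ℝ (Fin n) → ℝ)
            (Fin.cons (pd (c (σ i)) (f 0)) fun l => pd (c (σ l)) (f l.succ)) i.succ (f i.succ)
              l.succ x =
          pd (c (σ l)) (Function.update (fun l : Fin k => f l.succ) i (f 0) l) x := by
        intro l hl
        have hl := Finset.ne_of_mem_erase hl
        rw [Function.update_of_ne (fun h => hl (Fin.succ_injective _ h)), Function.update_of_ne hl]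
        rfl
      rw [Finset.prod_congr rfl this]
      simp only [Fin.cons_zero]
      ring
    · intro σ t
      by_cases ht : t = i.succ
      · subst ht; simpa using hA
      rw [Function.update_of_ne ht, Function.update_of_ne ht]
      induction t using Fin.cases with
      | zero => exact hB _ ht _
      | succ t => exact hB _ ht _

theorem jac_update_sub (c : Fin k → Fin n) {u : Fin k → EuclideanSpace ℝ (Fin n) → ℝ}
    {v w : EuclideanSpace ℝ (Fin n) → ℝ} (i : Fin k) (x : EuclideanSpace ℝ (Fin n))
    (hv : DifferentiableAt ℝ v x) (hw : DifferentiableAt ℝ w x) :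
    jac c (Function.update u i (v - w)) x =
      jac c (Function.update u i v) x - jac c (Function.update u i w) x := by
  have row : ∀ v : EuclideanSpace ℝ (Fin n) → ℝ,
      (Matrix.of fun l j => pd (c j) (Function.update u i v l) x) =
        (Matrix.of fun l j => pd (c j) (u l) x).updateRow i fun j => pd (c j) v x := by
    intro v
    ext l j
    by_cases hl : l = i
    · subst hl; simp
    · simp [Function.update_of_ne hl, Matrix.updateRow_ne hl]
  simp only [jac]
  rw [row, row, row]
  have : (fun j => pd (c j) (v - w) x) =
      (fun j => pd (c j) v x) + (-1 : ℝ) • fun j => pd (c j) w x := by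
    ext j
    simp only [pd, fderiv_sub hv hw]
    simp [sub_eq_add_neg]
  rw [this, Matrix.det_updateRow_add, Matrix.det_updateRow_smul]
  ring

theorem integrable_mul_jac (c : Fin k → Fin n)
    {f : Fin (k + 1) → EuclideanSpace ℝ (Fin n) → ℝ} (hf : ∀ i, ContDiff ℝ ∞ (f i))
    (hc : HasCompactSupport (f 0)) :
    Integrable fun x => f 0 x * jac c (fun i => f i.succ) x :=
  ((hf 0).mul (contDiff_jac c fun i => hf i.succ)).continuous.integrable_of_hasCompactSupport
    hc.mul_right

theorem jacIntegral_update_sub (c : Fin k → Fin n)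
    {f : Fin (k + 1) → EuclideanSpace ℝ (Fin n) → ℝ} {v w : EuclideanSpace ℝ (Fin n) → ℝ}
    (s : Fin (k + 1)) (hf : ∀ i, ContDiff ℝ ∞ (f i)) (hv : ContDiff ℝ ∞ v) (hw : ContDiff ℝ ∞ w)
    (hcv : HasCompactSupport (Function.update f s v 0))
    (hcw : HasCompactSupport (Function.update f s w 0)) :
    jacIntegral c (Function.update f s (v - w)) =
      jacIntegral c (Function.update f s v) - jacIntegral c (Function.update f s w) := by
  have hup : ∀ v, ContDiff ℝ ∞ v → ∀ l, ContDiff ℝ ∞ (Function.update f s v l) := by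
    intro v hv l
    by_cases hl : l = s
    · subst hl; simpa using hv
    · simpa [Function.update_of_ne hl] using hf l
  unfold jacIntegral
  rw [← integral_sub (integrable_mul_jac c (hup v hv) hcv) (integrable_mul_jac c (hup w hw) hcw)]
  refine integral_congr_ae (Eventually.of_forall fun x => ?_)
  dsimp only
  induction s using Fin.cases with
  | zero =>
    have : ∀ v : EuclideanSpace ℝ (Fin n) → ℝ,
        (fun i : Fin k => Function.update f 0 v i.succ) = fun i => f i.succ := by
      intro v; ext i : 1; rw [Function.update_of_ne (Fin.succ_ne_zero i)]
    rw [this, this, this]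
    simp [sub_mul]
  | succ i =>
    have : ∀ v : EuclideanSpace ℝ (Fin n) → ℝ,
        (fun l : Fin k => Function.update f i.succ v l.succ) =
          Function.update (fun l => f l.succ) i v := by
      intro v; ext l : 1
      by_cases hl : l = i
      · subst hl; simp
      · rw [Function.update_of_ne hl,
          Function.update_of_ne fun h => hl (Fin.succ_injective _ h)]
    rw [this, this, this, jac_update_sub c i x (hv.differentiable (by simp)).differentiableAt
      (hw.differentiable (by simp)).differentiableAt]
    simp [Function.update_of_ne (Fin.succ_ne_zero i).symm, mul_sub]

/-- The change of `∫ f_0 det (∂f_i)` when all the functions change. -/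
theorem enorm_jacIntegral_sub_le (c : Fin k → Fin n) {R : Set (EuclideanSpace ℝ (Fin n))}
    (hR : IsClosed R) {G : Fin (k + 1) → (EuclideanSpace ℝ (Fin n) → ℝ) → ENNReal}
    (hG : ∀ h : Fin (k + 1) → EuclideanSpace ℝ (Fin n) → ℝ, (∀ i, Continuous (h i)) →
      ∫⁻ x in R, ∏ i, ‖h i x‖ₑ ≤ ∏ i, G i (h i))
    {X Y : Fin (k + 1) → EuclideanSpace ℝ (Fin n) → ℝ} (hX : ∀ i, ContDiff ℝ ∞ (X i))
    (hY : ∀ i, ContDiff ℝ ∞ (Y i)) (hcX : HasCompactSupport (X 0)) (hcY : HasCompactSupport (Y 0))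
    (h0X : ∀ x ∉ R, X 0 x = 0) (h0Y : ∀ x ∉ R, Y 0 x = 0) {A B : Fin (k + 1) → ENNReal}
    (hA : ∀ s, G s (Y s - X s) ≤ A s) (hBX : ∀ s j, G s (pd j (X s)) ≤ B s)
    (hBY : ∀ s j, G s (pd j (Y s)) ≤ B s) :
    ‖jacIntegral c Y - jacIntegral c X‖ₑ ≤
      ∑ s, k.factorial * (A s * ∏ i ∈ Finset.univ.erase s, B i) := by
  classical
  -- Telescoping over the slots: the hybrid family uses `Y` on `S` and `X` elsewhere, and enlarging
  -- `S` by `s` produces an integral with the difference in slot `s`.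
  suffices h : ∀ S : Finset (Fin (k + 1)), ‖jacIntegral c (S.piecewise Y X) - jacIntegral c X‖ₑ ≤
      ∑ s ∈ S, k.factorial * (A s * ∏ i ∈ Finset.univ.erase s, B i) by
    simpa using h Finset.univ
  intro S
  induction S using Finset.induction_on with
  | empty => simp
  | insert s S hs ih =>
    have hZ : ∀ (S : Finset (Fin (k + 1))) i, S.piecewise Y X i = Y i ∨ S.piecewise Y X i = X i := by
      intro S i
      by_cases hi : i ∈ S
      · left; simp [hi]
      · right; simp [hi]
    have hsm : ∀ i, ContDiff ℝ ∞ (S.piecewise Y X i) := fun i => by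
      rcases hZ S i with h | h <;> rw [h]
      exacts [hY i, hX i]
    have e1 : (insert s S).piecewise Y X = Function.update (S.piecewise Y X) s (Y s) :=
      Finset.piecewise_insert ..
    have e2 : S.piecewise Y X = Function.update (S.piecewise Y X) s (X s) := by
      rw [eq_comm, Function.update_eq_self_iff]; simp [hs]
    have hcomp : ∀ S : Finset (Fin (k + 1)), HasCompactSupport (S.piecewise Y X 0) := fun S => by
      rcases hZ S 0 with h | h <;> rw [h]
      exacts [hcY, hcX]
    have hzero : ∀ S : Finset (Fin (k + 1)), ∀ x ∉ R, S.piecewise Y X 0 x = 0 := fun S => by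
      rcases hZ S 0 with h | h <;> rw [h]
      exacts [h0Y, h0X]
    have key := jacIntegral_update_sub c s hsm (hY s) (hX s) (by rw [← e1]; exact hcomp _)
      (by rw [← e2]; exact hcomp _)
    rw [← e1, ← e2] at key
    have bound : ‖jacIntegral c (Function.update (S.piecewise Y X) s (Y s - X s))‖ₑ ≤
        k.factorial * (A s * ∏ i ∈ Finset.univ.erase s, B i) := by
      refine enorm_jacIntegral_le c hR hG ?_ ?_ ?_ s ?_ ?_
      · intro i
        by_cases hi : i = s
        · subst hi; rw [Function.update_self]; exact (hY i).sub (hX i)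
        · simpa [Function.update_of_ne hi] using hsm i
      · by_cases hi : 0 = s
        · subst hi; rw [Function.update_self]; exact hcY.sub hcX
        · rw [Function.update_of_ne hi]; exact hcomp S
      · intro x hx
        by_cases hi : 0 = s
        · subst hi; simp [h0X x hx, h0Y x hx]
        · rw [Function.update_of_ne hi]; exact hzero S x hx
      · simpa using hA s
      · intro i hi j
        rw [Function.update_of_ne hi]
        rcases hZ S i with h | h <;> rw [h]
        exacts [hBY i j, hBX i j]
    rw [Finset.sum_insert hs]
    calc ‖jacIntegral c ((insert s S).piecewise Y X) - jacIntegral c X‖ₑ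
        = ‖jacIntegral c (Function.update (S.piecewise Y X) s (Y s - X s)) +
            (jacIntegral c (S.piecewise Y X) - jacIntegral c X)‖ₑ := by rw [key]; congr 1; ring
      _ ≤ _ := (enorm_add_le _ _).trans (add_le_add bound ih)

/-- The exponents `-σ s` and `1 - σ i` for `i ≠ s` add up to `k - ∑ σ`, independently of the
undifferentiated slot `s`. -/
theorem mul_prod_two_rpow_eq {m : ℕ} (σ : Fin (k + 1) → ℝ)
    (a : Fin (k + 1) → ENNReal) (s : Fin (k + 1)) :
    ((2 : ENNReal) ^ (-(m * σ s)) * a s) *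
        ∏ i ∈ Finset.univ.erase s, ((2 : ENNReal) ^ (m * (1 - σ i)) * a i) =
      (2 : ENNReal) ^ (-(m * (∑ i, σ i - k))) * ∏ i, a i := by
  have h2 : ∀ (S : Finset (Fin (k + 1))) (b : Fin (k + 1) → ℝ),
      ∏ i ∈ S, (2 : ENNReal) ^ b i = 2 ^ ∑ i ∈ S, b i := by
    intro S b
    induction S using Finset.induction_on with
    | empty => simp
    | insert i S hi ih => rw [Finset.prod_insert hi, Finset.sum_insert hi, ih,
        ENNReal.rpow_add _ _ (by simp) (by simp)]
  rw [Finset.prod_mul_distrib, h2]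
  calc _ = ((2 : ENNReal) ^ (-(m * σ s)) * 2 ^ ∑ i ∈ Finset.univ.erase s, (m * (1 - σ i))) *
        (a s * ∏ i ∈ Finset.univ.erase s, a i) := by ring
    _ = _ := by
      rw [Finset.mul_prod_erase _ _ (Finset.mem_univ s), ← ENNReal.rpow_add _ _ (by simp) (by simp)]
      congr 2
      have e := Finset.add_sum_erase Finset.univ (fun i => (m : ℝ) * (1 - σ i)) (Finset.mem_univ s)
      have e' : ∑ i, (m : ℝ) * (1 - σ i) = m * (k + 1 - ∑ i, σ i) := by
        rw [← Finset.mul_sum, Finset.sum_sub_distrib]; simp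
      rw [e'] at e
      linarith

/-- Summation of the multilinear estimate over dyadic scales. -/
theorem enorm_jacIntegral_le_sum (c : Fin k → Fin n) {R : Set (EuclideanSpace ℝ (Fin n))}
    (hR : IsClosed R) {G : Fin (k + 1) → (EuclideanSpace ℝ (Fin n) → ℝ) → ENNReal}
    (hG : ∀ h : Fin (k + 1) → EuclideanSpace ℝ (Fin n) → ℝ, (∀ i, Continuous (h i)) →
      ∫⁻ x in R, ∏ i, ‖h i x‖ₑ ≤ ∏ i, G i (h i))
    {X : ℕ → Fin (k + 1) → EuclideanSpace ℝ (Fin n) → ℝ} (hX : ∀ m i, ContDiff ℝ ∞ (X m i))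
    (hX0 : X 0 0 = 0)
    (hc : ∀ m, HasCompactSupport (X m 0)) (h0 : ∀ m, ∀ x ∉ R, X m 0 x = 0)
    {σ : Fin (k + 1) → ℝ} {a : ℕ → Fin (k + 1) → ENNReal}
    (hA : ∀ m s, G s (X (m + 1) s - X m s) ≤ (2 : ENNReal) ^ (-(m * σ s)) * a m s)
    (hB : ∀ m s j, G s (pd j (X m s)) ≤ (2 : ENNReal) ^ (m * (1 - σ s)) * a m s)
    (hB' : ∀ m s j, G s (pd j (X (m + 1) s)) ≤ (2 : ENNReal) ^ (m * (1 - σ s)) * a m s) (N : ℕ) :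
    ‖jacIntegral c (X N)‖ₑ ≤ (k + 1) * k.factorial *
      ∑ m ∈ Finset.range N, (2 : ENNReal) ^ (-(m * (∑ i, σ i - k))) * ∏ i, a m i := by
  induction N with
  | zero => simp [jacIntegral, hX0]
  | succ N ih =>
    have step := enorm_jacIntegral_sub_le c hR hG (hX N) (hX (N + 1)) (hc _) (hc _) (h0 _) (h0 _)
      (hA N) (hB N) (hB' N)
    -- All `k + 1` slots now have the same bound, whence the factor `k + 1`.
    simp_rw [mul_prod_two_rpow_eq σ] at step
    rw [Finset.sum_const, Finset.card_univ, Fintype.card_fin, nsmul_eq_mul] at step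
    rw [Finset.sum_range_succ, mul_add]
    calc ‖jacIntegral c (X (N + 1))‖ₑ
        = ‖jacIntegral c (X N) + (jacIntegral c (X (N + 1)) - jacIntegral c (X N))‖ₑ := by
          congr 1; ring
      _ ≤ _ := (enorm_add_le _ _).trans (add_le_add ih (step.trans (le_of_eq ?_)))
    push_cast
    ring

end Jacobian

end DistJacobian

namespace DistJacobian

/-! ### Mollification -/

section Mollification

variable {n : ℕ}

/-- The average `∫ φ(z) u(x + t z) dz` of `u` at scale `t`. -/
noncomputable def mol (φ : EuclideanSpace ℝ (Fin n) → ℝ) (t : ℝ) (u : EuclideanSpace ℝ (Fin n) → ℝ)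
    (x : EuclideanSpace ℝ (Fin n)) : ℝ :=
  ∫ z, φ z * u (x + t • z)

/-- The kernel such that averaging at scale `t` is convolution with it. -/
noncomputable def molKernel (φ : EuclideanSpace ℝ (Fin n) → ℝ) (t : ℝ)
    (v : EuclideanSpace ℝ (Fin n)) : ℝ :=
  |(t ^ n)⁻¹| * φ (-t⁻¹ • v)

variable {φ u : EuclideanSpace ℝ (Fin n) → ℝ} {t : ℝ}

/-- `mol` samples `u` at `x + t • z`, hence the reflected argument in `molKernel`. The convolution
form supplies smoothness and the formula for derivatives. -/
theorem mol_eq_convolution (φ u : EuclideanSpace ℝ (Fin n) → ℝ) (ht : t ≠ 0) :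
    mol φ t u = convolution u (molKernel φ t) (ContinuousLinearMap.mul ℝ ℝ) volume := by
  ext x
  rw [convolution_def, mol]
  have h1 := Measure.integral_comp_smul (volume : Measure (EuclideanSpace ℝ (Fin n)))
    (fun w => φ (t⁻¹ • w) * u (x + w)) t
  simp only [inv_smul_smul₀ ht, finrank_euclideanSpace, Fintype.card_fin] at h1
  rw [h1, ← integral_add_left_eq_self (μ := (volume : Measure (EuclideanSpace ℝ (Fin n))))
    (fun y => ContinuousLinearMap.mul ℝ ℝ (u y) (molKernel φ t (x - y))) x, ← integral_smul]
  refine integral_congr_ae (Eventually.of_forall fun w => ?_)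
  simp only [molKernel, ContinuousLinearMap.mul_apply', smul_eq_mul]
  rw [show -t⁻¹ • (x - (x + w)) = t⁻¹ • w by simp]
  ring

theorem hasCompactSupport_molKernel (hφ : HasCompactSupport φ) (ht : t ≠ 0) :
    HasCompactSupport (molKernel φ t) := by
  have := hφ.comp_smul (c := -t⁻¹) (by simpa using ht)
  exact this.mul_left

theorem contDiff_molKernel (hφ : ContDiff ℝ ∞ φ) (t : ℝ) : ContDiff ℝ ∞ (molKernel φ t) :=
  contDiff_const.mul (hφ.comp (contDiff_const_smul _))

theorem contDiff_mol (hφ : ContDiff ℝ ∞ φ) (hc : HasCompactSupport φ) (hu : LocallyIntegrable u)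
    (ht : t ≠ 0) : ContDiff ℝ ∞ (mol φ t u) := by
  rw [mol_eq_convolution φ u ht]
  exact (hasCompactSupport_molKernel hc ht).contDiff_convolution_right _ hu
    (contDiff_molKernel hφ t)

theorem pd_molKernel (hφ : ContDiff ℝ ∞ φ) (t : ℝ) (j : Fin n) (v : EuclideanSpace ℝ (Fin n)) :
    pd j (molKernel φ t) v = -t⁻¹ * molKernel (pd j φ) t v := by
  have hd : DifferentiableAt ℝ φ (-t⁻¹ • v) := (hφ.differentiable (by simp)).differentiableAt
  have h1 : HasFDerivAt (fun v : EuclideanSpace ℝ (Fin n) => φ (-t⁻¹ • v))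
      ((fderiv ℝ φ (-t⁻¹ • v)).comp (-t⁻¹ • ContinuousLinearMap.id ℝ _)) v :=
    hd.hasFDerivAt.comp v (-t⁻¹ • ContinuousLinearMap.id ℝ (EuclideanSpace ℝ (Fin n))).hasFDerivAt
  have h2 := h1.const_mul (|(t ^ n)⁻¹|)
  unfold pd
  rw [show molKernel φ t = fun v => |(t ^ n)⁻¹| * φ (-t⁻¹ • v) from rfl, h2.fderiv]
  simp [molKernel]
  ring

/-- The derivative falls on the kernel, and the chain rule costs a factor `t⁻¹`. -/
theorem pd_mol (hφ : ContDiff ℝ ∞ φ) (hc : HasCompactSupport φ) (hu : LocallyIntegrable u)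
    (ht : t ≠ 0) (j : Fin n) (x : EuclideanSpace ℝ (Fin n)) :
    pd j (mol φ t u) x = -t⁻¹ * mol (pd j φ) t u x := by
  have hK := hasCompactSupport_molKernel hc ht
  have hKs := contDiff_molKernel hφ t
  rw [mol_eq_convolution φ u ht, mol_eq_convolution _ u ht]
  unfold pd
  rw [(hK.hasFDerivAt_convolution_right (ContinuousLinearMap.mul ℝ ℝ) hu (hKs.of_le (by simp))
    x).fderiv, convolution_precompR_apply _ hu (hK.fderiv (𝕜 := ℝ))
    (hKs.continuous_fderiv (by simp)), convolution_def, convolution_def, ← integral_const_mul]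
  refine integral_congr_ae (Eventually.of_forall fun y => ?_)
  have h1 := pd_molKernel hφ t j (x - y)
  simp only [ContinuousLinearMap.mul_apply']
  change u y * pd j (molKernel φ t) (x - y) = -t⁻¹ * (u y * molKernel (pd j φ) t (x - y))
  rw [h1]
  ring

theorem integrable_mol (hφ : Continuous φ) (hc : HasCompactSupport φ) (hu : LocallyIntegrable u)
    (ht : t ≠ 0) (x : EuclideanSpace ℝ (Fin n)) : Integrable fun z => φ z * u (x + t • z) := by
  have h1 : Integrable fun w => φ (t⁻¹ • (w - x)) * u w := by
    refine hu.integrable_smul_left_of_hasCompactSupport (g := fun w => φ (t⁻¹ • (w - x)))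
      (by fun_prop) ?_
    exact hc.comp_homeomorph
      ((Homeomorph.subRight x).trans (Homeomorph.smulOfNeZero t⁻¹ (inv_ne_zero ht)))
  have h2 := (h1.comp_add_left x).comp_smul ht
  simpa [inv_smul_smul₀ ht] using h2

/-- Used twice: for `φ`, of integral one, and for `pd j φ`, of integral zero. In both cases it
leaves an average of increments of `u`, which regularity controls. -/
theorem mol_sub_mul_integral (hφ : Continuous φ) (hc : HasCompactSupport φ)
    (hu : LocallyIntegrable u) (ht : t ≠ 0) (x : EuclideanSpace ℝ (Fin n)) (a : ℝ) :
    mol φ t u x - (∫ z, φ z) * a = ∫ z, φ z * (u (x + t • z) - a) := by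
  simp_rw [mul_sub]
  rw [integral_sub (integrable_mol hφ hc hu ht x)
    ((hφ.integrable_of_hasCompactSupport hc).mul_const a), integral_mul_const]
  rfl

/-- Integration by parts. It identifies the contribution of the linear part of `u` to the derivative
of its averages. -/
theorem integral_pd_mul_clm (hφ : ContDiff ℝ ∞ φ) (hc : HasCompactSupport φ) (j : Fin n)
    (L : EuclideanSpace ℝ (Fin n) →L[ℝ] ℝ) :
    ∫ z, pd j φ z * L z = -(L (EuclideanSpace.single j 1) * ∫ z, φ z) := by
  have hL : ∀ x, fderiv ℝ (fun y => L y) x = L := fun x => L.fderiv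
  have := integral_mul_fderiv_eq_neg_fderiv_mul_of_integrable (μ := volume)
    (f := fun y => L y) (g := φ) (v := EuclideanSpace.single j (1 : ℝ)) ?_ ?_ ?_
    (fun x _ => L.differentiableAt) (fun x _ => (hφ.differentiable (by simp)).differentiableAt)
  · simp only [hL] at this
    rw [integral_const_mul] at this
    rw [← this]
    simp_rw [pd, mul_comm]
  · simp only [hL]
    exact (hφ.continuous.integrable_of_hasCompactSupport hc).const_mul _
  · exact ((L.continuous.mul
      (contDiff_pd hφ j).continuous).integrable_of_hasCompactSupport
        (HasCompactSupport.pd hc j).mul_left)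
  · exact (L.continuous.mul hφ.continuous).integrable_of_hasCompactSupport hc.mul_left

theorem integral_pd (hφ : ContDiff ℝ ∞ φ) (hc : HasCompactSupport φ) (j : Fin n) :
    ∫ z, pd j φ z = 0 := by
  have := integral_mul_fderiv_eq_neg_fderiv_mul_of_integrable (μ := volume)
    (f := fun _ : EuclideanSpace ℝ (Fin n) => (1 : ℝ)) (g := φ)
    (v := EuclideanSpace.single j (1 : ℝ)) (by simp) ?_ ?_
    (fun x _ => differentiableAt_const _) (fun x _ => (hφ.differentiable (by simp)).differentiableAt)
  · simpa [pd] using this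
  · simpa using! (contDiff_pd hφ j).continuous.integrable_of_hasCompactSupport
        (HasCompactSupport.pd hc j)
  · simpa using! hφ.continuous.integrable_of_hasCompactSupport hc

/-- From a point outside `S` the kernel only reaches points outside `T`, where `u` vanishes. -/
theorem mol_eq_zero {S T : Set (EuclideanSpace ℝ (Fin n))}
    (h : ∀ z ∈ tsupport φ, ∀ x ∉ S, x + t • z ∉ T) (hu : ∀ x ∉ T, u x = 0)
    {x : EuclideanSpace ℝ (Fin n)} (hx : x ∉ S) : mol φ t u x = 0 := by
  unfold mol
  rw [integral_congr_ae (g := fun _ => 0), integral_zero]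
  refine Eventually.of_forall fun z => ?_
  by_cases hz : z ∈ tsupport φ
  · simp [hu _ (h z hz x hx)]
  · simp [image_eq_zero_of_notMem_tsupport hz]

theorem mol_eq_zero_of_norm {r ρ : ℝ} (hr : ∀ z ∈ tsupport φ, ‖z‖ ≤ r) (ht : 0 ≤ t)
    (ht1 : t ≤ 1) (hu : ∀ x, ρ < ‖x‖ → u x = 0) {x : EuclideanSpace ℝ (Fin n)}
    (hx : ρ + r < ‖x‖) : mol φ t u x = 0 := by
  refine mol_eq_zero (S := {x | ‖x‖ ≤ ρ + r}) (T := {x | ‖x‖ ≤ ρ}) (fun z hz x hx => ?_)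
    (fun x hx => hu x (by simpa using hx)) (by simpa using hx)
  simp only [mem_ofPred_eq, not_le] at hx ⊢
  have h1 : ‖t • z‖ ≤ r := by
    rw [norm_smul, Real.norm_of_nonneg ht]
    calc t * ‖z‖ ≤ 1 * ‖z‖ := by gcongr
      _ ≤ r := by simpa using hr z hz
  have h2 := norm_sub_le (x + t • z) (t • z)
  rw [add_sub_cancel_right] at h2
  linarith

theorem norm_integral_mul_le {K f : EuclideanSpace ℝ (Fin n) → ℝ} (hK : Continuous K)
    (hc : HasCompactSupport K) {b : ℝ} (hf : ∀ z ∈ tsupport K, |f z| ≤ b) :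
    |∫ z, K z * f z| ≤ b * ∫ z, |K z| := by
  rw [← integral_const_mul, ← Real.norm_eq_abs]
  refine norm_integral_le_of_norm_le
    ((hK.integrable_of_hasCompactSupport hc).abs.const_mul b) (Eventually.of_forall fun z => ?_)
  by_cases hz : z ∈ tsupport K
  · rw [Real.norm_eq_abs, abs_mul, mul_comm]
    exact mul_le_mul_of_nonneg_right (hf z hz) (abs_nonneg _)
  · simp [image_eq_zero_of_notMem_tsupport hz]

theorem tsupport_pd_subset (φ : EuclideanSpace ℝ (Fin n) → ℝ) (j : Fin n) :
    tsupport (pd j φ) ⊆ tsupport φ := by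
  refine (closure_mono fun x hx => ?_).trans (tsupport_fderiv_subset (𝕜 := ℝ) (f := φ))
  intro h
  apply hx
  simp [pd, h]

/-- Smooth compactly supported kernels of integral one that, centred at a point of `R`, live
in `R`. -/
structure IsKernel (R : Set (EuclideanSpace ℝ (Fin n))) (φ : EuclideanSpace ℝ (Fin n) → ℝ) :
    Prop where
  contDiff : ContDiff ℝ ∞ φ
  hasCompactSupport : HasCompactSupport φ
  integral_eq_one : ∫ z, φ z = 1
  add_smul_mem : ∀ z ∈ tsupport φ, ∀ x ∈ R, ∀ t : ℝ, 0 ≤ t → x + t • z ∈ R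

theorem IsKernel.exists_norm_le {R : Set (EuclideanSpace ℝ (Fin n))} (hφ : IsKernel R φ) :
    ∃ r > 0, ∀ z ∈ tsupport φ, ‖z‖ ≤ r := by
  obtain ⟨r, h⟩ := hφ.hasCompactSupport.isBounded.exists_norm_le
  exact ⟨max r 1, by positivity, fun z hz => (h z hz).trans (le_max_left _ _)⟩

theorem exists_isKernel_of_ball {R : Set (EuclideanSpace ℝ (Fin n))} (e : EuclideanSpace ℝ (Fin n))
    (h : ∀ z ∈ Metric.closedBall e 1, ∀ x ∈ R, ∀ t : ℝ, 0 ≤ t → x + t • z ∈ R) :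
    ∃ φ, IsKernel R φ := by
  let f : ContDiffBump e := ⟨1 / 2, 1, by norm_num, by norm_num⟩
  refine ⟨f.normed volume, f.contDiff_normed, f.hasCompactSupport_normed, f.integral_normed, ?_⟩
  rw [f.tsupport_normed_eq]
  exact h

theorem exists_isKernel_univ : ∃ φ : EuclideanSpace ℝ (Fin n) → ℝ, IsKernel univ φ :=
  exists_isKernel_of_ball 0 fun _ _ _ _ _ _ => mem_univ _

/-- The closed unit ball around the inner unit normal lies in the half-space, which is closed under
addition and nonnegative scaling. -/
theorem exists_isKernel_halfSpace (i : Fin n) :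
    ∃ φ : EuclideanSpace ℝ (Fin n) → ℝ, IsKernel {x | 0 ≤ x i} φ := by
  refine exists_isKernel_of_ball (EuclideanSpace.single i 1) fun z hz x hx t ht => ?_
  have h1 : ‖(z - EuclideanSpace.single i (1 : ℝ)) i‖ ≤ 1 :=
    (PiLp.norm_apply_le _ i).trans (by simpa [dist_eq_norm] using hz)
  have h2 : 0 ≤ z i := by
    have := (abs_le.1 (by simpa using h1)).1
    linarith
  simp only [mem_ofPred_eq] at hx ⊢
  simp only [PiLp.add_apply, PiLp.smul_apply, smul_eq_mul]
  positivity

theorem mol_sub_eq {R : Set (EuclideanSpace ℝ (Fin n))} (hφ : IsKernel R φ)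
    (hu : LocallyIntegrable u) (ht : t ≠ 0) (x : EuclideanSpace ℝ (Fin n)) :
    mol φ t u x - u x = ∫ z, φ z * (u (x + t • z) - u x) := by
  rw [← mol_sub_mul_integral hφ.contDiff.continuous hφ.hasCompactSupport hu ht,
    hφ.integral_eq_one, one_mul]

theorem pd_mol_eq {R : Set (EuclideanSpace ℝ (Fin n))} (hφ : IsKernel R φ)
    (hu : LocallyIntegrable u) (ht : t ≠ 0) (j : Fin n) (x : EuclideanSpace ℝ (Fin n)) :
    pd j (mol φ t u) x = -t⁻¹ * ∫ z, pd j φ z * (u (x + t • z) - u x) := by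
  rw [pd_mol hφ.contDiff hφ.hasCompactSupport hu ht,
    ← mol_sub_mul_integral (contDiff_pd hφ.contDiff j).continuous
      (HasCompactSupport.pd hφ.hasCompactSupport j) hu ht,
    integral_pd hφ.contDiff hφ.hasCompactSupport, zero_mul, sub_zero]

/-- The derivatives of the averages converge at points of differentiability. -/
theorem tendsto_pd_mol {R : Set (EuclideanSpace ℝ (Fin n))} (hφ : IsKernel R φ)
    (hu : LocallyIntegrable u) (j : Fin n) {x : EuclideanSpace ℝ (Fin n)}
    (hx : DifferentiableAt ℝ u x) :
    Tendsto (fun t => pd j (mol φ t u) x) (𝓝[>] 0) (𝓝 (pd j u x)) := by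
  obtain ⟨r, hr, hrφ⟩ := hφ.exists_norm_le
  set L := fderiv ℝ u x
  set J := ∫ z, |pd j φ z|
  have hJ : 0 ≤ J := integral_nonneg fun _ => abs_nonneg _
  have hpc := (contDiff_pd hφ.contDiff j).continuous
  have hps := HasCompactSupport.pd hφ.hasCompactSupport j
  have hL : pd j u x = -∫ z, pd j φ z * L z := by
    rw [integral_pd_mul_clm hφ.contDiff hφ.hasCompactSupport, hφ.integral_eq_one]
    simp [pd, L]
  rw [Metric.tendsto_nhds]
  intro ε hε
  obtain ⟨η, hη, hηε⟩ : ∃ η > 0, η * r * J < ε := by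
    refine ⟨ε / (r * J + 1), by positivity, ?_⟩
    rw [mul_assoc, div_mul_eq_mul_div, div_lt_iff₀ (by positivity)]
    nlinarith
  have hlit := hx.hasFDerivAt.isLittleO.def hη
  obtain ⟨δ, hδ, hball⟩ := Metric.eventually_nhds_iff.1 hlit
  have hpos : ∀ᶠ t : ℝ in 𝓝[>] 0, 0 < t := self_mem_nhdsWithin
  have hsmall : ∀ᶠ t : ℝ in 𝓝[>] 0, t < δ / r :=
    (eventually_lt_nhds (by positivity)).filter_mono nhdsWithin_le_nhds
  filter_upwards [hpos, hsmall] with t ht ht'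
  -- By `hL` the linear part of `u` at `x` reproduces `pd j u x` exactly. What remains is the `o(t)`
  -- remainder, which beats the factor `t⁻¹`.
  have e1 : pd j (mol φ t u) x - pd j u x =
      -t⁻¹ * ∫ z, pd j φ z * (u (x + t • z) - u x - t * L z) := by
    have i1 : Integrable fun z => pd j φ z * (u (x + t • z) - u x) := by
      simp_rw [mul_sub]
      exact (integrable_mol hpc hps hu ht.ne' x).sub
        ((hpc.integrable_of_hasCompactSupport hps).mul_const _)
    have i2 : Integrable fun z => pd j φ z * (t * L z) :=
      (hpc.mul (by fun_prop)).integrable_of_hasCompactSupport hps.mul_right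
    simp_rw [mul_sub (pd j φ _) (u _ - u _)]
    rw [pd_mol_eq hφ hu ht.ne', hL, integral_sub i1 i2]
    have : ∀ z, pd j φ z * (t * L z) = t * (pd j φ z * L z) := fun z => by ring
    simp_rw [this, integral_const_mul]
    field_simp
    ring
  rw [Real.dist_eq, e1, abs_mul, abs_neg, abs_inv, abs_of_pos ht]
  have h2 := norm_integral_mul_le hpc hps (f := fun z => u (x + t • z) - u x - t * L z)
    (b := η * (t * r)) fun z hz => by
      have hz := hrφ z (tsupport_pd_subset φ j hz)
      have hn : ‖t • z‖ ≤ t * r := by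
        rw [norm_smul, Real.norm_of_nonneg ht.le]
        gcongr
      have hd : dist (x + t • z) x < δ := by
        rw [dist_eq_norm, add_sub_cancel_left]
        rw [lt_div_iff₀ hr] at ht'
        linarith
      have := hball hd
      simp only [add_sub_cancel_left, Real.norm_eq_abs, map_smul, smul_eq_mul] at this
      exact this.trans (by gcongr)
  calc t⁻¹ * |∫ z, pd j φ z * (u (x + t • z) - u x - t * L z)|
      ≤ t⁻¹ * (η * (t * r) * J) := by gcongr
    _ = η * r * J := by field_simp
    _ < ε := hηε

/-- Sup bounds for averages through a modulus of continuity. -/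
theorem abs_mol_sub_le {R : Set (EuclideanSpace ℝ (Fin n))} (hφ : IsKernel R φ)
    (hu : LocallyIntegrable u) (ht : t ≠ 0) {x : EuclideanSpace ℝ (Fin n)} {b : ℝ}
    (hb : ∀ z ∈ tsupport φ, |u (x + t • z) - u x| ≤ b) :
    |mol φ t u x - u x| ≤ b * ∫ z, |φ z| := by
  rw [mol_sub_eq hφ hu ht]
  exact norm_integral_mul_le hφ.contDiff.continuous hφ.hasCompactSupport hb

theorem abs_pd_mol_le {R : Set (EuclideanSpace ℝ (Fin n))} (hφ : IsKernel R φ)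
    (hu : LocallyIntegrable u) (ht : 0 < t) (j : Fin n) {x : EuclideanSpace ℝ (Fin n)} {b : ℝ}
    (hb : ∀ z ∈ tsupport φ, |u (x + t • z) - u x| ≤ b) :
    |pd j (mol φ t u) x| ≤ t⁻¹ * (b * ∫ z, |pd j φ z|) := by
  rw [pd_mol_eq hφ hu ht.ne', abs_mul, abs_neg, abs_inv, abs_of_pos ht]
  gcongr
  exact norm_integral_mul_le (contDiff_pd hφ.contDiff j).continuous
    (HasCompactSupport.pd hφ.hasCompactSupport j) fun z hz => hb z (tsupport_pd_subset φ j hz)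

/-- `L^p` bounds for averages through `L^p` moduli of continuity. -/
theorem lintegral_rpow_integral_mul_le_of_measurable {K : EuclideanSpace ℝ (Fin n) → ℝ}
    (hK : Continuous K) {r : ℝ} (hr : ∀ z ∈ tsupport K, ‖z‖ ≤ r) {p : ℝ} (hp : 1 ≤ p)
    {Ω : Type*} [MeasurableSpace Ω] :
    ∃ C : ENNReal, C ≠ ⊤ ∧ ∀ (μ : Measure Ω) [SFinite μ] (h : Ω → EuclideanSpace ℝ (Fin n) → ℝ),
      Measurable (Function.uncurry h) →
        ∫⁻ x, ‖∫ z, K z * h x z‖ₑ ^ p ∂μ ≤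
          C * ∫⁻ z in Metric.closedBall 0 r, ∫⁻ x, ‖h x z‖ₑ ^ p ∂μ := by
  have hp0 : 0 < p := by linarith
  have hc : HasCompactSupport K := by
    refine (isCompact_closedBall (0 : EuclideanSpace ℝ (Fin n)) r).of_isClosed_subset
      (isClosed_tsupport K) fun z hz => ?_
    simpa using hr z hz
  obtain ⟨M, hM⟩ := hK.bounded_above_of_compact_support hc
  set B := Metric.closedBall (0 : EuclideanSpace ℝ (Fin n)) r
  have hfin : (ENNReal.ofReal M * volume B ^ (1 / (1 : ℝ) - 1 / p)) ^ p ≠ ⊤ := by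
    refine ENNReal.rpow_ne_top_of_nonneg hp0.le (ENNReal.mul_ne_top ENNReal.ofReal_ne_top ?_)
    refine ENNReal.rpow_ne_top_of_nonneg ?_ measure_closedBall_lt_top.ne
    rw [sub_nonneg]
    exact one_div_le_one_div_of_le one_pos hp
  refine ⟨_, hfin, fun μ _ h meas => ?_⟩
  -- The kernel is bounded and lives in `B`, so the `L^1` norm over `B` is bounded by the `L^p` norm
  -- times a power of the volume; Tonelli's theorem then exchanges the integrals.
  have pt : ∀ x, ‖∫ z, K z * h x z‖ₑ ^ p ≤
      (ENNReal.ofReal M * volume B ^ (1 / (1 : ℝ) - 1 / p)) ^ p *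
        ∫⁻ z in B, ‖h x z‖ₑ ^ p := by
    intro x
    have hf : AEStronglyMeasurable (fun z => h x z) (volume.restrict B) :=
      (meas.comp measurable_prodMk_left).aestronglyMeasurable
    have h2 := eLpNorm'_le_eLpNorm'_mul_rpow_measure_univ (μ := volume.restrict B) one_pos hp hf
    rw [eLpNorm', eLpNorm'] at h2
    simp only [ENNReal.rpow_one, one_div, inv_one, Measure.restrict_apply_univ] at h2
    have h1 : ‖∫ z, K z * h x z‖ₑ ≤ ENNReal.ofReal M * ∫⁻ z in B, ‖h x z‖ₑ := by
      have : ∫ z, K z * h x z = ∫ z in B, K z * h x z := by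
        refine (setIntegral_eq_integral_of_forall_compl_eq_zero fun z hz => ?_).symm
        have : K z = 0 := image_eq_zero_of_notMem_tsupport fun h => hz (by simpa [B] using hr z h)
        rw [this, zero_mul]
      rw [this, ← lintegral_const_mul' _ _ ENNReal.ofReal_ne_top]
      refine (enorm_integral_le_lintegral_enorm _).trans (lintegral_mono fun z => ?_)
      rw [enorm_mul]
      gcongr
      rw [← ofReal_norm]
      exact ENNReal.ofReal_le_ofReal (hM z)
    calc ‖∫ z, K z * h x z‖ₑ ^ p
        ≤ (ENNReal.ofReal M * ((∫⁻ z in B, ‖h x z‖ₑ ^ p) ^ p⁻¹ *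
            volume B ^ (1 - p⁻¹))) ^ p := by
          gcongr
          refine h1.trans ?_
          gcongr
      _ = _ := by
          rw [mul_comm (_ ^ p⁻¹), ← mul_assoc, ENNReal.mul_rpow_of_nonneg _ _ hp0.le,
            ENNReal.rpow_inv_rpow hp0.ne']
          simp
  refine (lintegral_mono pt).trans ?_
  rw [lintegral_const_mul' _ _ hfin,
    lintegral_lintegral_swap (meas.enorm.pow_const p).aemeasurable]

theorem lintegral_rpow_integral_mul_le {K : EuclideanSpace ℝ (Fin n) → ℝ} (hK : Continuous K)
    {r : ℝ} (hr : ∀ z ∈ tsupport K, ‖z‖ ≤ r) {p : ℝ} (hp : 1 ≤ p) :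
    ∃ C : ENNReal, C ≠ ⊤ ∧ ∀ (u : EuclideanSpace ℝ (Fin n) → ℝ), Measurable u →
      ∀ (t : ℝ) (R : Set (EuclideanSpace ℝ (Fin n))),
        ∫⁻ x in R, ‖∫ z, K z * (u (x + t • z) - u x)‖ₑ ^ p ≤
          C * ∫⁻ z in Metric.closedBall 0 r, ∫⁻ x in R, ‖u (x + t • z) - u x‖ₑ ^ p := by
  obtain ⟨C, hC, H⟩ := lintegral_rpow_integral_mul_le_of_measurable
    (Ω := EuclideanSpace ℝ (Fin n)) hK hr hp
  refine ⟨C, hC, fun u hu t R => H _ (fun x z => u (x + t • z) - u x) ?_⟩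
  unfold Function.uncurry
  fun_prop

end Mollification

end DistJacobian

namespace DistJacobian

/-! ### The multilinear estimate in Euclidean space -/

section Core

variable {n k : ℕ}

/-- If a step along the reflected kernel led from outside `R` into `R`, the opposite step would
start in `R` and leave it. Hence averages with the reflected kernel preserve vanishing outside `R`.
-/
theorem IsKernel.neg {R : Set (EuclideanSpace ℝ (Fin n))} {φ : EuclideanSpace ℝ (Fin n) → ℝ}
    (hφ : IsKernel R φ) : IsKernel Rᶜ fun z => φ (-z) where
  contDiff := hφ.contDiff.comp contDiff_neg
  hasCompactSupport := hφ.hasCompactSupport.comp_homeomorph (Homeomorph.neg _)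
  integral_eq_one := by rw [integral_neg_eq_self φ]; exact hφ.integral_eq_one
  add_smul_mem z hz x hx t ht hmem := hx <| by
    have hz' : -z ∈ tsupport φ := by
      have := tsupport_comp_subset_preimage φ (f := fun z : EuclideanSpace ℝ (Fin n) => -z)
        continuous_neg hz
      exact this
    have := hφ.add_smul_mem _ hz' _ hmem t ht
    simpa using this

theorem abs_jac_le (c : Fin k → Fin n) {u : Fin k → EuclideanSpace ℝ (Fin n) → ℝ}
    {x : EuclideanSpace ℝ (Fin n)} {D : ℝ} (h : ∀ i j, |pd j (u i) x| ≤ D) :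
    |jac c u x| ≤ k.factorial * D ^ k := by
  have := Matrix.det_le (A := Matrix.of fun i j => pd (c j) (u i) x)
    (abv := (AbsoluteValue.abs : AbsoluteValue ℝ ℝ)) (x := D) fun i j => h i (c j)
  simpa [jac] using this

/-- Rademacher's theorem gives derivatives within `R`; they are full derivatives at interior points,
and the frontier of a convex set is a null set. -/
theorem ae_differentiableAt_of_lipschitzOnWith {R : Set (EuclideanSpace ℝ (Fin n))}
    (hR : IsClosed R) (hRc : Convex ℝ R) {f : EuclideanSpace ℝ (Fin n) → ℝ} {K : NNReal}
    (hf : LipschitzOnWith K f R) : ∀ᵐ x ∂(volume.restrict R), DifferentiableAt ℝ f x := by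
  have h1 : ∀ᵐ x ∂(volume : Measure (EuclideanSpace ℝ (Fin n))), x ∉ frontier R :=
    measure_eq_zero_iff_ae_notMem.1 (hRc.addHaar_frontier _)
  rw [ae_restrict_iff' hR.measurableSet]
  filter_upwards [h1, hf.ae_differentiableWithinAt_of_mem] with x hx hd hxR
  refine (hd hxR).differentiableAt ?_
  rw [← mem_interior_iff_mem_nhds]
  by_contra h
  exact hx ⟨subset_closure hxR, h⟩

theorem tendsto_jac {c : Fin k → Fin n} {u : Fin k → EuclideanSpace ℝ (Fin n) → ℝ}
    {U : ℕ → Fin k → EuclideanSpace ℝ (Fin n) → ℝ} {x : EuclideanSpace ℝ (Fin n)}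
    (h : ∀ i j, Tendsto (fun m => pd j (U m i) x) atTop (𝓝 (pd j (u i) x))) :
    Tendsto (fun m => jac c (U m) x) atTop (𝓝 (jac c u x)) := by
  simp_rw [jac_eq_sum]
  exact tendsto_finsetSum _ fun σ _ => (tendsto_finsetProd _ fun i _ => h _ _).const_mul _

/-- The Jacobians of the averaged Lipschitz functions are uniformly bounded and converge almost
everywhere. Dominated convergence handles `v`, and `L^1` convergence handles `V m - v`. No
regularity of `v` is needed, as it is not differentiated. -/
theorem tendsto_integral_mul_jac (c : Fin k → Fin n) {R : Set (EuclideanSpace ℝ (Fin n))}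
    (hR : IsClosed R) (hRc : Convex ℝ R) {φ : EuclideanSpace ℝ (Fin n) → ℝ} (hφ : IsKernel R φ)
    {v : EuclideanSpace ℝ (Fin n) → ℝ} (hv : Integrable v)
    {V : ℕ → EuclideanSpace ℝ (Fin n) → ℝ} (hV : ∀ m, Integrable (V m))
    (hVv : Tendsto (fun m => ∫⁻ x in R, ‖V m x - v x‖ₑ) atTop (𝓝 0))
    {u : Fin k → EuclideanSpace ℝ (Fin n) → ℝ} (hu : ∀ i, LocallyIntegrable (u i))
    {K : NNReal} (huL : ∀ i, LipschitzOnWith K (u i) R) {τ : ℕ → ℝ} (hτ : ∀ m, 0 < τ m)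
    (hτ0 : Tendsto τ atTop (𝓝 0)) :
    Tendsto (fun m => ∫ x in R, V m x * jac c (fun i => mol φ (τ m) (u i)) x) atTop
      (𝓝 (∫ x in R, v x * jac c u x)) := by
  obtain ⟨r, hr, hrφ⟩ := hφ.exists_norm_le
  -- Increments of `u i` at scale `τ m` are at most `K * (τ m * r)`, which cancels the factor `(τ
  -- m)⁻¹` of the derivative; the sum over `j` makes one constant serve all directions.
  set D := ∑ j, K * r * ∫ z, |pd j φ z| with hD
  have hI : ∀ j, 0 ≤ K * r * ∫ z, |pd j φ z| := fun j =>
    mul_nonneg (by positivity) (integral_nonneg fun _ => abs_nonneg _)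
  have hbound : ∀ m i j, ∀ x ∈ R, |pd j (mol φ (τ m) (u i)) x| ≤ D := by
    intro m i j x hx
    have h1 := abs_pd_mol_le hφ (hu i) (hτ m) j (x := x) (b := K * (τ m * r)) fun z hz => by
      have h := (huL i).dist_le_mul _ (hφ.add_smul_mem z hz x hx (τ m) (hτ m).le) _ hx
      rw [Real.dist_eq, dist_eq_norm, add_sub_cancel_left, norm_smul,
        Real.norm_of_nonneg (hτ m).le] at h
      have := hrφ z hz
      have := (hτ m).le
      exact h.trans (by gcongr)
    refine h1.trans (le_trans (le_of_eq ?_)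
      (Finset.single_le_sum (fun j _ => hI j) (Finset.mem_univ j)))
    have := (hτ m).ne'
    field_simp
  set J := k.factorial * D ^ k
  have hJ : ∀ m, ∀ x ∈ R, |jac c (fun i => mol φ (τ m) (u i)) x| ≤ J := fun m x hx =>
    abs_jac_le c fun i j => hbound m i j x hx
  have hsm : ∀ m, Continuous (jac c fun i => mol φ (τ m) (u i)) := fun m =>
    (contDiff_jac c fun i =>
      contDiff_mol hφ.contDiff hφ.hasCompactSupport (hu i) (hτ m).ne').continuous
  have int : ∀ (w : EuclideanSpace ℝ (Fin n) → ℝ) m, Integrable w →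
      IntegrableOn (fun x => w x * jac c (fun i => mol φ (τ m) (u i)) x) R := fun w m hw =>
    hw.integrableOn.mul_bdd (c := J) (hsm m).aestronglyMeasurable
      ((ae_restrict_iff' hR.measurableSet).2 (Eventually.of_forall fun x hx => hJ m x hx))
  have lim1 : Tendsto (fun m => ∫ x in R, v x * jac c (fun i => mol φ (τ m) (u i)) x) atTop
      (𝓝 (∫ x in R, v x * jac c u x)) := by
    refine tendsto_integral_of_dominated_convergence (fun x => ‖v x‖ * J)
      (fun m => (int v m hv).aestronglyMeasurable) (hv.integrableOn.norm.mul_const J) ?_ ?_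
    · intro m
      refine (ae_restrict_iff' hR.measurableSet).2 (Eventually.of_forall fun x hx => ?_)
      rw [norm_mul]
      exact mul_le_mul_of_nonneg_left (hJ m x hx) (norm_nonneg _)
    · filter_upwards [ae_all_iff.2 fun i => ae_differentiableAt_of_lipschitzOnWith hR hRc (huL i)]
        with x hx
      refine (tendsto_jac fun i j => ?_).const_mul _
      exact (tendsto_pd_mol hφ (hu i) j (hx i)).comp
        (tendsto_nhdsWithin_iff.2 ⟨hτ0, Eventually.of_forall hτ⟩)
  have lim2 : Tendsto (fun m => ∫ x in R, (V m x - v x) * jac c (fun i => mol φ (τ m) (u i)) x)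
      atTop (𝓝 0) := by
    rw [tendsto_zero_iff_enorm_tendsto_zero]
    have hJ' := ENNReal.Tendsto.mul_const hVv (b := ENNReal.ofReal J)
      (Or.inr ENNReal.ofReal_ne_top)
    rw [zero_mul] at hJ'
    refine tendsto_of_tendsto_of_tendsto_of_le_of_le tendsto_const_nhds hJ' (fun _ => zero_le)
      fun m => ?_
    refine (enorm_integral_le_lintegral_enorm _).trans ?_
    rw [← lintegral_mul_const' _ _ ENNReal.ofReal_ne_top]
    refine lintegral_mono_ae ((ae_restrict_iff' hR.measurableSet).2
      (Eventually.of_forall fun x hx => ?_))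
    rw [enorm_mul]
    gcongr
    rw [Real.enorm_eq_ofReal_abs]
    exact ENNReal.ofReal_le_ofReal (hJ m x hx)
  have := lim1.add lim2
  rw [add_zero] at this
  refine this.congr fun m => ?_
  rw [← integral_add (int v m hv) (int (fun x => V m x - v x) m ((hV m).sub hv))]
  refine integral_congr_ae (Eventually.of_forall fun x => ?_)
  dsimp only
  ring

/-- Bounds for the differences of dyadic averages, from bounds `e` for the errors and `g` for the
function. -/
noncomputable def dyadicBound (s : ℝ) (g : ENNReal) (e : ℕ → ENNReal) : ℕ → ENNReal
  | 0 => g + e 0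
  | m + 1 => 2 ^ ((m + 1 : ℕ) * s) * (e m + e (m + 1))

theorem two_pow_eq (m : ℕ) (s : ℝ) : (2 : ENNReal) ^ m = 2 ^ (m * (1 - s)) * 2 ^ (m * s) := by
  rw [← ENNReal.rpow_add _ _ (by simp) (by simp), ← ENNReal.rpow_natCast]
  congr 1; ring

theorem two_rpow_neg_mul (m : ℕ) (s : ℝ) (a : ENNReal) :
    (2 : ENNReal) ^ (-(m * s)) * (2 ^ (m * s) * a) = a := by
  rw [← mul_assoc, ← ENNReal.rpow_add _ _ (by simp) (by simp)]
  simp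

/-- The integral of `u_0 det (∂u_i)` is bounded by dyadic sums. -/
theorem enorm_integral_mul_jac_le_tsum (c : Fin k → Fin n) {R : Set (EuclideanSpace ℝ (Fin n))}
    (hR : IsClosed R) (hRc : Convex ℝ R) {φ : EuclideanSpace ℝ (Fin n) → ℝ} (hφ : IsKernel R φ)
    {G : Fin (k + 1) → (EuclideanSpace ℝ (Fin n) → ℝ) → ENNReal}
    (hG : ∀ h : Fin (k + 1) → EuclideanSpace ℝ (Fin n) → ℝ, (∀ i, Continuous (h i)) →
      ∫⁻ x in R, ∏ i, ‖h i x‖ₑ ≤ ∏ i, G i (h i))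
    (hG0 : ∀ s, G s 0 = 0)
    (hGs : ∀ s f g h, Measurable f → Measurable g → Measurable h →
      G s (f - g) ≤ G s (f - h) + G s (g - h))
    {u : Fin (k + 1) → EuclideanSpace ℝ (Fin n) → ℝ} {ρ : ℝ} (hρ : ∀ i x, ρ < ‖x‖ → u i x = 0)
    (h0 : ∀ x ∉ R, u 0 x = 0) (hu : ∀ i, Integrable (u i)) (hum : ∀ i, Measurable (u i))
    {K : NNReal} (huL : ∀ i : Fin k, LipschitzOnWith K (u i.succ) R)
    {κ : Fin (k + 1) → EuclideanSpace ℝ (Fin n) → ℝ} (hκ0 : κ 0 = fun z => φ (-z))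
    (hκ : ∀ i : Fin k, κ i.succ = φ) {σ : Fin (k + 1) → ℝ} {g : Fin (k + 1) → ENNReal}
    {e : Fin (k + 1) → ℕ → ENNReal}
    (hg : ∀ s, G s (u s) ≤ g s) (he : ∀ s m, G s (mol (κ s) ((1 / 2) ^ m) (u s) - u s) ≤ e s m)
    (hpd : ∀ s m j, G s (pd j (mol (κ s) ((1 / 2) ^ m) (u s))) ≤ 2 ^ m * e s m)
    (hlim : Tendsto (fun m : ℕ => ∫⁻ x in R, ‖mol (κ 0) ((1 / 2) ^ m) (u 0) x - u 0 x‖ₑ) atTop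
      (𝓝 0)) :
    ‖∫ x in R, u 0 x * jac c (fun i => u i.succ) x‖ₑ ≤ (k + 1) * k.factorial *
      ∑' m : ℕ, (2 : ENNReal) ^ (-(m * (∑ i, σ i - k))) *
        ∏ i, dyadicBound (σ i) (g i) (e i) m := by
  obtain ⟨r, hr, hrφ⟩ := hφ.exists_norm_le
  set τ : ℕ → ℝ := fun m => (1 / 2) ^ m
  have hτ : ∀ m, 0 < τ m := fun m => by positivity
  have hτ1 : ∀ m, τ m ≤ 1 := fun m => pow_le_one₀ (by norm_num) (by norm_num)
  have hloc : ∀ i, LocallyIntegrable (u i) := fun i => (hu i).locallyIntegrable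
  have hker : ∀ s, ∃ R', IsKernel R' (κ s) := by
    intro s
    induction s using Fin.cases with
    | zero => rw [hκ0]; exact ⟨_, hφ.neg⟩
    | succ i => rw [hκ]; exact ⟨_, hφ⟩
  have hsm : ∀ s m, ContDiff ℝ ∞ (mol (κ s) (τ m) (u s)) := fun s m => by
    obtain ⟨R', h⟩ := hker s
    exact contDiff_mol h.contDiff h.hasCompactSupport (hloc s) (hτ m).ne'
  have hcomp : ∀ m, HasCompactSupport (mol (κ 0) (τ m) (u 0)) := by
    intro m
    obtain ⟨R', h⟩ := hker 0
    obtain ⟨r', hr', hrφ'⟩ := h.exists_norm_le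
    refine HasCompactSupport.intro (isCompact_closedBall (0 : EuclideanSpace ℝ (Fin n)) (ρ + r'))
      fun x hx => ?_
    exact mol_eq_zero_of_norm hrφ' (hτ m).le (hτ1 m) (hρ 0) (by simpa using hx)
  have hzero : ∀ m, ∀ x ∉ R, mol (κ 0) (τ m) (u 0) x = 0 := by
    intro m x hx
    rw [hκ0]
    exact mol_eq_zero (S := R) (T := R)
      (fun z hz y hy => hφ.neg.add_smul_mem z hz y hy (τ m) (hτ m).le) h0 hx
  let X : ℕ → Fin (k + 1) → EuclideanSpace ℝ (Fin n) → ℝ := fun m s =>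
    match m with
    | 0 => 0
    | m + 1 => mol (κ s) (τ m) (u s)
  have hpd0 : ∀ j : Fin n, pd j (0 : EuclideanSpace ℝ (Fin n) → ℝ) = 0 := fun j => by
    ext x; simp [pd]
  have key := fun N => enorm_jacIntegral_le_sum c hR hG (X := X) (σ := σ)
    (a := fun m i => dyadicBound (σ i) (g i) (e i) m)
    (by rintro (_ | m) i; exacts [contDiff_const, hsm i m]) rfl
    (by rintro (_ | m); exacts [HasCompactSupport.zero, hcomp m])
    (by rintro (_ | m) x hx; exacts [rfl, hzero m x hx])
    (by
      rintro (_ | m) s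
      · simp only [X, sub_zero, dyadicBound, CharP.cast_eq_zero, zero_mul, neg_zero,
          ENNReal.rpow_zero, one_mul]
        have h1 := hGs s (mol (κ s) (τ 0) (u s)) 0 (u s) (hsm s 0).continuous.measurable
          measurable_zero (hum s)
        have h2 := hGs s 0 (u s) 0 measurable_zero (hum s) measurable_zero
        simp only [sub_zero, sub_self, hG0, zero_add] at h1 h2
        rw [add_comm]
        exact h1.trans (add_le_add (he s 0) (h2.trans (hg s)))
      · simp only [X, dyadicBound]
        rw [two_rpow_neg_mul, add_comm (e s m)]
        exact (hGs s _ _ (u s) (hsm s _).continuous.measurable (hsm s _).continuous.measurable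
          (hum s)).trans (add_le_add (he s _) (he s _)))
    (by
      rintro (_ | m) s j
      · simp only [X]
        rw [hpd0, hG0]
        exact zero_le
      · simp only [X, dyadicBound]
        rw [← mul_assoc, ← two_pow_eq]
        refine (hpd s m j).trans (mul_le_mul' (pow_le_pow_right₀ (by norm_num) (by omega)) ?_)
        exact le_self_add)
    (by
      rintro (_ | m) s j
      · have h1 := hpd s 0 j
        simp only [pow_zero, one_mul] at h1
        simp only [X, dyadicBound, CharP.cast_eq_zero, zero_mul, ENNReal.rpow_zero, one_mul, τ,
          pow_zero]
        exact h1.trans le_add_self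
      · simp only [X, dyadicBound]
        rw [← mul_assoc, ← two_pow_eq]
        exact (hpd s (m + 1) j).trans (mul_le_mul' le_rfl le_add_self)) N
  have hV : ∀ m, Integrable (mol (κ 0) (τ m) (u 0)) := fun m =>
    (hsm 0 m).continuous.integrable_of_hasCompactSupport (hcomp m)
  have lim := tendsto_integral_mul_jac c hR hRc hφ (hu 0) hV hlim (fun i => hloc i.succ) huL hτ
    (tendsto_pow_atTop_nhds_zero_of_lt_one (by norm_num) (by norm_num))
  refine le_of_tendsto' (lim.enorm) fun m => ?_
  -- The average of `u 0` vanishes outside `R`, so the integral over the whole space, where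
  -- integration by parts is free of boundary terms, is the integral over `R`.
  have e1 : jacIntegral c (X (m + 1)) =
      ∫ x in R, mol (κ 0) (τ m) (u 0) x * jac c (fun i => mol φ (τ m) (u i.succ)) x := by
    rw [setIntegral_eq_integral_of_forall_compl_eq_zero fun x hx => by rw [hzero m x hx, zero_mul]]
    simp only [jacIntegral, X, hκ]
  rw [← e1]
  exact (key (m + 1)).trans (mul_le_mul' le_rfl (ENNReal.sum_le_tsum _))

end Core

end DistJacobian

namespace DistJacobian

/-! ### Hölder norms -/

section HolderNorm

variable {n : ℕ} {D : Set (EuclideanSpace ℝ (Fin n))} {f : EuclideanSpace ℝ (Fin n) → ℝ}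
  {α : NNReal}

theorem abs_le_of_holderNorm (h : holderNorm α D f < ⊤) {x : EuclideanSpace ℝ (Fin n)}
    (hx : x ∈ D) : |f x| ≤ (holderNorm α D f).toReal := by
  have h1 : ‖f x‖ₑ ≤ holderNorm α D f :=
    (le_iSup (fun y : D => ‖f y‖ₑ) ⟨x, hx⟩).trans le_self_add
  have := ENNReal.toReal_mono h.ne h1
  simpa using this

theorem abs_sub_le_of_holderNorm (h : holderNorm α D f < ⊤) {x y : EuclideanSpace ℝ (Fin n)}
    (hx : x ∈ D) (hy : y ∈ D) :
    |f x - f y| ≤ (holderNorm α D f).toReal * ‖x - y‖ ^ (α : ℝ) := by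
  have h1 : eHolderNorm α (D.domRestrict f) < ⊤ := lt_of_le_of_lt le_add_self h
  have h2 := (eHolderNorm_lt_top.1 h1).holderWith.dist_le ⟨x, hx⟩ ⟨y, hy⟩
  rw [Real.dist_eq] at h2
  refine h2.trans ?_
  rw [show dist (⟨x, hx⟩ : D) ⟨y, hy⟩ = ‖x - y‖ from dist_eq_norm x y]
  gcongr
  have h3 : (nnHolderNorm α (D.domRestrict f) : ENNReal) ≤ holderNorm α D f := by
    rw [(eHolderNorm_lt_top.1 h1).coe_nnHolderNorm_eq_eHolderNorm]
    exact le_add_self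
  simpa using ENNReal.toReal_mono h.ne h3

theorem holderNorm_le {A B : ℝ} (hA0 : 0 ≤ A) (hB0 : 0 ≤ B) (hA : ∀ x ∈ D, |f x| ≤ A)
    (hB : ∀ x ∈ D, ∀ y ∈ D, |f x - f y| ≤ B * ‖x - y‖ ^ (α : ℝ)) :
    holderNorm α D f ≤ ENNReal.ofReal (A + B) := by
  rw [ENNReal.ofReal_add hA0 hB0]
  refine add_le_add (iSup_le fun x => ?_) ?_
  · rw [Real.enorm_eq_ofReal_abs]
    exact ENNReal.ofReal_le_ofReal (hA x x.2)
  · have : HolderWith B.toNNReal α (D.domRestrict f) := by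
      intro x y
      have h := hB x x.2 y y.2
      rw [edist_dist, Real.dist_eq, edist_dist]
      rw [show dist x y = ‖(x : EuclideanSpace ℝ (Fin n)) - y‖ from
        dist_eq_norm (x : EuclideanSpace ℝ (Fin n)) (y : EuclideanSpace ℝ (Fin n)),
        ENNReal.ofReal_rpow_of_nonneg (norm_nonneg _) α.coe_nonneg]
      change _ ≤ ENNReal.ofReal B * _
      rw [← ENNReal.ofReal_mul hB0]
      exact ENNReal.ofReal_le_ofReal h
    exact this.eHolderNorm_le

theorem LipschitzOnWith.of_holderNorm (h : holderNorm 1 D f < ⊤) :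
    LipschitzOnWith (holderNorm 1 D f).toNNReal f D := by
  refine LipschitzOnWith.of_dist_le_mul fun x hx y hy => ?_
  have := abs_sub_le_of_holderNorm h hx hy
  simp only [NNReal.coe_one, Real.rpow_one] at this
  rw [Real.dist_eq, dist_eq_norm]
  exact this

theorem continuousOn_of_holderNorm (hα : 0 < α) (h : holderNorm α D f < ⊤) : ContinuousOn f D := by
  intro x hx
  rw [ContinuousWithinAt, tendsto_iff_norm_sub_tendsto_zero]
  have h2 : Tendsto (fun y => (holderNorm α D f).toReal * ‖y - x‖ ^ (α : ℝ)) (𝓝[D] x) (𝓝 0) := by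
    have : Continuous fun y : EuclideanSpace ℝ (Fin n) =>
        (holderNorm α D f).toReal * ‖y - x‖ ^ (α : ℝ) :=
      continuous_const.mul ((continuous_id.sub continuous_const).norm.rpow_const
        fun _ => Or.inr α.2)
    have h3 := this.tendsto x
    simp only [sub_self, norm_zero, Real.zero_rpow (NNReal.coe_ne_zero.2 hα.ne'), mul_zero] at h3
    exact h3.mono_left nhdsWithin_le_nhds
  refine tendsto_of_tendsto_of_tendsto_of_le_of_le' tendsto_const_nhds h2
    (Eventually.of_forall fun _ => norm_nonneg _) ?_
  filter_upwards [self_mem_nhdsWithin] with y hy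
  exact abs_sub_le_of_holderNorm h hy hx

theorem measurable_of_holderNorm (hα : 0 < α) (hD : IsClosed D) (h : holderNorm α D f < ⊤)
    (h0 : ∀ x ∉ D, f x = 0) : Measurable f := by
  have : f = D.indicator f := by
    ext x
    by_cases hx : x ∈ D
    · simp [hx]
    · simp [hx, h0 x hx]
  classical
  rw [this, ← Set.piecewise_eq_indicator]
  exact (continuousOn_of_holderNorm hα h).measurable_piecewise continuousOn_const
    hD.measurableSet

theorem integrable_of_holderNorm (hα : 0 < α) (hD : IsClosed D) (h : holderNorm α D f < ⊤)
    (h0 : ∀ x ∉ D, f x = 0) {ρ : ℝ} (hρ : ∀ x, ρ < ‖x‖ → f x = 0) : Integrable f := by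
  have h1 : IntegrableOn f (Metric.closedBall 0 ρ) := by
    refine Measure.integrableOn_of_bounded (M := (holderNorm α D f).toReal)
      measure_closedBall_lt_top.ne
      (measurable_of_holderNorm hα hD h h0).aestronglyMeasurable (Eventually.of_forall fun x => ?_)
    by_cases hx : x ∈ D
    · exact abs_le_of_holderNorm h hx
    · simp [h0 x hx]
  refine (integrableOn_iff_integrable_of_support_subset fun x hx => ?_).1 h1
  by_contra hx'
  exact hx (hρ x (by simpa using hx'))

/-- The kinds of domains on which the multilinear estimate is proved: the whole space and closed
coordinate half-spaces. -/
def IsModelRange (R : Set (EuclideanSpace ℝ (Fin n))) : Prop :=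
  R = univ ∨ ∃ i : Fin n, R = {x | 0 ≤ x i}

theorem IsModelRange.isClosed {R : Set (EuclideanSpace ℝ (Fin n))} (hR : IsModelRange R) :
    IsClosed R := by
  rcases hR with rfl | ⟨i, rfl⟩
  · exact isClosed_univ
  · exact isClosed_le continuous_const (by fun_prop)

theorem IsModelRange.convex {R : Set (EuclideanSpace ℝ (Fin n))} (hR : IsModelRange R) :
    Convex ℝ R := by
  rcases hR with rfl | ⟨i, rfl⟩
  · exact convex_univ
  · intro x hx y hy a b ha hb _
    simp only [mem_ofPred_eq, PiLp.add_apply, PiLp.smul_apply, smul_eq_mul] at *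
    positivity

theorem IsModelRange.exists_isKernel {R : Set (EuclideanSpace ℝ (Fin n))} (hR : IsModelRange R) :
    ∃ φ, IsKernel R φ := by
  rcases hR with rfl | ⟨i, rfl⟩
  · exact exists_isKernel_univ
  · exact exists_isKernel_halfSpace i

/-- The points of a bounded part of `R` that leave `R` under a translation. -/
theorem IsModelRange.exists_volume_strip_le {R : Set (EuclideanSpace ℝ (Fin n))}
    (hR : IsModelRange R) (ρ : ℝ) :
    ∃ C : ℝ, 0 ≤ C ∧ ∀ h : EuclideanSpace ℝ (Fin n),
      volume {x | x ∈ R ∧ x + h ∉ R ∧ ‖x‖ ≤ ρ} ≤ ENNReal.ofReal (C * ‖h‖) := by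
  rcases hR with rfl | ⟨i, rfl⟩
  · exact ⟨0, le_rfl, by simp⟩
  refine ⟨∏ _j ∈ Finset.univ.erase i, max (ρ - -ρ) 0,
    Finset.prod_nonneg fun _ _ => le_max_right _ _, fun h => ?_⟩
  let box : Fin n → Set ℝ := fun j => if j = i then Icc 0 ‖h‖ else Icc (-ρ) ρ
  -- If `x i ≥ 0` and `x i + h i < 0`, then `x i` lies between `0` and `‖h‖`: the set is contained
  -- in a thin slab of a box.
  have hsub : {x : EuclideanSpace ℝ (Fin n) | x ∈ {x : EuclideanSpace ℝ (Fin n) | 0 ≤ x i} ∧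
      x + h ∉ {x : EuclideanSpace ℝ (Fin n) | 0 ≤ x i} ∧ ‖x‖ ≤ ρ} ⊆
      WithLp.ofLp ⁻¹' (Set.pi univ box) := by
    rintro x ⟨h1, h2, h3⟩ j -
    simp only [mem_ofPred_eq, PiLp.add_apply, not_le] at h1 h2
    have hj := (PiLp.norm_apply_le x j).trans h3
    have hh := PiLp.norm_apply_le h i
    rw [Real.norm_eq_abs, abs_le] at hj hh
    by_cases hji : j = i
    · subst hji
      simp only [box, if_true, mem_Icc]
      exact ⟨h1, by linarith⟩
    · simp only [box, hji, if_false, mem_Icc]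
      exact hj
  refine (measure_mono hsub).trans ?_
  have hbox : MeasurableSet (Set.pi univ box) := MeasurableSet.univ_pi fun j => by
    by_cases hji : j = i <;> simp [box, hji, measurableSet_Icc]
  rw [(PiLp.volume_preserving_ofLp (Fin n)).measure_preimage hbox.nullMeasurableSet, volume_pi_pi,
    ← Finset.mul_prod_erase _ _ (Finset.mem_univ i), mul_comm, ENNReal.ofReal_mul
      (Finset.prod_nonneg fun _ _ => le_max_right _ _), ENNReal.ofReal_prod_of_nonneg
      fun _ _ => le_max_right _ _]
  refine mul_le_mul' (Finset.prod_le_prod' fun j hj => ?_) (by simp [box])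
  simp [box, Finset.ne_of_mem_erase hj]

theorem ofReal_half_pow_rpow (m : ℕ) (s : ℝ) :
    ENNReal.ofReal (((1 / 2 : ℝ) ^ m) ^ s) = (2 : ENNReal) ^ (-(m * s)) := by
  rw [← ENNReal.ofReal_rpow_of_pos (by positivity), ENNReal.rpow_neg, ENNReal.rpow_mul,
    ← ENNReal.inv_rpow, ENNReal.rpow_natCast, ENNReal.inv_pow]
  congr 1
  rw [ENNReal.ofReal_pow (by norm_num), one_div, ENNReal.ofReal_inv_of_pos (by norm_num)]
  simp

theorem tsum_two_rpow_lt_top {δ : ℝ} (hδ : 0 < δ) :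
    ∑' m : ℕ, (2 : ENNReal) ^ (-(m * δ)) < ⊤ := by
  have : ∀ m : ℕ, (2 : ENNReal) ^ (-(m * δ)) = (2 ^ (-δ)) ^ m := fun m => by
    rw [← ENNReal.rpow_natCast, ← ENNReal.rpow_mul]
    congr 1; ring
  simp_rw [this]
  rw [ENNReal.tsum_geometric, ENNReal.inv_lt_top, tsub_pos_iff_lt]
  exact ENNReal.rpow_lt_one_of_one_lt_of_neg (by norm_num) (by linarith)

/-- The `L^1` modulus of continuity of a Hölder function. -/
theorem lintegral_enorm_add_sub_le {R : Set (EuclideanSpace ℝ (Fin n))} (hR : IsModelRange R)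
    (ρ r : ℝ) (hα1 : α ≤ 1) :
    ∃ C : ENNReal, C ≠ ⊤ ∧ ∀ u : EuclideanSpace ℝ (Fin n) → ℝ, holderNorm α R u < ⊤ →
      (∀ x ∉ R, u x = 0) → (∀ x, ρ < ‖x‖ → u x = 0) → ∀ (t : ℝ), 0 < t → t ≤ 1 →
      ∀ z ∈ Metric.closedBall (0 : EuclideanSpace ℝ (Fin n)) r,
        ∫⁻ x in R, ‖u (x + t • z) - u x‖ₑ ≤ C * holderNorm α R u * ENNReal.ofReal (t ^ (α : ℝ)) := by
  obtain ⟨S, hS0, hS⟩ := hR.exists_volume_strip_le ρ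
  set B := Metric.closedBall (0 : EuclideanSpace ℝ (Fin n)) (ρ + |r|)
  refine ⟨ENNReal.ofReal (|r| ^ (α : ℝ)) * volume B + ENNReal.ofReal (S * |r|),
    ENNReal.add_ne_top.2 ⟨ENNReal.mul_ne_top ENNReal.ofReal_ne_top measure_closedBall_lt_top.ne,
      ENNReal.ofReal_ne_top⟩, fun u hu h0 hρ t ht ht1 z hz => ?_⟩
  set N := (holderNorm α R u).toReal
  have hN : holderNorm α R u = ENNReal.ofReal N := (ENNReal.ofReal_toReal hu.ne).symm
  have hN0 : 0 ≤ N := ENNReal.toReal_nonneg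
  set T := {x | x ∈ R ∧ x + t • z ∉ R ∧ ‖x‖ ≤ ρ}
  have hz' : ‖t • z‖ ≤ t * |r| := by
    rw [norm_smul, Real.norm_of_nonneg ht.le]
    have : ‖z‖ ≤ r := by simpa using hz
    have := le_abs_self r
    gcongr
    linarith
  have hz'' : ‖t • z‖ ≤ |r| := hz'.trans (mul_le_of_le_one_left (abs_nonneg _) ht1)
  have hTm : MeasurableSet T := by
    have h1 : MeasurableSet {x | x + t • z ∉ R} :=
      (hR.isClosed.measurableSet.compl).preimage (measurable_add_const _)
    have h2 : MeasurableSet {x : EuclideanSpace ℝ (Fin n) | ‖x‖ ≤ ρ} :=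
      measurableSet_le measurable_norm measurable_const
    exact hR.isClosed.measurableSet.inter (h1.inter h2)
  -- Two sources: inside `R` the Hölder bound applies, and only on the bounded set `B`; if the
  -- translate leaves `R`, the function jumps to zero, but this happens only on the strip `T`.
  have pt : ∀ x ∈ R, ‖u (x + t • z) - u x‖ₑ ≤
      B.indicator (fun _ => ENNReal.ofReal (N * (t * |r|) ^ (α : ℝ))) x +
        T.indicator (fun _ => ENNReal.ofReal N) x := by
    intro x hx
    by_cases hxz : x + t • z ∈ R
    · by_cases hB : x ∈ B
      · rw [indicator_of_mem hB, Real.enorm_eq_ofReal_abs]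
        refine le_trans (ENNReal.ofReal_le_ofReal ?_) le_self_add
        refine (abs_sub_le_of_holderNorm hu hxz hx).trans ?_
        rw [add_sub_cancel_left]
        exact mul_le_mul_of_nonneg_left (Real.rpow_le_rpow (norm_nonneg _) hz' α.2) hN0
      · have hx1 : ρ + |r| < ‖x‖ := by simpa [B] using hB
        have hx2 : ρ < ‖x + t • z‖ := by
          have := norm_sub_le (x + t • z) (t • z)
          rw [add_sub_cancel_right] at this
          linarith
        rw [hρ _ hx2, hρ x (by linarith [abs_nonneg r])]
        simp
    · rw [h0 _ hxz, zero_sub, enorm_neg]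
      by_cases hxρ : ‖x‖ ≤ ρ
      · rw [indicator_of_mem (show x ∈ T from ⟨hx, hxz, hxρ⟩), Real.enorm_eq_ofReal_abs]
        exact le_trans (ENNReal.ofReal_le_ofReal (abs_le_of_holderNorm hu hx)) le_add_self
      · rw [hρ x (not_le.1 hxρ)]
        simp
  calc ∫⁻ x in R, ‖u (x + t • z) - u x‖ₑ
      ≤ ∫⁻ x in R, (B.indicator (fun _ => ENNReal.ofReal (N * (t * |r|) ^ (α : ℝ))) x +
        T.indicator (fun _ => ENNReal.ofReal N) x) :=
        setLIntegral_mono' hR.isClosed.measurableSet pt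
    _ ≤ ∫⁻ x, (B.indicator (fun _ => ENNReal.ofReal (N * (t * |r|) ^ (α : ℝ))) x +
        T.indicator (fun _ => ENNReal.ofReal N) x) := setLIntegral_le_lintegral _ _
    _ = ENNReal.ofReal (N * (t * |r|) ^ (α : ℝ)) * volume B + ENNReal.ofReal N * volume T := by
        rw [lintegral_add_right _ (measurable_const.indicator hTm),
          lintegral_indicator_const Metric.isClosed_closedBall.measurableSet,
          lintegral_indicator_const hTm]
    _ ≤ ENNReal.ofReal (N * (t * |r|) ^ (α : ℝ)) * volume B +
          ENNReal.ofReal N * ENNReal.ofReal (S * |r| * t ^ (α : ℝ)) := by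
        gcongr
        refine (hS _).trans (ENNReal.ofReal_le_ofReal ?_)
        -- The strip has measure of order `t`, which is good enough because `α ≤ 1` and `t ≤ 1`.
        have h1 : t ≤ t ^ (α : ℝ) := by
          have := Real.rpow_le_rpow_of_exponent_ge ht ht1 (show (α : ℝ) ≤ 1 by exact_mod_cast hα1)
          simpa using this
        have := abs_nonneg r
        calc S * ‖t • z‖ ≤ S * (t * |r|) := by gcongr
          _ ≤ S * (t ^ (α : ℝ) * |r|) := by gcongr
          _ = _ := by ring
    _ = _ := by
        rw [hN, Real.mul_rpow ht.le (abs_nonneg r), ENNReal.ofReal_mul hN0,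
          ENNReal.ofReal_mul (by positivity), ENNReal.ofReal_mul (by positivity)]
        ring

end HolderNorm

end DistJacobian

namespace DistJacobian

/-! ### The multilinear estimate for Hölder functions -/

section HolderCore

variable {n k : ℕ}

/-- The multilinear estimate for Hölder functions. -/
theorem enorm_integral_mul_jac_le_holder (c : Fin k → Fin n)
    {R : Set (EuclideanSpace ℝ (Fin n))} (hR : IsModelRange R) (ρ : ℝ)
    {α : Fin (k + 1) → NNReal} (hα0 : ∀ s, 0 < α s) (hα1 : ∀ s, α s ≤ 1)
    (hα : (k : ℝ) < ∑ s, (α s : ℝ)) :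
    ∃ C : ENNReal, C ≠ ⊤ ∧ ∀ u : Fin (k + 1) → EuclideanSpace ℝ (Fin n) → ℝ,
      (∀ s x, ρ < ‖x‖ → u s x = 0) → (∀ s, ∀ x ∉ R, u s x = 0) →
      (∀ s, holderNorm (α s) R (u s) < ⊤) → (∀ i : Fin k, holderNorm 1 R (u i.succ) < ⊤) →
      ‖∫ x in R, u 0 x * jac c (fun i => u i.succ) x‖ₑ ≤
        C * ∏ s, holderNorm (α s) R (u s) := by
  obtain ⟨φ, hφ⟩ := hR.exists_isKernel
  obtain ⟨r, hr, hrφ⟩ := hφ.exists_norm_le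
  have hRc := hR.isClosed
  -- Slot `0` gets the reflected kernel, which keeps its average zero outside `R`; the other slots
  -- look into `R`.
  set κ : Fin (k + 1) → EuclideanSpace ℝ (Fin n) → ℝ := Fin.cons (fun z => φ (-z)) fun _ => φ
  have hκr : ∀ z ∈ tsupport (κ 0), ‖z‖ ≤ r := fun z hz => by
    have := tsupport_comp_subset_preimage φ (f := fun z : EuclideanSpace ℝ (Fin n) => -z)
        continuous_neg hz
    simpa using hrφ _ this
  have hκj : ∀ j, ∀ z ∈ tsupport (pd j (κ 0)), ‖z‖ ≤ r := fun j z hz =>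
    hκr z (tsupport_pd_subset _ j hz)
  obtain ⟨C1, hC1, mod⟩ := lintegral_enorm_add_sub_le hR ρ r (hα1 0)
  obtain ⟨A, hA, hAmol⟩ := lintegral_rpow_integral_mul_le (K := κ 0) hφ.neg.contDiff.continuous hκr
    le_rfl
  choose A' hA' hAmol' using fun j => lintegral_rpow_integral_mul_le (K := pd j (κ 0))
    (contDiff_pd hφ.neg.contDiff j).continuous (hκj j) le_rfl
  set B := Metric.closedBall (0 : EuclideanSpace ℝ (Fin n)) r
  set B' := Metric.closedBall (0 : EuclideanSpace ℝ (Fin n)) ρ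
  have hB : volume B ≠ ⊤ := measure_closedBall_lt_top.ne
  have hB' : volume B' ≠ ⊤ := measure_closedBall_lt_top.ne
  -- uniform constants
  set E0 : ENNReal := (A + ∑ j, A' j) * (C1 * volume B)
  set E1 : Fin (k + 1) → ENNReal := fun s =>
    ENNReal.ofReal (r ^ (α s : ℝ) * (∫ z, |φ z|) + ∑ j, r ^ (α s : ℝ) * ∫ z, |pd j φ z|)
  have hE0 : E0 ≠ ⊤ := by
    refine ENNReal.mul_ne_top (ENNReal.add_ne_top.2 ⟨hA, ?_⟩) (ENNReal.mul_ne_top hC1 hB)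
    exact ENNReal.sum_ne_top.2 fun j _ => hA' j
  -- One constant for all requirements: the error bounds of slot `0` and of the other slots, the
  -- volume that converts a supremum into an `L^1` norm in slot `0`, and `1` for the suprema.
  set Q : ENNReal := E0 + (∑ s, E1 s) + volume B' + 1
  have hQ : Q ≠ ⊤ := by
    simp only [Q, ENNReal.add_ne_top]
    exact ⟨⟨⟨hE0, ENNReal.sum_ne_top.2 fun s _ => ENNReal.ofReal_ne_top⟩, hB'⟩, by simp⟩
  have hQ0 : E0 ≤ Q := by simp only [Q, add_assoc]; exact le_self_add
  have hQ1 : ∀ s, E1 s ≤ Q := fun s =>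
    (Finset.single_le_sum (fun _ _ => zero_le) (Finset.mem_univ s)).trans
      (le_add_self.trans (le_self_add.trans le_self_add))
  have hQ2 : volume B' ≤ Q := le_add_self.trans le_self_add
  have hQ3 : 1 ≤ Q := le_add_self
  set δ := ∑ s, (α s : ℝ) - k
  have hδ : 0 < δ := sub_pos.2 hα
  set S := ∑' m : ℕ, (2 : ENNReal) ^ (-(m * δ))
  refine ⟨(k + 1) * k.factorial * (S * ∏ _s : Fin (k + 1), (3 * Q)), ?_,
    fun u hρ h0 hN hL => ?_⟩
  · refine ENNReal.mul_ne_top (ENNReal.mul_ne_top (by finiteness) (by finiteness)) ?_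
    exact ENNReal.mul_ne_top (tsum_two_rpow_lt_top hδ).ne
      (ENNReal.prod_ne_top fun _ _ => ENNReal.mul_ne_top (by finiteness) hQ)
  have hum : ∀ s, Measurable (u s) := fun s => measurable_of_holderNorm (hα0 s) hRc (hN s) (h0 s)
  have hui : ∀ s, Integrable (u s) := fun s =>
    integrable_of_holderNorm (hα0 s) hRc (hN s) (h0 s) (hρ s)
  have hul := fun s => (hui s).locallyIntegrable
  have hpos : ∀ m : ℕ, (0 : ℝ) < (1 / 2) ^ m := fun m => by positivity
  have hle1 : ∀ m : ℕ, (1 / 2 : ℝ) ^ m ≤ 1 := fun m => pow_le_one₀ (by norm_num) (by norm_num)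
  -- Slot `0` is measured in `L^1` since its extension by zero may jump at the boundary of `R`; the
  -- other slots are measured by suprema over `R`.
  let G : Fin (k + 1) → (EuclideanSpace ℝ (Fin n) → ℝ) → ENNReal := fun s =>
    Fin.cases (fun f => ∫⁻ x in R, ‖f x‖ₑ) (fun _ f => ⨆ x ∈ R, ‖f x‖ₑ) s
  let e : Fin (k + 1) → ℕ → ENNReal := fun s m =>
    Q * holderNorm (α s) R (u s) * 2 ^ (-(m * (α s : ℝ)))
  obtain ⟨K, hK⟩ : ∃ K : NNReal, ∀ i : Fin k, LipschitzOnWith K (u i.succ) R := by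
    refine ⟨∑ i : Fin k, (holderNorm 1 R (u i.succ)).toNNReal, fun i => ?_⟩
    exact (LipschitzOnWith.of_holderNorm (hL i)).weaken
      (Finset.single_le_sum (f := fun i : Fin k => (holderNorm 1 R (u i.succ)).toNNReal)
        (fun _ _ => zero_le) (Finset.mem_univ i))
  have modi : ∀ s : Fin (k + 1), ∀ m : ℕ, ∀ x ∈ R, ∀ z ∈ tsupport φ,
      |u s (x + ((1 / 2 : ℝ) ^ m) • z) - u s x| ≤
        (holderNorm (α s) R (u s)).toReal * (((1 / 2 : ℝ) ^ m) ^ (α s : ℝ) * r ^ (α s : ℝ)) := by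
    intro s m x hx z hz
    refine (abs_sub_le_of_holderNorm (hN s) (hφ.add_smul_mem z hz x hx _ (hpos m).le) hx).trans ?_
    rw [add_sub_cancel_left, norm_smul, Real.norm_of_nonneg (hpos m).le,
      ← Real.mul_rpow (hpos m).le hr.le]
    have := hrφ z hz
    gcongr
  have heq : ∀ s m, e s m = Q * ENNReal.ofReal
      ((holderNorm (α s) R (u s)).toReal * ((1 / 2 : ℝ) ^ m) ^ (α s : ℝ)) := by
    intro s m
    rw [ENNReal.ofReal_mul ENNReal.toReal_nonneg, ENNReal.ofReal_toReal (hN s).ne,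
      ofReal_half_pow_rpow, ← mul_assoc]
  have h1 : ∀ (m : ℕ) (K : EuclideanSpace ℝ (Fin n) → ℝ) (a : ENNReal), a ≤ A + ∑ j, A' j →
      ∫⁻ x in R, ‖∫ z, K z * (u 0 (x + ((1 / 2 : ℝ) ^ m) • z) - u 0 x)‖ₑ ^ (1 : ℝ) ≤
        a * ∫⁻ z in B, ∫⁻ x in R, ‖u 0 (x + ((1 / 2 : ℝ) ^ m) • z) - u 0 x‖ₑ ^ (1 : ℝ) →
      ∫⁻ x in R, ‖∫ z, K z * (u 0 (x + ((1 / 2 : ℝ) ^ m) • z) - u 0 x)‖ₑ ≤ e 0 m := by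
    intro m K a ha hK
    simp only [ENNReal.rpow_one] at hK
    refine hK.trans ?_
    calc a * ∫⁻ z in B, ∫⁻ x in R, ‖u 0 (x + ((1 / 2 : ℝ) ^ m) • z) - u 0 x‖ₑ
        ≤ a * ∫⁻ z in B, C1 * holderNorm (α 0) R (u 0) *
            ENNReal.ofReal (((1 / 2 : ℝ) ^ m) ^ (α 0 : ℝ)) := by
          refine mul_le_mul' le_rfl ?_
          exact setLIntegral_mono' Metric.isClosed_closedBall.measurableSet fun z hz =>
            mod (u 0) (hN 0) (h0 0) (hρ 0) _ (hpos m) (hle1 m) z hz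
      _ = a * (C1 * volume B) * holderNorm (α 0) R (u 0) *
            ENNReal.ofReal (((1 / 2 : ℝ) ^ m) ^ (α 0 : ℝ)) := by
          rw [lintegral_const, Measure.restrict_apply_univ]; ring
      _ ≤ Q * holderNorm (α 0) R (u 0) * ENNReal.ofReal (((1 / 2 : ℝ) ^ m) ^ (α 0 : ℝ)) := by
          gcongr ?_ * _ * _
          refine le_trans ?_ hQ0
          exact mul_le_mul' ha le_rfl
      _ = e 0 m := by rw [ofReal_half_pow_rpow]
  have he0 : ∀ m : ℕ, ∫⁻ x in R, ‖mol (κ 0) ((1 / 2) ^ m) (u 0) x - u 0 x‖ₑ ≤ e 0 m := by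
    intro m
    simp_rw [mol_sub_eq (φ := κ 0) hφ.neg (hul 0) (hpos m).ne']
    exact h1 m _ A le_self_add (hAmol (u 0) (hum 0) _ R)
  have hinv : ∀ m : ℕ, ENNReal.ofReal ((1 / 2 : ℝ) ^ m)⁻¹ = 2 ^ m := fun m => by
    rw [one_div, inv_pow, inv_inv, ENNReal.ofReal_pow (by norm_num)]; simp
  have key := enorm_integral_mul_jac_le_tsum c hRc hR.convex hφ (G := G) (u := u) (κ := κ)
    (σ := fun s => (α s : ℝ)) (g := fun s => Q * holderNorm (α s) R (u s)) (e := e) (ρ := ρ) (K := K)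
    ?_ ?_ ?_ hρ (h0 0) hui hum hK rfl (fun _ => rfl) ?_ ?_ ?_ ?_
  · refine key.trans ?_
    rw [mul_assoc ((k + 1 : ENNReal) * _)]
    gcongr
    rw [mul_assoc, ← ENNReal.tsum_mul_right]
    refine ENNReal.tsum_le_tsum fun m => ?_
    gcongr
    rw [← Finset.prod_mul_distrib]
    refine Finset.prod_le_prod' fun s _ => ?_
    -- In units of `Q` times the norm, the dyadic bound is `2` at scale `0` and at most `1 + 2 ^ α ≤
    -- 3` afterwards.
    cases m with
    | zero =>
      simp only [dyadicBound, e, CharP.cast_eq_zero, zero_mul, neg_zero, ENNReal.rpow_zero, mul_one]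
      rw [← two_mul, ← mul_assoc]
      gcongr
      norm_num
    | succ m =>
      have e1 : (2 : ENNReal) ^ ((m + 1 : ℕ) * (α s : ℝ)) * e s (m + 1) =
          Q * holderNorm (α s) R (u s) := by
        rw [mul_comm _ (e s _), mul_assoc, ← ENNReal.rpow_add _ _ (by simp) (by simp)]
        simp
      have e2 : (2 : ENNReal) ^ ((m + 1 : ℕ) * (α s : ℝ)) * e s m ≤
          2 * (Q * holderNorm (α s) R (u s)) := by
        rw [mul_comm _ (e s _), mul_assoc, ← ENNReal.rpow_add _ _ (by simp) (by simp), mul_comm]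
        gcongr
        calc (2 : ENNReal) ^ (-(m * (α s : ℝ)) + (m + 1 : ℕ) * (α s : ℝ)) ≤ 2 ^ (1 : ℝ) := by
              refine ENNReal.rpow_le_rpow_of_exponent_le (by norm_num) ?_
              push_cast
              have : (α s : ℝ) ≤ 1 := by exact_mod_cast hα1 s
              linarith
          _ = 2 := by simp
      rw [dyadicBound, mul_add, e1]
      refine (add_le_add_left e2 _).trans (le_of_eq ?_)
      ring
  · intro h hh
    calc ∫⁻ x in R, ∏ i, ‖h i x‖ₑ
        ≤ ∫⁻ x in R, ‖h 0 x‖ₑ * ∏ i : Fin k, ⨆ y ∈ R, ‖h i.succ y‖ₑ := by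
          refine setLIntegral_mono' hRc.measurableSet fun x hx => ?_
          rw [Fin.prod_univ_succ]
          gcongr with i
          exact le_iSup₂ (f := fun y (_ : y ∈ R) => ‖h i.succ y‖ₑ) x hx
      _ = ∏ i, G i (h i) := by
          rw [lintegral_mul_const _ (hh 0).enorm.measurable, Fin.prod_univ_succ]
          rfl
  · intro s
    induction s using Fin.cases <;> simp [G]
  · intro s f g h hf hg hh
    have tri : ∀ x, ‖f x - g x‖ₑ ≤ ‖f x - h x‖ₑ + ‖g x - h x‖ₑ := fun x => by
      rw [← enorm_neg (g x - h x)]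
      refine le_trans (le_of_eq ?_) (enorm_add_le _ _)
      congr 1; ring
    induction s using Fin.cases with
    | zero =>
      change ∫⁻ x in R, ‖f x - g x‖ₑ ≤ (∫⁻ x in R, ‖f x - h x‖ₑ) + ∫⁻ x in R, ‖g x - h x‖ₑ
      have hm : Measurable fun x => ‖f x - h x‖ₑ := (hf.sub hh).enorm
      exact (lintegral_mono tri).trans (lintegral_add_left hm _).le
    | succ i =>
      refine iSup₂_le fun x hx => (tri x).trans (add_le_add ?_ ?_)
      · exact le_iSup₂ (f := fun y (_ : y ∈ R) => ‖f y - h y‖ₑ) x hx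
      · exact le_iSup₂ (f := fun y (_ : y ∈ R) => ‖g y - h y‖ₑ) x hx
  · intro s
    have hsup : ∀ x ∈ R, ‖u s x‖ₑ ≤ holderNorm (α s) R (u s) := fun x hx =>
      (le_iSup (fun y : R => ‖u s y‖ₑ) ⟨x, hx⟩).trans le_self_add
    induction s using Fin.cases with
    | zero =>
      calc ∫⁻ x in R, ‖u 0 x‖ₑ
          ≤ ∫⁻ x in R, B'.indicator (fun _ => holderNorm (α 0) R (u 0)) x := by
            refine setLIntegral_mono' hRc.measurableSet fun x hx => ?_
            by_cases hxB : x ∈ B'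
            · rw [indicator_of_mem hxB]; exact hsup x hx
            · rw [hρ 0 x (by simpa [B'] using hxB)]; simp
        _ ≤ ∫⁻ x, B'.indicator (fun _ => holderNorm (α 0) R (u 0)) x :=
            setLIntegral_le_lintegral _ _
        _ = volume B' * holderNorm (α 0) R (u 0) := by
            rw [lintegral_indicator_const Metric.isClosed_closedBall.measurableSet, mul_comm]
        _ ≤ _ := mul_le_mul' hQ2 le_rfl
    | succ i =>
      refine iSup₂_le fun x hx => (hsup x hx).trans ?_
      exact le_mul_of_one_le_left zero_le hQ3
  · intro s m
    induction s using Fin.cases with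
    | zero => exact he0 m
    | succ i =>
      refine iSup₂_le fun x hx => ?_
      rw [Pi.sub_apply, Real.enorm_eq_ofReal_abs, heq]
      have := abs_mol_sub_le hφ (hul i.succ) (hpos m).ne' (modi i.succ m x hx)
      refine (ENNReal.ofReal_le_ofReal this).trans ?_
      refine le_trans ?_ (mul_le_mul' (hQ1 i.succ) le_rfl)
      rw [← ENNReal.ofReal_mul' (by positivity)]
      refine ENNReal.ofReal_le_ofReal ?_
      have hJ : 0 ≤ ∑ j, r ^ (α i.succ : ℝ) * ∫ z, |pd j φ z| := Finset.sum_nonneg fun j _ =>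
        mul_nonneg (by positivity) (integral_nonneg fun _ => abs_nonneg _)
      have hM : 0 ≤ (holderNorm (α i.succ) R (u i.succ)).toReal *
        ((1 / 2 : ℝ) ^ m) ^ (α i.succ : ℝ) := by positivity
      nlinarith [mul_nonneg hJ hM]
  · intro s m j
    induction s using Fin.cases with
    | zero =>
      change ∫⁻ x in R, ‖pd j (mol (κ 0) ((1 / 2) ^ m) (u 0)) x‖ₑ ≤ _
      simp_rw [pd_mol_eq (φ := κ 0) hφ.neg (hul 0) (hpos m).ne', enorm_mul, enorm_neg]
      rw [lintegral_const_mul' _ _ (by finiteness),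
        Real.enorm_of_nonneg (inv_nonneg.2 (hpos m).le), hinv]
      gcongr
      exact h1 m _ (A' j) ((Finset.single_le_sum (fun _ _ => zero_le)
        (Finset.mem_univ j)).trans le_add_self) (hAmol' j (u 0) (hum 0) _ R)
    | succ i =>
      refine iSup₂_le fun x hx => ?_
      rw [Real.enorm_eq_ofReal_abs, heq]
      have := abs_pd_mol_le hφ (hul i.succ) (hpos m) j (modi i.succ m x hx)
      refine (ENNReal.ofReal_le_ofReal this).trans ?_
      rw [ENNReal.ofReal_mul (inv_nonneg.2 (hpos m).le), hinv]
      gcongr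
      refine le_trans ?_ (mul_le_mul' (hQ1 i.succ) le_rfl)
      rw [← ENNReal.ofReal_mul' (by positivity)]
      refine ENNReal.ofReal_le_ofReal ?_
      have hI : ∀ j, 0 ≤ r ^ (α i.succ : ℝ) * ∫ z, |pd j φ z| := fun j =>
        mul_nonneg (by positivity) (integral_nonneg fun _ => abs_nonneg _)
      have hJ := Finset.single_le_sum (f := fun j => r ^ (α i.succ : ℝ) * ∫ z, |pd j φ z|)
        (fun j _ => hI j) (Finset.mem_univ j)
      have hJ' : 0 ≤ r ^ (α i.succ : ℝ) * ∫ z, |φ z| :=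
        mul_nonneg (by positivity) (integral_nonneg fun _ => abs_nonneg _)
      have hM : 0 ≤ (holderNorm (α i.succ) R (u i.succ)).toReal *
        ((1 / 2 : ℝ) ^ m) ^ (α i.succ : ℝ) := by positivity
      nlinarith [mul_le_mul_of_nonneg_right hJ hM, mul_nonneg hJ' hM]
  · refine tendsto_of_tendsto_of_tendsto_of_le_of_le tendsto_const_nhds ?_ (fun _ => zero_le) he0
    have h2 : Tendsto (fun m : ℕ => (2 : ENNReal) ^ (-(m * (α 0 : ℝ)))) atTop (𝓝 0) := by
      refine ENNReal.tendsto_atTop_zero_of_tsum_ne_top (tsum_two_rpow_lt_top ?_).ne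
      exact_mod_cast hα0 0
    have := ENNReal.Tendsto.const_mul h2 (a := Q * holderNorm (α 0) R (u 0))
      (Or.inr (ENNReal.mul_ne_top hQ (hN 0).ne))
    simpa using this

end HolderCore

end DistJacobian

namespace DistJacobian

/-! ### The multilinear estimate for fractional Sobolev functions -/

section SobolevCore

variable {n k : ℕ}

/-- The terms are nonzero only while `2 ^ m ≤ r / ‖h‖`. A finite geometric sum is comparable with
its last term, which is at most `(r / ‖h‖) ^ a`. -/
theorem tsum_dyadic_weight_le {a r : ℝ} (ha : 0 < a) (hr : 0 < r) :
    ∃ C : ENNReal, C ≠ ⊤ ∧ ∀ h : EuclideanSpace ℝ (Fin n), h ≠ 0 →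
      ∑' m : ℕ, (if ‖h‖ ≤ r * (1 / 2) ^ m then (2 : ENNReal) ^ (m * a) else 0) ≤
        C * (‖h‖ₑ ^ a)⁻¹ := by
  refine ⟨ENNReal.ofReal r ^ a * ∑' m : ℕ, (2 : ENNReal) ^ (-(m * a)), ?_, fun h hh => ?_⟩
  · exact ENNReal.mul_ne_top (by finiteness) (tsum_two_rpow_lt_top ha).ne
  have hpos : 0 < ‖h‖ := norm_pos_iff.2 hh
  rcases lt_or_ge (r / ‖h‖) 1 with hlt | hge
  · have : ∀ m : ℕ, ¬ ‖h‖ ≤ r * (1 / 2) ^ m := fun m hm => by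
      rw [div_lt_one hpos] at hlt
      have : r * (1 / 2) ^ m ≤ r := mul_le_of_le_one_right hr.le
        (pow_le_one₀ (by norm_num) (by norm_num))
      linarith
    simp_rw [if_neg (this _)]
    simp
  obtain ⟨M, hM1, hM2⟩ := exists_nat_pow_near hge one_lt_two
  have hzero : ∀ m ∉ Finset.range (M + 1),
      (if ‖h‖ ≤ r * (1 / 2) ^ m then (2 : ENNReal) ^ (m * a) else 0) = 0 := by
    intro m hm
    rw [if_neg]
    intro hle
    have hm' : M + 1 ≤ m := by simpa using hm
    have h1 : (2 : ℝ) ^ (M + 1) ≤ 2 ^ m := pow_le_pow_right₀ (by norm_num) hm'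
    rw [div_lt_iff₀ hpos] at hM2
    have h2 : (2 : ℝ) ^ m * ‖h‖ ≤ r := by
      have := mul_le_mul_of_nonneg_left hle (show (0 : ℝ) ≤ 2 ^ m by positivity)
      rw [one_div, inv_pow, mul_comm r, ← mul_assoc, mul_inv_cancel₀ (by positivity), one_mul] at this
      exact this
    have := mul_le_mul_of_nonneg_right h1 hpos.le
    linarith
  rw [tsum_eq_sum hzero]
  calc ∑ m ∈ Finset.range (M + 1), (if ‖h‖ ≤ r * (1 / 2) ^ m then (2 : ENNReal) ^ (m * a) else 0)
      ≤ ∑ m ∈ Finset.range (M + 1), (2 : ENNReal) ^ (m * a) :=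
        Finset.sum_le_sum fun m _ => by split_ifs <;> simp
    _ = ∑ j ∈ Finset.range (M + 1), (2 : ENNReal) ^ (M * a) * 2 ^ (-(j * a)) := by
        rw [← Finset.sum_range_reflect]
        refine Finset.sum_congr rfl fun j hj => ?_
        rw [← ENNReal.rpow_add _ _ (by simp) (by simp)]
        congr 1
        have : j ≤ M := Nat.lt_succ_iff.1 (Finset.mem_range.1 hj)
        rw [show M + 1 - 1 - j = M - j by omega, Nat.cast_sub this]
        ring
    _ ≤ 2 ^ (M * a) * ∑' j : ℕ, (2 : ENNReal) ^ (-(j * a)) := by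
        rw [← Finset.mul_sum]
        gcongr
        exact ENNReal.sum_le_tsum _
    _ ≤ (ENNReal.ofReal r ^ a * (‖h‖ₑ ^ a)⁻¹) * ∑' j : ℕ, (2 : ENNReal) ^ (-(j * a)) := by
        gcongr
        rw [← ENNReal.inv_rpow, ← ENNReal.mul_rpow_of_nonneg _ _ ha.le, ENNReal.rpow_mul,
          ENNReal.rpow_natCast]
        gcongr
        rw [← ofReal_norm, ← ENNReal.ofReal_inv_of_pos hpos, ← ENNReal.ofReal_mul hr.le,
          ← div_eq_mul_inv]
        calc (2 : ENNReal) ^ M = ENNReal.ofReal (2 ^ M) := by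
              rw [ENNReal.ofReal_pow (by norm_num)]; simp
          _ ≤ _ := ENNReal.ofReal_le_ofReal hM1
    _ = _ := by ring

/-- The Gagliardo seminorm, raised to the power `p`. -/
noncomputable def gagliardo (s p : ℝ) (D : Set (EuclideanSpace ℝ (Fin n)))
    (f : EuclideanSpace ℝ (Fin n) → ℝ) : ENNReal :=
  ∫⁻ x in D, ∫⁻ y in D, ‖f x - f y‖ₑ ^ p / ‖x - y‖ₑ ^ (n + s * p)

/-- The substitution `h = 2 ^ (-m) z` has Jacobian `2 ^ (m * n)`; this is where the dimension enters
the exponent of the Gagliardo kernel. -/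
theorem setLIntegral_comp_smul {F : EuclideanSpace ℝ (Fin n) → ENNReal} (hF : Measurable F)
    (r : ℝ) (m : ℕ) :
    ∫⁻ z in Metric.closedBall (0 : EuclideanSpace ℝ (Fin n)) r, F (((1 / 2 : ℝ) ^ m) • z) =
      ∫⁻ h, (if ‖h‖ ≤ r * (1 / 2) ^ m then (2 : ENNReal) ^ (m * (n : ℝ)) else 0) * F h := by
  have ht : (0 : ℝ) < (1 / 2) ^ m := by positivity
  set S := {h : EuclideanSpace ℝ (Fin n) | ‖h‖ ≤ r * (1 / 2) ^ m}
  have hS : MeasurableSet S := measurableSet_le measurable_norm measurable_const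
  have e1 : ∫⁻ z in Metric.closedBall (0 : EuclideanSpace ℝ (Fin n)) r, F (((1 / 2 : ℝ) ^ m) • z) =
      ∫⁻ z, (S.indicator F) (((1 / 2 : ℝ) ^ m) • z) := by
    rw [← lintegral_indicator Metric.isClosed_closedBall.measurableSet]
    refine lintegral_congr fun z => ?_
    have : z ∈ Metric.closedBall (0 : EuclideanSpace ℝ (Fin n)) r ↔ ((1 / 2 : ℝ) ^ m) • z ∈ S := by
      simp only [mem_closedBall_zero_iff, S, mem_ofPred_eq]
      rw [norm_smul, Real.norm_of_nonneg ht.le, mul_comm, mul_le_mul_iff_left₀ ht]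
    by_cases hz : z ∈ Metric.closedBall (0 : EuclideanSpace ℝ (Fin n)) r
    · rw [indicator_of_mem hz, indicator_of_mem (this.1 hz)]
    · rw [indicator_of_notMem hz, indicator_of_notMem fun h => hz (this.2 h)]
  have hmap := Measure.map_addHaar_smul
    (volume : Measure (EuclideanSpace ℝ (Fin n))) (r := (1 / 2 : ℝ) ^ m) ht.ne'
  rw [e1, ← lintegral_map (hF.indicator hS) (measurable_const_smul _), hmap, lintegral_smul_measure,
    smul_eq_mul, ← lintegral_const_mul _ (hF.indicator hS)]
  have hconst : ENNReal.ofReal |(((1 / 2 : ℝ) ^ m) ^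
      Module.finrank ℝ (EuclideanSpace ℝ (Fin n)))⁻¹| = (2 : ENNReal) ^ (m * (n : ℝ)) := by
    rw [finrank_euclideanSpace, Fintype.card_fin, abs_of_pos (by positivity), one_div, inv_pow,
      inv_pow, inv_inv, ← pow_mul, ENNReal.ofReal_pow (by norm_num), ← Nat.cast_mul,
      ENNReal.rpow_natCast]
    simp
  rw [hconst]
  refine lintegral_congr fun h => ?_
  by_cases hh : ‖h‖ ≤ r * (1 / 2) ^ m
  · rw [indicator_of_mem (show h ∈ S from hh), if_pos hh]
  · rw [indicator_of_notMem (show h ∉ S from hh), if_neg hh]; simp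

/-- Dyadic sums of `L^p` moduli of continuity are bounded by the Gagliardo seminorm. -/
theorem tsum_modulus_le {s p r : ℝ} (hs : 0 < s) (hp : 1 ≤ p) (hr : 0 < r) :
    ∃ C : ENNReal, C ≠ ⊤ ∧ ∀ u : EuclideanSpace ℝ (Fin n) → ℝ, Measurable u →
      ∑' m : ℕ, (2 : ENNReal) ^ (m * (s * p)) *
        ∫⁻ z in Metric.closedBall (0 : EuclideanSpace ℝ (Fin n)) r,
          ∫⁻ x, ‖u (x + ((1 / 2 : ℝ) ^ m) • z) - u x‖ₑ ^ p ≤ C * gagliardo s p univ u := by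
  have hp0 : 0 < p := by linarith
  have ha : 0 < n + s * p := by positivity
  obtain ⟨C, hC, hw⟩ := tsum_dyadic_weight_le (n := n) ha hr
  refine ⟨C, hC, fun u hu => ?_⟩
  have meas : Measurable fun q : EuclideanSpace ℝ (Fin n) × EuclideanSpace ℝ (Fin n) =>
      ‖u (q.2 + q.1) - u q.2‖ₑ ^ p := by fun_prop
  set W : EuclideanSpace ℝ (Fin n) → ENNReal := fun h => ∫⁻ x, ‖u (x + h) - u x‖ₑ ^ p
  have hW : Measurable W := meas.lintegral_prod_right'
  have hind : ∀ (m : ℕ) (b : ENNReal), Measurable fun h : EuclideanSpace ℝ (Fin n) =>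
      if ‖h‖ ≤ r * (1 / 2) ^ m then b else 0 := fun m b =>
    Measurable.ite (measurableSet_le measurable_norm measurable_const) measurable_const
      measurable_const
  have hindW : ∀ (m : ℕ) (b : ENNReal), Measurable fun h : EuclideanSpace ℝ (Fin n) =>
      (if ‖h‖ ≤ r * (1 / 2) ^ m then b else 0) * W h := fun m b => (hind m b).mul hW
  have e1 : ∀ m : ℕ, (2 : ENNReal) ^ (m * (s * p)) *
        ∫⁻ z in Metric.closedBall (0 : EuclideanSpace ℝ (Fin n)) r,
          ∫⁻ x, ‖u (x + ((1 / 2 : ℝ) ^ m) • z) - u x‖ₑ ^ p =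
      ∫⁻ h, (if ‖h‖ ≤ r * (1 / 2) ^ m then (2 : ENNReal) ^ (m * (n + s * p)) else 0) * W h := by
    intro m
    rw [setLIntegral_comp_smul hW r m, ← lintegral_const_mul _ (hindW m _)]
    refine lintegral_congr fun h => ?_
    split_ifs
    · rw [← mul_assoc, ← ENNReal.rpow_add _ _ (by simp) (by simp)]
      congr 2; ring
    · simp
  simp_rw [e1]
  -- With the sum under the integral, the dyadic weights add up to the kernel `‖h‖ ^ (-(n + s *
  -- p))`, up to a constant.
  rw [← lintegral_tsum fun m => (hindW m _).aemeasurable]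
  have e2 : ∀ h, ∑' m : ℕ, (if ‖h‖ ≤ r * (1 / 2) ^ m then (2 : ENNReal) ^ (m * (n + s * p)) else 0) *
      W h ≤ C * ((‖h‖ₑ ^ (n + s * p))⁻¹ * W h) := by
    intro h
    rw [ENNReal.tsum_mul_right, ← mul_assoc]
    -- The weights diverge at `h = 0`, but there the modulus `W` vanishes.
    rcases eq_or_ne h 0 with rfl | hh
    · have : W 0 = 0 := by simp [W, hp0]
      simp [this]
    · gcongr
      exact hw h hh
  have hinv : Measurable fun h : EuclideanSpace ℝ (Fin n) => (‖h‖ₑ ^ (n + s * p))⁻¹ := by fun_prop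
  refine (lintegral_mono e2).trans ?_
  have hinvW : Measurable fun h : EuclideanSpace ℝ (Fin n) => (‖h‖ₑ ^ (n + s * p))⁻¹ * W h :=
    hinv.mul hW
  rw [lintegral_const_mul _ hinvW]
  gcongr
  refine le_of_eq ?_
  have e3 : ∀ h, (‖h‖ₑ ^ (n + s * p))⁻¹ * W h =
      ∫⁻ x, (‖h‖ₑ ^ (n + s * p))⁻¹ * ‖u (x + h) - u x‖ₑ ^ p := fun h => by
    rw [lintegral_const_mul _ (by fun_prop)]
  simp_rw [e3]
  rw [lintegral_lintegral_swap (by fun_prop)]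
  simp only [gagliardo, Measure.restrict_univ]
  refine lintegral_congr fun x => ?_
  rw [← lintegral_add_left_eq_self (μ := (volume : Measure (EuclideanSpace ℝ (Fin n)))) (fun y =>
    ‖u x - u y‖ₑ ^ p / ‖x - y‖ₑ ^ (n + s * p)) x]
  refine lintegral_congr fun h => ?_
  rw [sub_add_cancel_left, enorm_neg, ← enorm_neg (u x - _), neg_sub, ENNReal.div_eq_inv_mul]

/-- Hölder's inequality for the counting measure on the scales. It replaces the geometric series at
the critical exponents. -/
theorem tsum_prod_le {ι : Type*} (S : Finset ι) {p : ι → ℝ} (hp : ∀ i, 0 < p i)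
    (hsum : ∑ i ∈ S, 1 / p i = 1) (a : ι → ℕ → ENNReal) :
    ∑' m, ∏ i ∈ S, a i m ≤ ∏ i ∈ S, (∑' m, a i m ^ p i) ^ (1 / p i) := by
  have := ENNReal.lintegral_prod_norm_pow_le (μ := (Measure.count : Measure ℕ)) S
    (f := fun i m => a i m ^ p i) (fun i _ => (measurable_of_countable _).aemeasurable) hsum
    fun i _ => (one_div_pos.2 (hp i)).le
  simp only [lintegral_count] at this
  refine le_trans (le_of_eq ?_) this
  refine tsum_congr fun m => Finset.prod_congr rfl fun i _ => ?_
  rw [← ENNReal.rpow_mul, mul_one_div_cancel (hp i).ne', ENNReal.rpow_one]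

/-- The dyadic bounds for the averages of a Sobolev function are summable. -/
theorem tsum_dyadicBound_rpow_le {s p : ℝ} (hp : 1 ≤ p) (g : ENNReal) (e : ℕ → ENNReal) :
    ∑' m, dyadicBound s g e m ^ p ≤ 2 ^ (p - 1) * (g ^ p + (2 ^ (s * p) + 2) *
      ∑' m : ℕ, 2 ^ (m * (s * p)) * e m ^ p) := by
  have hp0 : 0 ≤ p := by linarith
  set T := ∑' m : ℕ, (2 : ENNReal) ^ (m * (s * p)) * e m ^ p
  have hshift : ∑' m : ℕ, (2 : ENNReal) ^ ((m + 1 : ℕ) * (s * p)) * e (m + 1) ^ p ≤ T :=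
    ENNReal.tsum_comp_le_tsum_of_injective (add_left_injective 1)
      (fun m : ℕ => (2 : ENNReal) ^ (m * (s * p)) * e m ^ p)
  have h0 : e 0 ^ p ≤ T := by
    have := ENNReal.le_tsum (f := fun m : ℕ => (2 : ENNReal) ^ (m * (s * p)) * e m ^ p) 0
    simpa using this
  rw [tsum_eq_zero_add' ENNReal.summable]
  have hstep : ∀ m : ℕ, dyadicBound s g e (m + 1) ^ p ≤ 2 ^ (p - 1) *
      (2 ^ (s * p) * (2 ^ (m * (s * p)) * e m ^ p) +
        2 ^ ((m + 1 : ℕ) * (s * p)) * e (m + 1) ^ p) := by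
    intro m
    rw [dyadicBound, ENNReal.mul_rpow_of_nonneg _ _ hp0, ← ENNReal.rpow_mul]
    refine (mul_le_mul' le_rfl (ENNReal.rpow_add_le_mul_rpow_add_rpow _ _ hp)).trans (le_of_eq ?_)
    rw [show ((m + 1 : ℕ) : ℝ) * s * p = s * p + m * (s * p) by push_cast; ring,
      show ((m + 1 : ℕ) : ℝ) * (s * p) = s * p + m * (s * p) by push_cast; ring,
      ENNReal.rpow_add _ _ (by simp) (by simp)]
    ring
  calc dyadicBound s g e 0 ^ p + ∑' m, dyadicBound s g e (m + 1) ^ p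
      ≤ 2 ^ (p - 1) * (g ^ p + T) + ∑' m : ℕ, 2 ^ (p - 1) *
        (2 ^ (s * p) * (2 ^ (m * (s * p)) * e m ^ p) +
          2 ^ ((m + 1 : ℕ) * (s * p)) * e (m + 1) ^ p) := by
        refine add_le_add ?_ (ENNReal.tsum_le_tsum hstep)
        rw [dyadicBound]
        refine (ENNReal.rpow_add_le_mul_rpow_add_rpow _ _ hp).trans ?_
        gcongr
    _ ≤ 2 ^ (p - 1) * (g ^ p + T) + 2 ^ (p - 1) * (2 ^ (s * p) * T + T) := by
        rw [ENNReal.tsum_mul_left, ENNReal.tsum_add, ENNReal.tsum_mul_left]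
        gcongr
    _ = _ := by ring

theorem sobolevNorm_eq {s p : ℝ} (hp : 0 < p) (D : Set (EuclideanSpace ℝ (Fin n)))
    (f : EuclideanSpace ℝ (Fin n) → ℝ) :
    sobolevNorm s p D f = (∫⁻ x in D, ‖f x‖ₑ ^ p) ^ (1 / p) + gagliardo s p D f ^ (1 / p) := by
  rw [sobolevNorm, eLpNorm_eq_lintegral_rpow_enorm_toReal (by simpa using hp) (by simp),
    ENNReal.toReal_ofReal hp.le]
  rfl

theorem gagliardo_le {s p : ℝ} (hp : 0 < p) (D : Set (EuclideanSpace ℝ (Fin n)))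
    (f : EuclideanSpace ℝ (Fin n) → ℝ) : gagliardo s p D f ≤ sobolevNorm s p D f ^ p := by
  rw [sobolevNorm_eq hp]
  calc gagliardo s p D f = (gagliardo s p D f ^ (1 / p)) ^ p := by
        rw [← ENNReal.rpow_mul, one_div_mul_cancel hp.ne', ENNReal.rpow_one]
    _ ≤ _ := by gcongr; exact le_add_self

theorem lintegral_rpow_le {s p : ℝ} (hp : 0 < p) (D : Set (EuclideanSpace ℝ (Fin n)))
    (f : EuclideanSpace ℝ (Fin n) → ℝ) :
    ∫⁻ x in D, ‖f x‖ₑ ^ p ≤ sobolevNorm s p D f ^ p := by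
  rw [sobolevNorm_eq hp]
  calc ∫⁻ x in D, ‖f x‖ₑ ^ p = ((∫⁻ x in D, ‖f x‖ₑ ^ p) ^ (1 / p)) ^ p := by
        rw [← ENNReal.rpow_mul, one_div_mul_cancel hp.ne', ENNReal.rpow_one]
    _ ≤ _ := by gcongr; exact le_self_add

theorem lintegral_enorm_le_of_support {f : EuclideanSpace ℝ (Fin n) → ℝ} (hf : Measurable f)
    {ρ p : ℝ} (hp : 1 ≤ p) (hρ : ∀ x, ρ < ‖x‖ → f x = 0) :
    ∫⁻ x, ‖f x‖ₑ ≤ (∫⁻ x, ‖f x‖ₑ ^ p) ^ (1 / p) *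
      volume (Metric.closedBall (0 : EuclideanSpace ℝ (Fin n)) ρ) ^ (1 - 1 / p) := by
  set B := Metric.closedBall (0 : EuclideanSpace ℝ (Fin n)) ρ
  have h2 := eLpNorm'_le_eLpNorm'_mul_rpow_measure_univ (μ := volume.restrict B) one_pos hp
    hf.aestronglyMeasurable
  simp only [eLpNorm', ENNReal.rpow_one, div_one, Measure.restrict_apply_univ] at h2
  have h1 : ∫⁻ x, ‖f x‖ₑ = ∫⁻ x in B, ‖f x‖ₑ := by
    refine (setLIntegral_eq_of_support_subset fun x hx => ?_).symm
    by_contra h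
    exact hx (by simp [hρ x (by simpa [B] using h)])
  rw [h1]
  refine h2.trans ?_
  gcongr
  exact Measure.restrict_le_self

/-- The multilinear estimate for fractional Sobolev functions, for measurable functions. -/
theorem enorm_integral_mul_jac_le_sobolev_of_measurable (c : Fin k → Fin n) (ρ : ℝ)
    {p : Fin (k + 1) → ℝ} (hp : ∀ s, 1 < p s) (hsum : ∑ s, 1 / p s = 1) :
    ∃ C : ENNReal, C ≠ ⊤ ∧ ∀ u : Fin (k + 1) → EuclideanSpace ℝ (Fin n) → ℝ,
      (∀ s x, ρ < ‖x‖ → u s x = 0) → (∀ s, Measurable (u s)) →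
      (∀ s, sobolevNorm (1 - 1 / p s) (p s) univ (u s) < ⊤) →
      (∀ i : Fin k, holderNorm 1 univ (u i.succ) < ⊤) →
      ‖∫ x, u 0 x * jac c (fun i => u i.succ) x‖ₑ ≤
        C * ∏ s, sobolevNorm (1 - 1 / p s) (p s) univ (u s) := by
  obtain ⟨φ, hφ⟩ := exists_isKernel_univ (n := n)
  obtain ⟨r, hr, hrφ⟩ := hφ.exists_norm_le
  have hp0 : ∀ s, 0 < p s := fun s => by linarith [hp s]
  have hσ : ∀ s, 0 < 1 - 1 / p s := fun s => by
    rw [sub_pos, div_lt_one (hp0 s)]; exact hp s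
  set κ : Fin (k + 1) → EuclideanSpace ℝ (Fin n) → ℝ := Fin.cons (fun z => φ (-z)) fun _ => φ
  have hker : ∀ s, ∃ R', IsKernel R' (κ s) := fun s => by
    induction s using Fin.cases with
    | zero => exact ⟨_, hφ.neg⟩
    | succ i => exact ⟨_, hφ⟩
  choose R' hκ using hker
  have hκr : ∀ s, ∀ z ∈ tsupport (κ s), ‖z‖ ≤ r := fun s => by
    induction s using Fin.cases with
    | zero =>
      intro z hz
      have := tsupport_comp_subset_preimage φ (f := fun z : EuclideanSpace ℝ (Fin n) => -z)
        continuous_neg hz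
      simpa using hrφ _ this
    | succ i => exact hrφ
  choose A hA hAmol using fun s => lintegral_rpow_integral_mul_le (K := κ s)
    (hκ s).contDiff.continuous (hκr s) (hp s).le
  choose A' hA' hAmol' using fun s j => lintegral_rpow_integral_mul_le (K := pd j (κ s))
    (contDiff_pd (hκ s).contDiff j).continuous
    (fun z hz => hκr s z (tsupport_pd_subset _ j hz)) (hp s).le
  choose C1 hC1 hmod using fun s => tsum_modulus_le (n := n) (hσ s) (hp s).le hr
  set Q : Fin (k + 1) → ENNReal := fun s => A s + ∑ j, A' s j
  have hQ : ∀ s, Q s ≠ ⊤ := fun s =>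
    ENNReal.add_ne_top.2 ⟨hA s, ENNReal.sum_ne_top.2 fun j _ => hA' s j⟩
  -- This is the constant that `tsum_dyadicBound_rpow_le` and `hsupp` produce together.
  set Z : Fin (k + 1) → ENNReal := fun s => 2 ^ (p s - 1) * (1 + (2 ^ ((1 - 1 / p s) * p s) + 2) *
    (Q s * C1 s))
  have hZ : ∀ s, Z s ≠ ⊤ := fun s => by
    refine ENNReal.mul_ne_top (by finiteness) (ENNReal.add_ne_top.2 ⟨by simp, ?_⟩)
    refine ENNReal.mul_ne_top (by finiteness) (ENNReal.mul_ne_top (hQ s) (hC1 s))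
  refine ⟨(k + 1) * k.factorial * ∏ s, Z s ^ (1 / p s), ?_, fun u hρ hum hN hL => ?_⟩
  · refine ENNReal.mul_ne_top (ENNReal.mul_ne_top (by finiteness) (by finiteness)) ?_
    exact ENNReal.prod_ne_top fun s _ =>
      ENNReal.rpow_ne_top_of_nonneg (one_div_pos.2 (hp0 s)).le (hZ s)
  have hui : ∀ s, Integrable (u s) := fun s => by
    refine ⟨(hum s).aestronglyMeasurable, ?_⟩
    refine lt_of_le_of_lt (lintegral_enorm_le_of_support (hum s) (hp s).le (hρ s)) ?_
    refine ENNReal.mul_lt_top (ENNReal.rpow_lt_top_of_nonneg (one_div_pos.2 (hp0 s)).le ?_)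
      (ENNReal.rpow_lt_top_of_nonneg (hσ s).le measure_closedBall_lt_top.ne)
    have := lintegral_rpow_le (s := 1 - 1 / p s) (hp0 s) univ (u s)
    rw [Measure.restrict_univ] at this
    exact (this.trans_lt (ENNReal.rpow_lt_top_of_nonneg (hp0 s).le (hN s).ne)).ne
  have hul := fun s => (hui s).locallyIntegrable
  have hpos : ∀ m : ℕ, (0 : ℝ) < (1 / 2) ^ m := fun m => by positivity
  have hle1 : ∀ m : ℕ, (1 / 2 : ℝ) ^ m ≤ 1 := fun m => pow_le_one₀ (by norm_num) (by norm_num)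
  -- Here the gauges are `L^{p s}` norms, and the required product inequality is Hölder's inequality
  -- in space, with the same exponents as later in the scales.
  let G : Fin (k + 1) → (EuclideanSpace ℝ (Fin n) → ℝ) → ENNReal := fun s f =>
    (∫⁻ x, ‖f x‖ₑ ^ p s) ^ (1 / p s)
  let w : Fin (k + 1) → ℕ → ENNReal := fun s m =>
    ∫⁻ z in Metric.closedBall (0 : EuclideanSpace ℝ (Fin n)) r,
      ∫⁻ x, ‖u s (x + ((1 / 2 : ℝ) ^ m) • z) - u s x‖ₑ ^ p s
  let e : Fin (k + 1) → ℕ → ENNReal := fun s m => (Q s * w s m) ^ (1 / p s)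
  obtain ⟨K, hK⟩ : ∃ K : NNReal, ∀ i : Fin k, LipschitzOnWith K (u i.succ) univ := by
    refine ⟨∑ i : Fin k, (holderNorm 1 univ (u i.succ)).toNNReal, fun i => ?_⟩
    exact (LipschitzOnWith.of_holderNorm (hL i)).weaken
      (Finset.single_le_sum (f := fun i : Fin k => (holderNorm 1 univ (u i.succ)).toNNReal)
        (fun _ _ => zero_le) (Finset.mem_univ i))
  have he : ∀ s m, G s (mol (κ s) ((1 / 2) ^ m) (u s) - u s) ≤ e s m := by
    intro s m
    have := hp0 s
    simp only [G, e, Pi.sub_apply, mol_sub_eq (hκ s) (hul s) (hpos m).ne']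
    gcongr
    have h1 := hAmol s (u s) (hum s) ((1 / 2) ^ m) univ
    simp only [Measure.restrict_univ] at h1
    exact h1.trans (mul_le_mul' le_self_add le_rfl)
  have hsupp : ∀ s, ∑' m : ℕ, (2 : ENNReal) ^ (m * ((1 - 1 / p s) * p s)) * e s m ^ p s ≤
      Q s * C1 s * sobolevNorm (1 - 1 / p s) (p s) univ (u s) ^ p s := by
    intro s
    have : ∀ m, e s m ^ p s = Q s * w s m := fun m => by
      rw [← ENNReal.rpow_mul, one_div_mul_cancel (hp0 s).ne', ENNReal.rpow_one]
    simp_rw [this, mul_left_comm _ (Q s)]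
    rw [ENNReal.tsum_mul_left, mul_assoc]
    refine mul_le_mul' le_rfl ((hmod s (u s) (hum s)).trans ?_)
    exact mul_le_mul' le_rfl (gagliardo_le (hp0 s) _ _)
  have key := enorm_integral_mul_jac_le_tsum c isClosed_univ convex_univ hφ (G := G) (u := u)
    (κ := κ) (σ := fun s => 1 - 1 / p s) (g := fun s => G s (u s)) (e := e) (ρ := ρ) (K := K)
    ?_ ?_ ?_ hρ (by simp) hui hum hK rfl (fun _ => rfl) (fun s => le_rfl) he ?_ ?_
  · simp only [Measure.restrict_univ] at key
    refine key.trans ?_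
    rw [mul_assoc ((k + 1 : ENNReal) * _)]
    gcongr
    -- The critical balance: the geometric factor is identically one, and convergence comes only
    -- from `ℓ^{p s}` summability over the scales.
    have hδ : ∑ s, (1 - 1 / p s) - k = 0 := by
      rw [Finset.sum_sub_distrib, hsum]; simp
    simp only [hδ, mul_zero, neg_zero, ENNReal.rpow_zero, one_mul]
    refine (tsum_prod_le Finset.univ hp0 hsum _).trans ?_
    rw [← Finset.prod_mul_distrib]
    refine Finset.prod_le_prod' fun s _ => ?_
    have hps := hp0 s
    calc (∑' m, dyadicBound (1 - 1 / p s) (G s (u s)) (e s) m ^ p s) ^ (1 / p s)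
        ≤ (Z s * sobolevNorm (1 - 1 / p s) (p s) univ (u s) ^ p s) ^ (1 / p s) := by
          gcongr
          refine (tsum_dyadicBound_rpow_le (hp s).le _ _).trans ?_
          have h1 : G s (u s) ^ p s ≤ sobolevNorm (1 - 1 / p s) (p s) univ (u s) ^ p s := by
            have := lintegral_rpow_le (s := 1 - 1 / p s) (hp0 s) univ (u s)
            rw [Measure.restrict_univ] at this
            simp only [G]
            rwa [← ENNReal.rpow_mul, one_div_mul_cancel (hp0 s).ne', ENNReal.rpow_one]
          refine (mul_le_mul' le_rfl (add_le_add h1 (mul_le_mul' le_rfl (hsupp s)))).trans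
            (le_of_eq ?_)
          simp only [Z]
          ring
      _ = _ := by
          rw [ENNReal.mul_rpow_of_nonneg _ _ (by positivity), ← ENNReal.rpow_mul,
            mul_one_div_cancel hps.ne', ENNReal.rpow_one]
  · intro h hh
    have := ENNReal.lintegral_prod_norm_pow_le (μ := volume) Finset.univ
      (f := fun i x => ‖h i x‖ₑ ^ p i) (fun i _ => ((hh i).enorm.measurable.pow_const _).aemeasurable)
      hsum fun i _ => (one_div_pos.2 (hp0 i)).le
    rw [Measure.restrict_univ]
    refine le_trans (le_of_eq ?_) this
    refine lintegral_congr fun x => Finset.prod_congr rfl fun i _ => ?_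
    rw [← ENNReal.rpow_mul, mul_one_div_cancel (hp0 i).ne', ENNReal.rpow_one]
  · intro s
    have := hp0 s
    simp [G, this]
  · intro s f g h hf hg hh
    have tri := eLpNorm'_add_le (μ := (volume : Measure (EuclideanSpace ℝ (Fin n))))
      (hf.sub hh).aestronglyMeasurable (hh.sub hg).aestronglyMeasurable (hp s).le
    rw [sub_add_sub_cancel] at tri
    refine tri.trans (le_of_eq ?_)
    congr 1
    simp only [eLpNorm', G, Pi.sub_apply]
    simp_rw [← enorm_neg (g _ - h _), neg_sub]
  · intro s m j
    have hps := hp0 s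
    have hscale : ∀ x, ‖pd j (mol (κ s) ((1 / 2) ^ m) (u s)) x‖ₑ ^ p s =
        ((2 : ENNReal) ^ m) ^ p s *
          ‖∫ z, pd j (κ s) z * (u s (x + ((1 / 2 : ℝ) ^ m) • z) - u s x)‖ₑ ^ p s := fun x => by
      rw [pd_mol_eq (hκ s) (hul s) (hpos m).ne', enorm_mul, enorm_neg,
        Real.enorm_of_nonneg (inv_nonneg.2 (hpos m).le), ENNReal.mul_rpow_of_nonneg _ _ hps.le]
      congr 2
      rw [one_div, inv_pow, inv_inv, ENNReal.ofReal_pow (by norm_num)]; simp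
    simp only [G, hscale]
    rw [lintegral_const_mul' _ _ (by finiteness), ENNReal.mul_rpow_of_nonneg _ _ (by positivity),
      ← ENNReal.rpow_mul, mul_one_div_cancel hps.ne', ENNReal.rpow_one]
    gcongr
    simp only [e]
    gcongr
    have h1 := hAmol' s j (u s) (hum s) ((1 / 2) ^ m) univ
    simp only [Measure.restrict_univ] at h1
    refine h1.trans (mul_le_mul' ?_ le_rfl)
    exact (Finset.single_le_sum (fun _ _ => zero_le) (Finset.mem_univ j)).trans le_add_self
  · simp only [Measure.restrict_univ]
    -- The weights `2 ^ (m * (s * p))` are at least one, so the unweighted series converges too and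
    -- its terms tend to zero. On bounded supports this yields convergence in `L^1`.
    have hsum0 : ∑' m : ℕ, e 0 m ^ p 0 ≠ ⊤ := by
      have h1 := (hsupp 0).trans_lt (ENNReal.mul_lt_top
        (ENNReal.mul_lt_top (hQ 0).lt_top (hC1 0).lt_top)
        (ENNReal.rpow_lt_top_of_nonneg (hp0 0).le (hN 0).ne))
      refine (lt_of_le_of_lt (ENNReal.tsum_le_tsum fun m => ?_) h1).ne
      refine le_mul_of_one_le_left zero_le ?_
      rw [← ENNReal.rpow_zero (x := 2)]
      refine ENNReal.rpow_le_rpow_of_exponent_le (by norm_num) ?_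
      have := hσ 0
      have := hp0 0
      positivity
    have hlim := (ENNReal.tendsto_atTop_zero_of_tsum_ne_top hsum0).ennrpow_const (1 / p 0)
    rw [ENNReal.zero_rpow_of_pos (one_div_pos.2 (hp0 0))] at hlim
    have hV := ENNReal.Tendsto.mul_const hlim
      (b := volume (Metric.closedBall (0 : EuclideanSpace ℝ (Fin n)) (|ρ| + r)) ^ (1 - 1 / p 0))
      (Or.inr (ENNReal.rpow_ne_top_of_nonneg (hσ 0).le measure_closedBall_lt_top.ne))
    rw [zero_mul] at hV
    refine tendsto_of_tendsto_of_tendsto_of_le_of_le tendsto_const_nhds hV (fun _ => zero_le)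
      fun m => ?_
    have hsmooth := contDiff_mol (hκ 0).contDiff (hκ 0).hasCompactSupport (hul 0) (hpos m).ne'
    have := lintegral_enorm_le_of_support (f := mol (κ 0) ((1 / 2) ^ m) (u 0) - u 0)
      (hsmooth.continuous.measurable.sub (hum 0)) (ρ := |ρ| + r) (hp 0).le fun x hx => by
        have h1 : u 0 x = 0 := hρ 0 x (by linarith [le_abs_self ρ])
        rw [Pi.sub_apply, h1, mol_eq_zero_of_norm (hκr 0) (hpos m).le (hle1 m)
          (fun y hy => hρ 0 y (lt_of_le_of_lt (le_abs_self ρ) hy)) hx, sub_zero]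
    refine this.trans (mul_le_mul' ((he 0 m).trans (le_of_eq ?_)) le_rfl)
    rw [← ENNReal.rpow_mul, mul_one_div_cancel (hp0 0).ne', ENNReal.rpow_one]

open Classical in
/-- The fractional Sobolev norm, infinite for functions that are not measurable. -/
noncomputable def sobolevNorm' (s p : ℝ) (D : Set (EuclideanSpace ℝ (Fin n)))
    (f : EuclideanSpace ℝ (Fin n) → ℝ) : ENNReal :=
  if AEStronglyMeasurable f (volume.restrict D) then sobolevNorm s p D f else ⊤

theorem sobolevNorm'_lt_top {s p : ℝ} {D : Set (EuclideanSpace ℝ (Fin n))}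
    {f : EuclideanSpace ℝ (Fin n) → ℝ} :
    sobolevNorm' s p D f < ⊤ ↔ MemSobolevSpace s p D f := by
  unfold sobolevNorm' MemSobolevSpace
  split_ifs with h <;> simp [h]

theorem sobolevNorm_congr_ae {s p : ℝ} {D : Set (EuclideanSpace ℝ (Fin n))}
    {f g : EuclideanSpace ℝ (Fin n) → ℝ} (h : f =ᵐ[volume.restrict D] g) :
    sobolevNorm s p D f = sobolevNorm s p D g := by
  unfold sobolevNorm
  rw [eLpNorm_congr_ae h]
  congr 2
  refine lintegral_congr_ae ?_
  filter_upwards [h] with x hx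
  refine lintegral_congr_ae ?_
  filter_upwards [h] with y hy
  rw [hx, hy]

theorem sobolevNorm'_congr_ae {s p : ℝ} {D : Set (EuclideanSpace ℝ (Fin n))}
    {f g : EuclideanSpace ℝ (Fin n) → ℝ} (h : f =ᵐ[volume.restrict D] g) :
    sobolevNorm' s p D f = sobolevNorm' s p D g := by
  unfold sobolevNorm'
  rw [aestronglyMeasurable_congr h, sobolevNorm_congr_ae h]

/-- The multilinear estimate for fractional Sobolev functions. -/
theorem enorm_integral_mul_jac_le_sobolev (c : Fin k → Fin n) (ρ : ℝ)
    {p : Fin (k + 1) → ℝ} (hp : ∀ s, 1 < p s) (hsum : ∑ s, 1 / p s = 1) :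
    ∃ C : ENNReal, C ≠ ⊤ ∧ ∀ u : Fin (k + 1) → EuclideanSpace ℝ (Fin n) → ℝ,
      (∀ s x, ρ < ‖x‖ → u s x = 0) →
      (∀ s, sobolevNorm' (1 - 1 / p s) (p s) univ (u s) < ⊤) →
      (∀ i : Fin k, holderNorm 1 univ (u i.succ) < ⊤) →
      ‖∫ x, u 0 x * jac c (fun i => u i.succ) x‖ₑ ≤
        C * ∏ s, sobolevNorm' (1 - 1 / p s) (p s) univ (u s) := by
  obtain ⟨C, hC, H⟩ := enorm_integral_mul_jac_le_sobolev_of_measurable c ρ hp hsum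
  refine ⟨C, hC, fun u hρ hN hL => ?_⟩
  have hae : AEStronglyMeasurable (u 0) volume := by
    have := (sobolevNorm'_lt_top.1 (hN 0)).1
    rwa [Measure.restrict_univ] at this
  set B : Set (EuclideanSpace ℝ (Fin n)) := {x | ‖x‖ ≤ ρ}
  have hB : MeasurableSet B := measurableSet_le measurable_norm measurable_const
  -- A measurable representative, cut off so that it vanishes at every point outside the ball. Only
  -- `u 0` is replaced: the other functions are Lipschitz, hence measurable.
  set g : EuclideanSpace ℝ (Fin n) → ℝ := B.indicator (hae.mk _)
  have hg : u 0 =ᵐ[volume] g := by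
    filter_upwards [hae.ae_eq_mk] with x hx
    by_cases hxB : x ∈ B
    · simp [g, hxB, hx]
    · simp only [g, indicator_of_notMem hxB]
      exact hρ 0 x (not_le.1 hxB)
  have hg' : u 0 =ᵐ[volume.restrict univ] g := by rwa [Measure.restrict_univ]
  have := H (Fin.cons g fun i => u i.succ) (fun s x hx => ?_) (fun s => ?_) (fun s => ?_)
    (fun i => hL i)
  · simp only [Fin.prod_univ_succ, Fin.cons_zero, Fin.cons_succ] at this ⊢
    have e : ∀ s, sobolevNorm' (1 - 1 / p s) (p s) univ (u s) =
        sobolevNorm (1 - 1 / p s) (p s) univ (u s) := fun s =>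
      if_pos (sobolevNorm'_lt_top.1 (hN s)).1
    have e' : ∫ x, u 0 x * jac c (fun i => u i.succ) x = ∫ x, g x * jac c (fun i => u i.succ) x :=
      integral_congr_ae (hg.mul (Filter.EventuallyEq.refl _ _))
    simp only [e, e']
    rwa [sobolevNorm_congr_ae hg']
  · induction s using Fin.cases with
    | zero =>
      have : x ∉ B := not_le.2 hx
      simp [g, this]
    | succ i => exact hρ i.succ x hx
  · induction s using Fin.cases with
    | zero => exact hae.stronglyMeasurable_mk.measurable.indicator hB
    | succ i =>
      exact (continuousOn_univ.1 (LipschitzOnWith.of_holderNorm (hL i)).continuousOn).measurable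
  · induction s using Fin.cases with
    | zero =>
      simp only [Fin.cons_zero]
      rw [← sobolevNorm_congr_ae hg']
      exact (sobolevNorm'_lt_top.1 (hN 0)).2
    | succ i => exact (sobolevNorm'_lt_top.1 (hN i.succ)).2

end SobolevCore

end DistJacobian

namespace DistJacobian

/-! ### Norms that are compatible with cut-offs and changes of coordinates -/

section Gauge

variable {n : ℕ}

/-- Data for pulling back functions from `D'` to `D`: a bi-Lipschitz map `ψ` from `V ⊆ D` to `D'`,
and a bounded Lipschitz factor `g` whose support has positive distance from `D \ V`. -/
structure IsPullbackDatum (D V D' : Set (EuclideanSpace ℝ (Fin n)))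
    (ψ : EuclideanSpace ℝ (Fin n) → EuclideanSpace ℝ (Fin n))
    (g : EuclideanSpace ℝ (Fin n) → ℝ) : Prop where
  measurableSet_domain : MeasurableSet D
  measurableSet : MeasurableSet V
  subset : V ⊆ D
  mapsTo : MapsTo ψ V D'
  lipschitz : ∃ K : NNReal, LipschitzOnWith K ψ V
  antilipschitz : ∃ K : NNReal, ∀ x ∈ V, ∀ y ∈ V, ‖x - y‖ ≤ K * ‖ψ x - ψ y‖
  bounded : ∃ G : ℝ, ∀ x ∈ V, |g x| ≤ G
  lipschitz_factor : ∃ K : NNReal, LipschitzOnWith K g V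
  separated : ∃ δ > 0, ∀ x ∈ V, g x ≠ 0 → ∀ y ∈ D, y ∉ V → δ ≤ ‖x - y‖

/-- A family of (extended) norms on functions on subsets of Euclidean space that is compatible
with cut-offs and changes of coordinates. -/
structure IsGauge (N : Set (EuclideanSpace ℝ (Fin n)) → (EuclideanSpace ℝ (Fin n) → ℝ) → ENNReal) :
    Prop where
  congr : ∀ D f g, MeasurableSet D → EqOn f g D → N D f = N D g
  zero : ∀ D, N D 0 = 0
  neg : ∀ D f, N D (-f) = N D f
  add : ∀ D f g, N D (f + g) ≤ N D f + N D g
  pullback : ∀ D V D' ψ g, IsPullbackDatum D V D' ψ g → ∃ C : ENNReal, C ≠ ⊤ ∧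
    ∀ f, N D (V.indicator fun x => g x * f (ψ x)) ≤ C * N D' f

variable {D V D' : Set (EuclideanSpace ℝ (Fin n))}
  {ψ : EuclideanSpace ℝ (Fin n) → EuclideanSpace ℝ (Fin n)} {g : EuclideanSpace ℝ (Fin n) → ℝ}

theorem IsGauge.sum {N : Set (EuclideanSpace ℝ (Fin n)) → (EuclideanSpace ℝ (Fin n) → ℝ) → ENNReal}
    (hN : IsGauge N) (D) {ι : Type*} (S : Finset ι) (f : ι → EuclideanSpace ℝ (Fin n) → ℝ) :
    N D (∑ i ∈ S, f i) ≤ ∑ i ∈ S, N D (f i) := by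
  classical
  induction S using Finset.induction_on with
  | empty => simp [hN.zero]
  | insert a S ha ih =>
    rw [Finset.sum_insert ha, Finset.sum_insert ha]
    exact (hN.add _ _ _).trans (by gcongr)

/-- For two points of `V` the increment splits as in the product rule. If only one of them lies in
`V`, then either `g` vanishes there or the points are `δ` apart, and `|g|` is at most a multiple of
`min 1 ‖x - y‖`. The truncation at `1` makes the bound integrable at infinity against the Gagliardo
kernel. -/
theorem IsPullbackDatum.exists_bound (h : IsPullbackDatum D V D' ψ g) :
    ∃ C : ℝ, 1 ≤ C ∧ ∀ f : EuclideanSpace ℝ (Fin n) → ℝ,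
      (∀ x, |V.indicator (fun x => g x * f (ψ x)) x| ≤ C * V.indicator (fun x => |f (ψ x)|) x) ∧
      ∀ x ∈ D, ∀ y ∈ D, |V.indicator (fun x => g x * f (ψ x)) x -
          V.indicator (fun x => g x * f (ψ x)) y| ≤
        C * (V.indicator (fun x => V.indicator (fun y => |f (ψ x) - f (ψ y)|) y) x +
          (min 1 ‖x - y‖ * V.indicator (fun x => |f (ψ x)|) x +
            min 1 ‖x - y‖ * V.indicator (fun x => |f (ψ x)|) y)) := by
  obtain ⟨G, hG⟩ := h.bounded
  obtain ⟨K, hK⟩ := h.lipschitz_factor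
  obtain ⟨δ, hδ, hsep⟩ := h.separated
  set C : ℝ := 1 + 2 * |G| + K + |G| / δ
  have hG0 := abs_nonneg G
  have hGδ : 0 ≤ |G| / δ := by positivity
  have hC1 : 1 ≤ C := by have := K.2; simp only [C]; linarith [K.coe_nonneg]
  have hCG : |G| ≤ C := by simp only [C]; linarith [K.coe_nonneg]
  have hCδ : |G| ≤ C * δ := by
    have : |G| / δ ≤ C := by simp only [C]; linarith [K.coe_nonneg]
    rwa [div_le_iff₀ hδ] at this
  have hCK : K ≤ C := by simp only [C]; linarith [K.coe_nonneg]
  have hC2 : 2 * |G| ≤ C := by simp only [C]; linarith [K.coe_nonneg]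
  have hGg : ∀ x ∈ V, |g x| ≤ |G| := fun x hx => (hG x hx).trans (le_abs_self G)
  have mixed : ∀ f : EuclideanSpace ℝ (Fin n) → ℝ, ∀ x ∈ V, ∀ y ∈ D, y ∉ V →
      |g x * f (ψ x)| ≤ C * (min 1 ‖x - y‖ * |f (ψ x)|) := by
    intro f x hx y hy hyV
    by_cases h0 : g x = 0
    · rw [h0, zero_mul, abs_zero]; positivity
    have hd := hsep x hx h0 y hy hyV
    rw [abs_mul, ← mul_assoc]
    refine mul_le_mul_of_nonneg_right ((hGg x hx).trans ?_) (abs_nonneg _)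
    rcases min_choice 1 ‖x - y‖ with hm | hm <;> rw [hm]
    · linarith
    · exact hCδ.trans (mul_le_mul_of_nonneg_left hd (by linarith))
  refine ⟨C, hC1, fun f => ⟨fun x => ?_, fun x hx y hy => ?_⟩⟩
  · by_cases hxV : x ∈ V
    · simp only [indicator_of_mem hxV, abs_mul]
      exact mul_le_mul_of_nonneg_right ((hGg x hxV).trans hCG) (abs_nonneg _)
    · simp [indicator_of_notMem hxV]
  by_cases hxV : x ∈ V <;> by_cases hyV : y ∈ V
  · simp only [indicator_of_mem hxV, indicator_of_mem hyV]
    have e : g x * f (ψ x) - g y * f (ψ y) = g x * (f (ψ x) - f (ψ y)) + (g x - g y) * f (ψ y) := by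
      ring
    rw [e]
    refine (abs_add_le _ _).trans ?_
    rw [abs_mul, abs_mul, mul_add]
    refine add_le_add (mul_le_mul_of_nonneg_right ((hGg x hxV).trans hCG) (abs_nonneg _)) ?_
    have h1 : |g x - g y| ≤ C * min 1 ‖x - y‖ := by
      rcases min_choice 1 ‖x - y‖ with hm | hm <;> rw [hm]
      · have := abs_sub (g x) (g y)
        linarith [hGg x hxV, hGg y hyV]
      · have := hK.dist_le_mul x hxV y hyV
        rw [Real.dist_eq, dist_eq_norm] at this
        exact this.trans (mul_le_mul_of_nonneg_right hCK (norm_nonneg _))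
    have h2 := mul_le_mul_of_nonneg_right h1 (abs_nonneg (f (ψ y)))
    have h3 : 0 ≤ min 1 ‖x - y‖ * |f (ψ x)| := by positivity
    nlinarith
  · have := mixed f x hxV y hy hyV
    simpa [indicator_of_mem hxV, indicator_of_notMem hyV] using this
  · have := mixed f y hyV x hx hxV
    rw [norm_sub_rev] at this
    simpa [indicator_of_mem hyV, indicator_of_notMem hxV] using this
  · simp [indicator_of_notMem hyV, indicator_of_notMem hxV]

/-- For `α ≤ 1` the quantity `min 1 ‖x - y‖` is at most `‖x - y‖ ^ α`, so the cut-off terms in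
`exists_bound` are Hölder terms as well. -/
theorem isGauge_holderNorm {α : NNReal} (hα : α ≤ 1) : IsGauge (holderNorm (n := n) α) where
  congr D f g _ h := by
    have h1 : D.domRestrict f = D.domRestrict g := by
      ext x; exact h x.2
    have h2 : (fun y : D => ‖f y‖ₑ) = fun y : D => ‖g y‖ₑ := by
      ext x; rw [h x.2]
    unfold holderNorm
    rw [h1, h2]
  zero D := by
    have := holderNorm_le (α := α) (D := D) (f := 0) le_rfl le_rfl (by simp) (by simp)
    simpa using this
  neg D f := by
    have key : ∀ f : EuclideanSpace ℝ (Fin n) → ℝ, holderNorm α D (-f) ≤ holderNorm α D f := by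
      intro f
      by_cases h : holderNorm α D f = ⊤
      · simp [h]
      have h' := lt_top_iff_ne_top.2 h
      unfold holderNorm
      refine add_le_add (by simp) ?_
      have h1 : eHolderNorm α (D.domRestrict f) < ⊤ := lt_of_le_of_lt le_add_self h'
      rw [← (eHolderNorm_lt_top.1 h1).coe_nnHolderNorm_eq_eHolderNorm]
      refine HolderWith.eHolderNorm_le fun x y => ?_
      have := (eHolderNorm_lt_top.1 h1).holderWith x y
      simpa [Set.domRestrict, edist_neg_neg] using this
    exact le_antisymm (key f) (by simpa using key (-f))
  add D f g := by
    unfold holderNorm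
    have h1 : (⨆ y : D, ‖(f + g) y‖ₑ) ≤ (⨆ y : D, ‖f y‖ₑ) + ⨆ y : D, ‖g y‖ₑ :=
      iSup_le fun y => (enorm_add_le _ _).trans
        (add_le_add (le_iSup (fun y : D => ‖f y‖ₑ) y) (le_iSup (fun y : D => ‖g y‖ₑ) y))
    have h2 : eHolderNorm α (D.domRestrict (f + g)) ≤
        eHolderNorm α (D.domRestrict f) + eHolderNorm α (D.domRestrict g) := eHolderNorm_add_le
    exact (add_le_add h1 h2).trans (le_of_eq (by ring))
  pullback D V D' ψ g h := by
    obtain ⟨C, hC, H⟩ := h.exists_bound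
    obtain ⟨K, hK⟩ := h.lipschitz
    -- The summand `1` makes the constant nonzero, so that the bound is trivial when the norm of `f`
    -- is infinite.
    refine ⟨ENNReal.ofReal (C + C * ((K : ℝ) ^ (α : ℝ) + 2)) + 1, by simp, fun f => ?_⟩
    by_cases hf : holderNorm α D' f = ⊤
    · rw [hf, ENNReal.mul_top (by simp)]; exact le_top
    have hf' := lt_top_iff_ne_top.2 hf
    set T := (holderNorm α D' f).toReal with hT
    have hT0 : 0 ≤ T := ENNReal.toReal_nonneg
    have hb : ∀ x, V.indicator (fun x => |f (ψ x)|) x ≤ T := fun x => by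
      by_cases hx : x ∈ V
      · rw [indicator_of_mem hx]; exact abs_le_of_holderNorm hf' (h.mapsTo hx)
      · rw [indicator_of_notMem hx]; exact hT0
    have hC0 : 0 ≤ C := by linarith
    obtain ⟨H1, H2⟩ := H f
    refine (holderNorm_le (A := C * T) (B := C * ((K : ℝ) ^ (α : ℝ) + 2) * T) (by positivity)
      (by positivity) (fun x _ => (H1 x).trans (mul_le_mul_of_nonneg_left (hb x) hC0))
      fun x hx y hy => (H2 x hx y hy).trans ?_).trans ?_
    · rw [mul_assoc, mul_assoc]
      refine mul_le_mul_of_nonneg_left ?_ hC0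
      have hmin : min 1 ‖x - y‖ ≤ ‖x - y‖ ^ (α : ℝ) := by
        rcases le_total 1 ‖x - y‖ with h1 | h1
        · exact (min_le_left _ _).trans (Real.one_le_rpow h1 α.coe_nonneg)
        · refine (min_le_right _ _).trans ?_
          nth_rewrite 1 [← Real.rpow_one ‖x - y‖]
          exact Real.rpow_le_rpow_of_exponent_ge' (norm_nonneg _) h1 α.coe_nonneg
            (by exact_mod_cast hα)
      have hm0 : 0 ≤ min 1 ‖x - y‖ := by positivity
      have t1 : V.indicator (fun x => V.indicator (fun y => |f (ψ x) - f (ψ y)|) y) x ≤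
          T * ((K : ℝ) ^ (α : ℝ) * ‖x - y‖ ^ (α : ℝ)) := by
        by_cases hxV : x ∈ V
        · by_cases hyV : y ∈ V
          · rw [indicator_of_mem hxV, indicator_of_mem hyV]
            refine (abs_sub_le_of_holderNorm hf' (h.mapsTo hxV) (h.mapsTo hyV)).trans ?_
            refine mul_le_mul_of_nonneg_left ?_ hT0
            rw [← Real.mul_rpow K.coe_nonneg (norm_nonneg _)]
            refine Real.rpow_le_rpow (norm_nonneg _) ?_ α.coe_nonneg
            have := hK.dist_le_mul x hxV y hyV
            rwa [dist_eq_norm, dist_eq_norm] at this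
          · rw [indicator_of_mem hxV, indicator_of_notMem hyV]; positivity
        · rw [indicator_of_notMem hxV]; positivity
      have t2 := mul_le_mul hmin (hb x) (indicator_nonneg (fun _ _ => abs_nonneg _) _)
        (by positivity : 0 ≤ ‖x - y‖ ^ (α : ℝ))
      have t3 := mul_le_mul hmin (hb y) (indicator_nonneg (fun _ _ => abs_nonneg _) _)
        (by positivity : 0 ≤ ‖x - y‖ ^ (α : ℝ))
      calc _ ≤ T * ((K : ℝ) ^ (α : ℝ) * ‖x - y‖ ^ (α : ℝ)) + (‖x - y‖ ^ (α : ℝ) * T +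
            ‖x - y‖ ^ (α : ℝ) * T) := add_le_add t1 (add_le_add t2 t3)
        _ = _ := by ring
    · rw [← add_mul, ENNReal.ofReal_mul (by positivity), hT, ENNReal.ofReal_toReal hf]
      exact mul_le_mul' le_self_add le_rfl

end Gauge

end DistJacobian

namespace DistJacobian

/-! ### Cut-offs and changes of coordinates in fractional Sobolev norms -/

section SobolevGauge

variable {n : ℕ}

/-- Lebesgue measure is a multiple of the `n`-dimensional Hausdorff measure, which scales by `K ^ n`
under Lipschitz maps. -/
theorem volume_image_le_of_lipschitzOnWith {K : NNReal}
    {f : EuclideanSpace ℝ (Fin n) → EuclideanSpace ℝ (Fin n)} {S : Set (EuclideanSpace ℝ (Fin n))}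
    (hf : LipschitzOnWith K f S) : volume (f '' S) ≤ (K : ENNReal) ^ (n : ℝ) * volume S := by
  have e := Measure.isAddLeftInvariant_eq_smul
    (volume : Measure (EuclideanSpace ℝ (Fin n))) (μH[(n : ℝ)])
  rw [e]
  simp only [Measure.smul_apply]
  have := hf.hausdorffMeasure_image_le (d := n) (by positivity)
  calc _ ≤ (Measure.addHaarScalarFactor (volume : Measure (EuclideanSpace ℝ (Fin n))) μH[(n : ℝ)]) •
        ((K : ENNReal) ^ (n : ℝ) * μH[(n : ℝ)] S) := by gcongr
    _ = _ := by rw [mul_smul_comm]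

/-- A change of variables in an integral, for bi-Lipschitz maps. -/
theorem setLIntegral_comp_le {V D' : Set (EuclideanSpace ℝ (Fin n))}
    {ψ : EuclideanSpace ℝ (Fin n) → EuclideanSpace ℝ (Fin n)} (hψ : Measurable ψ)
    (hmaps : MapsTo ψ V D') {K : NNReal} (hK : ∀ x ∈ V, ∀ y ∈ V, ‖x - y‖ ≤ K * ‖ψ x - ψ y‖)
    {F : EuclideanSpace ℝ (Fin n) → ENNReal} (hF : Measurable F) :
    ∫⁻ x in V, F (ψ x) ≤ (K : ENNReal) ^ (n : ℝ) * ∫⁻ x in D', F x := by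
  rw [← lintegral_map hF hψ, ← smul_eq_mul, ← lintegral_smul_measure]
  -- It is enough to compare measures of sets: `ψ` is injective on `V` with a `K`-Lipschitz inverse,
  -- so the part of a preimage in `V` is a Lipschitz image of a subset of `D'`.
  refine lintegral_mono' (Measure.le_iff.2 fun B hB => ?_) le_rfl
  rw [Measure.map_apply hψ hB, Measure.smul_apply, Measure.restrict_apply hB, smul_eq_mul,
    Measure.restrict_apply (hψ hB)]
  set S := ψ ⁻¹' B ∩ V
  have hinj : InjOn ψ V := fun x hx y hy h => by
    have := hK x hx y hy
    rw [h, sub_self, norm_zero, mul_zero] at this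
    exact sub_eq_zero.1 (norm_le_zero_iff.1 this)
  have hleft : ∀ x ∈ S, Function.invFunOn ψ V (ψ x) = x := fun x hx =>
    hinj.leftInvOn_invFunOn hx.2
  have hlip : LipschitzOnWith K (Function.invFunOn ψ V) (ψ '' S) := by
    refine LipschitzOnWith.of_dist_le_mul ?_
    rintro _ ⟨x, hx, rfl⟩ _ ⟨y, hy, rfl⟩
    rw [hleft x hx, hleft y hy, dist_eq_norm, dist_eq_norm]
    exact hK x hx.2 y hy.2
  have himg : Function.invFunOn ψ V '' (ψ '' S) = S := by
    rw [image_image]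
    exact (image_congr hleft).trans (by simp)
  calc volume S = volume (Function.invFunOn ψ V '' (ψ '' S)) := by rw [himg]
    _ ≤ (K : ENNReal) ^ (n : ℝ) * volume (ψ '' S) := volume_image_le_of_lipschitzOnWith hlip
    _ ≤ _ := by
      gcongr
      rintro _ ⟨x, hx, rfl⟩
      exact ⟨hx.1, hmaps hx.2⟩

/-- The kernel that bounds the contribution of cut-offs to the Gagliardo seminorm. -/
theorem lintegral_min_one_rpow_div_lt_top (hn : 0 < n) {s p : ℝ} (hs : 0 < s) (hs1 : s < 1)
    (hp : 0 < p) :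
    ∫⁻ h : EuclideanSpace ℝ (Fin n),
      (ENNReal.ofReal (min 1 ‖h‖)) ^ p / ‖h‖ₑ ^ (n + s * p) < ⊤ := by
  have : Nonempty (Fin n) := ⟨⟨0, hn⟩⟩
  set f : ℝ → ℝ := fun t => (min 1 t) ^ p / t ^ (n + s * p)
  have hdim : Module.finrank ℝ (EuclideanSpace ℝ (Fin n)) = n := by simp
  have hint : Integrable (fun h : EuclideanSpace ℝ (Fin n) => f ‖h‖) := by
    -- In polar coordinates the integrand is `t ^ (-1 + (1 - s) * p)` up to `1` and `t ^ (-1 - s *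
    -- p)` beyond; the first needs `s < 1`, the second `s > 0`.
    rw [integrable_fun_norm_addHaar, hdim, ← Ioc_union_Ioi_eq_Ioi zero_le_one]
    have aux : ∀ t : ℝ, 0 < t → t ^ (n - 1) / t ^ (n + s * p) = t ^ (-1 - s * p) := fun t ht => by
      rw [← Real.rpow_natCast, ← Real.rpow_sub ht, Nat.cast_sub hn]
      congr 1; push_cast; ring
    refine IntegrableOn.union ?_ ?_
    · have h1 : IntegrableOn (fun t : ℝ => t ^ (-1 + (1 - s) * p)) (Ioc 0 1) := by
        rw [← intervalIntegrable_iff_integrableOn_Ioc_of_le zero_le_one]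
        refine intervalIntegral.intervalIntegrable_rpow' ?_
        have : 0 < (1 - s) * p := by have := sub_pos.2 hs1; positivity
        linarith
      refine h1.congr_fun (fun t ht => ?_) measurableSet_Ioc
      simp only [f, smul_eq_mul, min_eq_right ht.2]
      rw [mul_div_left_comm, aux t ht.1, ← Real.rpow_add ht.1]
      congr 1; ring
    · have h1 : IntegrableOn (fun t : ℝ => t ^ (-1 - s * p)) (Ioi 1) :=
        integrableOn_Ioi_rpow_of_lt (by have : 0 < s * p := by positivity
                                        linarith) one_pos
      refine h1.congr_fun (fun t ht => ?_) measurableSet_Ioi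
      have ht' : (1 : ℝ) < t := ht
      simp only [f, smul_eq_mul, min_eq_left ht'.le, Real.one_rpow]
      rw [mul_one_div, aux t (by linarith)]
  refine lt_of_le_of_lt (lintegral_mono fun h => ?_) hint.2
  rw [Real.enorm_eq_ofReal_abs]
  by_cases h0 : h = 0
  · simp [h0, hp]
  have hpos : 0 < ‖h‖ := norm_pos_iff.2 h0
  have hm : 0 < min 1 ‖h‖ := lt_min one_pos hpos
  have ha : 0 < n + s * p := by positivity
  rw [abs_of_nonneg (by positivity : 0 ≤ f ‖h‖), ENNReal.ofReal_div_of_pos (by positivity),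
    ENNReal.ofReal_rpow_of_pos hm, ← ofReal_norm, ENNReal.ofReal_rpow_of_pos hpos]

/-- The difference quotient whose `L^p` norm is the Gagliardo seminorm. -/
noncomputable def gagliardoQuot (s p : ℝ) (f : EuclideanSpace ℝ (Fin n) → ℝ)
    (q : EuclideanSpace ℝ (Fin n) × EuclideanSpace ℝ (Fin n)) : ℝ :=
  (f q.1 - f q.2) / ‖q.1 - q.2‖ ^ (n / p + s)

theorem enorm_gagliardoQuot_rpow {s p : ℝ} (hs : 0 < s) (hp : 0 < p)
    (f : EuclideanSpace ℝ (Fin n) → ℝ) (x y : EuclideanSpace ℝ (Fin n)) :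
    ‖gagliardoQuot s p f (x, y)‖ₑ ^ p = ‖f x - f y‖ₑ ^ p / ‖x - y‖ₑ ^ (n + s * p) := by
  unfold gagliardoQuot
  rcases eq_or_ne x y with rfl | h
  · simp [hp]
  have hpos : 0 < ‖x - y‖ := norm_pos_iff.2 (sub_ne_zero.2 h)
  have ha : 0 < n / p + s := by positivity
  rw [← ofReal_norm (x - y), Real.enorm_eq_ofReal_abs, abs_div,
    abs_of_pos (by positivity : 0 < ‖x - y‖ ^ (n / p + s)),
    ENNReal.ofReal_div_of_pos (by positivity), ENNReal.div_rpow_of_nonneg _ _ hp.le,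
    ← Real.enorm_eq_ofReal_abs, ← ENNReal.ofReal_rpow_of_pos hpos, ← ENNReal.rpow_mul, add_mul,
    div_mul_cancel₀ _ hp.ne']

theorem aestronglyMeasurable_gagliardoQuot {s p : ℝ} {μ : Measure (EuclideanSpace ℝ (Fin n))}
    [SFinite μ] {f : EuclideanSpace ℝ (Fin n) → ℝ} (hf : AEStronglyMeasurable f μ) :
    AEStronglyMeasurable (gagliardoQuot s p f) (μ.prod μ) := by
  have h1 : AEStronglyMeasurable (fun q : EuclideanSpace ℝ (Fin n) × EuclideanSpace ℝ (Fin n) =>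
      f q.1 - f q.2) (μ.prod μ) := hf.comp_fst.sub hf.comp_snd
  have h2 : Measurable fun q : EuclideanSpace ℝ (Fin n) × EuclideanSpace ℝ (Fin n) =>
      ‖q.1 - q.2‖ ^ (n / p + s) := by fun_prop
  exact (h1.aemeasurable.div h2.aemeasurable).aestronglyMeasurable

theorem gagliardo_rpow_eq {s p : ℝ} (hs : 0 < s) (hp : 0 < p) (D : Set (EuclideanSpace ℝ (Fin n)))
    {f : EuclideanSpace ℝ (Fin n) → ℝ} (hf : AEStronglyMeasurable f (volume.restrict D)) :
    gagliardo s p D f ^ (1 / p) =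
      eLpNorm (gagliardoQuot s p f) (ENNReal.ofReal p)
        ((volume.restrict D).prod (volume.restrict D)) := by
  rw [eLpNorm_eq_lintegral_rpow_enorm_toReal (by simpa using hp) (by simp),
    ENNReal.toReal_ofReal hp.le, lintegral_prod _
      ((aestronglyMeasurable_gagliardoQuot hf).aemeasurable.enorm.pow_const _)]
  simp only [enorm_gagliardoQuot_rpow hs hp]
  rfl

theorem sobolevNorm_eq_eLpNorm {s p : ℝ} (hs : 0 < s) (hp : 0 < p)
    (D : Set (EuclideanSpace ℝ (Fin n)))
    {f : EuclideanSpace ℝ (Fin n) → ℝ} (hf : AEStronglyMeasurable f (volume.restrict D)) :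
    sobolevNorm s p D f = eLpNorm f (ENNReal.ofReal p) (volume.restrict D) +
      eLpNorm (gagliardoQuot s p f) (ENNReal.ofReal p)
        ((volume.restrict D).prod (volume.restrict D)) := by
  rw [← gagliardo_rpow_eq hs hp D hf]
  rfl

/-- Minkowski's inequality, once for the functions and once for their difference quotients on the
product space; measurability is essential here. -/
theorem sobolevNorm_add_le {s p : ℝ} (hs : 0 < s) (hp : 1 ≤ p) {D : Set (EuclideanSpace ℝ (Fin n))}
    {f g : EuclideanSpace ℝ (Fin n) → ℝ} (hf : AEStronglyMeasurable f (volume.restrict D))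
    (hg : AEStronglyMeasurable g (volume.restrict D)) :
    sobolevNorm s p D (f + g) ≤ sobolevNorm s p D f + sobolevNorm s p D g := by
  have hp0 : 0 < p := by linarith
  rw [sobolevNorm_eq_eLpNorm hs hp0 D (hf.add hg), sobolevNorm_eq_eLpNorm hs hp0 D hf,
    sobolevNorm_eq_eLpNorm hs hp0 D hg]
  have e : gagliardoQuot s p (f + g) = gagliardoQuot s p f + gagliardoQuot s p g := by
    ext q; simp only [gagliardoQuot, Pi.add_apply]; ring
  have hp' : 1 ≤ ENNReal.ofReal p := by simpa using hp
  rw [e]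
  exact (add_le_add (eLpNorm_add_le hf hg hp') (eLpNorm_add_le
    (aestronglyMeasurable_gagliardoQuot hf) (aestronglyMeasurable_gagliardoQuot hg) hp')).trans
      (le_of_eq (by ring))

theorem rpow_le_of_le_mul_add {p : ℝ} (hp : 1 ≤ p) {a C b c d : ENNReal}
    (h : a ≤ C * (b + (c + d))) : a ^ p ≤ (C * 4) ^ p * (b ^ p + (c ^ p + d ^ p)) := by
  have hp0 : 0 ≤ p := by linarith
  have hm : b + (c + d) ≤ 4 * max b (max c d) := by
    calc b + (c + d) ≤ max b (max c d) + (max b (max c d) + max b (max c d)) := by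
          gcongr <;> simp
      _ = 3 * max b (max c d) := by ring
      _ ≤ _ := by gcongr; norm_num
  calc a ^ p ≤ (C * 4 * max b (max c d)) ^ p := by
        rw [mul_assoc]
        exact ENNReal.rpow_le_rpow (h.trans (mul_le_mul' le_rfl hm)) hp0
    _ = (C * 4) ^ p * (max b (max c d)) ^ p := ENNReal.mul_rpow_of_nonneg _ _ hp0
    _ ≤ _ := by
      gcongr
      have mono : Monotone fun x : ENNReal => x ^ p := fun _ _ h => ENNReal.rpow_le_rpow h hp0
      rw [mono.map_max, mono.map_max]
      refine max_le le_self_add (max_le ?_ ?_)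
      · exact le_self_add.trans le_add_self
      · exact le_add_self.trans le_add_self

/-- The pointwise bound of `exists_bound` splits the seminorm in two. The increments of `f ∘ ψ` are
handled by changing variables in both integrals and comparing distances; the cut-off terms are
convolutions of `|f ∘ ψ| ^ p` with an integrable kernel. -/
theorem exists_gagliardo_pullback_le (hn : 0 < n) {s p : ℝ} (hs : 0 < s) (hs1 : s < 1) (hp : 1 ≤ p)
    {D V D' : Set (EuclideanSpace ℝ (Fin n))}
    {ψ : EuclideanSpace ℝ (Fin n) → EuclideanSpace ℝ (Fin n)} {g : EuclideanSpace ℝ (Fin n) → ℝ}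
    (h : IsPullbackDatum D V D' ψ g) (hψ : Measurable ψ) :
    ∃ C : ENNReal, C ≠ ⊤ ∧ ∀ f, Measurable f →
      ∫⁻ x in D, ‖V.indicator (fun x => g x * f (ψ x)) x‖ₑ ^ p ≤ C * ∫⁻ x in D', ‖f x‖ₑ ^ p ∧
      gagliardo s p D (V.indicator fun x => g x * f (ψ x)) ≤
        C * (gagliardo s p D' f + ∫⁻ x in D', ‖f x‖ₑ ^ p) := by
  have hp0 : 0 < p := by linarith
  obtain ⟨C, hC, H⟩ := h.exists_bound
  obtain ⟨L, hL⟩ := h.lipschitz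
  obtain ⟨K, hK⟩ := h.antilipschitz
  set a : ℝ := n + s * p with ha
  have ha0 : 0 < a := by positivity
  set κ : EuclideanSpace ℝ (Fin n) → ENNReal := fun h =>
    (ENNReal.ofReal (min 1 ‖h‖)) ^ p / ‖h‖ₑ ^ a with hκ
  have hκm : Measurable κ := by
    have h1 : Measurable fun h : EuclideanSpace ℝ (Fin n) => (ENNReal.ofReal (min 1 ‖h‖)) ^ p := by
      fun_prop
    exact h1.div (by fun_prop)
  have hκI : ∫⁻ h, κ h ≠ ⊤ := (lintegral_min_one_rpow_div_lt_top hn hs hs1 hp0).ne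
  have hκneg : ∀ h, κ (-h) = κ h := fun h => by simp only [hκ, norm_neg, enorm_neg]
  set Q : ENNReal := (K : ENNReal) ^ (n : ℝ)
  have hQ : Q ≠ ⊤ := by simp only [Q]; finiteness
  -- The Lipschitz constant is enlarged by `1` so that `L'` can be inverted.
  set L' : ENNReal := ((L + 1 : NNReal) : ENNReal) ^ a
  have hL' : L' ≠ ⊤ := by simp only [L']; finiteness
  have hL0 : L' ≠ 0 := by
    simp only [L']
    exact (ENNReal.rpow_pos (by simp) (by simp)).ne'
  set C1 : ENNReal := ENNReal.ofReal C ^ p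
  set C2 : ENNReal := (ENNReal.ofReal C * 4) ^ p
  have hVm := h.measurableSet
  have hVD : D ∩ V = V := inter_eq_right.2 h.subset
  have hres : ∀ F : EuclideanSpace ℝ (Fin n) → ENNReal, ∫⁻ x in D, V.indicator F x =
      ∫⁻ x in V, F x := fun F => by
    rw [lintegral_indicator hVm, Measure.restrict_restrict hVm, inter_comm, hVD]
  refine ⟨C1 * Q + C2 * (L' * Q * Q + 2 * (∫⁻ h, κ h) * Q), ?_, fun f hf => ?_⟩
  · simp only [C1, C2]; finiteness
  obtain ⟨H1, H2⟩ := H f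
  have hcv : ∫⁻ x in V, ‖f (ψ x)‖ₑ ^ p ≤ Q * ∫⁻ x in D', ‖f x‖ₑ ^ p :=
    setLIntegral_comp_le hψ h.mapsTo hK (F := fun x => ‖f x‖ₑ ^ p) (by fun_prop)
  constructor
  · calc ∫⁻ x in D, ‖V.indicator (fun x => g x * f (ψ x)) x‖ₑ ^ p
        ≤ ∫⁻ x in D, C1 * V.indicator (fun x => ‖f (ψ x)‖ₑ ^ p) x := by
          refine lintegral_mono fun x => ?_
          by_cases hx : x ∈ V
          · have := H1 x
            simp only [indicator_of_mem hx] at this ⊢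
            rw [← ENNReal.mul_rpow_of_nonneg _ _ hp0.le, Real.enorm_eq_ofReal_abs,
              Real.enorm_eq_ofReal_abs, ← ENNReal.ofReal_mul (by linarith)]
            gcongr
          · simp [indicator_of_notMem hx, hp0]
      _ = C1 * ∫⁻ x in V, ‖f (ψ x)‖ₑ ^ p := by
          rw [lintegral_const_mul' _ _ (by simp only [C1]; finiteness), hres]
      _ ≤ C1 * (Q * ∫⁻ x in D', ‖f x‖ₑ ^ p) := by gcongr
      _ ≤ _ := by rw [← mul_assoc]; gcongr; exact le_self_add
  set hh : EuclideanSpace ℝ (Fin n) → ENNReal := V.indicator fun x => ‖f (ψ x)‖ₑ ^ p with hhh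
  have hhm : Measurable hh := Measurable.indicator (by fun_prop) hVm
  set G : EuclideanSpace ℝ (Fin n) → EuclideanSpace ℝ (Fin n) → ENNReal := fun x y =>
    ‖f x - f y‖ₑ ^ p / ‖x - y‖ₑ ^ a
  have hGm : Measurable (fun q : EuclideanSpace ℝ (Fin n) × EuclideanSpace ℝ (Fin n) =>
      G q.1 q.2) := by
    have h1 : Measurable (fun q : EuclideanSpace ℝ (Fin n) × EuclideanSpace ℝ (Fin n) =>
      ‖f q.1 - f q.2‖ₑ ^ p) := by fun_prop
    exact h1.div (by fun_prop)
  have point : ∀ x ∈ D, ∀ y ∈ D, ‖V.indicator (fun x => g x * f (ψ x)) x -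
      V.indicator (fun x => g x * f (ψ x)) y‖ₑ ^ p / ‖x - y‖ₑ ^ a ≤
      C2 * (L' * V.indicator (fun x => V.indicator (fun y => G (ψ x) (ψ y)) y) x +
        (κ (x - y) * hh x + κ (x - y) * hh y)) := by
    intro x hx y hy
    have e1 : ‖V.indicator (fun x => g x * f (ψ x)) x -
        V.indicator (fun x => g x * f (ψ x)) y‖ₑ ≤ ENNReal.ofReal C *
        (V.indicator (fun x => V.indicator (fun y => ‖f (ψ x) - f (ψ y)‖ₑ) y) x +
          (ENNReal.ofReal (min 1 ‖x - y‖) * V.indicator (fun x => ‖f (ψ x)‖ₑ) x +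
            ENNReal.ofReal (min 1 ‖x - y‖) * V.indicator (fun x => ‖f (ψ x)‖ₑ) y)) := by
      rw [Real.enorm_eq_ofReal_abs]
      refine (ENNReal.ofReal_le_ofReal (H2 x hx y hy)).trans (le_of_eq ?_)
      have hm0 : 0 ≤ min 1 ‖x - y‖ := by positivity
      rw [ENNReal.ofReal_mul (by linarith)]
      by_cases hxV : x ∈ V <;> by_cases hyV : y ∈ V <;>
        simp only [indicator_of_mem, indicator_of_notMem, hxV, hyV, not_false_eq_true, mul_zero,
          add_zero, zero_add, ENNReal.ofReal_zero, Real.enorm_eq_ofReal_abs]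
      · rw [ENNReal.ofReal_add (by positivity) (by positivity),
          ENNReal.ofReal_add (by positivity) (by positivity), ENNReal.ofReal_mul hm0,
          ENNReal.ofReal_mul hm0]
      · rw [ENNReal.ofReal_mul hm0]
      · rw [ENNReal.ofReal_mul hm0]
    have e2 := rpow_le_of_le_mul_add hp e1
    refine (ENNReal.div_le_div_right e2 _).trans ?_
    rw [mul_div_assoc, ENNReal.add_div, ENNReal.add_div,
      ENNReal.mul_rpow_of_nonneg (ENNReal.ofReal (min 1 ‖x - y‖)) _ hp0.le,
      ENNReal.mul_rpow_of_nonneg (ENNReal.ofReal (min 1 ‖x - y‖)) _ hp0.le]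
    refine mul_le_mul' le_rfl (add_le_add ?_ (le_of_eq ?_))
    · by_cases hxV : x ∈ V <;> by_cases hyV : y ∈ V <;>
        simp only [indicator_of_mem, indicator_of_notMem, hxV, hyV, not_false_eq_true,
          ENNReal.zero_rpow_of_pos hp0, ENNReal.zero_div, zero_le]
      have e3 : ‖ψ x - ψ y‖ₑ ^ a ≤ L' * ‖x - y‖ₑ ^ a := by
        rw [← ENNReal.mul_rpow_of_nonneg _ _ ha0.le]
        refine ENNReal.rpow_le_rpow ?_ ha0.le
        have := hL hxV hyV
        rw [edist_eq_enorm_sub, edist_eq_enorm_sub] at this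
        refine this.trans ?_
        gcongr
        exact le_self_add
      simp only [G]
      rw [ENNReal.div_eq_inv_mul, ENNReal.div_eq_inv_mul, ← mul_assoc]
      refine mul_le_mul' ?_ le_rfl
      calc (‖x - y‖ₑ ^ a)⁻¹ = L' * (L' * ‖x - y‖ₑ ^ a)⁻¹ := by
            rw [ENNReal.mul_inv (Or.inl hL0) (Or.inl hL'), ← mul_assoc,
              ENNReal.mul_inv_cancel hL0 hL', one_mul]
        _ ≤ _ := by gcongr
    · have e4 : ∀ z, (V.indicator (fun x => ‖f (ψ x)‖ₑ) z) ^ p = hh z := fun z => by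
        by_cases hz : z ∈ V
        · simp [hhh, hz]
        · simp [hhh, hz, hp0]
      rw [e4, e4]
      simp only [hκ, ENNReal.div_eq_inv_mul]
      ring
  have I1 : ∫⁻ x in D, ∫⁻ y in D, V.indicator (fun x => V.indicator (fun y => G (ψ x) (ψ y)) y) x ≤
      Q * Q * gagliardo s p D' f := by
    have e1 : ∀ x, ∫⁻ y in D, V.indicator (fun x => V.indicator (fun y => G (ψ x) (ψ y)) y) x =
        V.indicator (fun x => ∫⁻ y in V, G (ψ x) (ψ y)) x := fun x => by
      by_cases hx : x ∈ V
      · simp only [indicator_of_mem hx]; exact hres _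
      · simp only [indicator_of_notMem hx, lintegral_zero]
    simp_rw [e1]
    rw [hres]
    calc ∫⁻ x in V, ∫⁻ y in V, G (ψ x) (ψ y)
        ≤ ∫⁻ x in V, Q * ∫⁻ y in D', G (ψ x) y := by
          refine lintegral_mono fun x => ?_
          exact setLIntegral_comp_le hψ h.mapsTo hK (F := fun y => G (ψ x) y)
            (hGm.comp (measurable_const.prodMk measurable_id))
      _ = Q * ∫⁻ x in V, ∫⁻ y in D', G (ψ x) y := lintegral_const_mul' _ _ hQ
      _ ≤ Q * (Q * ∫⁻ x in D', ∫⁻ y in D', G x y) := by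
          gcongr
          exact setLIntegral_comp_le hψ h.mapsTo hK (F := fun x => ∫⁻ y in D', G x y)
            hGm.lintegral_prod_right'
      _ = _ := by rw [mul_assoc]; rfl
  have shift : ∀ x, ∫⁻ y, κ (x - y) = ∫⁻ h, κ h := fun x => by
    rw [lintegral_sub_left_eq_self (fun h => κ h) x]
  have I2 : ∫⁻ x in D, ∫⁻ y in D, κ (x - y) * hh x ≤
      (∫⁻ h, κ h) * (Q * ∫⁻ x in D', ‖f x‖ₑ ^ p) := by
    calc _ ≤ ∫⁻ x in D, (∫⁻ h, κ h) * hh x := by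
          refine lintegral_mono fun x => ?_
          rw [lintegral_mul_const _ (by fun_prop), ← shift x]
          gcongr
          exact Measure.restrict_le_self
      _ = (∫⁻ h, κ h) * ∫⁻ x in D, hh x := lintegral_const_mul' _ _ hκI
      _ ≤ _ := by rw [hres]; gcongr
  have I3 : ∫⁻ x in D, ∫⁻ y in D, κ (x - y) * hh y ≤
      (∫⁻ h, κ h) * (Q * ∫⁻ x in D', ‖f x‖ₑ ^ p) := by
    rw [lintegral_lintegral_swap (by fun_prop)]
    refine le_trans (le_of_eq ?_) I2
    refine lintegral_congr fun x => lintegral_congr fun y => ?_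
    rw [← hκneg, neg_sub]
  have hm1 : Measurable (fun q : EuclideanSpace ℝ (Fin n) × EuclideanSpace ℝ (Fin n) =>
      κ (q.1 - q.2) * hh q.1) := by fun_prop
  have hm2 : Measurable (fun q : EuclideanSpace ℝ (Fin n) × EuclideanSpace ℝ (Fin n) =>
      κ (q.1 - q.2) * hh q.2) := by fun_prop
  have hC2 : C2 ≠ ⊤ := by simp only [C2]; finiteness
  calc gagliardo s p D (V.indicator fun x => g x * f (ψ x))
      ≤ ∫⁻ x in D, ∫⁻ y in D, C2 * (L' *
          V.indicator (fun x => V.indicator (fun y => G (ψ x) (ψ y)) y) x +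
        (κ (x - y) * hh x + κ (x - y) * hh y)) := by
        exact setLIntegral_mono' h.measurableSet_domain fun x hx =>
          setLIntegral_mono' h.measurableSet_domain fun y hy => point x hx y hy
    _ = C2 * (L' * (∫⁻ x in D, ∫⁻ y in D,
          V.indicator (fun x => V.indicator (fun y => G (ψ x) (ψ y)) y) x) +
        ((∫⁻ x in D, ∫⁻ y in D, κ (x - y) * hh x) + ∫⁻ x in D, ∫⁻ y in D, κ (x - y) * hh y)) := by
        have l1 : ∀ x, ∫⁻ y in D, C2 * (L' *
            V.indicator (fun x => V.indicator (fun y => G (ψ x) (ψ y)) y) x +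
            (κ (x - y) * hh x + κ (x - y) * hh y)) = C2 * (L' * (∫⁻ y in D,
            V.indicator (fun x => V.indicator (fun y => G (ψ x) (ψ y)) y) x) +
            ((∫⁻ y in D, κ (x - y) * hh x) + ∫⁻ y in D, κ (x - y) * hh y)) := fun x => by
          rw [lintegral_const_mul' _ _ hC2, lintegral_add_right _ (by fun_prop),
            lintegral_const_mul' _ _ hL', lintegral_add_left (by fun_prop)]
        simp_rw [l1]
        rw [lintegral_const_mul' _ _ hC2, lintegral_add_right, lintegral_const_mul' _ _ hL',
          lintegral_add_left hm1.lintegral_prod_right']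
        exact hm1.lintegral_prod_right'.add hm2.lintegral_prod_right'
    _ ≤ C2 * (L' * (Q * Q * gagliardo s p D' f) +
        ((∫⁻ h, κ h) * (Q * ∫⁻ x in D', ‖f x‖ₑ ^ p) +
          (∫⁻ h, κ h) * (Q * ∫⁻ x in D', ‖f x‖ₑ ^ p))) := by gcongr
    _ ≤ C2 * ((L' * Q * Q + 2 * (∫⁻ h, κ h) * Q) *
          (gagliardo s p D' f + ∫⁻ x in D', ‖f x‖ₑ ^ p)) := by
        gcongr
        rw [add_mul, mul_add, mul_add (2 * _ * _)]
        refine add_le_add ?_ ?_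
        · rw [← mul_assoc, ← mul_assoc]; exact le_self_add
        · refine le_trans (le_of_eq ?_) le_add_self
          ring
    _ ≤ _ := by rw [← mul_assoc]; gcongr; exact le_add_self

/-- The value `⊤` off the measurable functions makes the triangle inequality unconditional. For
pullbacks, `f` may be replaced by a Borel representative because null sets of `D'` have null
preimages in `V`. -/
theorem isGauge_sobolevNorm' (hn : 0 < n) {s p : ℝ} (hs : 0 < s) (hs1 : s < 1) (hp : 1 ≤ p) :
    IsGauge (sobolevNorm' (n := n) s p) := by
  have hp0 : 0 < p := by linarith
  refine ⟨fun D f g hD h => ?_, fun D => ?_, fun D f => ?_, fun D f g => ?_,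
    fun D V D' ψ g h => ?_⟩
  · exact sobolevNorm'_congr_ae ((ae_restrict_iff' hD).2 (Eventually.of_forall fun x hx => h hx))
  · unfold sobolevNorm'
    rw [if_pos aestronglyMeasurable_zero, sobolevNorm_eq hp0]
    simp [gagliardo, hp0]
  · have h1 : ∀ f : EuclideanSpace ℝ (Fin n) → ℝ, AEStronglyMeasurable f (volume.restrict D) →
        AEStronglyMeasurable (-f) (volume.restrict D) := fun f hf => hf.neg
    have h2 : AEStronglyMeasurable (-f) (volume.restrict D) ↔
        AEStronglyMeasurable f (volume.restrict D) :=
      ⟨fun h => by simpa using h1 _ h, h1 f⟩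
    have h3 : ∀ x y, ‖-f x - -f y‖ₑ = ‖f x - f y‖ₑ := fun x y => by
      rw [← enorm_neg]; congr 1; ring
    have h4 : sobolevNorm s p D (-f) = sobolevNorm s p D f := by
      simp only [sobolevNorm_eq hp0, gagliardo, Pi.neg_apply, enorm_neg, h3]
    unfold sobolevNorm'
    by_cases hf : AEStronglyMeasurable f (volume.restrict D)
    · rw [if_pos hf, if_pos (h2.2 hf), h4]
    · rw [if_neg hf, if_neg (h2.not.2 hf)]
  · unfold sobolevNorm'
    by_cases hf : AEStronglyMeasurable f (volume.restrict D)
    · by_cases hg : AEStronglyMeasurable g (volume.restrict D)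
      · rw [if_pos hf, if_pos hg, if_pos (hf.add hg)]
        exact sobolevNorm_add_le hs hp hf hg
      · simp [hg]
    · simp [hf]
  · have hVm := h.measurableSet
    classical
    obtain ⟨K, hK⟩ := h.lipschitz
    obtain ⟨Kg, hKg⟩ := h.lipschitz_factor
    obtain ⟨Ka, hKa⟩ := h.antilipschitz
    -- Redefining `ψ` outside `V` makes it Borel measurable on the whole space and does not affect
    -- the function, which vanishes there.
    set ψ' : EuclideanSpace ℝ (Fin n) → EuclideanSpace ℝ (Fin n) := V.piecewise ψ fun _ => 0
    have hψ' : Measurable ψ' := hK.continuousOn.measurable_piecewise continuousOn_const hVm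
    have heq : EqOn ψ' ψ V := fun x hx => piecewise_eq_of_mem _ _ _ hx
    have h' : IsPullbackDatum D V D' ψ' g :=
      { h with
        mapsTo := fun x hx => by rw [heq hx]; exact h.mapsTo hx
        lipschitz := ⟨K, fun x hx y hy => by rw [heq hx, heq hy]; exact hK hx hy⟩
        antilipschitz := ⟨Ka, fun x hx y hy => by rw [heq hx, heq hy]; exact hKa x hx y hy⟩ }
    obtain ⟨C, hC, H⟩ := exists_gagliardo_pullback_le hn hs hs1 hp h' hψ'
    obtain ⟨Ka, hKa⟩ := h'.antilipschitz
    refine ⟨C ^ (1 / p) + (C * 2) ^ (1 / p) + 1, ?_, fun f => ?_⟩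
    · have : 0 ≤ 1 / p := by positivity
      finiteness
    by_cases hf : AEStronglyMeasurable f (volume.restrict D')
    swap
    · have : sobolevNorm' s p D' f = ⊤ := by simp [sobolevNorm', hf]
      rw [this, ENNReal.mul_top (by simp)]
      exact le_top
    have hmeas : Measurable hf.mk := hf.stronglyMeasurable_mk.measurable
    -- The change of variables applied to the indicator of a Borel null set shows that its preimage
    -- in `V` is null.
    have hnull : ∀ᵐ x ∂volume.restrict V, f (ψ' x) = hf.mk f (ψ' x) := by
      obtain ⟨B, hB, hBm, hB0⟩ := exists_measurable_superset_of_null (ae_iff.1 hf.ae_eq_mk)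
      rw [ae_iff]
      have h0 := setLIntegral_comp_le hψ' h'.mapsTo hKa
        (F := B.indicator fun _ => (1 : ENNReal)) (measurable_const.indicator hBm)
      rw [lintegral_indicator_const hBm, hB0, mul_zero, mul_zero] at h0
      have h1 : ∫⁻ x in V, B.indicator (fun _ => (1 : ENNReal)) (ψ' x) = volume.restrict V (ψ' ⁻¹' B) := by
        rw [← one_mul (volume.restrict V _), ← lintegral_indicator_const (hψ' hBm)]
        rfl
      rw [h1] at h0
      exact measure_mono_null (t := ψ' ⁻¹' B) (fun x hx => hB hx) (nonpos_iff_eq_zero.1 h0)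
    have hVae : (V.indicator fun x => g x * f (ψ x)) =ᵐ[volume.restrict D]
        V.indicator fun x => g x * hf.mk f (ψ' x) := by
      refine ae_restrict_of_ae ?_
      have := (ae_restrict_iff' hVm).1 hnull
      filter_upwards [this] with x hx
      by_cases hxV : x ∈ V
      · rw [indicator_of_mem hxV, indicator_of_mem hxV, ← hx hxV, heq hxV]
      · rw [indicator_of_notMem hxV, indicator_of_notMem hxV]
    rw [sobolevNorm'_congr_ae hVae, sobolevNorm'_congr_ae hf.ae_eq_mk]
    have hgm : Measurable (V.indicator g) := by
      rw [← Set.piecewise_eq_indicator]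
      exact hKg.continuousOn.measurable_piecewise continuousOn_const hVm
    have hm : Measurable (V.indicator fun x => g x * hf.mk f (ψ' x)) := by
      have e : (V.indicator fun x => g x * hf.mk f (ψ' x)) =
          fun x => V.indicator g x * hf.mk f (ψ' x) := by
        ext x
        by_cases hx : x ∈ V <;> simp [hx]
      rw [e]
      exact hgm.mul (hmeas.comp hψ')
    unfold sobolevNorm'
    rw [if_pos hm.aestronglyMeasurable, if_pos hmeas.aestronglyMeasurable]
    obtain ⟨H1, H2⟩ := H _ hmeas
    have hp1 : 0 ≤ 1 / p := by positivity
    set S := sobolevNorm s p D' (hf.mk f)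
    have b1 : ∫⁻ x in D', ‖hf.mk f x‖ₑ ^ p ≤ S ^ p := lintegral_rpow_le hp0 _ _
    have b2 : gagliardo s p D' (hf.mk f) ≤ S ^ p := gagliardo_le hp0 _ _
    have hS : ∀ c : ENNReal, (c * S ^ p) ^ (1 / p) = c ^ (1 / p) * S := fun c => by
      rw [ENNReal.mul_rpow_of_nonneg _ _ hp1, ← ENNReal.rpow_mul, mul_one_div_cancel hp0.ne',
        ENNReal.rpow_one]
    rw [sobolevNorm_eq hp0]
    calc _ ≤ (C * S ^ p) ^ (1 / p) + (C * (S ^ p + S ^ p)) ^ (1 / p) := by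
          gcongr
          · exact H1.trans (by gcongr)
          · exact H2.trans (by gcongr)
      _ = C ^ (1 / p) * S + (C * 2) ^ (1 / p) * S := by
          rw [← two_mul, ← mul_assoc, hS, hS]
      _ ≤ _ := by rw [add_mul, add_mul]; exact le_self_add

end SobolevGauge

end DistJacobian

namespace DistJacobian

/-! ### Convergence of mollifications -/

section MolConvergence

variable {n : ℕ}

/-- Interpolation: the error is `O(t ^ β)` uniformly and bounded in the `β`-Hölder seminorm. Using
the second bound for `‖x - y‖ ≤ t` and the first otherwise gives `t ^ (β - β')` in the weaker
seminorm. In the `β`-norm itself there is no convergence in general. -/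
theorem tendsto_holderNorm_mol_sub {R : Set (EuclideanSpace ℝ (Fin n))}
    {φ u : EuclideanSpace ℝ (Fin n) → ℝ} (hφ : IsKernel R φ) {β β' : NNReal}
    (hβ : β' < β) (h : holderNorm β R u < ⊤) (hu : LocallyIntegrable u) :
    Tendsto (fun t => holderNorm β' R (mol φ t u - u)) (𝓝[>] 0) (𝓝 0) := by
  obtain ⟨r, hr, hrφ⟩ := hφ.exists_norm_le
  set T := (holderNorm β R u).toReal
  have hT : 0 ≤ T := ENNReal.toReal_nonneg
  set A := ∫ z, |φ z|
  have hA : 0 ≤ A := integral_nonneg fun _ => abs_nonneg _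
  have hββ : (β' : ℝ) < β := by exact_mod_cast hβ
  set B : ℝ := T * (r ^ (β : ℝ) + 2) * A
  have hB : 0 ≤ B := by positivity
  have bound : ∀ t : ℝ, 0 < t → ∀ x ∈ R, |mol φ t u x - u x| ≤ B * t ^ (β : ℝ) := by
    intro t ht x hx
    have h1 : ∀ z ∈ tsupport φ, |u (x + t • z) - u x| ≤ T * (r ^ (β : ℝ) * t ^ (β : ℝ)) := by
      intro z hz
      refine (abs_sub_le_of_holderNorm h (hφ.add_smul_mem z hz x hx t ht.le) hx).trans ?_
      rw [add_sub_cancel_left, norm_smul, Real.norm_of_nonneg ht.le,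
        ← Real.mul_rpow hr.le ht.le, mul_comm r t]
      gcongr
      exact hrφ z hz
    refine (abs_mol_sub_le hφ hu ht.ne' h1).trans ?_
    have : 0 ≤ T * 2 * A * t ^ (β : ℝ) := by positivity
    simp only [B]
    nlinarith
  have bound2 : ∀ t : ℝ, 0 < t → ∀ x ∈ R, ∀ y ∈ R,
      |(mol φ t u x - u x) - (mol φ t u y - u y)| ≤ B * ‖x - y‖ ^ (β : ℝ) := by
    intro t ht x hx y hy
    have hint : ∀ x, Integrable fun z => φ z * (u (x + t • z) - u x) := fun x => by
      simp only [mul_sub]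
      exact (integrable_mol hφ.contDiff.continuous hφ.hasCompactSupport hu ht.ne' x).sub
        ((hφ.contDiff.continuous.integrable_of_hasCompactSupport hφ.hasCompactSupport).mul_const _)
    rw [mol_sub_eq hφ hu ht.ne', mol_sub_eq hφ hu ht.ne', ← integral_sub (hint x) (hint y)]
    simp only [← mul_sub]
    refine (norm_integral_mul_le (b := T * 2 * ‖x - y‖ ^ (β : ℝ)) hφ.contDiff.continuous
      hφ.hasCompactSupport fun z hz => ?_).trans ?_
    · have h1 := abs_sub_le_of_holderNorm h (hφ.add_smul_mem z hz x hx t ht.le)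
        (hφ.add_smul_mem z hz y hy t ht.le)
      have h2 := abs_sub_le_of_holderNorm h hx hy
      rw [add_sub_add_right_eq_sub] at h1
      have h3 := abs_sub (u (x + t • z) - u (y + t • z)) (u x - u y)
      calc _ = |(u (x + t • z) - u (y + t • z)) - (u x - u y)| := by congr 1; ring
        _ ≤ _ := by linarith
    · have : 0 ≤ T * r ^ (β : ℝ) * A * ‖x - y‖ ^ (β : ℝ) := by positivity
      simp only [B]
      nlinarith
  have key : ∀ t : ℝ, 0 < t → holderNorm β' R (mol φ t u - u) ≤
      ENNReal.ofReal (B * t ^ (β : ℝ) + 2 * B * t ^ ((β : ℝ) - β')) := by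
    intro t ht
    refine holderNorm_le (by positivity) (by positivity) (bound t ht) fun x hx y hy => ?_
    simp only [Pi.sub_apply]
    rcases eq_or_ne x y with rfl | hne
    · simp only [sub_self, abs_zero]; positivity
    have hd : 0 < ‖x - y‖ := norm_pos_iff.2 (sub_ne_zero.2 hne)
    rcases le_total ‖x - y‖ t with hle | hle
    · refine (bound2 t ht x hx y hy).trans ?_
      have e : ‖x - y‖ ^ (β : ℝ) = ‖x - y‖ ^ ((β : ℝ) - β') * ‖x - y‖ ^ (β' : ℝ) := by
        rw [← Real.rpow_add hd]; congr 1; ring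
      rw [e, ← mul_assoc]
      gcongr ?_ * _
      have : ‖x - y‖ ^ ((β : ℝ) - β') ≤ t ^ ((β : ℝ) - β') :=
        Real.rpow_le_rpow hd.le hle (by linarith)
      have h2 : 0 ≤ B * t ^ ((β : ℝ) - β') := by positivity
      nlinarith
    · have h1 := abs_sub (mol φ t u x - u x) (mol φ t u y - u y)
      have h2 := bound t ht x hx
      have h3 := bound t ht y hy
      have e : t ^ (β : ℝ) = t ^ ((β : ℝ) - β') * t ^ (β' : ℝ) := by
        rw [← Real.rpow_add ht]; congr 1; ring
      have h4 : t ^ (β' : ℝ) ≤ ‖x - y‖ ^ (β' : ℝ) := Real.rpow_le_rpow ht.le hle β'.coe_nonneg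
      calc _ ≤ 2 * B * t ^ ((β : ℝ) - β') * t ^ (β' : ℝ) := by rw [mul_assoc, ← e]; linarith
        _ ≤ _ := by gcongr
  have hlim : Tendsto (fun t : ℝ => ENNReal.ofReal (B * t ^ (β : ℝ) + 2 * B * t ^ ((β : ℝ) - β')))
      (𝓝[>] 0) (𝓝 0) := by
    have h1 : ∀ a : ℝ, 0 < a → Tendsto (fun t : ℝ => t ^ a) (𝓝[>] 0) (𝓝 0) := fun a ha => by
      have := (Real.continuous_rpow_const ha.le).tendsto 0
      rw [Real.zero_rpow ha.ne'] at this
      exact this.mono_left nhdsWithin_le_nhds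
    have hβ0 : (0 : ℝ) < β := lt_of_le_of_lt β'.coe_nonneg hββ
    have := ((h1 _ hβ0).const_mul B).add ((h1 _ (sub_pos.2 hββ)).const_mul (2 * B))
    simp only [mul_zero, add_zero] at this
    simpa using ENNReal.tendsto_ofReal this
  refine tendsto_of_tendsto_of_tendsto_of_le_of_le' tendsto_const_nhds hlim
    (Eventually.of_forall fun _ => zero_le) ?_
  filter_upwards [self_mem_nhdsWithin] with t ht
  exact key t ht

/-- Continuity of translations in `L^p`. -/
theorem tendsto_eLpNorm_translate {X : Type*} [NormedAddCommGroup X] [NormedSpace ℝ X]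
    [FiniteDimensional ℝ X] [MeasurableSpace X] [BorelSpace X] (μ : Measure X) [μ.IsAddHaarMeasure]
    {p : ℝ} (hp : 1 ≤ p) {f : X → ℝ} (hf : MemLp f (ENNReal.ofReal p) μ) :
    Tendsto (fun v : X => eLpNorm (fun x => f (x + v) - f x) (ENNReal.ofReal p) μ) (𝓝 0) (𝓝 0) := by
  have : Fact (1 ≤ ENNReal.ofReal p) := ⟨by simpa using hp⟩
  let g : X → C(X, X) := fun v => ⟨fun x => x + v, by fun_prop⟩
  have hg : Continuous g := (ContinuousMap.mk (fun q : X × X => q.2 + q.1) (by fun_prop)).curry.continuous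
  have hmp : ∀ v, MeasurePreserving (g v) μ μ := fun v => measurePreserving_add_right μ v
  have h1 := Filter.Tendsto.compMeasurePreservingLp (tendsto_const_nhds (x := hf.toLp f))
    (hg.tendsto 0) hmp (hmp 0) (by simp)
  rw [tendsto_iff_edist_tendsto_0] at h1
  refine h1.congr fun v => ?_
  have e0 : Lp.compMeasurePreserving (g 0) (hmp 0) (hf.toLp f) = hf.toLp f := by
    rw [Lp.toLp_compMeasurePreserving]
    congr 1
    ext x
    simp [g]
  rw [e0, Lp.toLp_compMeasurePreserving, Lp.edist_toLp_toLp]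
  rfl

theorem tendsto_setLIntegral_closedBall {r : ℝ} {F : EuclideanSpace ℝ (Fin n) → ENNReal}
    (hF : Tendsto F (𝓝 0) (𝓝 0)) :
    Tendsto (fun t : ℝ => ∫⁻ z in Metric.closedBall (0 : EuclideanSpace ℝ (Fin n)) r, F (t • z))
      (𝓝 0) (𝓝 0) := by
  rw [ENNReal.tendsto_nhds_zero] at hF ⊢
  intro ε hε
  have hV : volume (Metric.closedBall (0 : EuclideanSpace ℝ (Fin n)) r) ≠ ⊤ :=
    measure_closedBall_lt_top.ne
  obtain ⟨δ, hδ, hδε⟩ : ∃ δ > 0,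
      δ * volume (Metric.closedBall (0 : EuclideanSpace ℝ (Fin n)) r) ≤ ε := by
    rcases eq_or_ne ε ⊤ with rfl | hε'
    · exact ⟨1, one_pos, le_top⟩
    refine ⟨ε / (volume (Metric.closedBall (0 : EuclideanSpace ℝ (Fin n)) r) + 1), ?_, ?_⟩
    · exact ENNReal.div_pos hε.ne' (by finiteness)
    · calc _ ≤ ε / (volume (Metric.closedBall (0 : EuclideanSpace ℝ (Fin n)) r) + 1) *
            (volume (Metric.closedBall (0 : EuclideanSpace ℝ (Fin n)) r) + 1) := by
            gcongr; exact le_self_add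
        _ = ε := ENNReal.div_mul_cancel (by simp) (by finiteness)
  obtain ⟨η, hη, hball⟩ := Metric.eventually_nhds_iff.1 (hF δ hδ)
  have hr1 : 0 < |r| + 1 := by positivity
  refine Metric.eventually_nhds_iff.2 ⟨η / (|r| + 1), by positivity, fun t ht => ?_⟩
  refine le_trans ?_ hδε
  rw [← setLIntegral_const]
  refine setLIntegral_mono' measurableSet_closedBall fun z hz => hball ?_
  rw [dist_zero_right] at ht ⊢
  have hz' : ‖z‖ ≤ |r| + 1 := by
    have := mem_closedBall_zero_iff.1 hz
    linarith [le_abs_self r]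
  rw [norm_smul]
  rw [lt_div_iff₀ hr1] at ht
  exact lt_of_le_of_lt (by gcongr) ht

theorem mol_congr_ae {φ u v : EuclideanSpace ℝ (Fin n) → ℝ} {t : ℝ} (ht : t ≠ 0)
    (h : u =ᵐ[volume] v) : mol φ t u = mol φ t v := by
  ext x
  refine integral_congr_ae ?_
  have h1 : Measure.QuasiMeasurePreserving (fun z : EuclideanSpace ℝ (Fin n) => x + t • z) volume
      volume :=
    (measurePreserving_add_left volume x).quasiMeasurePreserving.comp
      ⟨by fun_prop, by
        rw [Measure.map_addHaar_smul volume ht]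
        exact Measure.smul_absolutelyContinuous⟩
  filter_upwards [h1.ae h] with z hz
  rw [hz]

/-- Translating both points leaves `x - y` unchanged, so the difference quotient of an average is an
average of the quotient along the diagonal. Both parts of the norm reduce to continuity of
translations in `L^p`, on the space and on its square. -/
theorem tendsto_sobolevNorm'_mol_sub {φ u : EuclideanSpace ℝ (Fin n) → ℝ}
    (hφ : IsKernel univ φ) {s p : ℝ} (hs : 0 < s) (hp : 1 ≤ p)
    (h : sobolevNorm' s p univ u < ⊤) :
    Tendsto (fun t => sobolevNorm' s p univ (mol φ t u - u)) (𝓝[>] 0) (𝓝 0) := by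
  have hp0 : 0 < p := by linarith
  wlog hum : Measurable u generalizing u
  · have hae : AEStronglyMeasurable u volume := by
      have := (sobolevNorm'_lt_top.1 h).1
      rwa [Measure.restrict_univ] at this
    have hmk : u =ᵐ[volume.restrict univ] hae.mk u := by
      rw [Measure.restrict_univ]; exact hae.ae_eq_mk
    have := this (u := hae.mk u) (by rwa [← sobolevNorm'_congr_ae hmk])
      hae.stronglyMeasurable_mk.measurable
    refine this.congr' ?_
    filter_upwards [self_mem_nhdsWithin] with t ht
    refine sobolevNorm'_congr_ae ?_
    rw [mol_congr_ae (ne_of_gt ht) hae.ae_eq_mk]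
    filter_upwards [hmk] with x hx
    rw [Pi.sub_apply, Pi.sub_apply, hx]
  have hN := (sobolevNorm'_lt_top.1 h).2
  have hp' : 1 ≤ ENNReal.ofReal p := by simpa using hp
  rw [sobolevNorm_eq_eLpNorm hs hp0 univ hum.aestronglyMeasurable, Measure.restrict_univ] at hN
  have hLu : MemLp u (ENNReal.ofReal p) volume :=
    ⟨hum.aestronglyMeasurable, lt_of_le_of_lt le_self_add hN⟩
  have hul : LocallyIntegrable u := hLu.locallyIntegrable hp'
  have hG : Measurable (gagliardoQuot s p u) := by
    have h2 : Measurable fun q : EuclideanSpace ℝ (Fin n) × EuclideanSpace ℝ (Fin n) =>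
      ‖q.1 - q.2‖ ^ (n / p + s) := by fun_prop
    have h1 : Measurable fun q : EuclideanSpace ℝ (Fin n) × EuclideanSpace ℝ (Fin n) =>
      u q.1 - u q.2 := by fun_prop
    exact h1.div h2
  have hLG : MemLp (gagliardoQuot s p u) (ENNReal.ofReal p) (volume.prod volume) :=
    ⟨hG.aestronglyMeasurable, lt_of_le_of_lt le_add_self hN⟩
  obtain ⟨r, hr, hrφ⟩ := hφ.exists_norm_le
  obtain ⟨C1, hC1, H1⟩ := lintegral_rpow_integral_mul_le_of_measurable
    (Ω := EuclideanSpace ℝ (Fin n)) hφ.contDiff.continuous hrφ hp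
  obtain ⟨C2, hC2, H2⟩ := lintegral_rpow_integral_mul_le_of_measurable
    (Ω := EuclideanSpace ℝ (Fin n) × EuclideanSpace ℝ (Fin n)) hφ.contDiff.continuous hrφ hp
  let diag : EuclideanSpace ℝ (Fin n) → EuclideanSpace ℝ (Fin n) × EuclideanSpace ℝ (Fin n) :=
    fun z => (z, z)
  have norm_rpow : ∀ {X : Type} [MeasurableSpace X] (μ : Measure X) (f : X → ℝ),
      ∫⁻ x, ‖f x‖ₑ ^ p ∂μ = eLpNorm f (ENNReal.ofReal p) μ ^ p := fun μ f => by
    rw [eLpNorm_eq_lintegral_rpow_enorm_toReal (by simpa using hp0) (by simp),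
      ENNReal.toReal_ofReal hp0.le, ← ENNReal.rpow_mul, one_div_mul_cancel hp0.ne',
      ENNReal.rpow_one]
  have rpow_tendsto : ∀ {ι : Type} {l : Filter ι} {F : ι → ENNReal} {a : ℝ}, 0 < a →
      Tendsto F l (𝓝 0) → Tendsto (fun z => F z ^ a) l (𝓝 0) := fun {_ _ _ a} ha hF => by
    have := hF.ennrpow_const a
    rwa [ENNReal.zero_rpow_of_pos ha] at this
  have L1 := tendsto_setLIntegral_closedBall (r := r)
    (rpow_tendsto hp0 (tendsto_eLpNorm_translate volume hp hLu))
  have hdiag : Tendsto diag (𝓝 0) (𝓝 0) := by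
    have : Continuous diag := by fun_prop
    exact this.tendsto 0
  have L2 := tendsto_setLIntegral_closedBall (r := r) (rpow_tendsto hp0
    ((tendsto_eLpNorm_translate (volume.prod volume) hp hLG).comp hdiag))
  have hq : 0 < 1 / p := by positivity
  have lim1 := rpow_tendsto hq (by simpa using ENNReal.Tendsto.const_mul L1 (Or.inr hC1))
  have lim2 := rpow_tendsto hq (by simpa using ENNReal.Tendsto.const_mul L2 (Or.inr hC2))
  have lim := (lim1.add lim2).mono_left (nhdsWithin_le_nhds (s := Ioi 0))
  rw [add_zero] at lim
  refine tendsto_of_tendsto_of_tendsto_of_le_of_le' tendsto_const_nhds lim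
    (Eventually.of_forall fun _ => zero_le) ?_
  filter_upwards [self_mem_nhdsWithin] with t ht
  have ht0 : t ≠ 0 := ne_of_gt ht
  have hsmooth := contDiff_mol hφ.contDiff hφ.hasCompactSupport hul ht0
  have hvm : AEStronglyMeasurable (mol φ t u - u) (volume.restrict univ) :=
    (hsmooth.continuous.measurable.sub hum).aestronglyMeasurable
  unfold sobolevNorm'
  rw [if_pos hvm, sobolevNorm_eq_eLpNorm hs hp0 univ hvm, Measure.restrict_univ]
  have root : ∀ {X : Type} [MeasurableSpace X] (μ : Measure X) (f : X → ℝ) (b : ENNReal),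
      ∫⁻ x, ‖f x‖ₑ ^ p ∂μ ≤ b → eLpNorm f (ENNReal.ofReal p) μ ≤ b ^ (1 / p) := fun μ f b hb => by
    rw [norm_rpow] at hb
    calc _ = (eLpNorm f (ENNReal.ofReal p) μ ^ p) ^ (1 / p) := by
          rw [← ENNReal.rpow_mul, mul_one_div_cancel hp0.ne', ENNReal.rpow_one]
      _ ≤ _ := by gcongr
  refine add_le_add (root _ _ _ ?_) (root _ _ _ ?_)
  · simp only [Pi.sub_apply, mol_sub_eq hφ hul ht0]
    refine (H1 volume (fun x z => u (x + t • z) - u x) ?_).trans (le_of_eq ?_)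
    · unfold Function.uncurry; fun_prop
    · simp only [norm_rpow]
  · have hint : ∀ x, Integrable fun z => φ z * (u (x + t • z) - u x) := fun x => by
      simp only [mul_sub]
      exact (integrable_mol hφ.contDiff.continuous hφ.hasCompactSupport hul ht0 x).sub
        ((hφ.contDiff.continuous.integrable_of_hasCompactSupport hφ.hasCompactSupport).mul_const _)
    have e : ∀ q, gagliardoQuot s p (mol φ t u - u) q =
        ∫ z, φ z * (gagliardoQuot s p u (q + diag (t • z)) - gagliardoQuot s p u q) := fun q => by
      have : ∀ z, φ z * (gagliardoQuot s p u (q + diag (t • z)) - gagliardoQuot s p u q) =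
          (φ z * (u (q.1 + t • z) - u q.1) - φ z * (u (q.2 + t • z) - u q.2)) /
            ‖q.1 - q.2‖ ^ (n / p + s) := fun z => by
        simp only [gagliardoQuot, diag, Prod.fst_add, Prod.snd_add, add_sub_add_right_eq_sub]
        ring
      simp only [this]
      rw [integral_div, integral_sub (hint _) (hint _), ← mol_sub_eq hφ hul ht0,
        ← mol_sub_eq hφ hul ht0]
      rfl
    simp only [e]
    refine (H2 (volume.prod volume)
      (fun q z => gagliardoQuot s p u (q + diag (t • z)) - gagliardoQuot s p u q) ?_).trans
      (le_of_eq ?_)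
    · have hd : Measurable diag := by fun_prop
      unfold Function.uncurry
      fun_prop
    · simp only [norm_rpow]

end MolConvergence

end DistJacobian

namespace DistJacobian

/-! ### Changes of coordinates -/

set_option linter.unusedSectionVars false

section Transition

variable {n : ℕ} {H : Type*} [TopologicalSpace H]
  {I : ModelWithCorners ℝ (EuclideanSpace ℝ (Fin n)) H}
  {M : Type*} [TopologicalSpace M] [ChartedSpace H M]

variable (I) in
/-- The derivative of the change of coordinates from `c` to `c'`. -/
noncomputable def transDeriv (c c' : OpenPartialHomeomorph M H) (y : EuclideanSpace ℝ (Fin n)) :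
    EuclideanSpace ℝ (Fin n) →L[ℝ] EuclideanSpace ℝ (Fin n) :=
  fderivWithin ℝ (I.extendCoordChange c c') (range I) y

variable {c c' c'' : OpenPartialHomeomorph M H} {y : EuclideanSpace ℝ (Fin n)}

theorem mem_extendCoordChange_source :
    y ∈ (I.extendCoordChange c c').source ↔
      y ∈ (c.extend I).target ∧ (c.extend I).symm y ∈ c'.source := by
  rw [PartialEquiv.trans_source, PartialEquiv.symm_source, c'.extend_source]
  rfl

theorem extendCoordChange_mem_target (h : y ∈ (I.extendCoordChange c c').source) :
    I.extendCoordChange c c' y ∈ (c'.extend I).target :=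
  (c'.extend I).map_source (by
    rw [c'.extend_source]
    exact (mem_extendCoordChange_source.1 h).2)

theorem extend_symm_extendCoordChange (h : y ∈ (I.extendCoordChange c c').source) :
    (c'.extend I).symm (I.extendCoordChange c c' y) = (c.extend I).symm y :=
  (c'.extend I).left_inv (by
    rw [c'.extend_source]
    exact (mem_extendCoordChange_source.1 h).2)

theorem extendCoordChange_mem_range (c c' : OpenPartialHomeomorph M H)
    (y : EuclideanSpace ℝ (Fin n)) : I.extendCoordChange c c' y ∈ range I := by
  simp only [PartialEquiv.coe_trans, Function.comp_apply, c'.extend_coe]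
  exact mem_range_self _

theorem extendCoordChange_mem_source_symm (h : y ∈ (I.extendCoordChange c c').source) :
    I.extendCoordChange c c' y ∈ (I.extendCoordChange c' c).source := by
  refine mem_extendCoordChange_source.2 ⟨extendCoordChange_mem_target h, ?_⟩
  rw [extend_symm_extendCoordChange h, ← c.extend_source (I := I)]
  exact (c.extend I).map_target (mem_extendCoordChange_source.1 h).1

theorem extendCoordChange_extendCoordChange (h : y ∈ (I.extendCoordChange c c').source) :
    I.extendCoordChange c' c (I.extendCoordChange c c' y) = y :=
  (I.extendCoordChange c c').left_inv h

theorem mem_range_of_mem_source (h : y ∈ (I.extendCoordChange c c').source) : y ∈ range I :=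
  c.extend_target_subset_range (mem_extendCoordChange_source.1 h).1

theorem contDiffWithinAt_extendCoordChange
    (hc : c ∈ IsManifold.maximalAtlas I ∞ M) (hc' : c' ∈ IsManifold.maximalAtlas I ∞ M)
    (h : y ∈ (I.extendCoordChange c c').source) :
    ContDiffWithinAt ℝ ∞ (I.extendCoordChange c c') (range I) y :=
  I.contDiffWithinAt_extendCoordChange hc hc' h

theorem contDiffWithinAt_transDeriv
    (hc : c ∈ IsManifold.maximalAtlas I ∞ M) (hc' : c' ∈ IsManifold.maximalAtlas I ∞ M)
    (h : y ∈ (I.extendCoordChange c c').source) :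
    ContDiffWithinAt ℝ ∞ (transDeriv I c c') (range I) y :=
  (contDiffWithinAt_extendCoordChange hc hc' h).fderivWithin_right I.uniqueDiffOn (by simp)
    (mem_range_of_mem_source h)

theorem transDeriv_comp
    (hc : c ∈ IsManifold.maximalAtlas I ∞ M) (hc' : c' ∈ IsManifold.maximalAtlas I ∞ M)
    (hc'' : c'' ∈ IsManifold.maximalAtlas I ∞ M)
    (h : y ∈ (I.extendCoordChange c c').source) (h' : y ∈ (I.extendCoordChange c c'').source) :
    (transDeriv I c' c'' (I.extendCoordChange c c' y)).comp (transDeriv I c c' y) =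
      transDeriv I c c'' y := by
  have hz : I.extendCoordChange c c' y ∈ (I.extendCoordChange c' c'').source := by
    refine mem_extendCoordChange_source.2 ⟨extendCoordChange_mem_target h, ?_⟩
    rw [extend_symm_extendCoordChange h]
    exact (mem_extendCoordChange_source.1 h').2
  have hy := mem_range_of_mem_source h
  unfold transDeriv
  rw [← fderivWithin_comp]
  · refine Filter.EventuallyEq.fderivWithin_eq ?_ ?_
    · filter_upwards [I.extendCoordChange_source_mem_nhdsWithin h] with z hz
      exact congrArg (c''.extend I) (extend_symm_extendCoordChange hz)
    · exact congrArg (c''.extend I) (extend_symm_extendCoordChange h)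
  · exact (contDiffWithinAt_extendCoordChange hc' hc'' hz).differentiableWithinAt (by simp)
  · exact (contDiffWithinAt_extendCoordChange hc hc' h).differentiableWithinAt (by simp)
  · exact fun z _ => extendCoordChange_mem_range c c' z
  · exact I.uniqueDiffOn _ hy

theorem transDeriv_self (hy : y ∈ (c.extend I).target) :
    transDeriv I c c y = ContinuousLinearMap.id ℝ _ := by
  have h : y ∈ (I.extendCoordChange c c).source := mem_extendCoordChange_source.2
    ⟨hy, by rw [← c.extend_source (I := I)]; exact (c.extend I).map_target hy⟩
  unfold transDeriv
  have : I.extendCoordChange c c =ᶠ[𝓝[range I] y] id := by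
    filter_upwards [I.extendCoordChange_source_mem_nhdsWithin h] with z hz
    exact (c.extend I).right_inv (mem_extendCoordChange_source.1 hz).1
  rw [this.fderivWithin_eq ((c.extend I).right_inv hy)]
  exact fderivWithin_id (I.uniqueDiffOn _ (mem_range_of_mem_source h))

variable [IsManifold I ∞ M]

theorem mem_source_chartAt (hy : y ∈ (c.extend I).target) :
    y ∈ (I.extendCoordChange c (chartAt H ((c.extend I).symm y))).source :=
  mem_extendCoordChange_source.2 ⟨hy, mem_chart_source H _⟩

/-- The tangent space at a point is the model space, read through the preferred chart there; hence
the differential of the parametrization is that of the change to this chart. -/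
theorem paramDeriv_eq (hc : c ∈ IsManifold.maximalAtlas I ∞ M) (hy : y ∈ (c.extend I).target) :
    paramDeriv I c y = transDeriv I c (chartAt H ((c.extend I).symm y)) y := by
  have hsm : MDifferentiableWithinAt 𝓘(ℝ, EuclideanSpace ℝ (Fin n)) I (c.extend I).symm
      (range I) y := by
    have h1 := (contMDiffOn_extend_symm hc).mdifferentiableOn (by simp : (∞ : ℕ∞ω) ≠ 0)
    rw [← c.extend_target'] at h1
    refine (h1 y hy).mono_of_mem_nhdsWithin ?_
    have := I.extendCoordChange_source_mem_nhdsWithin (mem_source_chartAt hy)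
    exact mem_of_superset this fun z hz => (mem_extendCoordChange_source.1 hz).1
  unfold paramDeriv
  refine hsm.mfderivWithin.trans ?_
  simp only [writtenInExtChartAt, extChartAt_model_space_eq_id, PartialEquiv.refl_symm,
    PartialEquiv.refl_coe, preimage_id, id_eq, Function.comp_id, modelWithCornersSelf_coe, range_id,
    inter_univ]
  rfl

/-- A form as a function with values in the alternating forms on the model space. -/
def Form.toFun {k : ℕ} (γ : Form I M k) : M → EuclideanSpace ℝ (Fin n) [⋀^Fin k]→L[ℝ] ℝ := γ

theorem Form.inChart_eq {k : ℕ} (γ : Form I M k) (hc : c ∈ IsManifold.maximalAtlas I ∞ M)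
    (hy : y ∈ (c.extend I).target) : γ.inChart c y =
      (γ.toFun ((c.extend I).symm y)).compContinuousLinearMap
        (transDeriv I c (chartAt H ((c.extend I).symm y)) y) := by
  unfold Form.inChart
  rw [paramDeriv_eq hc hy]
  rfl

theorem Form.inChart_eq_comp {k : ℕ} (γ : Form I M k) (hc : c ∈ IsManifold.maximalAtlas I ∞ M)
    (hc' : c' ∈ IsManifold.maximalAtlas I ∞ M) (h : y ∈ (I.extendCoordChange c c').source) :
    γ.inChart c y = (γ.inChart c' (I.extendCoordChange c c' y)).compContinuousLinearMap
      (transDeriv I c c' y) := by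
  have hy := (mem_extendCoordChange_source.1 h).1
  rw [γ.inChart_eq hc hy, γ.inChart_eq hc' (extendCoordChange_mem_target h),
    extend_symm_extendCoordChange h,
    ← transDeriv_comp hc hc' (IsManifold.chart_mem_maximalAtlas _) h (mem_source_chartAt hy)]
  rfl

theorem Form.toFun_eq {k : ℕ} (γ : Form I M k) (hc : c ∈ IsManifold.maximalAtlas I ∞ M) {x : M}
    (hx : x ∈ c.source) : γ.toFun x = (γ.inChart c (c.extend I x)).compContinuousLinearMap
      (transDeriv I (chartAt H x) c (extChartAt I x x)) := by
  have hx' : x ∈ (c.extend I).source := by rwa [c.extend_source]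
  have hxy : (c.extend I).symm (c.extend I x) = x := (c.extend I).left_inv hx'
  have hc0 : chartAt H x ∈ IsManifold.maximalAtlas I ∞ M := IsManifold.chart_mem_maximalAtlas _
  have hy0 : extChartAt I x x ∈ (I.extendCoordChange (chartAt H x) c).source :=
    mem_extendCoordChange_source.2 ⟨mem_extChartAt_target x, by
      change (extChartAt I x).symm (extChartAt I x x) ∈ _
      rwa [extChartAt_to_inv]⟩
  have hψ : I.extendCoordChange (chartAt H x) c (extChartAt I x x) = c.extend I x :=
    congrArg (c.extend I) (extChartAt_to_inv x)
  have h1 := γ.inChart_eq_comp hc0 hc hy0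
  rw [hψ] at h1
  rw [← h1, γ.inChart_eq hc0 (mem_extChartAt_target x)]
  change _ = (γ.toFun ((extChartAt I x).symm (extChartAt I x x))).compContinuousLinearMap
    (transDeriv I (chartAt H x) (chartAt H ((extChartAt I x).symm (extChartAt I x x))) _)
  rw [extChartAt_to_inv, transDeriv_self (mem_extChartAt_target x)]
  rfl

/-- `Form.d` uses the preferred chart at each point separately. The exterior derivative commutes
with pullback by the smooth change of coordinates, so any other chart may be used, given
differentiability at the single point `y`. -/
theorem Form.d_comp_paramDeriv {k : ℕ} (γ : Form I M k) (hc : c ∈ IsManifold.maximalAtlas I ∞ M)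
    (hy : y ∈ (c.extend I).target) (hint : y ∈ closure (interior (range I)))
    (hγ : DifferentiableWithinAt ℝ (γ.inChart c) (range I) y) :
    (γ.d ((c.extend I).symm y)).compContinuousLinearMap (paramDeriv I c y) =
      extDerivWithin (γ.inChart c) (range I) y := by
  set x := (c.extend I).symm y with hx
  set c0 := chartAt H x
  have hc0 : c0 ∈ IsManifold.maximalAtlas I ∞ M := IsManifold.chart_mem_maximalAtlas _
  have hyr := c.extend_target_subset_range hy
  have h : y ∈ (I.extendCoordChange c c0).source := mem_source_chartAt hy
  have hψ : I.extendCoordChange c c0 y = extChartAt I x x := rfl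
  have h' := extendCoordChange_mem_source_symm h
  have hback := extendCoordChange_extendCoordChange h
  rw [hψ] at h' hback
  have hdiff : DifferentiableWithinAt ℝ (γ.inChart c0) (range I) (extChartAt I x x) := by
    have e : γ.inChart c0 =ᶠ[𝓝[range I] (extChartAt I x x)] fun z =>
        (γ.inChart c (I.extendCoordChange c0 c z)).compContinuousLinearMap
          (transDeriv I c0 c z) := by
      filter_upwards [I.extendCoordChange_source_mem_nhdsWithin h'] with z hz
      exact γ.inChart_eq_comp hc0 hc hz
    refine DifferentiableWithinAt.congr_of_eventuallyEq ?_ e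
      (e.self_of_nhdsWithin (extendCoordChange_mem_range c c0 y))
    have d1 : DifferentiableWithinAt ℝ (fun z => γ.inChart c (I.extendCoordChange c0 c z)) (range I)
        (extChartAt I x x) := by
      refine DifferentiableWithinAt.comp (t := range I) _ (by rwa [hback])
        ((contDiffWithinAt_extendCoordChange hc0 hc h').differentiableWithinAt (by simp))
        fun z _ => extendCoordChange_mem_range c0 c z
    have d2 := (contDiffWithinAt_transDeriv hc0 hc h').differentiableWithinAt (by simp)
    exact d1.continuousAlternatingMapCompContinuousLinearMap d2
  have e : γ.inChart c =ᶠ[𝓝[range I] y] fun z =>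
      (γ.inChart c0 (I.extendCoordChange c c0 z)).compContinuousLinearMap
        (fderivWithin ℝ (I.extendCoordChange c c0) (range I) z) := by
    filter_upwards [I.extendCoordChange_source_mem_nhdsWithin h] with z hz
    exact γ.inChart_eq_comp hc hc0 hz
  have hdiff' : DifferentiableWithinAt ℝ (γ.inChart c0) (range I)
    (I.extendCoordChange c c0 y) := hdiff
  rw [e.extDerivWithin_eq (e.self_of_nhdsWithin hyr), extDerivWithin_pullback (t := range I)
    (r := ∞) hdiff' (contDiffWithinAt_extendCoordChange hc hc0 h)
    (by simpa using ENat.LEInfty.out) I.uniqueDiffOn hint hyr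
    fun z _ => extendCoordChange_mem_range c c0 z, paramDeriv_eq hc hy]
  change ((extDerivWithin (γ.inChart c0) (range I) (extChartAt I x x)).compContinuousLinearMap
    (mfderiv I 𝓘(ℝ, EuclideanSpace ℝ (Fin n)) (extChartAt I x) x)).compContinuousLinearMap _ = _
  have : IsManifold I 1 M := IsManifold.of_le (n := ∞) (by simp)
  rw [mfderiv_extChartAt_self]
  rfl

end Transition

end DistJacobian

namespace DistJacobian

/-! ### Components of forms -/

section Components

variable {n k : ℕ}

/-- The family of standard basis vectors with the given indices. -/
noncomputable def basisFamily (b : Fin k → Fin n) : Fin k → EuclideanSpace ℝ (Fin n) :=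
  fun j => EuclideanSpace.single (b j) 1

theorem exists_orderEmbedding_comp_perm (b : Fin k → Fin n) (hb : Function.Injective b) :
    ∃ (s : Fin k ↪o Fin n) (π : Equiv.Perm (Fin k)), b = s ∘ π := by
  have hs : StrictMono (b ∘ Tuple.sort b) :=
    (Tuple.monotone_sort b).strictMono_of_injective (hb.comp (Tuple.sort b).injective)
  refine ⟨OrderEmbedding.ofStrictMono _ hs, (Tuple.sort b)⁻¹, ?_⟩
  ext j
  simp

/-- Every component of an alternating form is zero or, up to sign, a component for a strictly
increasing multi-index. -/
theorem exists_component_eq (b : Fin k → Fin n) :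
    ∃ (s : Option (Fin k ↪o Fin n)) (ε : ℤˣ), ∀ η : EuclideanSpace ℝ (Fin n) [⋀^Fin k]→L[ℝ] ℝ,
      η (basisFamily b) = s.elim 0 fun s => ((ε : ℤ) : ℝ) * η (basisFamily s) := by
  by_cases hb : Function.Injective b
  · obtain ⟨s, π, rfl⟩ := exists_orderEmbedding_comp_perm b hb
    refine ⟨some s, Equiv.Perm.sign π, fun η => ?_⟩
    have := η.toAlternatingMap.map_perm (basisFamily s) π
    have e : basisFamily (s ∘ π) = basisFamily s ∘ π := rfl
    rw [e]
    simp only [Option.elim]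
    refine this.trans ?_
    rw [Units.smul_def, zsmul_eq_mul]
    rfl
  · refine ⟨none, 1, fun η => ?_⟩
    simp only [Function.Injective, not_forall] at hb
    obtain ⟨i, j, hij, hne⟩ := hb
    exact η.map_eq_zero_of_eq _ (i := i) (j := j) (by simp [basisFamily, hij]) hne

theorem eq_of_component_eq {η ζ : EuclideanSpace ℝ (Fin n) [⋀^Fin k]→L[ℝ] ℝ}
    (h : ∀ s : Fin k ↪o Fin n, η (basisFamily s) = ζ (basisFamily s)) : η = ζ := by
  apply ContinuousAlternatingMap.toAlternatingMap_injective
  apply AlternatingMap.coe_multilinearMap_injective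
  refine Module.Basis.ext_multilinear (fun _ => (EuclideanSpace.basisFun (Fin n) ℝ).toBasis) fun b => ?_
  obtain ⟨s, ε, H⟩ := exists_component_eq (n := n) b
  have e : (fun i => (EuclideanSpace.basisFun (Fin n) ℝ).toBasis (b i)) = basisFamily b := by
    ext i; simp [basisFamily]
  change η (fun i => (EuclideanSpace.basisFun (Fin n) ℝ).toBasis (b i)) =
    ζ fun i => (EuclideanSpace.basisFun (Fin n) ℝ).toBasis (b i)
  rw [e, H, H]
  cases s with
  | none => rfl
  | some s => simp [h]

/-- Only the reconstruction formula is needed, so any linear left inverse of the injective map to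
the components will do. -/
theorem exists_dualFamily (n k : ℕ) :
    ∃ E : (Fin k ↪o Fin n) → EuclideanSpace ℝ (Fin n) [⋀^Fin k]→L[ℝ] ℝ,
      ∀ η : EuclideanSpace ℝ (Fin n) [⋀^Fin k]→L[ℝ] ℝ,
        ∑ s : Fin k ↪o Fin n, η (basisFamily s) • E s = η := by
  let ev : (EuclideanSpace ℝ (Fin n) [⋀^Fin k]→L[ℝ] ℝ) →ₗ[ℝ] ((Fin k ↪o Fin n) → ℝ) :=
    { toFun := fun η s => η (basisFamily s)
      map_add' := fun _ _ => rfl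
      map_smul' := fun _ _ => rfl }
  obtain ⟨T, hT⟩ := ev.exists_leftInverse_of_injective
    (LinearMap.ker_eq_bot.2 fun η ζ h => eq_of_component_eq fun s => congrFun h s)
  refine ⟨fun s => T (Pi.single s 1), fun η => ?_⟩
  have h1 : T (ev η) = η := LinearMap.congr_fun hT η
  conv_rhs => rw [← h1, ← Finset.univ_sum_single (ev η)]
  rw [map_sum]
  refine Finset.sum_congr rfl fun s _ => ?_
  rw [← map_smul, ← Pi.single_smul, smul_eq_mul, mul_one]
  rfl

/-- A family of alternating forms with `η = ∑ s, η_s • dualFamily s`, where `s` runs through the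
strictly increasing multi-indices. -/
noncomputable def dualFamily (n k : ℕ) :
    (Fin k ↪o Fin n) → EuclideanSpace ℝ (Fin n) [⋀^Fin k]→L[ℝ] ℝ :=
  (exists_dualFamily n k).choose

theorem sum_smul_dualFamily (η : EuclideanSpace ℝ (Fin n) [⋀^Fin k]→L[ℝ] ℝ) :
    ∑ s : Fin k ↪o Fin n, η (basisFamily s) • dualFamily n k s = η :=
  (exists_dualFamily n k).choose_spec η

/-- The components of the pullback of an alternating form by a linear map. -/
theorem comp_basisFamily (η : EuclideanSpace ℝ (Fin n) [⋀^Fin k]→L[ℝ] ℝ)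
    (L : EuclideanSpace ℝ (Fin n) →L[ℝ] EuclideanSpace ℝ (Fin n)) (a : Fin k → Fin n) :
    η.compContinuousLinearMap L (basisFamily a) =
      ∑ b : Fin k → Fin n, (∏ j, L (EuclideanSpace.single (a j) 1) (b j)) * η (basisFamily b) := by
  have e : ∀ v : EuclideanSpace ℝ (Fin n), v = ∑ i, v i • EuclideanSpace.single i (1 : ℝ) := by
    intro v
    have := (EuclideanSpace.basisFun (Fin n) ℝ).sum_repr v
    simpa using this.symm
  have e2 : (fun j => L (basisFamily a j)) = fun j =>
      ∑ i, L (EuclideanSpace.single (a j) 1) i • EuclideanSpace.single i (1 : ℝ) := by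
    ext1 j
    exact e _
  change η (fun j => L (basisFamily a j)) = _
  rw [e2]
  have := η.toAlternatingMap.toMultilinearMap.map_sum
    (fun j i => L (EuclideanSpace.single (a j) 1) i • EuclideanSpace.single i (1 : ℝ))
  refine this.trans (Finset.sum_congr rfl fun b _ => ?_)
  exact (η.toAlternatingMap.toMultilinearMap.map_smul_univ _ _)

variable {H : Type*} [TopologicalSpace H]
  {I : ModelWithCorners ℝ (EuclideanSpace ℝ (Fin n)) H}
  {M : Type*} [TopologicalSpace M] [ChartedSpace H M]

/-- The component of a form in a coordinate system, for an arbitrary multi-index. -/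
noncomputable def Form.component (γ : Form I M k) (c : OpenPartialHomeomorph M H)
    (b : Fin k → Fin n) (y : EuclideanSpace ℝ (Fin n)) : ℝ :=
  γ.inChart c y (basisFamily b)

theorem IsGauge.component_le
    {N : Set (EuclideanSpace ℝ (Fin n)) → (EuclideanSpace ℝ (Fin n) → ℝ) → ENNReal}
    (hN : IsGauge N) (D : Set (EuclideanSpace ℝ (Fin n))) (γ : Form I M k)
    (c : OpenPartialHomeomorph M H) (b : Fin k → Fin n) :
    N D (γ.component c b) ≤ ∑ s : Fin k ↪o Fin n, N D (γ.coeff c s) := by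
  obtain ⟨s, ε, h⟩ := exists_component_eq (n := n) b
  cases s with
  | none =>
    have : γ.component c b = 0 := by ext y; exact h _
    rw [this, hN.zero]
    exact zero_le
  | some s =>
    refine le_trans ?_ (Finset.single_le_sum (fun _ _ => zero_le) (Finset.mem_univ s))
    have e : γ.component c b = fun y => ((ε : ℤ) : ℝ) * γ.coeff c s y := by ext y; exact h _
    rcases Int.units_eq_one_or ε with rfl | rfl
    · rw [e]; simp
    · have : γ.component c b = -γ.coeff c s := by rw [e]; ext; simp
      rw [this, hN.neg]

end Components

end DistJacobian

namespace DistJacobian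

/-! ### Bounded Lipschitz maps -/

section LipBdd

variable {X F G : Type*} [PseudoMetricSpace X] [NormedAddCommGroup F] [NormedSpace ℝ F]
  [NormedAddCommGroup G] [NormedSpace ℝ G] {S T : Set X}

/-- The map `f` is Lipschitz and bounded on `S`. -/
def IsLipBdd (f : X → F) (S : Set X) : Prop :=
  (∃ K : NNReal, LipschitzOnWith K f S) ∧ ∃ B : ℝ, ∀ x ∈ S, ‖f x‖ ≤ B

theorem IsLipBdd.mono {f : X → F} (hf : IsLipBdd f S) (h : T ⊆ S) : IsLipBdd f T :=
  ⟨hf.1.imp fun _ hK => hK.mono h, hf.2.imp fun _ hB x hx => hB x (h hx)⟩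

theorem IsLipBdd.congr {f g : X → F} (hf : IsLipBdd f S) (h : EqOn g f S) : IsLipBdd g S := by
  obtain ⟨⟨K, hK⟩, B, hB⟩ := hf
  exact ⟨⟨K, fun x hx y hy => by rw [h hx, h hy]; exact hK hx hy⟩, B, fun x hx => by
    rw [h hx]; exact hB x hx⟩

theorem isLipBdd_const (a : F) : IsLipBdd (fun _ : X => a) S :=
  ⟨⟨0, (LipschitzWith.const a).lipschitzOnWith⟩, ‖a‖, fun _ _ => le_rfl⟩

theorem IsLipBdd.add {f g : X → F} (hf : IsLipBdd f S) (hg : IsLipBdd g S) :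
    IsLipBdd (fun x => f x + g x) S := by
  obtain ⟨⟨K, hK⟩, B, hB⟩ := hf
  obtain ⟨⟨K', hK'⟩, B', hB'⟩ := hg
  exact ⟨⟨_, hK.add hK'⟩, B + B', fun x hx =>
    (norm_add_le _ _).trans (add_le_add (hB x hx) (hB' x hx))⟩

theorem IsLipBdd.clm (L : F →L[ℝ] G) {f : X → F} (hf : IsLipBdd f S) :
    IsLipBdd (fun x => L (f x)) S := by
  obtain ⟨⟨K, hK⟩, B, hB⟩ := hf
  exact ⟨⟨_, L.lipschitz.comp_lipschitzOnWith hK⟩, ‖L‖ * B, fun x hx =>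
    (L.le_opNorm _).trans (by gcongr; exact hB x hx)⟩

theorem IsLipBdd.mul {f g : X → ℝ} (hf : IsLipBdd f S) (hg : IsLipBdd g S) :
    IsLipBdd (fun x => f x * g x) S := by
  obtain ⟨⟨K, hK⟩, B, hB⟩ := hf
  obtain ⟨⟨K', hK'⟩, B', hB'⟩ := hg
  refine ⟨⟨(|B| * K' + K * |B'|).toNNReal, LipschitzOnWith.of_dist_le_mul fun x hx y hy => ?_⟩,
    |B| * |B'|, fun x hx => ?_⟩
  · have h1 := hK.dist_le_mul x hx y hy
    have h2 := hK'.dist_le_mul x hx y hy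
    rw [Real.coe_toNNReal _ (by positivity)]
    rw [Real.dist_eq] at h1 h2 ⊢
    have e : f x * g x - f y * g y = f x * (g x - g y) + (f x - f y) * g y := by ring
    rw [e]
    refine (abs_add_le _ _).trans ?_
    rw [abs_mul, abs_mul, add_mul]
    refine add_le_add ?_ ?_
    · rw [mul_assoc]
      exact mul_le_mul ((hB x hx).trans (le_abs_self _)) h2 (abs_nonneg _) (abs_nonneg _)
    · rw [mul_right_comm]
      exact mul_le_mul h1 ((hB' y hy).trans (le_abs_self _)) (abs_nonneg _) (by positivity)
  · rw [norm_mul]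
    exact mul_le_mul ((hB x hx).trans (le_abs_self _)) ((hB' x hx).trans (le_abs_self _))
      (norm_nonneg _) (abs_nonneg _)

theorem IsLipBdd.sum {ι : Type*} (s : Finset ι) {f : ι → X → F} (hf : ∀ i ∈ s, IsLipBdd (f i) S) :
    IsLipBdd (fun x => ∑ i ∈ s, f i x) S := by
  classical
  induction s using Finset.induction_on with
  | empty => simpa using isLipBdd_const (0 : F)
  | insert a s ha ih =>
    simp only [Finset.sum_insert ha]
    exact (hf a (Finset.mem_insert_self a s)).add
      (ih fun i hi => hf i (Finset.mem_insert_of_mem hi))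

theorem IsLipBdd.prod {ι : Type*} (s : Finset ι) {f : ι → X → ℝ} (hf : ∀ i ∈ s, IsLipBdd (f i) S) :
    IsLipBdd (fun x => ∏ i ∈ s, f i x) S := by
  classical
  induction s using Finset.induction_on with
  | empty => simpa using isLipBdd_const (1 : ℝ)
  | insert a s ha ih =>
    simp only [Finset.prod_insert ha]
    exact (hf a (Finset.mem_insert_self a s)).mul
      (ih fun i hi => hf i (Finset.mem_insert_of_mem hi))

theorem IsLipBdd.comp {Y : Type*} [PseudoMetricSpace Y] {S : Set Y} {g : X → F} {f : Y → X}
    (hg : IsLipBdd g T) {K : NNReal} (hf : LipschitzOnWith K f S) (h : MapsTo f S T) :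
    IsLipBdd (fun x => g (f x)) S := by
  obtain ⟨⟨K', hK'⟩, B, hB⟩ := hg
  exact ⟨⟨_, hK'.comp hf h⟩, B, fun x hx => hB _ (h hx)⟩

theorem isLipBdd_of_isBounded {f : X → F} {K : NNReal} (hf : LipschitzOnWith K f S)
    (hS : Bornology.IsBounded S) : IsLipBdd f S := by
  refine ⟨⟨K, hf⟩, ?_⟩
  rcases S.eq_empty_or_nonempty with rfl | ⟨x0, hx0⟩
  · exact ⟨0, by simp⟩
  refine ⟨‖f x0‖ + K * Metric.diam S, fun x hx => ?_⟩
  have h1 := hf.dist_le_mul x hx x0 hx0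
  have h2 := Metric.dist_le_diam_of_mem hS hx hx0
  rw [dist_eq_norm] at h1
  calc ‖f x‖ ≤ ‖f x0‖ + ‖f x - f x0‖ := norm_le_norm_add_norm_sub' _ _
    _ ≤ _ := by gcongr; exact h1.trans (by gcongr)

/-- Local properties are stated for all small radii, so that finitely many of them can be required
of one ball. -/
theorem eventually_forall_ball {x : X} {p : X → Prop} (h : ∀ᶠ y in 𝓝[S] x, p y) :
    ∀ᶠ r in 𝓝[>] (0 : ℝ), ∀ y ∈ Metric.ball x r ∩ S, p y := by
  obtain ⟨ε, hε, hs⟩ := Metric.mem_nhdsWithin_iff.1 h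
  filter_upwards [Ioo_mem_nhdsGT hε] with r hr y hy
  exact hs ⟨Metric.ball_subset_ball hr.2.le hy.1, hy.2⟩

theorem eventually_isLipBdd {E : Type*} [NormedAddCommGroup E] [NormedSpace ℝ E] {f : E → F}
    {S : Set E} {x : E} (hf : ContDiffWithinAt ℝ ∞ f S x) (hS : Convex ℝ S) :
    ∀ᶠ r in 𝓝[>] (0 : ℝ), IsLipBdd f (Metric.ball x r ∩ S) := by
  obtain ⟨K, t, ht, hK⟩ := (hf.of_le (m := 1) (by simp)).exists_lipschitzOnWith hS
  filter_upwards [eventually_forall_ball ht] with r hr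
  exact isLipBdd_of_isBounded (hK.mono hr) (Metric.isBounded_ball.subset inter_subset_left)

/-- A locally Lipschitz function on a compact set is bounded and Lipschitz. -/
theorem isLipBdd_of_isCompact (hS : IsCompact S) {f : X → F}
    (h : ∀ x ∈ S, ∃ r > 0, IsLipBdd f (Metric.ball x r ∩ S)) : IsLipBdd f S := by
  have hbd : ∃ B : ℝ, ∀ x ∈ S, ‖f x‖ ≤ B := by
    refine hS.induction_on (p := fun T => ∃ B : ℝ, ∀ x ∈ T, ‖f x‖ ≤ B) ⟨0, by simp⟩ ?_ ?_ ?_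
    · rintro s t hst ⟨B, hB⟩
      exact ⟨B, fun x hx => hB x (hst hx)⟩
    · rintro s t ⟨B, hB⟩ ⟨B', hB'⟩
      refine ⟨max B B', fun x hx => ?_⟩
      rcases hx with hx | hx
      · exact (hB x hx).trans (le_max_left _ _)
      · exact (hB' x hx).trans (le_max_right _ _)
    · intro x hx
      obtain ⟨r, hr, hl⟩ := h x hx
      exact ⟨_, Metric.mem_nhdsWithin_iff.2 ⟨r, hr, subset_rfl⟩, hl.2⟩
  refine ⟨?_, hbd⟩
  obtain ⟨B, hB⟩ := hbd
  choose! r hr hl using h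
  obtain ⟨t, htS, ht⟩ := hS.elim_nhds_subcover (fun x => Metric.ball x (r x / 2))
    fun x hx => Metric.ball_mem_nhds x (half_pos (hr x hx))
  choose! K hK using fun x hx => (hl x hx).1
  -- A Lebesgue number: points closer than `δ` share a ball of the cover and its Lipschitz constant;
  -- for more distant points boundedness is enough.
  obtain ⟨δ, hδ, hδr⟩ : ∃ δ > 0, ∀ x ∈ t, δ ≤ r x / 2 := by
    rcases t.eq_empty_or_nonempty with rfl | hne
    · exact ⟨1, one_pos, by simp⟩
    · obtain ⟨x, hx, hmin⟩ := t.exists_min_image (fun x => r x / 2) hne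
      exact ⟨r x / 2, half_pos (hr x (htS x hx)), hmin⟩
  refine ⟨(∑ x ∈ t, K x) + (2 * |B| / δ).toNNReal, LipschitzOnWith.of_dist_le_mul
    fun x hx y hy => ?_⟩
  rw [NNReal.coe_add, Real.coe_toNNReal _ (by positivity), add_mul]
  rcases lt_or_ge (dist x y) δ with hlt | hge
  · obtain ⟨z, hz, hxz⟩ := mem_iUnion₂.1 (ht hx)
    rw [Metric.mem_ball] at hxz
    have hδz := hδr z hz
    have hrz := hr z (htS z hz)
    have hxz' : dist x z < r z := by linarith
    have hyz : dist y z < r z := by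
      have := dist_triangle_left y z x
      linarith
    have h1 := (hK z (htS z hz)).dist_le_mul x ⟨hxz', hx⟩ y ⟨hyz, hy⟩
    have h2 : (K z : ℝ) ≤ (∑ x ∈ t, K x : NNReal) := by
      exact_mod_cast Finset.single_le_sum (f := K) (fun _ _ => zero_le) hz
    have h3 : 0 ≤ 2 * |B| / δ * dist x y := by positivity
    have h4 := mul_le_mul_of_nonneg_right h2 (dist_nonneg (x := x) (y := y))
    linarith
  · have h1 : dist (f x) (f y) ≤ 2 * |B| := by
      rw [dist_eq_norm]
      have := norm_sub_le (f x) (f y)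
      linarith [hB x hx, hB y hy, le_abs_self B]
    have h2 : 2 * |B| ≤ 2 * |B| / δ * dist x y := by
      rw [div_mul_eq_mul_div, le_div_iff₀ hδ]
      gcongr
    have h3 : 0 ≤ ((∑ x ∈ t, K x : NNReal) : ℝ) * dist x y := by positivity
    linarith

theorem IsLipBdd.holderNorm_lt_top {n : ℕ} {D : Set (EuclideanSpace ℝ (Fin n))}
    {f : EuclideanSpace ℝ (Fin n) → ℝ} (h : IsLipBdd f D) : holderNorm 1 D f < ⊤ := by
  obtain ⟨⟨K, hK⟩, B, hB⟩ := h
  refine lt_of_le_of_lt (holderNorm_le (A := |B|) (B := K) (abs_nonneg _) K.coe_nonneg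
    (fun x hx => (hB x hx).trans (le_abs_self _)) fun x hx y hy => ?_) ENNReal.ofReal_lt_top
  have := hK.dist_le_mul x hx y hy
  rw [Real.dist_eq, dist_eq_norm] at this
  simpa using this

end LipBdd

end DistJacobian

namespace DistJacobian

/-! ### Local pieces of forms -/

section Pieces

variable {n : ℕ} {H : Type*} [TopologicalSpace H]
  {I : ModelWithCorners ℝ (EuclideanSpace ℝ (Fin n)) H}
  {M : Type*} [TopologicalSpace M] [ChartedSpace H M]
  {c c' : OpenPartialHomeomorph M H} {y₀ : EuclideanSpace ℝ (Fin n)}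

theorem IsLipBdd.transDeriv_component {S : Set (EuclideanSpace ℝ (Fin n))}
    (h : IsLipBdd (transDeriv I c c') S) {k : ℕ} (a b : Fin k → Fin n) :
    IsLipBdd (fun y => ∏ j, transDeriv I c c' y (EuclideanSpace.single (a j) 1) (b j)) S := by
  refine IsLipBdd.prod _ fun j _ => ?_
  exact h.clm ((EuclideanSpace.proj (b j) : EuclideanSpace ℝ (Fin n) →L[ℝ] ℝ).comp
    (ContinuousLinearMap.apply ℝ (EuclideanSpace ℝ (Fin n)) (EuclideanSpace.single (a j) 1)))

theorem IsLipBdd.comp_transDeriv {S : Set (EuclideanSpace ℝ (Fin n))}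
    (h : IsLipBdd (transDeriv I c c') S) {k : ℕ}
    (η : EuclideanSpace ℝ (Fin n) [⋀^Fin k]→L[ℝ] ℝ) (a : Fin k → Fin n) :
    IsLipBdd (fun y => η.compContinuousLinearMap (transDeriv I c c' y) (basisFamily a)) S := by
  simp only [comp_basisFamily]
  exact IsLipBdd.sum _ fun b _ => (h.transDeriv_component a b).mul (isLipBdd_const _)

/-- On small (half-)balls, a change of coordinates is bi-Lipschitz with Lipschitz derivative. -/
theorem eventually_transition (hR : Convex ℝ (range I)) (hc : c ∈ IsManifold.maximalAtlas I ∞ M)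
    (hc' : c' ∈ IsManifold.maximalAtlas I ∞ M) (h : y₀ ∈ (I.extendCoordChange c c').source) :
    ∀ᶠ r in 𝓝[>] (0 : ℝ),
      Metric.ball y₀ r ∩ range I ⊆ (I.extendCoordChange c c').source ∧
      IsLipBdd (I.extendCoordChange c c') (Metric.ball y₀ r ∩ range I) ∧
      IsLipBdd (transDeriv I c c') (Metric.ball y₀ r ∩ range I) ∧
      ∃ K : NNReal, ∀ x ∈ Metric.ball y₀ r ∩ range I, ∀ y ∈ Metric.ball y₀ r ∩ range I,
        ‖x - y‖ ≤ K * ‖I.extendCoordChange c c' x - I.extendCoordChange c c' y‖ := by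
  have hψ := contDiffWithinAt_extendCoordChange hc hc' h
  have h' := extendCoordChange_mem_source_symm h
  -- The inverse change of coordinates is smooth too; its Lipschitz constant near the image point is
  -- the lower Lipschitz bound.
  obtain ⟨ρ, hρ, hρ0⟩ := ((eventually_isLipBdd (contDiffWithinAt_extendCoordChange hc' hc h') hR).and
    self_mem_nhdsWithin).exists
  obtain ⟨⟨K, hK⟩, -⟩ := hρ
  have hcont : ∀ᶠ y in 𝓝[range I] y₀,
      I.extendCoordChange c c' y ∈ Metric.ball (I.extendCoordChange c c' y₀) ρ :=
    hψ.continuousWithinAt (Metric.ball_mem_nhds _ hρ0)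
  filter_upwards [eventually_forall_ball (I.extendCoordChange_source_mem_nhdsWithin h),
    eventually_isLipBdd hψ hR, eventually_isLipBdd (contDiffWithinAt_transDeriv hc hc' h) hR,
    eventually_forall_ball hcont] with r h1 h2 h3 h4
  refine ⟨h1, h2, h3, K, fun x hx y hy => ?_⟩
  have := hK.dist_le_mul _ ⟨h4 x hx, extendCoordChange_mem_range c c' x⟩ _
    ⟨h4 y hy, extendCoordChange_mem_range c c' y⟩
  rwa [extendCoordChange_extendCoordChange (h1 x hx),
    extendCoordChange_extendCoordChange (h1 y hy), dist_eq_norm, dist_eq_norm] at this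

/-- A good coordinate system maps onto a subset of the target. -/
theorem GoodChart.image_subset (A : GoodChart I M) : A.image ⊆ (A.chart.extend I).target :=
  fun _ hy => A.subset_target ⟨Metric.ball_subset_closedBall hy.1, hy.2⟩

theorem GoodChart.domain_subset (A : GoodChart I M) : A.domain ⊆ A.chart.source := by
  rintro _ ⟨y, hy, rfl⟩
  rw [← A.chart.extend_source (I := I)]
  exact (A.chart.extend I).map_target (A.image_subset hy)

theorem GoodChart.measurableSet_image (hI : IsClosed (range I)) (A : GoodChart I M) :
    MeasurableSet A.image :=
  measurableSet_ball.inter hI.measurableSet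

/-- The domains `R` that coincide locally with the range of the model near the images of all
coordinate systems. -/
structure IsLocalRange (I : ModelWithCorners ℝ (EuclideanSpace ℝ (Fin n)) H) (M : Type*)
    [TopologicalSpace M] [ChartedSpace H M] (R : Set (EuclideanSpace ℝ (Fin n))) : Prop where
  range_subset : range I ⊆ R
  eventually_eq : ∀ c ∈ IsManifold.maximalAtlas I ∞ M, ∀ y ∈ (c.extend I).target,
    ∀ᶠ r in 𝓝[>] (0 : ℝ), Metric.ball y r ∩ R = Metric.ball y r ∩ range I

variable [IsManifold I ∞ M] {R : Set (EuclideanSpace ℝ (Fin n))}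

/-- The norms of local pieces of a form are bounded by the norm of the form. -/
theorem eventually_norm_piece_le (hI : IsClosed (range I)) (hIc : Convex ℝ (range I))
    (hRm : MeasurableSet R) (hR : IsLocalRange I M R)
    (A : GoodCover I M) (hc : c ∈ IsManifold.maximalAtlas I ∞ M) (hy : y₀ ∈ (c.extend I).target) :
    ∀ᶠ r in 𝓝[>] (0 : ℝ), ∀ g : EuclideanSpace ℝ (Fin n) → ℝ,
      IsLipBdd g (Metric.ball y₀ r ∩ R) → (∀ y ∉ Metric.ball y₀ (r / 2), g y = 0) →
      ∀ {k : ℕ} (b : Fin k → Fin n)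
        (N : Set (EuclideanSpace ℝ (Fin n)) → (EuclideanSpace ℝ (Fin n) → ℝ) → ENNReal),
        IsGauge N → ∃ C : ENNReal, C ≠ ⊤ ∧ ∀ γ : Form I M k,
          N R ((Metric.ball y₀ r ∩ R).indicator fun y => g y * γ.component c b y) ≤
            C * A.norm N γ := by
  obtain ⟨i, hi⟩ : ∃ i, (c.extend I).symm y₀ ∈ (A.chart i).domain :=
    mem_iUnion.1 (A.covers ▸ mem_univ _)
  set c' := (A.chart i).chart
  have hc' : c' ∈ IsManifold.maximalAtlas I ∞ M := (A.chart i).chart_mem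
  have h : y₀ ∈ (I.extendCoordChange c c').source :=
    mem_extendCoordChange_source.2 ⟨hy, (A.chart i).domain_subset hi⟩
  have him : I.extendCoordChange c c' y₀ ∈ (A.chart i).image := by
    obtain ⟨z, hz, hzy⟩ := hi
    have : I.extendCoordChange c c' y₀ = z := by
      change c'.extend I ((c.extend I).symm y₀) = z
      rw [← hzy]
      exact (c'.extend I).right_inv ((A.chart i).image_subset hz)
    rwa [this]
  have hcont : ∀ᶠ y in 𝓝[range I] y₀, I.extendCoordChange c c' y ∈ (A.chart i).image := by
    filter_upwards [(contDiffWithinAt_extendCoordChange hc hc' h).continuousWithinAt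
      (Metric.isOpen_ball.mem_nhds him.1)] with y hy
    exact ⟨hy, extendCoordChange_mem_range c c' y⟩
  filter_upwards [eventually_transition hIc hc hc' h, eventually_forall_ball hcont,
    hR.eventually_eq c hc y₀ hy, self_mem_nhdsWithin] with r ⟨h1, ⟨hl, _⟩, h3, h4⟩ hmaps hball hr0
  rw [hball]
  intro g hg hg0 k b N hN
  set V := Metric.ball y₀ r ∩ range I
  have hr0' : 0 < r := hr0
  have hVm : MeasurableSet V := measurableSet_ball.inter hI.measurableSet
  -- The factor lives in the ball of radius `r / 2`, while by `hball` the points of `R` outside `V`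
  -- are at distance at least `r` from the centre; this gives the separation `r / 2`.
  have hdatum : ∀ b' : Fin k → Fin n, IsPullbackDatum R V (A.chart i).image
      (I.extendCoordChange c c')
      (fun y => g y * ∏ j, transDeriv I c c' y (EuclideanSpace.single (b j) 1) (b' j)) := fun b' => by
    have hlb := hg.mul (h3.transDeriv_component b b')
    refine ⟨hRm, hVm, fun y hy => hR.range_subset hy.2, hmaps, hl, h4, hlb.2, hlb.1,
      r / 2, half_pos hr0', fun x hx hx0 y hyR hyV => ?_⟩
    have hx2 : x ∈ Metric.ball y₀ (r / 2) := by
      by_contra hx2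
      exact hx0 (by rw [hg0 x hx2, zero_mul])
    have hyr : r ≤ dist y y₀ := by
      by_contra hlt
      exact hyV (hball ▸ ⟨Metric.mem_ball.2 (not_le.1 hlt), hyR⟩)
    rw [Metric.mem_ball] at hx2
    have := dist_triangle y x y₀
    rw [← dist_eq_norm, dist_comm x y]
    linarith
  choose C hC HC using fun b' => hN.pullback _ _ _ _ _ (hdatum b')
  refine ⟨∑ b', C b', ENNReal.sum_ne_top.2 fun b' _ => hC b', fun γ => ?_⟩
  have e : (V.indicator fun y => g y * γ.component c b y) = ∑ b' : Fin k → Fin n,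
      V.indicator fun y => (g y * ∏ j, transDeriv I c c' y (EuclideanSpace.single (b j) 1) (b' j)) *
        γ.component c' b' (I.extendCoordChange c c' y) := by
    ext y
    rw [Finset.sum_apply]
    by_cases hyV : y ∈ V
    · simp only [indicator_of_mem hyV]
      rw [Form.component, γ.inChart_eq_comp hc hc' (h1 hyV), comp_basisFamily, Finset.mul_sum]
      exact Finset.sum_congr rfl fun b' _ => (mul_assoc _ _ _).symm
    · simp [indicator_of_notMem hyV]
  rw [e, Finset.sum_mul]
  refine (hN.sum _ _ _).trans (Finset.sum_le_sum fun b' _ => (HC b' _).trans ?_)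
  gcongr
  refine (hN.component_le _ _ _ _).trans ?_
  exact Finset.single_le_sum (f := fun i => ∑ s : Fin k ↪o Fin n,
    N (A.chart i).image (γ.coeff (A.chart i).chart s)) (fun _ _ => zero_le) (Finset.mem_univ i)

open Classical in
/-- The form with coefficients `h * w s` in the coordinate system `c`, extended by zero. -/
noncomputable def pieceForm {k : ℕ} (I : ModelWithCorners ℝ (EuclideanSpace ℝ (Fin n)) H)
    (c : OpenPartialHomeomorph M H) (h : EuclideanSpace ℝ (Fin n) → ℝ)
    (w : (Fin k ↪o Fin n) → EuclideanSpace ℝ (Fin n) → ℝ) : Form I M k := fun x =>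
  if x ∈ c.source then
    h (c.extend I x) • ∑ s, w s (c.extend I x) •
      (dualFamily n k s).compContinuousLinearMap (transDeriv I (chartAt H x) c (extChartAt I x x))
  else (0 : EuclideanSpace ℝ (Fin n) [⋀^Fin k]→L[ℝ] ℝ)

theorem pieceForm_inChart {k : ℕ} (hc : c ∈ IsManifold.maximalAtlas I ∞ M)
    (hc' : c' ∈ IsManifold.maximalAtlas I ∞ M) (h : EuclideanSpace ℝ (Fin n) → ℝ)
    (w : (Fin k ↪o Fin n) → EuclideanSpace ℝ (Fin n) → ℝ) {z : EuclideanSpace ℝ (Fin n)}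
    (hz : z ∈ (I.extendCoordChange c' c).source) :
    (pieceForm I c h w : Form I M k).inChart c' z = h (I.extendCoordChange c' c z) •
      ∑ s, w s (I.extendCoordChange c' c z) •
        (dualFamily n k s).compContinuousLinearMap (transDeriv I c' c z) := by
  obtain ⟨hzt, hx⟩ := mem_extendCoordChange_source.1 hz
  rw [Form.inChart_eq _ hc' hzt, ← transDeriv_comp hc'
    (IsManifold.chart_mem_maximalAtlas ((c'.extend I).symm z)) hc (mem_source_chartAt hzt) hz]
  have e : (pieceForm I c h w : Form I M k).toFun ((c'.extend I).symm z) = _ := if_pos hx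
  rw [e]
  ext v
  simp only [ContinuousAlternatingMap.compContinuousLinearMap_apply,
    ContinuousAlternatingMap.smul_apply, ContinuousAlternatingMap.sum_apply]
  rfl

theorem pieceForm_inChart_of_notMem {k : ℕ}
    (hc' : c' ∈ IsManifold.maximalAtlas I ∞ M) (h : EuclideanSpace ℝ (Fin n) → ℝ)
    (w : (Fin k ↪o Fin n) → EuclideanSpace ℝ (Fin n) → ℝ) {z : EuclideanSpace ℝ (Fin n)}
    (hz : z ∈ (c'.extend I).target) (hx : (c'.extend I).symm z ∉ c.source) :
    (pieceForm I c h w : Form I M k).inChart c' z = 0 := by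
  rw [Form.inChart_eq _ hc' hz]
  have e : (pieceForm I c h w : Form I M k).toFun ((c'.extend I).symm z) = _ := if_neg hx
  rw [e]
  rfl

theorem pieceForm_component {k : ℕ} (hc : c ∈ IsManifold.maximalAtlas I ∞ M)
    (hc' : c' ∈ IsManifold.maximalAtlas I ∞ M) (h : EuclideanSpace ℝ (Fin n) → ℝ)
    (w : (Fin k ↪o Fin n) → EuclideanSpace ℝ (Fin n) → ℝ) {z : EuclideanSpace ℝ (Fin n)}
    (hz : z ∈ (I.extendCoordChange c' c).source) (b : Fin k → Fin n) :
    (pieceForm I c h w : Form I M k).component c' b z =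
      ∑ s, (h (I.extendCoordChange c' c z) *
        (dualFamily n k s).compContinuousLinearMap (transDeriv I c' c z) (basisFamily b)) *
          w s (I.extendCoordChange c' c z) := by
  rw [Form.component, pieceForm_inChart hc hc' h w hz, ContinuousAlternatingMap.smul_apply,
    ContinuousAlternatingMap.sum_apply, smul_eq_mul, Finset.mul_sum]
  refine Finset.sum_congr rfl fun s _ => ?_
  rw [ContinuousAlternatingMap.smul_apply, smul_eq_mul]
  ring

theorem pieceForm_component_eq_zero {k : ℕ} (hc : c ∈ IsManifold.maximalAtlas I ∞ M)
    (hc' : c' ∈ IsManifold.maximalAtlas I ∞ M) {h : EuclideanSpace ℝ (Fin n) → ℝ}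
    (w : (Fin k ↪o Fin n) → EuclideanSpace ℝ (Fin n) → ℝ) {z : EuclideanSpace ℝ (Fin n)}
    (hz : z ∈ (c'.extend I).target)
    (h0 : z ∈ (I.extendCoordChange c' c).source → h (I.extendCoordChange c' c z) = 0)
    (b : Fin k → Fin n) : (pieceForm I c h w : Form I M k).component c' b z = 0 := by
  by_cases hx : (c'.extend I).symm z ∈ c.source
  · have hzs := mem_extendCoordChange_source.2 ⟨hz, hx⟩
    rw [pieceForm_component hc hc' h w hzs, h0 hzs]
    simp
  · rw [Form.component, pieceForm_inChart_of_notMem hc' h w hz hx]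
    rfl

/-- The coordinate system reaches past the closed (half-)ball, whose image is compact and therefore
closed. This is how the extension of good coordinate systems beyond their domains enters. -/
theorem GoodChart.closure_domain_subset [T2Space M] (hI : IsClosed (range I)) (A : GoodChart I M) :
    closure A.domain ⊆ (A.chart.extend I).symm ''
      (Metric.closedBall A.center A.radius ∩ range I) := by
  refine closure_minimal (image_mono (inter_subset_inter_left _ Metric.ball_subset_closedBall)) ?_
  refine IsCompact.isClosed (((isCompact_closedBall _ _).inter_right hI).image_of_continuousOn ?_)
  exact A.chart.continuousOn_extend_symm.mono A.subset_target

/-- The norm of a form that is supported in a small (half-)ball is bounded by the norms of its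
coefficients there. -/
theorem eventually_norm_pieceForm_le [T2Space M] (hI : IsClosed (range I))
    (hIc : Convex ℝ (range I)) (hR : IsLocalRange I M R)
    (A : GoodCover I M) (hc : c ∈ IsManifold.maximalAtlas I ∞ M) (hy : y₀ ∈ (c.extend I).target) :
    ∀ᶠ r in 𝓝[>] (0 : ℝ), ∀ h : EuclideanSpace ℝ (Fin n) → ℝ, IsLipBdd h univ →
      (∀ y ∉ Metric.ball y₀ r, h y = 0) →
      ∀ {k : ℕ} (N : Set (EuclideanSpace ℝ (Fin n)) → (EuclideanSpace ℝ (Fin n) → ℝ) → ENNReal),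
        IsGauge N → ∃ C : ENNReal, C ≠ ⊤ ∧
          ∀ w : (Fin k ↪o Fin n) → EuclideanSpace ℝ (Fin n) → ℝ,
            A.norm N (pieceForm I c h w : Form I M k) ≤ C * ∑ s, N R (w s) := by
  have key : ∀ i, ∀ᶠ r in 𝓝[>] (0 : ℝ), ∀ h : EuclideanSpace ℝ (Fin n) → ℝ, IsLipBdd h univ →
      (∀ y ∉ Metric.ball y₀ r, h y = 0) →
      ∀ {k : ℕ} (b : Fin k → Fin n)
        (N : Set (EuclideanSpace ℝ (Fin n)) → (EuclideanSpace ℝ (Fin n) → ℝ) → ENNReal),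
        IsGauge N → ∃ C : ENNReal, C ≠ ⊤ ∧
          ∀ w : (Fin k ↪o Fin n) → EuclideanSpace ℝ (Fin n) → ℝ,
            N (A.chart i).image ((pieceForm I c h w : Form I M k).component (A.chart i).chart b) ≤
              C * ∑ s, N R (w s) := by
    intro i
    set c' := (A.chart i).chart
    have hc' : c' ∈ IsManifold.maximalAtlas I ∞ M := (A.chart i).chart_mem
    set x₀ := (c.extend I).symm y₀
    have hsymm : ContinuousWithinAt (c.extend I).symm (range I) y₀ :=
      (c.continuousAt_extend_symm' hy).continuousWithinAt
    -- Near a point of the closure the coordinates of the cover are still defined, and the piece is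
    -- a pullback from `R`. Away from the closure, small pieces miss the domain altogether.
    by_cases hx₀ : x₀ ∈ closure (A.chart i).domain
    · obtain ⟨z₀, hz₀, hzx⟩ := (A.chart i).closure_domain_subset hI hx₀
      have hz₀t : z₀ ∈ (c'.extend I).target := (A.chart i).subset_target hz₀
      have hx₀' : x₀ ∈ c.source := by
        rw [← c.extend_source (I := I)]; exact (c.extend I).map_target hy
      have hz₀s : z₀ ∈ (I.extendCoordChange c' c).source :=
        mem_extendCoordChange_source.2 ⟨hz₀t, by rw [hzx]; exact hx₀'⟩
      have hψz : I.extendCoordChange c' c z₀ = y₀ := by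
        change c.extend I ((c'.extend I).symm z₀) = y₀
        rw [hzx]
        exact (c.extend I).right_inv hy
      have hy₀s : y₀ ∈ (I.extendCoordChange c c').source :=
        hψz ▸ extendCoordChange_mem_source_symm hz₀s
      have hback : I.extendCoordChange c c' y₀ = z₀ := by
        rw [← hψz]; exact extendCoordChange_extendCoordChange hz₀s
      obtain ⟨ρ, ⟨h1, h2, h3, h4⟩, hρ⟩ := ((eventually_transition hIc hc' hc hz₀s).and
        self_mem_nhdsWithin).exists
      have hρ' : 0 < ρ := hρ
      have hnear : ∀ᶠ y in 𝓝[range I] y₀,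
          I.extendCoordChange c c' y ∈ Metric.ball z₀ (ρ / 2) := by
        have := (contDiffWithinAt_extendCoordChange hc hc' hy₀s).continuousWithinAt
        refine this ?_
        rw [hback]
        exact Metric.ball_mem_nhds _ (half_pos hρ')
      filter_upwards [eventually_forall_ball hnear] with r hr h hh h0 k b N hN
      set D := (A.chart i).image
      set V := Metric.ball z₀ ρ ∩ D
      have hV : V ⊆ Metric.ball z₀ ρ ∩ range I := inter_subset_inter_right _ inter_subset_right
      have hVs : V ⊆ (I.extendCoordChange c' c).source := hV.trans h1
      have hDm := (A.chart i).measurableSet_image hI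
      have hVm : MeasurableSet V := measurableSet_ball.inter hDm
      have hclose : ∀ z ∈ (I.extendCoordChange c' c).source, h (I.extendCoordChange c' c z) ≠ 0 →
          z ∈ Metric.ball z₀ (ρ / 2) := by
        intro z hz hne
        have hb : I.extendCoordChange c' c z ∈ Metric.ball y₀ r := by
          by_contra hb
          exact hne (h0 _ hb)
        have := hr _ ⟨hb, extendCoordChange_mem_range c' c z⟩
        rwa [extendCoordChange_extendCoordChange hz] at this
      obtain ⟨Kψ, hKψ⟩ := (h2.mono hV).1
      have hdatum : ∀ s : Fin k ↪o Fin n, IsPullbackDatum D V R (I.extendCoordChange c' c)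
          (fun z => h (I.extendCoordChange c' c z) *
            (dualFamily n k s).compContinuousLinearMap (transDeriv I c' c z)
              (basisFamily b)) := fun s => by
        have hl := (hh.comp hKψ (mapsTo_univ _ _)).mul
          ((h3.mono hV).comp_transDeriv (dualFamily n k s) b)
        refine ⟨hDm, hVm, inter_subset_right, fun z _ => hR.range_subset
          (extendCoordChange_mem_range c' c z), ⟨Kψ, hKψ⟩, h4.imp fun K hK x hx y hy =>
            hK x (hV hx) y (hV hy), hl.2, hl.1, ρ / 2, half_pos hρ', fun x hx hx0 y hyD hyV => ?_⟩
        have hx2 := hclose x (hVs hx) (left_ne_zero_of_mul hx0)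
        have hyr : ρ ≤ dist y z₀ := by
          by_contra hlt
          exact hyV ⟨Metric.mem_ball.2 (not_le.1 hlt), hyD⟩
        rw [Metric.mem_ball] at hx2
        have := dist_triangle y x z₀
        rw [← dist_eq_norm, dist_comm x y]
        linarith
      choose C hC HC using fun s => hN.pullback _ _ _ _ _ (hdatum s)
      refine ⟨∑ s, C s, ENNReal.sum_ne_top.2 fun s _ => hC s, fun w => ?_⟩
      have e : EqOn ((pieceForm I c h w : Form I M k).component c' b) (∑ s, V.indicator fun z =>
          (h (I.extendCoordChange c' c z) * (dualFamily n k s).compContinuousLinearMap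
            (transDeriv I c' c z) (basisFamily b)) * w s (I.extendCoordChange c' c z)) D := by
        intro z hz
        rw [Finset.sum_apply]
        by_cases hzV : z ∈ V
        · simp only [indicator_of_mem hzV]
          exact pieceForm_component hc hc' h w (hVs hzV) b
        · simp only [indicator_of_notMem hzV, Finset.sum_const_zero]
          refine pieceForm_component_eq_zero hc hc' w ((A.chart i).image_subset hz) (fun hzs => ?_) b
          by_contra hne
          exact hzV ⟨Metric.ball_subset_ball (by linarith) (hclose z hzs hne), hz⟩
      rw [hN.congr _ _ _ hDm e, Finset.sum_mul]
      refine (hN.sum _ _ _).trans (Finset.sum_le_sum fun s _ => (HC s _).trans ?_)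
      gcongr
      exact Finset.single_le_sum (f := fun s => N R (w s)) (fun _ _ => zero_le) (Finset.mem_univ s)
    · have hfar : ∀ᶠ y in 𝓝[range I] y₀, (c.extend I).symm y ∈ (closure (A.chart i).domain)ᶜ :=
        hsymm (isClosed_closure.isOpen_compl.mem_nhds hx₀)
      filter_upwards [eventually_forall_ball hfar] with r hr h hh h0 k b N hN
      refine ⟨0, by simp, fun w => ?_⟩
      have e : EqOn ((pieceForm I c h w : Form I M k).component c' b) 0 (A.chart i).image := by
        intro z hz
        refine pieceForm_component_eq_zero hc hc' w ((A.chart i).image_subset hz) (fun hzs => ?_) b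
        by_contra hne
        have hb : I.extendCoordChange c' c z ∈ Metric.ball y₀ r := by
          by_contra hb
          exact hne (h0 _ hb)
        refine hr _ ⟨hb, extendCoordChange_mem_range c' c z⟩ (subset_closure ?_)
        rw [extend_symm_extendCoordChange hzs]
        exact mem_image_of_mem _ hz
      rw [hN.congr _ _ _ ((A.chart i).measurableSet_image hI) e, hN.zero]
      exact zero_le
  filter_upwards [eventually_all.2 key] with r hr h hh h0 k N hN
  choose C hC HC using fun i (s : Fin k ↪o Fin n) => hr i h hh h0 s N hN
  refine ⟨∑ i, ∑ s, C i s, ENNReal.sum_ne_top.2 fun i _ => ENNReal.sum_ne_top.2 fun s _ => hC i s,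
    fun w => ?_⟩
  rw [Finset.sum_mul]
  refine Finset.sum_le_sum fun i _ => ?_
  rw [Finset.sum_mul]
  exact Finset.sum_le_sum fun s _ => HC i s w

/-- Forms with smooth coefficients in a (half-)ball are Lipschitz in all good coordinate systems. -/
theorem pieceForm_hasCoeffs [T2Space M] (hI : IsClosed (range I)) (hIc : Convex ℝ (range I)) {k : ℕ}
    (hc : c ∈ IsManifold.maximalAtlas I ∞ M) {h : EuclideanSpace ℝ (Fin n) → ℝ}
    (hh : ContDiff ℝ ∞ h) (hcpt : HasCompactSupport h) (ht : tsupport h ∩ range I ⊆ (c.extend I).target)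
    {w : (Fin k ↪o Fin n) → EuclideanSpace ℝ (Fin n) → ℝ} (hw : ∀ s, ContDiff ℝ ∞ (w s)) :
    (pieceForm I c h w : Form I M k).HasCoeffs (MemHolderSpace 1) := by
  intro A b
  set c' := A.chart
  have hc' : c' ∈ IsManifold.maximalAtlas I ∞ M := A.chart_mem
  set S := Metric.closedBall A.center A.radius ∩ range I
  set K : Set M := (c.extend I).symm '' (tsupport h ∩ range I)
  have hK : IsClosed K := by
    refine IsCompact.isClosed ((hcpt.isCompact.inter_right hI).image_of_continuousOn ?_)
    exact c.continuousOn_extend_symm.mono ht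
  -- By compactness of the closed (half-)ball a local argument suffices: inside the domain of `c`
  -- the coefficients are smooth, and at all other points they vanish nearby because `K` is closed.
  have key : IsLipBdd ((pieceForm I c h w : Form I M k).component c' b) S := by
    refine isLipBdd_of_isCompact ((isCompact_closedBall _ _).inter_right hI) fun z hz => ?_
    have hzt := A.subset_target hz
    have hSr : S ⊆ range I := inter_subset_right
    by_cases hx : (c'.extend I).symm z ∈ c.source
    · have hzs : z ∈ (I.extendCoordChange c' c).source := mem_extendCoordChange_source.2 ⟨hzt, hx⟩
      have h1 := eventually_isLipBdd (contDiffWithinAt_transDeriv hc' hc hzs) hIc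
      have h2 := fun s : Fin k ↪o Fin n => eventually_isLipBdd ((hw s).contDiffAt.comp_contDiffWithinAt
        z (contDiffWithinAt_extendCoordChange hc' hc hzs)) hIc
      have h3 := eventually_isLipBdd (hh.contDiffAt.comp_contDiffWithinAt
        z (contDiffWithinAt_extendCoordChange hc' hc hzs)) hIc
      obtain ⟨r, ⟨⟨⟨h1, h2⟩, h3⟩, h4⟩, hr⟩ := ((((h1.and (eventually_all.2 h2)).and h3).and
        (eventually_forall_ball (I.extendCoordChange_source_mem_nhdsWithin hzs))).and
          self_mem_nhdsWithin).exists
      refine ⟨r, hr, IsLipBdd.mono ?_ (inter_subset_inter_right _ hSr)⟩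
      refine IsLipBdd.congr (f := fun z => ∑ s, (h (I.extendCoordChange c' c z) *
        (dualFamily n k s).compContinuousLinearMap (transDeriv I c' c z) (basisFamily b)) *
          w s (I.extendCoordChange c' c z)) ?_
        fun z hz => pieceForm_component hc hc' h w (h4 z hz) b
      exact IsLipBdd.sum _ fun s _ => (h3.mul (h1.comp_transDeriv _ _)).mul (h2 s)
    · have hxK : (c'.extend I).symm z ∈ Kᶜ := by
        rintro ⟨y, hy, hyz⟩
        refine hx (hyz ▸ ?_)
        rw [← c.extend_source (I := I)]
        exact (c.extend I).map_target (ht hy)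
      have hnear : ∀ᶠ z' in 𝓝[S] z, (c'.extend I).symm z' ∈ Kᶜ :=
        (c'.continuousAt_extend_symm' hzt).continuousWithinAt (hK.isOpen_compl.mem_nhds hxK)
      obtain ⟨r, h1, hr⟩ := ((eventually_forall_ball hnear).and self_mem_nhdsWithin).exists
      refine ⟨r, hr, (isLipBdd_const 0).congr fun z' hz' => ?_⟩
      refine pieceForm_component_eq_zero hc hc' w (A.subset_target hz'.2) (fun hzs => ?_) b
      by_contra hne
      refine h1 z' hz' ⟨I.extendCoordChange c' c z', ⟨subset_tsupport _ hne,
        extendCoordChange_mem_range c' c z'⟩, extend_symm_extendCoordChange hzs⟩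
  exact (key.mono (inter_subset_inter_left _ Metric.ball_subset_closedBall)).holderNorm_lt_top

end Pieces

end DistJacobian

namespace DistJacobian

/-! ### The wedge product in coordinates -/

section Wedge

variable {n k : ℕ}

/-- Composing `σ` with a permutation `π` of the positions `q` multiplies its sign by the sign of `π`
and leaves `h σ` alone. Averaging over all `π` antisymmetrizes the summand in these positions. -/
theorem sum_sign_eq_average (q : Fin k ↪ Fin n)
    (h : Equiv.Perm (Fin n) → (Fin k → Fin n) → ℝ)
    (hinv : ∀ (σ : Equiv.Perm (Fin n)) (π : Equiv.Perm (Fin k)) (v : Fin k → Fin n),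
      h (σ * π.viaFintypeEmbedding q) v = h σ v) :
    ∑ σ : Equiv.Perm (Fin n), ((Equiv.Perm.sign σ : ℤ) : ℝ) * h σ (fun i => σ (q i)) =
      ∑ σ : Equiv.Perm (Fin n), ((Equiv.Perm.sign σ : ℤ) : ℝ) * (k.factorial : ℝ)⁻¹ *
        ∑ π : Equiv.Perm (Fin k), ((Equiv.Perm.sign π : ℤ) : ℝ) * h σ fun i => σ (q (π i)) := by
  have key : ∀ π : Equiv.Perm (Fin k),
      ∑ σ : Equiv.Perm (Fin n), ((Equiv.Perm.sign σ : ℤ) : ℝ) * h σ (fun i => σ (q i)) =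
      ∑ σ : Equiv.Perm (Fin n), ((Equiv.Perm.sign σ : ℤ) : ℝ) *
        (((Equiv.Perm.sign π : ℤ) : ℝ) * h σ fun i => σ (q (π i))) := by
    intro π
    rw [← Equiv.sum_comp (Equiv.mulRight (π.viaFintypeEmbedding q))]
    refine Finset.sum_congr rfl fun σ _ => ?_
    simp only [Equiv.coe_mulRight, hinv, Equiv.Perm.sign_mul, Equiv.Perm.viaFintypeEmbedding_sign,
      Equiv.Perm.mul_apply, Equiv.Perm.viaFintypeEmbedding_apply_image, Units.val_mul, Int.cast_mul]
    ring
  have hk : (k.factorial : ℝ) ≠ 0 := by positivity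
  have hsum : ∑ _π : Equiv.Perm (Fin k),
      ∑ σ : Equiv.Perm (Fin n), ((Equiv.Perm.sign σ : ℤ) : ℝ) * h σ (fun i => σ (q i)) =
      (k.factorial : ℝ) *
        ∑ σ : Equiv.Perm (Fin n), ((Equiv.Perm.sign σ : ℤ) : ℝ) * h σ (fun i => σ (q i)) := by
    rw [Finset.sum_const, Finset.card_univ, Fintype.card_perm, Fintype.card_fin, nsmul_eq_mul]
  rw [← mul_right_inj' hk, ← hsum, Finset.sum_congr rfl fun π _ => key π, Finset.sum_comm,
    Finset.mul_sum]
  refine Finset.sum_congr rfl fun σ _ => ?_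
  rw [← Finset.mul_sum]
  field_simp

variable {ℓ : ℕ} {d : Fin k → ℕ} (hdeg : ℓ + ∑ i, (d i + 1) = n)

/-- The indices of the coefficient of the undifferentiated form. -/
def wedgeIndexZero (σ : Equiv.Perm (Fin n)) : Fin ℓ → Fin n :=
  fun j => σ (blockEquiv hdeg (Sum.inl j))

/-- The directions in which the coefficients are differentiated. -/
def wedgeDirection (J : ∀ i, Fin (d i + 1)) (σ : Equiv.Perm (Fin n)) : Fin k → Fin n :=
  fun i => σ (blockEquiv (deg := fun i => d i + 1) hdeg (Sum.inr ⟨i, J i⟩))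

/-- The indices of the coefficients that are differentiated. -/
def wedgeIndex (J : ∀ i, Fin (d i + 1)) (σ : Equiv.Perm (Fin n)) (i : Fin k) : Fin (d i) → Fin n :=
  fun j => σ (blockEquiv (deg := fun i => d i + 1) hdeg (Sum.inr ⟨i, (J i).succAbove j⟩))

/-- The weights in the coordinate expression of `lam ∧ dγ_1 ∧ ⋯ ∧ dγ_k`. -/
noncomputable def wedgeWeight (ℓ : ℕ) {d : Fin k → ℕ} (J : ∀ i, Fin (d i + 1))
    (σ : Equiv.Perm (Fin n)) : ℝ :=
  ((ℓ.factorial : ℝ) * ∏ i, ((d i + 1).factorial : ℝ))⁻¹ * (k.factorial : ℝ)⁻¹ *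
    ((Equiv.Perm.sign σ : ℤ) : ℝ) * ∏ i, (-1 : ℝ) ^ (J i : ℕ)

/-- Permuting the positions of the differentiating directions moves no other index, so the averaging
lemma turns products of single derivatives into minors of the Jacobian. -/
theorem sum_sign_eq_sum_jac (L : (Fin ℓ → Fin n) → ℝ)
    (u : ∀ i, (Fin (d i) → Fin n) → EuclideanSpace ℝ (Fin n) → ℝ) (y : EuclideanSpace ℝ (Fin n))
    (J : ∀ i, Fin (d i + 1)) :
    ∑ σ : Equiv.Perm (Fin n), ((Equiv.Perm.sign σ : ℤ) : ℝ) * (L (wedgeIndexZero hdeg σ) *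
        ∏ i, pd (wedgeDirection hdeg J σ i) (u i (wedgeIndex hdeg J σ i)) y) =
      ∑ σ : Equiv.Perm (Fin n), ((Equiv.Perm.sign σ : ℤ) : ℝ) * (k.factorial : ℝ)⁻¹ *
        (L (wedgeIndexZero hdeg σ) *
          jac (wedgeDirection hdeg J σ) (fun i => u i (wedgeIndex hdeg J σ i)) y) := by
  let q : Fin k ↪ Fin n := ⟨fun i => blockEquiv (deg := fun i => d i + 1) hdeg
    (Sum.inr ⟨i, J i⟩), fun i j hij => by
      have := (blockEquiv (deg := fun i => d i + 1) hdeg).injective hij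
      exact congrArg Sigma.fst (Sum.inr_injective this)⟩
  have hq : ∀ i, q i = blockEquiv (deg := fun i => d i + 1) hdeg (Sum.inr ⟨i, J i⟩) := fun _ => rfl
  have hfix : ∀ (x : Fin ℓ ⊕ ((i : Fin k) × Fin (d i + 1))), (∀ i, x ≠ Sum.inr ⟨i, J i⟩) →
      ∀ π : Equiv.Perm (Fin k), π.viaFintypeEmbedding q (blockEquiv hdeg x) = blockEquiv hdeg x := by
    intro x hx π
    refine Equiv.Perm.viaFintypeEmbedding_apply_notMem_range _ _ ?_
    rintro ⟨i, hi⟩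
    exact hx i ((blockEquiv hdeg).injective hi).symm
  have := sum_sign_eq_average q (fun σ v => L (wedgeIndexZero hdeg σ) *
        ∏ i, pd (v i) (u i (wedgeIndex hdeg J σ i)) y) fun σ π v => by
    have e1 : wedgeIndexZero hdeg (σ * π.viaFintypeEmbedding q) = wedgeIndexZero hdeg σ := by
      ext j
      simp only [wedgeIndexZero, Equiv.Perm.mul_apply]
      rw [hfix _ (by simp)]
    have e2 : ∀ i, wedgeIndex hdeg J (σ * π.viaFintypeEmbedding q) i = wedgeIndex hdeg J σ i := by
      intro i
      ext j
      simp only [wedgeIndex, Equiv.Perm.mul_apply]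
      rw [hfix]
      intro i' h
      have h1 := Sum.inr_injective h
      obtain rfl : i = i' := congrArg Sigma.fst h1
      exact Fin.succAbove_ne _ _ (eq_of_heq (Sigma.mk.inj h1).2)
    simp only [e1, e2]
  refine this.trans (Finset.sum_congr rfl fun σ _ => ?_)
  rw [jac_eq_sum, Finset.mul_sum, Finset.mul_sum, Finset.mul_sum]
  refine Finset.sum_congr rfl fun π _ => ?_
  simp only [hq, wedgeDirection]
  ring

variable {H : Type*} [TopologicalSpace H]
  {I : ModelWithCorners ℝ (EuclideanSpace ℝ (Fin n)) H}
  {M : Type*} [TopologicalSpace M] [ChartedSpace H M] [IsManifold I ∞ M]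
  {c : OpenPartialHomeomorph M H} {y : EuclideanSpace ℝ (Fin n)}

theorem Form.d_coordFrame {m : ℕ} (γ : Form I M m) (hc : c ∈ IsManifold.maximalAtlas I ∞ M)
    (hy : y ∈ (c.extend I).target) (hint : y ∈ interior (range I))
    (hγ : DifferentiableAt ℝ (γ.inChart c) y) (v : Fin (m + 1) → Fin n) :
    γ.d ((c.extend I).symm y) (fun j => coordFrame I c y (v j)) =
      ∑ j : Fin (m + 1), (-1) ^ (j : ℕ) * pd (v j) (γ.component c (v ∘ j.succAbove)) y := by
  have h1 := γ.d_comp_paramDeriv hc hy (subset_closure hint) hγ.differentiableWithinAt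
  have h2 := congrArg (fun η : EuclideanSpace ℝ (Fin n) [⋀^Fin (m + 1)]→L[ℝ] ℝ =>
    η (basisFamily v)) h1
  refine Eq.trans ?_ (h2.trans ?_)
  · rfl
  · have hu := I.uniqueDiffOn y (interior_subset hint)
    change extDerivWithin (γ.inChart c) (range I) y (basisFamily v) = _
    rw [extDerivWithin_apply hγ.differentiableWithinAt hu]
    refine Finset.sum_congr rfl fun j _ => ?_
    rw [fderivWithin_of_mem_nhds (mem_interior_iff_mem_nhds.1 hint), zsmul_eq_mul, Int.cast_pow,
      Int.cast_neg, Int.cast_one]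
    rfl

/-- The coordinate expression of `lam ∧ dγ_1 ∧ ⋯ ∧ dγ_k`. -/
theorem wedgeD_coordFrame (lam : Form I M ℓ) (γ : ∀ i, Form I M (d i))
    (hc : c ∈ IsManifold.maximalAtlas I ∞ M)
    (hy : y ∈ (c.extend I).target) (hint : y ∈ interior (range I))
    (hγ : ∀ i, DifferentiableAt ℝ ((γ i).inChart c) y) :
    wedgeD hdeg lam γ ((c.extend I).symm y) (coordFrame I c y) =
      ∑ J : ∀ i, Fin (d i + 1), ∑ σ : Equiv.Perm (Fin n), wedgeWeight ℓ J σ *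
        (lam.component c (wedgeIndexZero hdeg σ) y *
          jac (wedgeDirection hdeg J σ) (fun i => (γ i).component c (wedgeIndex hdeg J σ i)) y) := by
  have h1 : wedgeD hdeg lam γ ((c.extend I).symm y) (coordFrame I c y) =
      ((ℓ.factorial : ℝ) * ∏ i, ((d i + 1).factorial : ℝ))⁻¹ *
        ∑ σ : Equiv.Perm (Fin n), ((Equiv.Perm.sign σ : ℤ) : ℝ) *
          (lam.component c (wedgeIndexZero hdeg σ) y *
            ∏ i, (γ i).d ((c.extend I).symm y) (fun j => coordFrame I c y
              (σ (blockEquiv (deg := fun i => d i + 1) hdeg (Sum.inr ⟨i, j⟩))))) := by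
    unfold wedgeD wedgeProd
    rw [ContinuousAlternatingMap.smul_apply, smul_eq_mul,
      ContinuousMultilinearMap.alternatization_apply_apply]
    congr 1
    refine Finset.sum_congr rfl fun σ _ => ?_
    rw [Units.smul_def, zsmul_eq_mul]
    rfl
  rw [h1]
  -- Each `dγ_i` is expanded in coordinates, and `J i` records which of its arguments is the
  -- direction of differentiation.
  have h2 : ∀ σ : Equiv.Perm (Fin n), ∏ i, (γ i).d ((c.extend I).symm y) (fun j => coordFrame I c y
      (σ (blockEquiv (deg := fun i => d i + 1) hdeg (Sum.inr ⟨i, j⟩)))) =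
      ∑ J : ∀ i, Fin (d i + 1), (∏ i, (-1 : ℝ) ^ (J i : ℕ)) *
        ∏ i, pd (wedgeDirection hdeg J σ i) ((γ i).component c (wedgeIndex hdeg J σ i)) y := by
    intro σ
    have e : ∀ i, (γ i).d ((c.extend I).symm y) (fun j => coordFrame I c y
        (σ (blockEquiv (deg := fun i => d i + 1) hdeg (Sum.inr ⟨i, j⟩)))) = _ := fun i =>
      (γ i).d_coordFrame hc hy hint (hγ i)
        fun j => σ (blockEquiv (deg := fun i => d i + 1) hdeg (Sum.inr ⟨i, j⟩))
    simp only [e]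
    rw [Finset.prod_univ_sum]
    refine Finset.sum_congr (by simp) fun J _ => ?_
    rw [Finset.prod_mul_distrib]
    rfl
  simp only [h2, Finset.mul_sum]
  rw [Finset.sum_comm]
  refine Finset.sum_congr rfl fun J _ => ?_
  have h3 := sum_sign_eq_sum_jac hdeg (fun a => lam.component c a y)
    (fun i b => (γ i).component c b) y J
  have h4 := congrArg (fun t => ((ℓ.factorial : ℝ) * ∏ i, ((d i + 1).factorial : ℝ))⁻¹ *
    (∏ i, (-1 : ℝ) ^ (J i : ℕ)) * t) h3
  simp only [Finset.mul_sum] at h4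
  refine Eq.trans (Finset.sum_congr rfl fun σ _ => ?_)
    (h4.trans (Finset.sum_congr rfl fun σ _ => ?_))
  · ring
  · unfold wedgeWeight
    ring

end Wedge

end DistJacobian

namespace DistJacobian

/-! ### Signs of coordinate frames -/

section Sign

variable {n : ℕ} {H : Type*} [TopologicalSpace H]
  {I : ModelWithCorners ℝ (EuclideanSpace ℝ (Fin n)) H}
  {M : Type*} [TopologicalSpace M] [ChartedSpace H M] [IsManifold I ∞ M]
  {c c' : OpenPartialHomeomorph M H} {y₀ y : EuclideanSpace ℝ (Fin n)}

/-- The sign of a frame of tangent vectors, given in the preferred coordinates. -/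
noncomputable def ManifoldOrientation.sign (o : ManifoldOrientation I M) (x : M)
    (v : Fin n → EuclideanSpace ℝ (Fin n)) : ℝ :=
  frameSign (V := EuclideanSpace ℝ (Fin n)) (o.at' x) v

theorem frameSign_comp (o : Orientation ℝ (EuclideanSpace ℝ (Fin n)) (Fin n))
    (P T : EuclideanSpace ℝ (Fin n) →L[ℝ] EuclideanSpace ℝ (Fin n)) :
    frameSign o (fun j => P (T (EuclideanSpace.single j 1))) =
      SignType.sign (LinearMap.det (T : EuclideanSpace ℝ (Fin n) →ₗ[ℝ] EuclideanSpace ℝ (Fin n))) *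
        frameSign o (fun j => P (EuclideanSpace.single j 1)) := by
  set e := (EuclideanSpace.basisFun (Fin n) ℝ).toBasis
  have he : ∀ j, e j = EuclideanSpace.single j 1 := fun j => by simp [e]
  set f := o.someVector.compLinearMap (P : EuclideanSpace ℝ (Fin n) →ₗ[ℝ] EuclideanSpace ℝ (Fin n))
  have h1 : f (fun j => T (EuclideanSpace.single j 1)) =
      LinearMap.det (T : EuclideanSpace ℝ (Fin n) →ₗ[ℝ] EuclideanSpace ℝ (Fin n)) *
        f (fun j => EuclideanSpace.single j 1) := by
    have h2 : (fun j => EuclideanSpace.single j (1 : ℝ)) = e := funext fun j => (he j).symm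
    have h3 : (fun j => T (EuclideanSpace.single j 1)) =
        (T : EuclideanSpace ℝ (Fin n) →ₗ[ℝ] EuclideanSpace ℝ (Fin n)) ∘ e :=
      funext fun j => by rw [← he]; rfl
    rw [h2, h3, f.eq_smul_basis_det e]
    simp only [AlternatingMap.smul_apply, smul_eq_mul, e.det_comp, e.det_self]
    ring
  have h4 := congrArg (fun t : ℝ => ((SignType.sign t : SignType) : ℝ)) h1
  simp only [sign_mul, SignType.coe_mul] at h4
  exact h4

/-- In every coordinate system, the sign of the coordinate frame is locally constant. -/
theorem eventually_frameSign_eq (o : ManifoldOrientation I M)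
    (hc : c ∈ IsManifold.maximalAtlas I ∞ M) (hy : y₀ ∈ (c.extend I).target) :
    ∃ s : ℝ, ∀ᶠ y in 𝓝[range I] y₀,
      frameSign (o.at' ((c.extend I).symm y)) (coordFrame I c y) = s := by
  set x := (c.extend I).symm y₀
  set c0 := chartAt H x
  have hc0 : c0 ∈ IsManifold.maximalAtlas I ∞ M := IsManifold.chart_mem_maximalAtlas _
  have h : y₀ ∈ (I.extendCoordChange c c0).source := mem_source_chartAt hy
  have hframe : ∀ {c : OpenPartialHomeomorph M H}, c ∈ IsManifold.maximalAtlas I ∞ M → ∀ {y},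
      y ∈ (c.extend I).target → frameSign (o.at' ((c.extend I).symm y)) (coordFrame I c y) =
        o.sign ((c.extend I).symm y) fun j =>
          transDeriv I c (chartAt H ((c.extend I).symm y)) y (EuclideanSpace.single j 1) := by
    intro c hc y hy
    have : coordFrame I c y = fun j =>
        transDeriv I c (chartAt H ((c.extend I).symm y)) y (EuclideanSpace.single j 1) := by
      ext1 j
      unfold coordFrame
      rw [paramDeriv_eq hc hy]
      rfl
    rw [this]
    rfl
  -- The determinant of an invertible change of coordinates is continuous and nonzero, so its sign
  -- does not change nearby.
  have hdet : ∀ᶠ y in 𝓝[range I] y₀,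
      SignType.sign (LinearMap.det (transDeriv I c c0 y : EuclideanSpace ℝ (Fin n) →ₗ[ℝ] _)) =
        SignType.sign (LinearMap.det (transDeriv I c c0 y₀ : EuclideanSpace ℝ (Fin n) →ₗ[ℝ] _)) := by
    have hne : LinearMap.det (transDeriv I c c0 y₀ : EuclideanSpace ℝ (Fin n) →ₗ[ℝ] _) ≠ 0 := by
      have h1 := transDeriv_comp hc hc0 hc h (mem_extendCoordChange_source.2
        ⟨hy, by rw [← c.extend_source (I := I)]; exact (c.extend I).map_target hy⟩)
      rw [transDeriv_self hy] at h1
      have h2 := congrArg ContinuousLinearMap.det h1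
      refine right_ne_zero_of_mul (a := LinearMap.det (transDeriv I c0 c
        (I.extendCoordChange c c0 y₀) : EuclideanSpace ℝ (Fin n) →ₗ[ℝ] _)) ?_
      rw [← LinearMap.det_comp]
      exact ne_of_eq_of_ne (h2.trans LinearMap.det_id) one_ne_zero
    have hcont : ContinuousWithinAt (fun y => (transDeriv I c c0 y).det) (range I) y₀ :=
      ContinuousLinearMap.continuous_det.continuousAt.comp_continuousWithinAt
        (contDiffWithinAt_transDeriv hc hc0 h).continuousWithinAt
    rcases lt_or_gt_of_ne hne with hlt | hgt
    · filter_upwards [hcont.eventually (gt_mem_nhds hlt)] with y hy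
      rw [sign_neg hlt]
      exact sign_neg hy
    · filter_upwards [hcont.eventually (lt_mem_nhds hgt)] with y hy
      rw [sign_pos hgt]
      exact sign_pos hy
  have hlc : ∀ᶠ y in 𝓝[range I] y₀,
      frameSign (o.at' ((c0.extend I).symm (I.extendCoordChange c c0 y)))
        (coordFrame I c0 (I.extendCoordChange c c0 y)) =
      frameSign (o.at' ((extChartAt I x).symm (extChartAt I x x)))
        (coordFrame I (chartAt H x) (extChartAt I x x)) := by
    have ht : Tendsto (I.extendCoordChange c c0) (𝓝[range I] y₀) (𝓝[range I] (extChartAt I x x)) :=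
      tendsto_nhdsWithin_iff.2 ⟨(contDiffWithinAt_extendCoordChange hc hc0 h).continuousWithinAt,
        Eventually.of_forall fun y => extendCoordChange_mem_range c c0 y⟩
    exact ht.eventually (o.locallyConst x)
  refine ⟨SignType.sign (LinearMap.det (transDeriv I c c0 y₀ : EuclideanSpace ℝ (Fin n) →ₗ[ℝ] _)) *
    frameSign (o.at' ((extChartAt I x).symm (extChartAt I x x)))
      (coordFrame I (chartAt H x) (extChartAt I x x)), ?_⟩
  filter_upwards [I.extendCoordChange_source_mem_nhdsWithin h, hdet, hlc] with y hys hd hl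
  have hyt := (mem_extendCoordChange_source.1 hys).1
  rw [hframe hc0 (extendCoordChange_mem_target hys), extend_symm_extendCoordChange hys] at hl
  rw [hframe hc hyt, ← transDeriv_comp hc hc0 (IsManifold.chart_mem_maximalAtlas _) hys
    (mem_source_chartAt hyt)]
  refine (frameSign_comp _ _ _).trans ?_
  rw [hd]
  exact congrArg _ hl

end Sign

end DistJacobian

namespace DistJacobian

/-! ### Localization -/

section FormLocalization

universe u v

variable {n : ℕ} {H : Type v} [TopologicalSpace H]
  {I : ModelWithCorners ℝ (EuclideanSpace ℝ (Fin n)) H}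
  {M : Type u} [TopologicalSpace M] [ChartedSpace H M] [IsManifold I ∞ M]
  {c : OpenPartialHomeomorph M H} {y : EuclideanSpace ℝ (Fin n)}

theorem contDiffWithinAt_comp_extend_symm {ρ : M → ℝ} (hρ : ContMDiff I 𝓘(ℝ) ∞ ρ)
    (hc : c ∈ IsManifold.maximalAtlas I ∞ M) (hy : y ∈ (c.extend I).target) :
    ContDiffWithinAt ℝ ∞ (fun y => ρ ((c.extend I).symm y)) (range I) y := by
  have h1 := hρ.comp_contMDiffOn (contMDiffOn_extend_symm hc)
  rw [← c.extend_target'] at h1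
  refine (contMDiffOn_iff_contDiffOn.1 h1 y hy).mono_of_mem_nhdsWithin ?_
  exact mem_of_superset (I.extendCoordChange_source_mem_nhdsWithin (mem_source_chartAt hy))
    fun z hz => (mem_extendCoordChange_source.1 hz).1

theorem measurableSet_extend_target (hI : IsClosed (range I)) (c : OpenPartialHomeomorph M H) :
    MeasurableSet (c.extend I).target := by
  rw [c.extend_target]
  exact ((c.open_target.preimage I.continuous_symm).measurableSet).inter hI.measurableSet

/-- The support of `ρ` has compact image in the model, so finitely many quarter balls with property
`P` cover it, and an auxiliary partition of unity there splits `ρ`. Cutoffs in quarter balls leave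
room for bumps that equal one around them. -/
theorem exists_cutoffs [CompactSpace M] (hIc : Convex ℝ (range I))
    (hc : c ∈ IsManifold.maximalAtlas I ∞ M) {ρ : M → ℝ} (hρ : ContMDiff I 𝓘(ℝ) ∞ ρ)
    (hs : tsupport ρ ⊆ c.source) {P : EuclideanSpace ℝ (Fin n) → ℝ → Prop}
    (hP : ∀ y ∈ (c.extend I).target, ∀ᶠ r in 𝓝[>] (0 : ℝ), P y r) :
    ∃ (t : Finset (EuclideanSpace ℝ (Fin n))) (r : EuclideanSpace ℝ (Fin n) → ℝ)
      (g : t → EuclideanSpace ℝ (Fin n) → ℝ),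
      (∀ y : t, 0 < r y ∧ P y (r y) ∧ Metric.ball (y : EuclideanSpace ℝ (Fin n)) (r y) ∩ range I ⊆
          (c.extend I).target ∧
        IsLipBdd (g y) (Metric.ball (y : EuclideanSpace ℝ (Fin n)) (r y) ∩ range I) ∧
        ∀ z ∉ Metric.ball (y : EuclideanSpace ℝ (Fin n)) (r y / 4), g y z = 0) ∧
      ∀ z ∈ (c.extend I).target, ∑ y, g y z = ρ ((c.extend I).symm z) := by
  set K := c.extend I '' tsupport ρ with hKdef
  have hK : IsCompact K := (isClosed_tsupport ρ).isCompact.image_of_continuousOn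
    (c.continuousOn_extend.mono (by rwa [c.extend_source]))
  have hKt : K ⊆ (c.extend I).target := by
    rintro _ ⟨x, hx, rfl⟩
    exact (c.extend I).map_source (by rw [c.extend_source]; exact hs hx)
  have hex : ∀ y ∈ (c.extend I).target, ∃ r : ℝ, 0 < r ∧ P y r ∧
      Metric.ball y r ∩ range I ⊆ (c.extend I).target ∧
      IsLipBdd (fun y => ρ ((c.extend I).symm y)) (Metric.ball y r ∩ range I) := by
    intro y hy
    obtain ⟨r, ⟨⟨h1, h2⟩, h3⟩, h4⟩ := (((hP y hy).and (eventually_forall_ball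
      (I.extendCoordChange_source_mem_nhdsWithin (mem_source_chartAt hy)))).and
      (eventually_isLipBdd (contDiffWithinAt_comp_extend_symm hρ hc hy) hIc)).and
      self_mem_nhdsWithin |>.exists
    exact ⟨r, h4, h1, fun z hz => (mem_extendCoordChange_source.1 (h2 z hz)).1, h3⟩
  choose! r hr0 hrP hrt hrl using hex
  obtain ⟨t, htK, ht⟩ := hK.elim_nhds_subcover (fun y => Metric.ball y (r y / 4)) fun y hy =>
    Metric.ball_mem_nhds _ (by linarith [hr0 y (hKt hy)])
  obtain ⟨χ, hχ⟩ := SmoothPartitionOfUnity.exists_isSubordinate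
    𝓘(ℝ, EuclideanSpace ℝ (Fin n)) hK.isClosed
    (fun y : t => Metric.ball (y : EuclideanSpace ℝ (Fin n)) (r y / 4))
    (fun _ => Metric.isOpen_ball) (fun z hz => by
      obtain ⟨y, hy, hzy⟩ := mem_iUnion₂.1 (ht hz)
      exact mem_iUnion.2 ⟨⟨y, hy⟩, hzy⟩)
  have hχ0 : ∀ (y : t), ∀ z ∉ Metric.ball (y : EuclideanSpace ℝ (Fin n)) (r y / 4), χ y z = 0 :=
    fun y z hz => image_eq_zero_of_notMem_tsupport fun h => hz (hχ y h)
  refine ⟨t, r, fun y z => χ y z * ρ ((c.extend I).symm z), fun y => ?_, fun z hz => ?_⟩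
  · have hyt := hKt (htK y y.2)
    refine ⟨hr0 _ hyt, hrP _ hyt, hrt _ hyt, IsLipBdd.mul ?_ (hrl _ hyt), fun z hz => ?_⟩
    · obtain ⟨C, hC⟩ := ((χ y).contMDiff.contDiff).lipschitzWith_of_hasCompactSupport
        (HasCompactSupport.of_support_subset_isCompact (isCompact_closedBall _ _)
          ((subset_tsupport _).trans ((hχ y).trans Metric.ball_subset_closedBall))) (by simp)
      exact isLipBdd_of_isBounded hC.lipschitzOnWith
        (Metric.isBounded_ball.subset inter_subset_left)
    · simp only [hχ0 y z hz, zero_mul]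
  · rw [← Finset.sum_mul]
    by_cases hzK : z ∈ K
    · rw [← finsum_eq_sum_of_fintype, χ.sum_eq_one hzK, one_mul]
    · rw [image_eq_zero_of_notMem_tsupport (f := ρ) fun h => hzK ⟨_, h, (c.extend I).right_inv hz⟩,
        mul_zero]

variable [CompactSpace M] [T2Space M]

/-- A finite family of small (half-)balls in coordinate systems, with cutoff functions that form a
partition of unity on the manifold, by which integrals and norms of forms are localized. -/
structure FormLocalization (o : ManifoldOrientation I M) (A : GoodCover I M)
    (R : Set (EuclideanSpace ℝ (Fin n))) (ι : Type*) [Fintype ι] where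
  /-- the coordinate systems -/
  chart : ι → OpenPartialHomeomorph M H
  /-- the (half-)balls in the coordinate systems -/
  piece : ι → Set (EuclideanSpace ℝ (Fin n))
  /-- the cutoff functions -/
  cutoff : ι → EuclideanSpace ℝ (Fin n) → ℝ
  /-- functions that are `1` near the supports of the cutoff functions -/
  bump : ι → EuclideanSpace ℝ (Fin n) → ℝ
  /-- the orientations of the coordinate systems -/
  sign : ι → ℝ
  chart_mem : ∀ j, chart j ∈ IsManifold.maximalAtlas I ∞ M
  measurableSet_piece : ∀ j, MeasurableSet (piece j)
  isBounded_piece : ∀ j, Bornology.IsBounded (piece j)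
  piece_subset : ∀ j, piece j ⊆ ((chart j).extend I).target
  piece_subset_domain : ∀ j, piece j ⊆ R
  bump_contDiff : ∀ j, ContDiff ℝ ∞ (bump j)
  hasCompactSupport_bump : ∀ j, HasCompactSupport (bump j)
  tsupport_bump : ∀ j, tsupport (bump j) ∩ R ⊆ piece j
  cutoff_eq_zero : ∀ j, ∀ y ∈ range I, y ∉ piece j → cutoff j y = 0
  bump_eq_one : ∀ j y, cutoff j y ≠ 0 → ∀ᶠ z in 𝓝 y, bump j z = 1
  norm_cutoff_le : ∀ j {m : ℕ} (b : Fin m → Fin n)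
    (N : Set (EuclideanSpace ℝ (Fin n)) → (EuclideanSpace ℝ (Fin n) → ℝ) → ENNReal), IsGauge N →
    ∃ C : ENNReal, C ≠ ⊤ ∧ ∀ γ : Form I M m,
      N R ((piece j).indicator fun y => cutoff j y * γ.component (chart j) b y) ≤ C * A.norm N γ
  norm_bump_le : ∀ j {m : ℕ} (b : Fin m → Fin n)
    (N : Set (EuclideanSpace ℝ (Fin n)) → (EuclideanSpace ℝ (Fin n) → ℝ) → ENNReal), IsGauge N →
    ∃ C : ENNReal, C ≠ ⊤ ∧ ∀ γ : Form I M m,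
      N R ((piece j).indicator fun y => bump j y * γ.component (chart j) b y) ≤ C * A.norm N γ
  norm_pieceForm_le : ∀ j {m : ℕ}
    (N : Set (EuclideanSpace ℝ (Fin n)) → (EuclideanSpace ℝ (Fin n) → ℝ) → ENNReal), IsGauge N →
    ∃ C : ENNReal, C ≠ ⊤ ∧ ∀ w : (Fin m ↪o Fin n) → EuclideanSpace ℝ (Fin n) → ℝ,
      A.norm N (pieceForm I (chart j) (bump j) w : Form I M m) ≤ C * ∑ s, N R (w s)
  sum_cutoff : ∀ x, ∑ j, (chart j).source.indicator (fun x => cutoff j ((chart j).extend I x)) x = 1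
  formIntegral_eq : ∀ η : Form I M n, (∀ j, IntegrableOn (fun y => cutoff j y *
      η (((chart j).extend I).symm y) (coordFrame I (chart j) y)) (piece j)) →
    formIntegral o η = ∑ j, sign j * ∫ y in piece j, cutoff j y *
      η (((chart j).extend I).symm y) (coordFrame I (chart j) y)

/-- Where `g j` is supported the sign factor `f` is the constant `σ j`, so it leaves the integral;
the pieces may overlap since the `g j` add up to `ρ`. -/
theorem integral_target_eq_sum (hI : IsClosed (range I)) {ρ : M → ℝ} {ι : Type*} [Fintype ι]
    {S : ι → Set (EuclideanSpace ℝ (Fin n))} {g : ι → EuclideanSpace ℝ (Fin n) → ℝ}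
    (hSm : ∀ j, MeasurableSet (S j)) (hSt : ∀ j, S j ⊆ (c.extend I).target)
    (hg : ∀ z ∈ (c.extend I).target, ∑ j, g j z = ρ ((c.extend I).symm z))
    (hg0 : ∀ j, ∀ z ∈ range I, z ∉ S j → g j z = 0) {f φ : EuclideanSpace ℝ (Fin n) → ℝ} {σ : ι → ℝ}
    (hf : ∀ j, ∀ z ∈ S j, f z = σ j) (hφ : ∀ j, IntegrableOn (fun y => g j y * φ y) (S j)) :
    ∫ y in (c.extend I).target, ρ ((c.extend I).symm y) * (f y * φ y) =
      ∑ j, σ j * ∫ y in S j, g j y * φ y := by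
  have htm := measurableSet_extend_target hI c
  have h0 : ∀ j, ∀ z ∈ (c.extend I).target \ S j, g j z * (f z * φ z) = 0 := fun j z hz => by
    rw [hg0 j z (c.extend_target_subset_range hz.1) hz.2, zero_mul]
  have hS : ∀ j, EqOn (fun y => σ j * (g j y * φ y)) (fun z => g j z * (f z * φ z)) (S j) :=
    fun j z hz => by
      simp only [hf j z hz]
      ring
  have hint : ∀ j, IntegrableOn (fun z => g j z * (f z * φ z)) (c.extend I).target := fun j =>
    (IntegrableOn.congr_fun ((hφ j).const_mul (σ j)) (hS j) (hSm j)).of_forall_sdiff_eq_zero htm (h0 j)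
  have e1 : ∫ y in (c.extend I).target, ρ ((c.extend I).symm y) * (f y * φ y) =
      ∫ y in (c.extend I).target, ∑ j, g j y * (f y * φ y) :=
    setIntegral_congr_fun htm fun y hy => by
      simp only [← hg y hy, Finset.sum_mul]
  rw [e1, integral_finsetSum _ fun j _ => hint j]
  refine Finset.sum_congr rfl fun j _ => ?_
  rw [setIntegral_eq_of_subset_of_forall_sdiff_eq_zero htm (hSt j) (h0 j),
    ← setIntegral_congr_fun (hSm j) (hS j), integral_const_mul]

/-- The partition of unity chosen in `formIntegral` is refined to balls on which the orientation
sign is constant and both norm comparisons hold. All these properties hold for every small radius,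
so `exists_cutoffs` provides them together. -/
theorem exists_localization (hI : IsClosed (range I)) (hIc : Convex ℝ (range I))
    (o : ManifoldOrientation I M) (A : GoodCover I M) {R : Set (EuclideanSpace ℝ (Fin n))}
    (hRm : MeasurableSet R) (hR : IsLocalRange I M R) :
    ∃ (ι : Type u) (_ : Fintype ι), Nonempty (FormLocalization o A R ι) := by
  set ρ := chartPartition I M
  have hρs : ∀ p, tsupport (ρ p) ⊆ (chartAt H p).source :=
    (SmoothPartitionOfUnity.exists_isSubordinate_chartAt_source I M).choose_spec
  have hfin : {p : M | (Function.support (ρ p)).Nonempty}.Finite :=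
    ρ.locallyFinite.finite_nonempty_of_compact
  set F := hfin.toFinset
  have hmem : ∀ p : M, chartAt H p ∈ IsManifold.maximalAtlas I ∞ M := fun p =>
    IsManifold.chart_mem_maximalAtlas _
  let P : M → EuclideanSpace ℝ (Fin n) → ℝ → Prop := fun p y r =>
    (∃ s : ℝ, ∀ z ∈ Metric.ball y r ∩ range I, frameSign (o.at' (((chartAt H p).extend I).symm z))
      (coordFrame I (chartAt H p) z) = s) ∧
    Metric.ball y r ∩ R = Metric.ball y r ∩ range I ∧
    (∀ g : EuclideanSpace ℝ (Fin n) → ℝ,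
      IsLipBdd g (Metric.ball y r ∩ R) → (∀ z ∉ Metric.ball y (r / 2), g z = 0) →
      ∀ {k : ℕ} (b : Fin k → Fin n)
        (N : Set (EuclideanSpace ℝ (Fin n)) → (EuclideanSpace ℝ (Fin n) → ℝ) → ENNReal),
        IsGauge N → ∃ C : ENNReal, C ≠ ⊤ ∧ ∀ γ : Form I M k,
          N R ((Metric.ball y r ∩ R).indicator fun z => g z * γ.component (chartAt H p) b z) ≤
            C * A.norm N γ) ∧
    ∀ h : EuclideanSpace ℝ (Fin n) → ℝ, IsLipBdd h univ →
      (∀ z ∉ Metric.ball y r, h z = 0) →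
      ∀ {k : ℕ} (N : Set (EuclideanSpace ℝ (Fin n)) → (EuclideanSpace ℝ (Fin n) → ℝ) → ENNReal),
        IsGauge N → ∃ C : ENNReal, C ≠ ⊤ ∧
          ∀ w : (Fin k ↪o Fin n) → EuclideanSpace ℝ (Fin n) → ℝ,
            A.norm N (pieceForm I (chartAt H p) h w : Form I M k) ≤ C * ∑ s, N R (w s)
  have hP : ∀ p, ∀ y ∈ ((chartAt H p).extend I).target, ∀ᶠ r in 𝓝[>] (0 : ℝ), P p y r := by
    intro p y hy
    obtain ⟨s, hs⟩ := eventually_frameSign_eq o (hmem p) hy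
    filter_upwards [eventually_forall_ball hs, hR.eventually_eq _ (hmem p) y hy,
      eventually_norm_piece_le hI hIc hRm hR A (hmem p) hy,
      eventually_norm_pieceForm_le hI hIc hR A (hmem p) hy] with r h1 h2 h3 h4
    exact ⟨⟨s, h1⟩, h2, h3, h4⟩
  choose t r g hg hsum using fun p : M => exists_cutoffs hIc (hmem p) (ρ p).contMDiff (hρs p) (hP p)
  choose hr0 hPr hbt hgl hg0 using hg
  choose sg hsg using fun p y => (hPr p y).1
  have hballR := fun p y => (hPr p y).2.1
  have hpiece := fun p y => (hPr p y).2.2.1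
  have hform := fun p y => (hPr p y).2.2.2
  -- The bump is one on the quarter ball that carries the cutoff, and its outer radius `r / 3` is
  -- below the `r / 2` required by the norm estimate.
  let h : ∀ (p : M) (y : t p), ContDiffBump (y : EuclideanSpace ℝ (Fin n)) := fun p y =>
    ⟨r p y / 4, r p y / 3, by linarith [hr0 p y], by linarith [hr0 p y]⟩
  have hh0 : ∀ (p : M) (y : t p), ∀ z ∉ Metric.ball (y : EuclideanSpace ℝ (Fin n)) (r p y / 2),
      h p y z = 0 := fun p y z hz => by
    refine (h p y).zero_of_le_dist ?_
    change r p y / 3 ≤ _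
    rw [Metric.mem_ball, not_lt] at hz
    linarith [hr0 p y]
  have hhl : ∀ (p : M) (y : t p), IsLipBdd (h p y) univ := fun p y => by
    obtain ⟨C, hC⟩ := (h p y).contDiff (n := ⊤) |>.lipschitzWith_of_hasCompactSupport
      (h p y).hasCompactSupport (by simp)
    refine ⟨⟨C, hC.lipschitzOnWith⟩, 1, fun x _ => ?_⟩
    rw [Real.norm_eq_abs, abs_of_nonneg (h p y).nonneg]
    exact (h p y).le_one
  refine ⟨Σ p : F, t p, inferInstance, ⟨{
    chart := fun j => chartAt H (j.1 : M)
    piece := fun j => Metric.ball (j.2 : EuclideanSpace ℝ (Fin n)) (r j.1 j.2) ∩ R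
    cutoff := fun j => g j.1 j.2
    bump := fun j => h j.1 j.2
    sign := fun j => sg j.1 j.2
    chart_mem := fun j => hmem _
    measurableSet_piece := fun j => measurableSet_ball.inter hRm
    isBounded_piece := fun j => Metric.isBounded_ball.subset inter_subset_left
    piece_subset := fun j => by rw [hballR]; exact hbt _ _
    piece_subset_domain := fun j => inter_subset_right
    bump_contDiff := fun j => (h j.1 j.2).contDiff
    hasCompactSupport_bump := fun j => (h j.1 j.2).hasCompactSupport
    tsupport_bump := fun j => by
      rw [(h j.1 j.2).tsupport_eq]
      refine inter_subset_inter_left _ (Metric.closedBall_subset_ball ?_)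
      change r j.1 j.2 / 3 < _
      linarith [hr0 j.1 j.2]
    cutoff_eq_zero := fun j y hy hyp => by
      refine hg0 _ _ _ fun hb => hyp ⟨Metric.ball_subset_ball ?_ hb, hR.range_subset hy⟩
      linarith [hr0 j.1 j.2]
    bump_eq_one := fun j y hy => by
      have hyb : y ∈ Metric.ball (j.2 : EuclideanSpace ℝ (Fin n)) (r j.1 j.2 / 4) := by
        by_contra hb
        exact hy (hg0 _ _ _ hb)
      exact (h j.1 j.2).eventuallyEq_one_of_mem_ball hyb
    norm_cutoff_le := fun j _ b N hN => hpiece j.1 j.2 _ (by rw [hballR]; exact hgl _ _)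
      (fun z hz => hg0 _ _ _ fun hb => hz (Metric.ball_subset_ball (by linarith [hr0 j.1 j.2]) hb))
      b N hN
    norm_bump_le := fun j _ b N hN => hpiece j.1 j.2 _ ((hhl _ _).mono (subset_univ _))
      (hh0 _ _) b N hN
    norm_pieceForm_le := fun j _ N hN => hform j.1 j.2 _ (hhl _ _)
      (fun z hz => hh0 _ _ z fun hb => hz (Metric.ball_subset_ball (by linarith [hr0 j.1 j.2]) hb))
      N hN
    sum_cutoff := fun x => ?_
    formIntegral_eq := fun η hη => ?_ }⟩⟩
  · rw [Fintype.sum_sigma]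
    have e : ∀ p : M, ∑ y : t p, (chartAt H p).source.indicator
        (fun x => g p y ((chartAt H p).extend I x)) x = ρ p x := by
      intro p
      by_cases hx : x ∈ (chartAt H p).source
      · have hx' : x ∈ ((chartAt H p).extend I).source := by
          rwa [(chartAt H p).extend_source]
        simp only [indicator_of_mem hx]
        rw [hsum p _ (((chartAt H p).extend I).map_source hx'),
          ((chartAt H p).extend I).left_inv hx']
      · simp only [indicator_of_notMem hx, Finset.sum_const_zero]
        exact (image_eq_zero_of_notMem_tsupport fun h => hx (hρs p h)).symm
    simp only [e]
    rw [Finset.sum_coe_sort F fun p => ρ p x, ← finsum_eq_sum_of_support_subset,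
      ρ.sum_eq_one (mem_univ x)]
    intro p hp
    exact hfin.mem_toFinset.2 ⟨x, hp⟩
  · rw [Fintype.sum_sigma]
    unfold formIntegral
    rw [finsum_eq_sum_of_support_subset (s := F), ← Finset.sum_coe_sort F]
    · refine Finset.sum_congr rfl fun p _ => ?_
      refine integral_target_eq_sum (c := chartAt H (p : M)) hI (ρ := ρ p)
        (S := fun y : t p => Metric.ball (y : EuclideanSpace ℝ (Fin n)) (r p y) ∩ R)
        (fun y => measurableSet_ball.inter hRm) (fun y => by rw [hballR]; exact hbt _ _) (hsum p)
        (fun y z hz hzp => hg0 _ _ _ fun hb =>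
          hzp ⟨Metric.ball_subset_ball (by linarith [hr0 p y]) hb, hR.range_subset hz⟩)
        (fun y z hz => hsg p y z (by rwa [hballR] at hz)) fun y => hη ⟨p, y⟩
    · intro p hp
      refine hfin.mem_toFinset.2 ?_
      by_contra hne
      refine hp (integral_eq_zero_of_ae (Eventually.of_forall fun y => ?_))
      have : ρ p ((extChartAt I p).symm y) = 0 := by
        by_contra h0
        exact hne ⟨_, h0⟩
      simp only [ρ] at this
      simp only [this, zero_mul, Pi.zero_apply]

end FormLocalization

end DistJacobian

namespace DistJacobian

/-! ### The integral in terms of local pieces -/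

section Lipschitz

variable {n k : ℕ} {R : Set (EuclideanSpace ℝ (Fin n))}

theorem ae_abs_pd_le (hR : IsClosed R) (hRc : Convex ℝ R) {f : EuclideanSpace ℝ (Fin n) → ℝ}
    (hf : holderNorm 1 R f < ⊤) :
    ∀ᵐ x ∂(volume.restrict R), ∀ j, |pd j f x| ≤ (holderNorm 1 R f).toNNReal := by
  have h1 : ∀ᵐ x ∂(volume : Measure (EuclideanSpace ℝ (Fin n))), x ∉ frontier R :=
    measure_eq_zero_iff_ae_notMem.1 (hRc.addHaar_frontier _)
  rw [ae_restrict_iff' hR.measurableSet]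
  filter_upwards [h1] with x hx hxR j
  have hint : R ∈ 𝓝 x := by
    rw [← mem_interior_iff_mem_nhds]
    by_contra h
    exact hx ⟨subset_closure hxR, h⟩
  have h2 := norm_fderiv_le_of_lipschitzOn ℝ hint (LipschitzOnWith.of_holderNorm hf)
  have h3 := (fderiv ℝ f x).le_of_opNorm_le h2 (EuclideanSpace.single j 1)
  simpa [pd] using h3

theorem measurable_jac (c : Fin k → Fin n) (u : Fin k → EuclideanSpace ℝ (Fin n) → ℝ) :
    Measurable (jac c u) := by
  have e : jac c u = fun x => ∑ σ : Equiv.Perm (Fin k), ((Equiv.Perm.sign σ : ℤ) : ℝ) *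
      ∏ i, pd (c (σ i)) (u i) x := funext fun x => jac_eq_sum c u x
  rw [e]
  refine Finset.measurable_sum _ fun σ _ => Measurable.const_mul ?_ _
  exact Finset.measurable_prod _ fun i _ => measurable_fderiv_apply_const ℝ (u i) _

theorem integrableOn_mul_jac (hR : IsClosed R) (hRc : Convex ℝ R) (c : Fin k → Fin n)
    {f : EuclideanSpace ℝ (Fin n) → ℝ} (hf : IntegrableOn f R)
    {u : Fin k → EuclideanSpace ℝ (Fin n) → ℝ} (hu : ∀ i, holderNorm 1 R (u i) < ⊤) :
    IntegrableOn (fun x => f x * jac c u x) R := by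
  refine Integrable.mul_bdd (c := k.factorial * (∑ i, ((holderNorm 1 R (u i)).toNNReal : ℝ)) ^ k) hf
    (measurable_jac c u).aestronglyMeasurable ?_
  filter_upwards [ae_all_iff.2 fun i => ae_abs_pd_le hR hRc (hu i)] with x hx
  refine abs_jac_le c fun i j => (hx i j).trans ?_
  exact Finset.single_le_sum (f := fun i => ((holderNorm 1 R (u i)).toNNReal : ℝ))
    (fun _ _ => NNReal.coe_nonneg _) (Finset.mem_univ i)

end Lipschitz

section Representation

variable {n : ℕ} {H : Type*} [TopologicalSpace H]
  {I : ModelWithCorners ℝ (EuclideanSpace ℝ (Fin n)) H}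
  {M : Type*} [TopologicalSpace M] [ChartedSpace H M] [IsManifold I ∞ M]
  [CompactSpace M] [T2Space M] {o : ManifoldOrientation I M} {A : GoodCover I M}
  {R : Set (EuclideanSpace ℝ (Fin n))} {ι : Type*} [Fintype ι]

/-- The localized components of a form. -/
noncomputable def FormLocalization.cut (F : FormLocalization o A R ι) {m : ℕ} (j : ι)
    (b : Fin m → Fin n) (γ : Form I M m) : EuclideanSpace ℝ (Fin n) → ℝ :=
  (F.piece j).indicator fun y => F.cutoff j y * γ.component (F.chart j) b y

/-- The components of a form, localized to slightly larger sets. -/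
noncomputable def FormLocalization.wideCut (F : FormLocalization o A R ι) {m : ℕ} (j : ι)
    (b : Fin m → Fin n) (γ : Form I M m) : EuclideanSpace ℝ (Fin n) → ℝ :=
  (F.piece j).indicator fun y => F.bump j y * γ.component (F.chart j) b y

theorem FormLocalization.cut_sub (F : FormLocalization o A R ι) {m : ℕ} (j : ι)
    (b : Fin m → Fin n) (γ γ' : Form I M m) :
    F.cut j b (γ - γ') = F.cut j b γ - F.cut j b γ' := by
  unfold FormLocalization.cut
  rw [← indicator_sub']
  congr 1
  ext y
  exact mul_sub _ _ _

theorem FormLocalization.wideCut_sub (F : FormLocalization o A R ι) {m : ℕ} (j : ι)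
    (b : Fin m → Fin n) (γ γ' : Form I M m) :
    F.wideCut j b (γ - γ') = F.wideCut j b γ - F.wideCut j b γ' := by
  unfold FormLocalization.wideCut
  rw [← indicator_sub']
  congr 1
  ext y
  exact mul_sub _ _ _

variable {k ℓ : ℕ} {d : Fin k → ℕ} (hdeg : ℓ + ∑ i, (d i + 1) = n)

/-- Where the cutoff is nonzero the bump is one nearby, so the localized and the true components of
`γ i` have the same derivatives; elsewhere both sides vanish. The cutoff multiplies only `lam` and
is never differentiated. -/
theorem FormLocalization.cutoff_mul_wedgeD (F : FormLocalization o A R ι) (hIR : range I ⊆ R)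
    (lam : Form I M ℓ)
    (γ : ∀ i, Form I M (d i)) {j : ι} {y : EuclideanSpace ℝ (Fin n)} (hy : y ∈ F.piece j)
    (hint : y ∈ interior (range I))
    (hγ : ∀ i b, DifferentiableAt ℝ (F.wideCut j b (γ i)) y) :
    F.cutoff j y * wedgeD hdeg lam γ (((F.chart j).extend I).symm y) (coordFrame I (F.chart j) y) =
      ∑ J : ∀ i, Fin (d i + 1), ∑ σ : Equiv.Perm (Fin n), wedgeWeight ℓ J σ *
        (F.cut j (wedgeIndexZero hdeg σ) lam y * jac (wedgeDirection hdeg J σ)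
          (fun i => F.wideCut j (wedgeIndex hdeg J σ i) (γ i)) y) := by
  by_cases h0 : F.cutoff j y = 0
  · have hc : ∀ b : Fin ℓ → Fin n, F.cut j b lam y = 0 := fun b => by
      rw [FormLocalization.cut, indicator_of_mem hy, h0, zero_mul]
    simp [h0, hc]
  have heq : ∀ i (b : Fin (d i) → Fin n),
      F.wideCut j b (γ i) =ᶠ[𝓝 y] (γ i).component (F.chart j) b := by
    intro i b
    filter_upwards [F.bump_eq_one j y h0, mem_interior_iff_mem_nhds.1 hint] with z hz hzI
    have hzp : z ∈ F.piece j :=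
      F.tsupport_bump j ⟨subset_tsupport _ (by simp [hz]), hIR hzI⟩
    rw [FormLocalization.wideCut, indicator_of_mem hzp, hz, one_mul]
  have hdiff : ∀ i, DifferentiableAt ℝ ((γ i).inChart (F.chart j)) y := by
    intro i
    have e : (γ i).inChart (F.chart j) = fun z => ∑ s : Fin (d i) ↪o Fin n,
        (γ i).component (F.chart j) s z • dualFamily n (d i) s :=
      funext fun z => (sum_smul_dualFamily _).symm
    rw [e]
    refine DifferentiableAt.fun_sum fun s _ => DifferentiableAt.smul_const ?_ _
    exact (hγ i s).congr_of_eventuallyEq (heq i s).symm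
  rw [wedgeD_coordFrame hdeg lam γ (F.chart_mem j) (F.piece_subset j hy) hint hdiff, Finset.mul_sum]
  refine Finset.sum_congr rfl fun J _ => ?_
  rw [Finset.mul_sum]
  refine Finset.sum_congr rfl fun σ _ => ?_
  have hj : jac (wedgeDirection hdeg J σ)
      (fun i => F.wideCut j (wedgeIndex hdeg J σ i) (γ i)) y = jac (wedgeDirection hdeg J σ)
        (fun i => (γ i).component (F.chart j) (wedgeIndex hdeg J σ i)) y := by
    unfold jac pd
    congr 2
    ext i l
    rw [(heq i _).fderiv_eq]
  rw [hj, FormLocalization.cut, indicator_of_mem hy]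
  ring

/-- The integral of `lam ∧ dγ_1 ∧ ⋯ ∧ dγ_k` in terms of the localized components. -/
theorem FormLocalization.formIntegral_wedgeD (F : FormLocalization o A R ι)
    (hIc : Convex ℝ (range I)) (hIR : range I ⊆ R)
    (hR : IsClosed R) (hRc : Convex ℝ R) (lam : Form I M ℓ) (γ : ∀ i, Form I M (d i))
    (hlam : ∀ j (b : Fin ℓ → Fin n), IntegrableOn (F.cut j b lam) R)
    (hγ : ∀ i j b, holderNorm 1 R (F.wideCut j b (γ i)) < ⊤) :
    formIntegral o (wedgeD hdeg lam γ) = ∑ j, F.sign j *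
      ∑ J : ∀ i, Fin (d i + 1), ∑ σ : Equiv.Perm (Fin n), wedgeWeight ℓ J σ *
        ∫ y in R, F.cut j (wedgeIndexZero hdeg σ) lam y * jac (wedgeDirection hdeg J σ)
          (fun i => F.wideCut j (wedgeIndex hdeg J σ i) (γ i)) y := by
  have hint : ∀ j J σ, IntegrableOn (fun y => wedgeWeight ℓ J σ *
      (F.cut j (wedgeIndexZero hdeg σ) lam y * jac (wedgeDirection hdeg J σ)
          (fun i => F.wideCut j (wedgeIndex hdeg J σ i) (γ i)) y)) R := fun j J σ =>
    (integrableOn_mul_jac hR hRc _ (hlam j _) fun i => hγ i j _).const_mul _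
  have hae : ∀ j, (fun y => F.cutoff j y * wedgeD hdeg lam γ (((F.chart j).extend I).symm y)
      (coordFrame I (F.chart j) y)) =ᵐ[volume.restrict (F.piece j)] fun y =>
      ∑ J : ∀ i, Fin (d i + 1), ∑ σ : Equiv.Perm (Fin n), wedgeWeight ℓ J σ *
        (F.cut j (wedgeIndexZero hdeg σ) lam y * jac (wedgeDirection hdeg J σ)
          (fun i => F.wideCut j (wedgeIndex hdeg J σ i) (γ i)) y) := by
    intro j
    have h1 : ∀ᵐ x ∂(volume : Measure (EuclideanSpace ℝ (Fin n))), x ∉ frontier (range I) :=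
      measure_eq_zero_iff_ae_notMem.1 (hIc.addHaar_frontier _)
    have h2 : ∀ᵐ x ∂(volume.restrict (F.piece j)), ∀ i b,
        DifferentiableAt ℝ (F.wideCut j b (γ i)) x :=
      ae_restrict_of_ae_restrict_of_subset (F.piece_subset_domain j) (ae_all_iff.2 fun i =>
        ae_all_iff.2 fun b => ae_differentiableAt_of_lipschitzOnWith hR hRc
          (LipschitzOnWith.of_holderNorm (hγ i j b)))
    filter_upwards [ae_restrict_of_ae h1, h2, ae_restrict_mem (F.measurableSet_piece j)]
      with y hy1 hy2 hy3
    refine F.cutoff_mul_wedgeD hdeg hIR lam γ hy3 ?_ hy2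
    by_contra h
    exact hy1 ⟨subset_closure ((F.chart j).extend_target_subset_range (F.piece_subset j hy3)), h⟩
  have hsum : ∀ j, IntegrableOn (fun y =>
      ∑ J : ∀ i, Fin (d i + 1), ∑ σ : Equiv.Perm (Fin n), wedgeWeight ℓ J σ *
        (F.cut j (wedgeIndexZero hdeg σ) lam y * jac (wedgeDirection hdeg J σ)
          (fun i => F.wideCut j (wedgeIndex hdeg J σ i) (γ i)) y)) R := fun j =>
    integrable_finsetSum _ fun J _ => integrable_finsetSum _ fun σ _ => hint j J σ
  rw [F.formIntegral_eq _ fun j =>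
    ((hsum j).mono_set (F.piece_subset_domain j)).congr (hae j).symm]
  refine Finset.sum_congr rfl fun j _ => ?_
  rw [integral_congr_ae (hae j), ← setIntegral_eq_of_subset_of_forall_sdiff_eq_zero
    hR.measurableSet (F.piece_subset_domain j), integral_finsetSum _ fun J _ =>
    integrable_finsetSum _ fun σ _ => hint j J σ]
  · congr 1
    refine Finset.sum_congr rfl fun J _ => ?_
    rw [integral_finsetSum _ fun σ _ => hint j J σ]
    exact Finset.sum_congr rfl fun σ _ => integral_const_mul _ _
  · intro y hy
    refine Finset.sum_eq_zero fun J _ => Finset.sum_eq_zero fun σ _ => ?_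
    rw [FormLocalization.cut, indicator_of_notMem hy.2, zero_mul, mul_zero]

end Representation

end DistJacobian

namespace DistJacobian

/-! ### Multilinear estimates for the integral -/

section Norm

variable {n : ℕ} {H : Type*} [TopologicalSpace H]
  {I : ModelWithCorners ℝ (EuclideanSpace ℝ (Fin n)) H}
  {M : Type*} [TopologicalSpace M] [ChartedSpace H M]
  {N : Set (EuclideanSpace ℝ (Fin n)) → (EuclideanSpace ℝ (Fin n) → ℝ) → ENNReal}

theorem GoodCover.norm_add_le (A : GoodCover I M) (hN : IsGauge N) {m : ℕ} (γ γ' : Form I M m) :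
    A.norm N (γ + γ') ≤ A.norm N γ + A.norm N γ' := by
  unfold GoodCover.norm
  simp only [← Finset.sum_add_distrib]
  exact Finset.sum_le_sum fun i _ => Finset.sum_le_sum fun s _ => hN.add _ _ _

theorem GoodCover.norm_neg (A : GoodCover I M) (hN : IsGauge N) {m : ℕ} (γ : Form I M m) :
    A.norm N (-γ) = A.norm N γ :=
  Finset.sum_congr rfl fun _ _ => Finset.sum_congr rfl fun _ _ => hN.neg _ _

theorem GoodCover.norm_zero (A : GoodCover I M) (hN : IsGauge N) {m : ℕ} :
    A.norm N (0 : Form I M m) = 0 :=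
  Finset.sum_eq_zero fun _ _ => Finset.sum_eq_zero fun _ _ => hN.zero _

theorem GoodCover.norm_sub_le (A : GoodCover I M) (hN : IsGauge N) {m : ℕ} (γ γ' : Form I M m) :
    A.norm N (γ - γ') ≤ A.norm N γ + A.norm N γ' := by
  rw [sub_eq_add_neg, ← A.norm_neg hN γ']
  exact A.norm_add_le hN _ _

theorem GoodCover.norm_sum_le (A : GoodCover I M) (hN : IsGauge N) {m : ℕ} {ι : Type*}
    (S : Finset ι) (γ : ι → Form I M m) : A.norm N (∑ i ∈ S, γ i) ≤ ∑ i ∈ S, A.norm N (γ i) := by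
  classical
  induction S using Finset.induction_on with
  | empty => simp [A.norm_zero hN]
  | insert a S ha ih =>
    rw [Finset.sum_insert ha, Finset.sum_insert ha]
    exact (A.norm_add_le hN _ _).trans (by gcongr)

end Norm

/-- The norms `N` satisfy the multilinear estimate for the integrals of Jacobians over `R`. -/
structure IsIntegralBound {n k : ℕ} (R : Set (EuclideanSpace ℝ (Fin n)))
    (N : Fin (k + 1) → Set (EuclideanSpace ℝ (Fin n)) → (EuclideanSpace ℝ (Fin n) → ℝ) → ENNReal) :
    Prop where
  gauge : ∀ s, IsGauge (N s)
  integrableOn : ∀ (f : EuclideanSpace ℝ (Fin n) → ℝ) (ρ : ℝ), (∀ x, ρ < ‖x‖ → f x = 0) →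
    (∀ x ∉ R, f x = 0) → N 0 R f < ⊤ → IntegrableOn f R
  bound : ∀ (c : Fin k → Fin n) (ρ : ℝ), ∃ C : ENNReal, C ≠ ⊤ ∧
    ∀ u : Fin (k + 1) → EuclideanSpace ℝ (Fin n) → ℝ,
      (∀ s x, ρ < ‖x‖ → u s x = 0) → (∀ s, ∀ x ∉ R, u s x = 0) →
      (∀ s, N s R (u s) < ⊤) → (∀ i : Fin k, holderNorm 1 R (u i.succ) < ⊤) →
      ‖∫ x in R, u 0 x * jac c (fun i => u i.succ) x‖ₑ ≤ C * ∏ s, N s R (u s)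

section Estimates

variable {n : ℕ} {H : Type*} [TopologicalSpace H]
  {I : ModelWithCorners ℝ (EuclideanSpace ℝ (Fin n)) H}
  {M : Type*} [TopologicalSpace M] [ChartedSpace H M] [IsManifold I ∞ M]
  [CompactSpace M] [T2Space M] {o : ManifoldOrientation I M} {A : GoodCover I M}
  {R : Set (EuclideanSpace ℝ (Fin n))} {ι : Type*} [Fintype ι]

theorem FormLocalization.exists_forall_norm_cut_le (F : FormLocalization o A R ι) (m : ℕ)
    {N : Set (EuclideanSpace ℝ (Fin n)) → (EuclideanSpace ℝ (Fin n) → ℝ) → ENNReal}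
    (hN : IsGauge N) : ∃ C : ENNReal, C ≠ ⊤ ∧ ∀ j (b : Fin m → Fin n) (γ : Form I M m),
      N R (F.cut j b γ) ≤ C * A.norm N γ ∧ N R (F.wideCut j b γ) ≤ C * A.norm N γ := by
  choose C hC hCγ using fun j (b : Fin m → Fin n) => F.norm_cutoff_le j b N hN
  choose C' hC' hCγ' using fun j (b : Fin m → Fin n) => F.norm_bump_le j b N hN
  refine ⟨∑ j, ∑ b, (C j b + C' j b), ENNReal.sum_ne_top.2 fun j _ => ENNReal.sum_ne_top.2 fun b _ =>
    ENNReal.add_ne_top.2 ⟨hC j b, hC' j b⟩, fun j b γ => ?_⟩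
  have h : C j b + C' j b ≤ ∑ j, ∑ b, (C j b + C' j b) :=
    (Finset.single_le_sum (f := fun b => C j b + C' j b) (fun _ _ => zero_le)
      (Finset.mem_univ b)).trans (Finset.single_le_sum (f := fun j => ∑ b, (C j b + C' j b))
        (fun _ _ => zero_le) (Finset.mem_univ j))
  exact ⟨(hCγ j b γ).trans (by gcongr; exact le_self_add.trans h),
    (hCγ' j b γ).trans (by gcongr; exact le_add_self.trans h)⟩

theorem FormLocalization.wideCut_lt_top (F : FormLocalization o A R ι) {m : ℕ}
    {N : Set (EuclideanSpace ℝ (Fin n)) → (EuclideanSpace ℝ (Fin n) → ℝ) → ENNReal}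
    (hN : IsGauge N) {γ : Form I M m} (hγ : A.norm N γ < ⊤) (j : ι) (b : Fin m → Fin n) :
    N R (F.wideCut j b γ) < ⊤ := by
  obtain ⟨C, hC, h⟩ := F.exists_forall_norm_cut_le m hN
  exact (h j b γ).2.trans_lt (ENNReal.mul_lt_top hC.lt_top hγ)

theorem FormLocalization.cut_lt_top (F : FormLocalization o A R ι) {m : ℕ}
    {N : Set (EuclideanSpace ℝ (Fin n)) → (EuclideanSpace ℝ (Fin n) → ℝ) → ENNReal}
    (hN : IsGauge N) {γ : Form I M m} (hγ : A.norm N γ < ⊤) (j : ι) (b : Fin m → Fin n) :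
    N R (F.cut j b γ) < ⊤ := by
  obtain ⟨C, hC, h⟩ := F.exists_forall_norm_cut_le m hN
  exact (h j b γ).1.trans_lt (ENNReal.mul_lt_top hC.lt_top hγ)

theorem FormLocalization.exists_radius (F : FormLocalization o A R ι) :
    ∃ ρ : ℝ, ∀ j x, ρ < ‖x‖ → x ∉ F.piece j := by
  choose ρ hρ using fun j => (F.isBounded_piece j).exists_norm_le
  refine ⟨∑ j, |ρ j|, fun j x hx hxj => ?_⟩
  have h1 := hρ j x hxj
  have h2 := Finset.single_le_sum (f := fun j => |ρ j|) (fun _ _ => abs_nonneg _) (Finset.mem_univ j)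
  have h3 := le_abs_self (ρ j)
  linarith

theorem FormLocalization.cut_eq_zero (F : FormLocalization o A R ι) {m : ℕ} (j : ι)
    (b : Fin m → Fin n) (γ : Form I M m) {x : EuclideanSpace ℝ (Fin n)} (hx : x ∉ R) :
    F.cut j b γ x = 0 :=
  indicator_of_notMem (fun h => hx (F.piece_subset_domain j h)) _

theorem FormLocalization.wideCut_eq_zero (F : FormLocalization o A R ι) {m : ℕ} (j : ι)
    (b : Fin m → Fin n) (γ : Form I M m) {x : EuclideanSpace ℝ (Fin n)} (hx : x ∉ R) :
    F.wideCut j b γ x = 0 :=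
  indicator_of_notMem (fun h => hx (F.piece_subset_domain j h)) _

variable {k ℓ : ℕ} {d : Fin k → ℕ} (hdeg : ℓ + ∑ i, (d i + 1) = n)
  {N : Fin (k + 1) → Set (EuclideanSpace ℝ (Fin n)) → (EuclideanSpace ℝ (Fin n) → ℝ) → ENNReal}

theorem FormLocalization.integrableOn_cut (F : FormLocalization o A R ι)
    (hN : IsIntegralBound R N) {lam : Form I M ℓ} (hlam : A.norm (N 0) lam < ⊤) (j : ι)
    (b : Fin ℓ → Fin n) : IntegrableOn (F.cut j b lam) R := by
  obtain ⟨ρ, hρ⟩ := F.exists_radius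
  exact hN.integrableOn _ ρ (fun x hx => indicator_of_notMem (hρ j x hx) _)
    (fun x hx => F.cut_eq_zero j b lam hx) (F.cut_lt_top (hN.gauge 0) hlam j b)

/-- The multilinear bound for `∫ lam ∧ dγ_1 ∧ ⋯ ∧ dγ_k`. -/
theorem FormLocalization.exists_enorm_formIntegral_le (F : FormLocalization o A R ι)
    (hIc : Convex ℝ (range I)) (hIR : range I ⊆ R) (hR : IsClosed R) (hRc : Convex ℝ R)
    (hN : IsIntegralBound R N) : ∃ C : ENNReal, C ≠ ⊤ ∧
      ∀ (lam : Form I M ℓ) (γ : ∀ i, Form I M (d i)), A.norm (N 0) lam < ⊤ →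
        (∀ i, A.norm (N i.succ) (γ i) < ⊤) → (∀ i, A.norm (holderNorm 1) (γ i) < ⊤) →
        ‖formIntegral o (wedgeD hdeg lam γ)‖ₑ ≤
          C * (A.norm (N 0) lam * ∏ i, A.norm (N i.succ) (γ i)) := by
  obtain ⟨ρ, hρ⟩ := F.exists_radius
  choose B hB hBu using fun c : Fin k → Fin n => hN.bound c ρ
  obtain ⟨C0, hC0, hC0l⟩ := F.exists_forall_norm_cut_le ℓ (hN.gauge 0)
  choose C hC hCγ using fun i => F.exists_forall_norm_cut_le (d i) (hN.gauge (Fin.succ i))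
  refine ⟨∑ j, ‖F.sign j‖ₑ * ∑ J : ∀ i, Fin (d i + 1), ∑ σ : Equiv.Perm (Fin n),
    ‖wedgeWeight ℓ J σ‖ₑ * (B (wedgeDirection hdeg J σ) * (C0 * ∏ i, C i)), ?_,
    fun lam γ hlam hγ hγ1 => ?_⟩
  · refine ENNReal.sum_ne_top.2 fun j _ => ENNReal.mul_ne_top enorm_ne_top <|
      ENNReal.sum_ne_top.2 fun J _ => ENNReal.sum_ne_top.2 fun σ _ =>
      ENNReal.mul_ne_top enorm_ne_top (ENNReal.mul_ne_top (hB _)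
        (ENNReal.mul_ne_top hC0 (ENNReal.prod_ne_top fun i _ => hC i)))
  · rw [F.formIntegral_wedgeD hdeg hIc hIR hR hRc lam γ (F.integrableOn_cut hN hlam)
      fun i j b => F.wideCut_lt_top (isGauge_holderNorm le_rfl) (hγ1 i) j b, Finset.sum_mul]
    refine (enorm_sum_le _ _).trans (Finset.sum_le_sum fun j _ => ?_)
    rw [enorm_mul, mul_assoc, Finset.sum_mul]
    gcongr
    refine (enorm_sum_le _ _).trans (Finset.sum_le_sum fun J _ => ?_)
    rw [Finset.sum_mul]
    refine (enorm_sum_le _ _).trans (Finset.sum_le_sum fun σ _ => ?_)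
    rw [enorm_mul, mul_assoc, mul_assoc]
    gcongr
    set u : Fin (k + 1) → EuclideanSpace ℝ (Fin n) → ℝ :=
      Fin.cons (F.cut j (wedgeIndexZero hdeg σ) lam)
        (fun i => F.wideCut j (wedgeIndex hdeg J σ i) (γ i))
    have h1 : ∀ s x, ρ < ‖x‖ → u s x = 0 := by
      intro s x hx
      refine Fin.cases ?_ (fun i => ?_) s
      · change F.cut j (wedgeIndexZero hdeg σ) lam x = 0
        exact indicator_of_notMem (hρ j x hx) _
      · change F.wideCut j (wedgeIndex hdeg J σ i) (γ i) x = 0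
        exact indicator_of_notMem (hρ j x hx) _
    have h2 : ∀ s, ∀ x ∉ R, u s x = 0 := by
      intro s x hx
      refine Fin.cases ?_ (fun i => ?_) s
      · exact F.cut_eq_zero j _ _ hx
      · exact F.wideCut_eq_zero j _ _ hx
    have h3 : ∀ s, N s R (u s) < ⊤ := by
      intro s
      refine Fin.cases ?_ (fun i => ?_) s
      · exact F.cut_lt_top (hN.gauge 0) hlam j _
      · exact F.wideCut_lt_top (hN.gauge i.succ) (hγ i) j _
    have h4 : ∀ i : Fin k, holderNorm 1 R (u i.succ) < ⊤ := fun i =>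
      F.wideCut_lt_top (isGauge_holderNorm le_rfl) (hγ1 i) j _
    refine (hBu (wedgeDirection hdeg J σ) u h1 h2 h3 h4).trans ?_
    gcongr
    rw [Fin.prod_univ_succ]
    calc N 0 R (u 0) * ∏ i : Fin k, N i.succ R (u i.succ)
        ≤ (C0 * A.norm (N 0) lam) * ∏ i : Fin k, (C i * A.norm (N i.succ) (γ i)) :=
          mul_le_mul' (hC0l j _ lam).1 (Finset.prod_le_prod' fun i _ => (hCγ i j _ (γ i)).2)
      _ = _ := by rw [Finset.prod_mul_distrib]; ring

/-- Integrals of arbitrary forms need not be additive; here additivity is read off the local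
representation, whose integrands are integrable. -/
theorem FormLocalization.formIntegral_wedgeD_sub_left (F : FormLocalization o A R ι)
    (hIc : Convex ℝ (range I)) (hIR : range I ⊆ R) (hR : IsClosed R) (hRc : Convex ℝ R)
    (hN : IsIntegralBound R N) {lam lam' : Form I M ℓ} {γ : ∀ i, Form I M (d i)}
    (hlam : A.norm (N 0) lam < ⊤) (hlam' : A.norm (N 0) lam' < ⊤)
    (hγ1 : ∀ i, A.norm (holderNorm 1) (γ i) < ⊤) :
    formIntegral o (wedgeD hdeg lam γ) - formIntegral o (wedgeD hdeg lam' γ) =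
      formIntegral o (wedgeD hdeg (lam - lam') γ) := by
  have hw : ∀ i j b, holderNorm 1 R (F.wideCut j b (γ i)) < ⊤ := fun i j b =>
    F.wideCut_lt_top (isGauge_holderNorm le_rfl) (hγ1 i) j b
  have hsub : A.norm (N 0) (lam - lam') < ⊤ :=
    (A.norm_sub_le (hN.gauge 0) _ _).trans_lt (ENNReal.add_lt_top.2 ⟨hlam, hlam'⟩)
  rw [F.formIntegral_wedgeD hdeg hIc hIR hR hRc lam γ (F.integrableOn_cut hN hlam) hw,
    F.formIntegral_wedgeD hdeg hIc hIR hR hRc lam' γ (F.integrableOn_cut hN hlam') hw,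
    F.formIntegral_wedgeD hdeg hIc hIR hR hRc _ γ (F.integrableOn_cut hN hsub) hw]
  simp only [← Finset.sum_sub_distrib, ← mul_sub]
  refine Finset.sum_congr rfl fun j _ => ?_
  congr 1
  refine Finset.sum_congr rfl fun J _ => Finset.sum_congr rfl fun σ _ => ?_
  congr 1
  rw [← integral_sub]
  · simp only [F.cut_sub, Pi.sub_apply, sub_mul]
  · exact integrableOn_mul_jac hR hRc _ (F.integrableOn_cut hN hlam j _) fun i => hw i j _
  · exact integrableOn_mul_jac hR hRc _ (F.integrableOn_cut hN hlam' j _) fun i => hw i j _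

/-- The exterior derivative is additive where the components are differentiable, which for Lipschitz
pieces is almost everywhere. -/
theorem FormLocalization.formIntegral_wedgeD_update_sub (F : FormLocalization o A R ι)
    (hIc : Convex ℝ (range I)) (hIR : range I ⊆ R) (hR : IsClosed R) (hRc : Convex ℝ R)
    (hN : IsIntegralBound R N) {lam : Form I M ℓ} {γ : ∀ i, Form I M (d i)} (i : Fin k)
    {γ₁ γ₂ : Form I M (d i)} (hlam : A.norm (N 0) lam < ⊤)
    (hγ1 : ∀ i, A.norm (holderNorm 1) (γ i) < ⊤)
    (h1 : A.norm (holderNorm 1) γ₁ < ⊤) (h2 : A.norm (holderNorm 1) γ₂ < ⊤) :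
    formIntegral o (wedgeD hdeg lam (Function.update γ i γ₁)) -
        formIntegral o (wedgeD hdeg lam (Function.update γ i γ₂)) =
      formIntegral o (wedgeD hdeg lam (Function.update γ i (γ₁ - γ₂))) := by
  have hg : IsGauge (holderNorm (n := n) 1) := isGauge_holderNorm le_rfl
  have hw : ∀ η : Form I M (d i), A.norm (holderNorm 1) η < ⊤ → ∀ i' j b,
      holderNorm 1 R (F.wideCut j b (Function.update γ i η i')) < ⊤ := fun η hη i' j b => by
    refine F.wideCut_lt_top hg ?_ j b
    rcases eq_or_ne i' i with rfl | hne
    · rwa [Function.update_self]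
    · rw [Function.update_of_ne hne]; exact hγ1 i'
  have hsub : A.norm (holderNorm 1) (γ₁ - γ₂) < ⊤ :=
    (A.norm_sub_le hg _ _).trans_lt (ENNReal.add_lt_top.2 ⟨h1, h2⟩)
  rw [F.formIntegral_wedgeD hdeg hIc hIR hR hRc lam _ (F.integrableOn_cut hN hlam) (hw _ h1),
    F.formIntegral_wedgeD hdeg hIc hIR hR hRc lam _ (F.integrableOn_cut hN hlam) (hw _ h2),
    F.formIntegral_wedgeD hdeg hIc hIR hR hRc lam _ (F.integrableOn_cut hN hlam) (hw _ hsub)]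
  simp only [← Finset.sum_sub_distrib, ← mul_sub]
  refine Finset.sum_congr rfl fun j _ => ?_
  congr 1
  refine Finset.sum_congr rfl fun J _ => Finset.sum_congr rfl fun σ _ => ?_
  congr 1
  have hint := fun η hη => integrableOn_mul_jac hR hRc (wedgeDirection hdeg J σ)
    (F.integrableOn_cut hN hlam j (wedgeIndexZero hdeg σ)) fun i' => hw η hη i' j (wedgeIndex hdeg J σ i')
  have hup : ∀ η : Form I M (d i), (fun i' => F.wideCut j (wedgeIndex hdeg J σ i')
      (Function.update γ i η i')) = Function.update (fun i' => F.wideCut j (wedgeIndex hdeg J σ i')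
        (γ i')) i (F.wideCut j (wedgeIndex hdeg J σ i) η) := fun η => by
    ext1 i'
    exact Function.apply_update (fun i' => F.wideCut j (wedgeIndex hdeg J σ i')) γ i η i'
  have hd : ∀ η : Form I M (d i), A.norm (holderNorm 1) η < ⊤ → ∀ᵐ x ∂(volume.restrict R),
      DifferentiableAt ℝ (F.wideCut j (wedgeIndex hdeg J σ i) η) x := fun η hη =>
    ae_differentiableAt_of_lipschitzOnWith hR hRc
      (LipschitzOnWith.of_holderNorm (F.wideCut_lt_top hg hη j _))
  rw [← integral_sub (hint _ h1) (hint _ h2)]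
  refine integral_congr_ae ?_
  filter_upwards [hd _ h1, hd _ h2] with x hx1 hx2
  rw [hup, hup, hup, F.wideCut_sub, jac_update_sub _ _ _ hx1 hx2, mul_sub]

/-- The difference estimate for `∫ lam ∧ dγ_1 ∧ ⋯ ∧ dγ_k`. -/
theorem FormLocalization.exists_enorm_formIntegral_sub_le (F : FormLocalization o A R ι)
    (hIc : Convex ℝ (range I)) (hIR : range I ⊆ R) (hR : IsClosed R) (hRc : Convex ℝ R)
    (hN : IsIntegralBound R N) : ∃ C : ENNReal, C ≠ ⊤ ∧
      ∀ (lam lam' : Form I M ℓ) (γ γ' : ∀ i, Form I M (d i)),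
        A.norm (N 0) lam < ⊤ → A.norm (N 0) lam' < ⊤ →
        (∀ i, A.norm (N i.succ) (γ i) < ⊤) → (∀ i, A.norm (holderNorm 1) (γ i) < ⊤) →
        (∀ i, A.norm (N i.succ) (γ' i) < ⊤) → (∀ i, A.norm (holderNorm 1) (γ' i) < ⊤) →
        ‖formIntegral o (wedgeD hdeg lam γ) - formIntegral o (wedgeD hdeg lam' γ')‖ₑ ≤
          C * (A.norm (N 0) (lam - lam') * ∏ i, A.norm (N i.succ) (γ i) +
            A.norm (N 0) lam' * ∑ i, A.norm (N i.succ) (γ i - γ' i) *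
              ∏ m ∈ Finset.univ.erase i, (A.norm (N m.succ) (γ m) + A.norm (N m.succ) (γ' m))) := by
  classical
  obtain ⟨C, hC, hb⟩ := F.exists_enorm_formIntegral_le hdeg hIc hIR hR hRc hN
  refine ⟨C, hC, fun lam lam' γ γ' hlam hlam' hγ hγ1 hγ' hγ1' => ?_⟩
  have hg : IsGauge (holderNorm (n := n) 1) := isGauge_holderNorm le_rfl
  -- The forms `γ i` are exchanged one at a time with `lam'` fixed. In the other slots either `γ` or
  -- `γ'` may stand, hence the sums of both norms in the product.
  have key : ∀ S : Finset (Fin k),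
      ‖formIntegral o (wedgeD hdeg lam' γ) - formIntegral o (wedgeD hdeg lam' (S.piecewise γ' γ))‖ₑ ≤
        ∑ i ∈ S, C * (A.norm (N 0) lam' * (A.norm (N i.succ) (γ i - γ' i) *
          ∏ m ∈ Finset.univ.erase i, (A.norm (N m.succ) (γ m) + A.norm (N m.succ) (γ' m)))) := by
    intro S
    induction S using Finset.induction_on with
    | empty => simp
    | insert i S hi ih =>
      rw [Finset.sum_insert hi, add_comm]
      have hp : ∀ m, S.piecewise γ' γ m = γ m ∨ S.piecewise γ' γ m = γ' m := fun m => by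
        by_cases hm : m ∈ S
        · exact Or.inr (Finset.piecewise_eq_of_mem _ _ _ hm)
        · exact Or.inl (Finset.piecewise_eq_of_notMem _ _ _ hm)
      have hself : Function.update (S.piecewise γ' γ) i (γ i) = S.piecewise γ' γ := by
        rw [← Finset.piecewise_eq_of_notMem S γ' γ hi, Function.update_eq_self]
      have h1 : ∀ m, A.norm (holderNorm 1) (S.piecewise γ' γ m) < ⊤ := fun m => by
        rcases hp m with h | h <;> rw [h]
        · exact hγ1 m
        · exact hγ1' m
      have hfin : A.norm (N i.succ) (γ i - γ' i) < ⊤ :=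
        (A.norm_sub_le (hN.gauge _) _ _).trans_lt (ENNReal.add_lt_top.2 ⟨hγ i, hγ' i⟩)
      have hfin1 : A.norm (holderNorm 1) (γ i - γ' i) < ⊤ :=
        (A.norm_sub_le hg _ _).trans_lt (ENNReal.add_lt_top.2 ⟨hγ1 i, hγ1' i⟩)
      have h2 := F.formIntegral_wedgeD_update_sub hdeg hIc hIR hR hRc hN i hlam' h1 (hγ1 i) (hγ1' i)
      rw [hself, ← Finset.piecewise_insert] at h2
      have h3 := hb lam' (Function.update (S.piecewise γ' γ) i (γ i - γ' i)) hlam' (fun m => by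
        rcases eq_or_ne m i with rfl | hne
        · rwa [Function.update_self]
        · rw [Function.update_of_ne hne]
          rcases hp m with h | h <;> rw [h]
          · exact hγ m
          · exact hγ' m) (fun m => by
        rcases eq_or_ne m i with rfl | hne
        · rwa [Function.update_self]
        · rw [Function.update_of_ne hne]
          exact h1 m)
      rw [← sub_add_sub_cancel _ (formIntegral o (wedgeD hdeg lam' (S.piecewise γ' γ)))]
      refine (enorm_add_le _ _).trans (add_le_add ih ?_)
      rw [h2]
      refine h3.trans ?_
      gcongr
      rw [← Finset.mul_prod_erase _ _ (Finset.mem_univ i), Function.update_self]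
      gcongr with m hm
      rw [Function.update_of_ne (Finset.ne_of_mem_erase hm)]
      rcases hp m with h | h <;> rw [h]
      · exact le_self_add
      · exact le_add_self
  have hsub : A.norm (N 0) (lam - lam') < ⊤ :=
    (A.norm_sub_le (hN.gauge 0) _ _).trans_lt (ENNReal.add_lt_top.2 ⟨hlam, hlam'⟩)
  rw [← sub_add_sub_cancel _ (formIntegral o (wedgeD hdeg lam' γ)), mul_add]
  refine (enorm_add_le _ _).trans (add_le_add ?_ ?_)
  · rw [F.formIntegral_wedgeD_sub_left hdeg hIc hIR hR hRc hN hlam hlam' hγ1]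
    exact hb _ _ hsub hγ hγ1
  · have := key Finset.univ
    rw [Finset.piecewise_univ] at this
    simpa only [Finset.mul_sum] using this

/-- Two approximations of the same forms have asymptotically the same integrals. -/
theorem FormLocalization.tendsto_formIntegral_sub (F : FormLocalization o A R ι)
    (hIc : Convex ℝ (range I)) (hIR : range I ⊆ R) (hR : IsClosed R) (hRc : Convex ℝ R)
    (hN : IsIntegralBound R N) {lam : Form I M ℓ} {γ : ∀ i, Form I M (d i)}
    (hlam : A.norm (N 0) lam < ⊤) (hγ : ∀ i, A.norm (N i.succ) (γ i) < ⊤)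
    {T : Type*} {l : Filter T} {lam₁ lam₂ : T → Form I M ℓ} {γ₁ γ₂ : T → ∀ i, Form I M (d i)}
    (hγ₁ : ∀ᶠ t in l, ∀ i, A.norm (holderNorm 1) (γ₁ t i) < ⊤)
    (hγ₂ : ∀ᶠ t in l, ∀ i, A.norm (holderNorm 1) (γ₂ t i) < ⊤)
    (h₁ : Tendsto (fun t => A.norm (N 0) (lam₁ t - lam)) l (𝓝 0))
    (h₂ : Tendsto (fun t => A.norm (N 0) (lam₂ t - lam)) l (𝓝 0))
    (h₁' : ∀ i, Tendsto (fun t => A.norm (N i.succ) (γ₁ t i - γ i)) l (𝓝 0))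
    (h₂' : ∀ i, Tendsto (fun t => A.norm (N i.succ) (γ₂ t i - γ i)) l (𝓝 0)) :
    Tendsto (fun t => formIntegral o (wedgeD hdeg (lam₁ t) (γ₁ t)) -
      formIntegral o (wedgeD hdeg (lam₂ t) (γ₂ t))) l (𝓝 0) := by
  obtain ⟨C, hC, hb⟩ := F.exists_enorm_formIntegral_sub_le hdeg hIc hIR hR hRc hN
    (ℓ := ℓ) (d := d)
  have hnear : ∀ {m : ℕ} {N : Set (EuclideanSpace ℝ (Fin n)) → (EuclideanSpace ℝ (Fin n) → ℝ) →
      ENNReal}, IsGauge N → ∀ {η : Form I M m} {η₁ : T → Form I M m},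
      Tendsto (fun t => A.norm N (η₁ t - η)) l (𝓝 0) →
      ∀ᶠ t in l, A.norm N (η₁ t) ≤ A.norm N η + 1 := by
    intro m N hN η η₁ h
    filter_upwards [h.eventually (gt_mem_nhds one_pos)] with t ht
    calc A.norm N (η₁ t) = A.norm N (η + (η₁ t - η)) := by rw [add_sub_cancel]
      _ ≤ _ := (A.norm_add_le hN _ _).trans (by gcongr)
  have hdist : ∀ {m : ℕ} {N : Set (EuclideanSpace ℝ (Fin n)) → (EuclideanSpace ℝ (Fin n) → ℝ) →
      ENNReal}, IsGauge N → ∀ {η : Form I M m} {η₁ η₂ : T → Form I M m},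
      Tendsto (fun t => A.norm N (η₁ t - η)) l (𝓝 0) →
      Tendsto (fun t => A.norm N (η₂ t - η)) l (𝓝 0) →
      Tendsto (fun t => A.norm N (η₁ t - η₂ t)) l (𝓝 0) := by
    intro m N hN η η₁ η₂ h h'
    refine tendsto_of_tendsto_of_tendsto_of_le_of_le tendsto_const_nhds (by simpa using h.add h')
      (fun _ => zero_le) fun t => ?_
    change A.norm N (η₁ t - η₂ t) ≤ _
    rw [← sub_sub_sub_cancel_right (η₁ t) (η₂ t) η]
    exact A.norm_sub_le hN _ _
  have hL : A.norm (N 0) lam + 1 ≠ ⊤ := (ENNReal.add_lt_top.2 ⟨hlam, ENNReal.one_lt_top⟩).ne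
  have hG : ∀ i, A.norm (N (Fin.succ i)) (γ i) + 1 ≠ ⊤ := fun i =>
    (ENNReal.add_lt_top.2 ⟨hγ i, ENNReal.one_lt_top⟩).ne
  set P := ∏ i, (A.norm (N (Fin.succ i)) (γ i) + 1)
  set Q : Fin k → ENNReal := fun i => ∏ m ∈ Finset.univ.erase i,
    ((A.norm (N (Fin.succ m)) (γ m) + 1) + (A.norm (N (Fin.succ m)) (γ m) + 1))
  have hP : P ≠ ⊤ := ENNReal.prod_ne_top fun i _ => hG i
  have hQ : ∀ i, Q i ≠ ⊤ := fun i =>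
    ENNReal.prod_ne_top fun m _ => ENNReal.add_ne_top.2 ⟨hG m, hG m⟩
  have hlim : Tendsto (fun t => C * (A.norm (N 0) (lam₁ t - lam₂ t) * P +
      (A.norm (N 0) lam + 1) * ∑ i, A.norm (N (Fin.succ i)) (γ₁ t i - γ₂ t i) * Q i)) l (𝓝 0) := by
    have e1 := ENNReal.Tendsto.mul_const (hdist (hN.gauge 0) h₁ h₂) (Or.inr hP)
    have e2 := tendsto_finsetSum Finset.univ fun i (_ : i ∈ Finset.univ) =>
      ENNReal.Tendsto.mul_const (hdist (hN.gauge (Fin.succ i)) (h₁' i) (h₂' i)) (Or.inr (hQ i))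
    have e3 := ENNReal.Tendsto.const_mul
      (e1.add (ENNReal.Tendsto.const_mul e2 (Or.inr hL))) (Or.inr hC)
    simpa using e3
  rw [tendsto_iff_enorm_sub_tendsto_zero]
  refine tendsto_of_tendsto_of_tendsto_of_le_of_le' tendsto_const_nhds hlim
    (Eventually.of_forall fun _ => zero_le) ?_
  filter_upwards [hγ₁, hγ₂, hnear (hN.gauge 0) h₁, hnear (hN.gauge 0) h₂,
    eventually_all.2 fun i => hnear (hN.gauge (Fin.succ i)) (h₁' i),
    eventually_all.2 fun i => hnear (hN.gauge (Fin.succ i)) (h₂' i)] with t a1 a2 b1 b2 c1 c2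
  rw [sub_zero]
  refine (hb _ _ _ _ (b1.trans_lt hL.lt_top) (b2.trans_lt hL.lt_top)
    (fun i => (c1 i).trans_lt (hG i).lt_top) a1 (fun i => (c2 i).trans_lt (hG i).lt_top) a2).trans ?_
  gcongr with i
  · exact Finset.prod_le_prod' fun m _ => c1 m
  · exact Finset.prod_le_prod' fun m _ => add_le_add (c1 m) (c2 m)

end Estimates

end DistJacobian

namespace DistJacobian

/-! ### Smooth approximations of forms -/

section Regularize

variable {n : ℕ} {H : Type*} [TopologicalSpace H]
  {I : ModelWithCorners ℝ (EuclideanSpace ℝ (Fin n)) H}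
  {M : Type*} [TopologicalSpace M] [ChartedSpace H M] [IsManifold I ∞ M]
  {R : Set (EuclideanSpace ℝ (Fin n))}

theorem isLocalRange_range : IsLocalRange I M (range I) :=
  ⟨subset_rfl, fun _ _ _ _ => Eventually.of_forall fun _ => rfl⟩

/-- The assumption concerns the preferred charts only. A coordinate change with surjective
derivative at an interior point, taking values in the convex set `range I`, hits the interior of
that set. -/
theorem mem_interior_range_of_boundaryless [BoundarylessManifold I M]
    {c : OpenPartialHomeomorph M H} (hc : c ∈ IsManifold.maximalAtlas I ∞ M)
    {y : EuclideanSpace ℝ (Fin n)} (hy : y ∈ (c.extend I).target) : y ∈ interior (range I) := by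
  set x := (c.extend I).symm y
  set c0 := chartAt H x
  have hc0 : c0 ∈ IsManifold.maximalAtlas I ∞ M := IsManifold.chart_mem_maximalAtlas _
  have h : y ∈ (I.extendCoordChange c c0).source := mem_source_chartAt hy
  have h' := extendCoordChange_mem_source_symm h
  have hint : range I ∈ 𝓝 (I.extendCoordChange c c0 y) :=
    mem_interior_iff_mem_nhds.1 (BoundarylessManifold.isInteriorPoint (I := I) (x := x))
  have hback := extendCoordChange_extendCoordChange h
  have hs : Function.Surjective (fderiv ℝ (I.extendCoordChange c0 c)
      (I.extendCoordChange c c0 y)) := by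
    intro v
    refine ⟨transDeriv I c c0 y v, ?_⟩
    have h1 := transDeriv_comp hc hc0 hc h (mem_extendCoordChange_source.2
      ⟨hy, by rw [← c.extend_source (I := I)]; exact (c.extend I).map_target hy⟩)
    rw [transDeriv_self hy, transDeriv, fderivWithin_of_mem_nhds hint] at h1
    exact DFunLike.congr_fun h1 v
  have := (((contDiffWithinAt_extendCoordChange hc0 hc h').differentiableWithinAt
    (by simp)).differentiableAt hint).mem_interior_convex_of_surjective_fderiv hint
    I.convex_range I.isClosed_range I.nonempty_interior
    (fun z _ => extendCoordChange_mem_range c0 c z) hs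
  rwa [hback] at this

/-- Without boundary every coordinate image stays in the interior of `range I`, so the whole space
can serve as domain even if `I` models a half-space. This lets the Sobolev estimate on the whole
space apply. -/
theorem isLocalRange_univ [BoundarylessManifold I M] : IsLocalRange I M univ := by
  refine ⟨subset_univ _, fun c hc y hy => ?_⟩
  have h : range I ∈ 𝓝[univ] y := mem_nhdsWithin_of_mem_nhds
    (mem_interior_iff_mem_nhds.1 (mem_interior_range_of_boundaryless hc hy))
  filter_upwards [eventually_forall_ball h] with r hr
  exact subset_antisymm (fun z hz => ⟨hz.1, hr z hz⟩) (inter_subset_inter_right _ (subset_univ _))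

variable [CompactSpace M] [T2Space M] {o : ManifoldOrientation I M} {A : GoodCover I M}
  {ι : Type*} [Fintype ι]

/-- The bump is one where the cutoff is nonzero, so the `j`-th piece is the form times the `j`-th
cutoff, and the cutoffs add up to one. -/
theorem FormLocalization.sum_pieceForm (F : FormLocalization o A R ι) {m : ℕ} (γ : Form I M m) :
    ∑ j, pieceForm I (F.chart j) (F.bump j) (fun s => F.cut j s γ) = γ := by
  have key : ∀ x j, (pieceForm I (F.chart j) (F.bump j) (fun s => F.cut j s γ) : Form I M m).toFun x =
      (F.chart j).source.indicator (fun x => F.cutoff j ((F.chart j).extend I x)) x • γ.toFun x := by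
    intro x j
    by_cases hx : x ∈ (F.chart j).source
    · have e : (pieceForm I (F.chart j) (F.bump j) (fun s => F.cut j s γ) : Form I M m).toFun x = _ :=
        if_pos hx
      rw [e, indicator_of_mem hx, γ.toFun_eq (F.chart_mem j) hx]
      set y := (F.chart j).extend I x with hy
      by_cases h0 : F.cutoff j y = 0
      · have hc : ∀ s : Fin m ↪o Fin n, F.cut j s γ y = 0 := fun s => by
          by_cases hyp : y ∈ F.piece j
          · rw [FormLocalization.cut, indicator_of_mem hyp, h0, zero_mul]
          · exact indicator_of_notMem hyp _
        simp [h0, hc]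
      · have hyr : y ∈ range I := by
          rw [hy, (F.chart j).extend_coe]
          exact mem_range_self _
        have hyp : y ∈ F.piece j := by
          by_contra h
          exact h0 (F.cutoff_eq_zero j y hyr h)
        rw [(F.bump_eq_one j y h0).self_of_nhds, one_smul]
        conv_rhs => rw [← sum_smul_dualFamily (γ.inChart (F.chart j) y)]
        ext v
        simp only [ContinuousAlternatingMap.compContinuousLinearMap_apply,
          ContinuousAlternatingMap.smul_apply, ContinuousAlternatingMap.sum_apply, Finset.smul_sum]
        refine Finset.sum_congr rfl fun s _ => ?_
        rw [FormLocalization.cut, indicator_of_mem hyp, smul_smul]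
        rfl
    · have e : (pieceForm I (F.chart j) (F.bump j) (fun s => F.cut j s γ) : Form I M m).toFun x = _ :=
        if_neg hx
      rw [e, indicator_of_notMem hx, zero_smul]
  funext x
  rw [Finset.sum_apply]
  have h1 := Finset.sum_congr rfl fun j (_ : j ∈ (Finset.univ : Finset ι)) => key x j
  rw [← Finset.sum_smul, F.sum_cutoff, one_smul] at h1
  exact h1

/-- The smooth approximation of a form at scale `t`. -/
noncomputable def FormLocalization.regularize (F : FormLocalization o A R ι)
    (φ : EuclideanSpace ℝ (Fin n) → ℝ) {m : ℕ} (γ : Form I M m) (t : ℝ) : Form I M m :=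
  ∑ j, pieceForm I (F.chart j) (F.bump j) fun s => mol φ t (F.cut j s γ)

theorem pieceForm_sub (c : OpenPartialHomeomorph M H) (h : EuclideanSpace ℝ (Fin n) → ℝ) {m : ℕ}
    (w w' : (Fin m ↪o Fin n) → EuclideanSpace ℝ (Fin n) → ℝ) :
    (pieceForm I c h (fun s => w s - w' s) : Form I M m) = pieceForm I c h w - pieceForm I c h w' := by
  have key : ∀ x, (pieceForm I c h (fun s => w s - w' s) : Form I M m).toFun x =
      (pieceForm I c h w : Form I M m).toFun x - (pieceForm I c h w' : Form I M m).toFun x := by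
    intro x
    by_cases hx : x ∈ c.source
    · have e : ∀ w : (Fin m ↪o Fin n) → EuclideanSpace ℝ (Fin n) → ℝ,
          (pieceForm I c h w : Form I M m).toFun x = h (c.extend I x) • ∑ s, w s (c.extend I x) •
            (dualFamily n m s).compContinuousLinearMap
              (transDeriv I (chartAt H x) c (extChartAt I x x)) := fun w => if_pos hx
      rw [e, e, e]
      ext v
      simp only [ContinuousAlternatingMap.smul_apply, ContinuousAlternatingMap.sub_apply,
        ContinuousAlternatingMap.sum_apply, Pi.sub_apply, sub_smul, Finset.sum_sub_distrib, smul_sub]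
    · have e : ∀ w : (Fin m ↪o Fin n) → EuclideanSpace ℝ (Fin n) → ℝ,
          (pieceForm I c h w : Form I M m).toFun x = 0 := fun w => if_neg hx
      rw [e, e, e, sub_zero]
  exact funext key

/-- Subtracting `sum_pieceForm` leaves pieces whose coefficients are the errors of the averages, and
these bound the norm of the form. -/
theorem FormLocalization.tendsto_norm_regularize_sub (F : FormLocalization o A R ι)
    {N : Set (EuclideanSpace ℝ (Fin n)) → (EuclideanSpace ℝ (Fin n) → ℝ) → ENNReal}
    (hN : IsGauge N) {φ : EuclideanSpace ℝ (Fin n) → ℝ} {m : ℕ} {γ : Form I M m}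
    (h : ∀ j (s : Fin m ↪o Fin n),
      Tendsto (fun t => N R (mol φ t (F.cut j s γ) - F.cut j s γ)) (𝓝[>] 0) (𝓝 0)) :
    Tendsto (fun t => A.norm N (F.regularize φ γ t - γ)) (𝓝[>] 0) (𝓝 0) := by
  choose C hC hCw using fun j => F.norm_pieceForm_le j (m := m) N hN
  have hlim : Tendsto (fun t => ∑ j, C j * ∑ s : Fin m ↪o Fin n,
      N R (mol φ t (F.cut j s γ) - F.cut j s γ)) (𝓝[>] 0) (𝓝 0) := by
    have := tendsto_finsetSum Finset.univ fun j (_ : j ∈ Finset.univ) =>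
      ENNReal.Tendsto.const_mul (tendsto_finsetSum Finset.univ
        fun s (_ : s ∈ Finset.univ) => h j s) (Or.inr (hC j))
    simpa using this
  refine tendsto_of_tendsto_of_tendsto_of_le_of_le tendsto_const_nhds hlim (fun _ => zero_le)
    fun t => ?_
  have e : F.regularize φ γ t - γ = ∑ j, pieceForm I (F.chart j) (F.bump j)
      (fun s => mol φ t (F.cut j s γ) - F.cut j s γ) := by
    simp only [pieceForm_sub, Finset.sum_sub_distrib, F.sum_pieceForm]
    rfl
  change A.norm N (F.regularize φ γ t - γ) ≤ _
  rw [e]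
  exact (A.norm_sum_le hN _ _).trans (Finset.sum_le_sum fun j _ => hCw j _)

theorem Form.HasCoeffs.sum {m : ℕ} {α : NNReal} (hα : α ≤ 1) {κ : Type*} (S : Finset κ)
    {γ : κ → Form I M m} (h : ∀ i ∈ S, (γ i).HasCoeffs (MemHolderSpace α)) :
    (∑ i ∈ S, γ i).HasCoeffs (MemHolderSpace α) := by
  classical
  intro c s
  have hg : IsGauge (holderNorm (n := n) α) := isGauge_holderNorm hα
  induction S using Finset.induction_on with
  | empty =>
    have : holderNorm α c.image ((0 : Form I M m).coeff c.chart s) = 0 := hg.zero _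
    rw [Finset.sum_empty, MemHolderSpace, this]
    exact ENNReal.zero_lt_top
  | insert a S ha ih =>
    rw [Finset.sum_insert ha]
    exact (hg.add _ _ _).trans_lt (ENNReal.add_lt_top.2 ⟨h a (Finset.mem_insert_self a S) c s,
      ih fun i hi => h i (Finset.mem_insert_of_mem hi)⟩)

theorem FormLocalization.regularize_hasCoeffs (F : FormLocalization o A R ι) (hIR : range I ⊆ R)
    {φ : EuclideanSpace ℝ (Fin n) → ℝ} (hφ : IsKernel R φ) {m : ℕ} {γ : Form I M m}
    (hγ : ∀ j (s : Fin m ↪o Fin n), LocallyIntegrable (F.cut j s γ)) {t : ℝ} (ht : 0 < t) :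
    (F.regularize φ γ t).HasCoeffs (MemHolderSpace 1) := by
  refine Form.HasCoeffs.sum le_rfl _ fun j _ => ?_
  exact pieceForm_hasCoeffs I.isClosed_range I.convex_range (F.chart_mem j) (F.bump_contDiff j)
    (F.hasCompactSupport_bump j) ((inter_subset_inter_right _ hIR).trans
      ((F.tsupport_bump j).trans (F.piece_subset j)))
    fun s => contDiff_mol hφ.contDiff hφ.hasCompactSupport (hγ j s) ht.ne'

theorem Form.HasCoeffs.norm_lt_top {m : ℕ} {γ : Form I M m}
    {N : Set (EuclideanSpace ℝ (Fin n)) → (EuclideanSpace ℝ (Fin n) → ℝ) → ENNReal}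
    (h : γ.HasCoeffs fun D f => N D f < ⊤) (A : GoodCover I M) : A.norm N γ < ⊤ :=
  ENNReal.sum_lt_top.2 fun i _ => ENNReal.sum_lt_top.2 fun s _ => h (A.chart i) s

end Regularize

/-! ### The integral bounds for Hölder and Sobolev norms -/

section Bounds

variable {n k : ℕ}

theorem isIntegralBound_holderNorm {R : Set (EuclideanSpace ℝ (Fin n))} (hR : IsModelRange R)
    {α : Fin (k + 1) → NNReal} (hα0 : ∀ s, 0 < α s) (hα1 : ∀ s, α s ≤ 1)
    (hα : (k : ℝ) < ∑ s, (α s : ℝ)) : IsIntegralBound R fun s => holderNorm (α s) where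
  gauge s := isGauge_holderNorm (hα1 s)
  integrableOn _ _ hρ h0 h :=
    (integrable_of_holderNorm (hα0 0) hR.isClosed h h0 hρ).integrableOn
  bound c ρ := enorm_integral_mul_jac_le_holder c hR ρ hα0 hα1 hα

theorem integrable_of_sobolevNorm' {s p : ℝ} (hp : 1 ≤ p) {f : EuclideanSpace ℝ (Fin n) → ℝ} {ρ : ℝ}
    (hρ : ∀ x, ρ < ‖x‖ → f x = 0) (h : sobolevNorm' s p univ f < ⊤) : Integrable f := by
  obtain ⟨hm, hf⟩ := sobolevNorm'_lt_top.1 h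
  have hf' : MemLp f (ENNReal.ofReal p) (volume.restrict univ) := ⟨hm, lt_of_le_of_lt le_self_add hf⟩
  rw [Measure.restrict_univ] at hf'
  have h1 : IntegrableOn f (Metric.closedBall 0 ρ) := by
    have : IsFiniteMeasure (volume.restrict (Metric.closedBall (0 : EuclideanSpace ℝ (Fin n)) ρ)) :=
      ⟨by simpa using measure_closedBall_lt_top⟩
    exact (hf'.restrict _).integrable (by simpa using hp)
  refine (integrableOn_iff_integrable_of_support_subset fun x hx => ?_).1 h1
  rw [mem_closedBall_zero_iff]
  by_contra hlt
  exact hx (hρ x (not_le.1 hlt))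

theorem isIntegralBound_sobolevNorm' (hn : 0 < n) {p : Fin (k + 1) → ℝ} (hp : ∀ s, 1 < p s)
    (hsum : ∑ s, 1 / p s = 1) :
    IsIntegralBound (univ : Set (EuclideanSpace ℝ (Fin n)))
      fun s => sobolevNorm' (1 - 1 / p s) (p s) where
  gauge s := by
    have h1 : 1 / p s < 1 := (div_lt_one (by linarith [hp s])).2 (hp s)
    have h2 : 0 < 1 / p s := div_pos one_pos (by linarith [hp s])
    exact isGauge_sobolevNorm' hn (by linarith) (by linarith) (hp s).le
  integrableOn _ _ hρ _ h := (integrable_of_sobolevNorm' (hp 0).le hρ h).integrableOn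
  bound c ρ := by
    obtain ⟨C, hC, h⟩ := enorm_integral_mul_jac_le_sobolev c ρ hp hsum
    refine ⟨C, hC, fun u h1 _ h3 h4 => ?_⟩
    rw [Measure.restrict_univ]
    exact h u h1 h3 h4

end Bounds

end DistJacobian

namespace DistJacobian

/-! ### Limits of integrals -/

section Limits

variable {n : ℕ} {H : Type*} [TopologicalSpace H]
  {I : ModelWithCorners ℝ (EuclideanSpace ℝ (Fin n)) H}
  {M : Type*} [TopologicalSpace M] [ChartedSpace H M] [IsManifold I ∞ M]
  [CompactSpace M] [T2Space M] {o : ManifoldOrientation I M} {A : GoodCover I M}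
  {R : Set (EuclideanSpace ℝ (Fin n))} {ι : Type*} [Fintype ι]
  {k ℓ : ℕ} {d : Fin k → ℕ} (hdeg : ℓ + ∑ i, (d i + 1) = n)
  {N : Fin (k + 1) → Set (EuclideanSpace ℝ (Fin n)) → (EuclideanSpace ℝ (Fin n) → ℝ) → ENNReal}

/-- The comparison lemma applied to two independent parameters is the Cauchy criterion. `lam` needs
no approximation, since it is not differentiated. -/
theorem FormLocalization.exists_tendsto_formIntegral (F : FormLocalization o A R ι)
    (hIR : range I ⊆ R) (hR : IsClosed R) (hRc : Convex ℝ R)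
    (hN : IsIntegralBound R N) {lam : Form I M ℓ} {γ : ∀ i, Form I M (d i)}
    (hlam : A.norm (N 0) lam < ⊤) (hγ : ∀ i, A.norm (N i.succ) (γ i) < ⊤)
    {γr : ℝ → ∀ i, Form I M (d i)}
    (hγr : ∀ᶠ t in 𝓝[>] (0 : ℝ), ∀ i, A.norm (holderNorm 1) (γr t i) < ⊤)
    (h : ∀ i, Tendsto (fun t => A.norm (N i.succ) (γr t i - γ i)) (𝓝[>] 0) (𝓝 0)) :
    ∃ L, Tendsto (fun t => formIntegral o (wedgeD hdeg lam (γr t))) (𝓝[>] 0) (𝓝 L) := by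
  refine cauchy_map_iff_exists_tendsto.1 (cauchy_map_iff.2 ⟨inferInstance, ?_⟩)
  rw [uniformity_eq_comap_nhds_zero ℝ, tendsto_comap_iff]
  have h0 : A.norm (N 0) (lam - lam) = 0 := by rw [sub_self, A.norm_zero (hN.gauge 0)]
  exact F.tendsto_formIntegral_sub hdeg I.convex_range hIR hR hRc hN hlam hγ
    (l := 𝓝[>] (0 : ℝ) ×ˢ 𝓝[>] (0 : ℝ)) (lam₁ := fun _ => lam) (lam₂ := fun _ => lam)
    (γ₁ := fun p => γr p.2) (γ₂ := fun p => γr p.1)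
    (tendsto_snd.eventually hγr) (tendsto_fst.eventually hγr)
    (by simp only [h0]; exact tendsto_const_nhds) (by simp only [h0]; exact tendsto_const_nhds)
    (fun i => (h i).comp tendsto_snd) (fun i => (h i).comp tendsto_fst)

theorem FormLocalization.tendsto_formIntegral_of_reference (F : FormLocalization o A R ι)
    (hIR : range I ⊆ R) (hR : IsClosed R) (hRc : Convex ℝ R)
    (hN : IsIntegralBound R N) {lam : Form I M ℓ} {γ : ∀ i, Form I M (d i)}
    (hlam : A.norm (N 0) lam < ⊤) (hγ : ∀ i, A.norm (N i.succ) (γ i) < ⊤)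
    {γr : ℝ → ∀ i, Form I M (d i)}
    (hγr : ∀ᶠ t in 𝓝[>] (0 : ℝ), ∀ i, A.norm (holderNorm 1) (γr t i) < ⊤)
    (h : ∀ i, Tendsto (fun t => A.norm (N i.succ) (γr t i - γ i)) (𝓝[>] 0) (𝓝 0))
    {L : ℝ} (hL : Tendsto (fun t => formIntegral o (wedgeD hdeg lam (γr t))) (𝓝[>] 0) (𝓝 L))
    {lam₁ : ℝ → Form I M ℓ} {γ₁ : ℝ → ∀ i, Form I M (d i)}
    (hγ₁ : ∀ᶠ t in 𝓝[>] (0 : ℝ), ∀ i, A.norm (holderNorm 1) (γ₁ t i) < ⊤)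
    (h₁ : Tendsto (fun t => A.norm (N 0) (lam₁ t - lam)) (𝓝[>] 0) (𝓝 0))
    (h₁' : ∀ i, Tendsto (fun t => A.norm (N i.succ) (γ₁ t i - γ i)) (𝓝[>] 0) (𝓝 0)) :
    Tendsto (fun t => formIntegral o (wedgeD hdeg (lam₁ t) (γ₁ t))) (𝓝[>] 0) (𝓝 L) := by
  have h0 : A.norm (N 0) (lam - lam) = 0 := by rw [sub_self, A.norm_zero (hN.gauge 0)]
  have := (F.tendsto_formIntegral_sub hdeg I.convex_range hIR hR hRc hN hlam hγ
    (lam₂ := fun _ => lam) hγ₁ hγr h₁ (by simp only [h0]; exact tendsto_const_nhds) h₁' h).add hL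
  simpa using this

/-- The difference estimate for limits of integrals. -/
theorem FormLocalization.exists_enorm_limit_sub_le (F : FormLocalization o A R ι)
    (hIR : range I ⊆ R) (hR : IsClosed R) (hRc : Convex ℝ R)
    (hN : IsIntegralBound R N) : ∃ C : ENNReal, C ≠ ⊤ ∧
      ∀ (lam lam' : Form I M ℓ) (γ γ' : ∀ i, Form I M (d i)) (γr γr' : ℝ → ∀ i, Form I M (d i))
        (L L' : ℝ), A.norm (N 0) lam < ⊤ → A.norm (N 0) lam' < ⊤ →
        (∀ i, A.norm (N i.succ) (γ i) < ⊤) → (∀ i, A.norm (N i.succ) (γ' i) < ⊤) →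
        (∀ᶠ t in 𝓝[>] (0 : ℝ), ∀ i, A.norm (holderNorm 1) (γr t i) < ⊤) →
        (∀ᶠ t in 𝓝[>] (0 : ℝ), ∀ i, A.norm (holderNorm 1) (γr' t i) < ⊤) →
        (∀ i, Tendsto (fun t => A.norm (N i.succ) (γr t i - γ i)) (𝓝[>] 0) (𝓝 0)) →
        (∀ i, Tendsto (fun t => A.norm (N i.succ) (γr' t i - γ' i)) (𝓝[>] 0) (𝓝 0)) →
        Tendsto (fun t => formIntegral o (wedgeD hdeg lam (γr t))) (𝓝[>] 0) (𝓝 L) →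
        Tendsto (fun t => formIntegral o (wedgeD hdeg lam' (γr' t))) (𝓝[>] 0) (𝓝 L') →
        ‖L - L'‖ₑ ≤ C * (A.norm (N 0) (lam - lam') * ∏ i, A.norm (N i.succ) (γ i) +
            A.norm (N 0) lam' * ∑ i, A.norm (N i.succ) (γ i - γ' i) *
              ∏ m ∈ Finset.univ.erase i, (A.norm (N m.succ) (γ m) + A.norm (N m.succ) (γ' m))) := by
  obtain ⟨C, hC, hb⟩ := F.exists_enorm_formIntegral_sub_le hdeg I.convex_range hIR hR hRc hN
    (ℓ := ℓ) (d := d)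
  refine ⟨C, hC, fun lam lam' γ γ' γr γr' L L' hlam hlam' hγ hγ' hγr hγr' h h' hL hL' => ?_⟩
  set e : Fin k → ℝ → ENNReal := fun i t => A.norm (N (Fin.succ i)) (γr t i - γ i)
  set e' : Fin k → ℝ → ENNReal := fun i t => A.norm (N (Fin.succ i)) (γr' t i - γ' i)
  have hsub : A.norm (N 0) (lam - lam') < ⊤ :=
    (A.norm_sub_le (hN.gauge 0) _ _).trans_lt (ENNReal.add_lt_top.2 ⟨hlam, hlam'⟩)
  have hsub' : ∀ i, A.norm (N (Fin.succ i)) (γ i - γ' i) < ⊤ := fun i =>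
    (A.norm_sub_le (hN.gauge _) _ _).trans_lt (ENNReal.add_lt_top.2 ⟨hγ i, hγ' i⟩)
  have hnear : ∀ {m : ℕ} {N : Set (EuclideanSpace ℝ (Fin n)) → (EuclideanSpace ℝ (Fin n) → ℝ) →
      ENNReal}, IsGauge N → ∀ η η₁ : Form I M m, A.norm N η₁ ≤ A.norm N η + A.norm N (η₁ - η) := by
    intro m N hN η η₁
    calc A.norm N η₁ = A.norm N (η + (η₁ - η)) := by rw [add_sub_cancel]
      _ ≤ _ := A.norm_add_le hN _ _
  have t1 : ∀ i, Tendsto (fun t => A.norm (N (Fin.succ i)) (γ i) + e i t) (𝓝[>] 0)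
      (𝓝 (A.norm (N (Fin.succ i)) (γ i))) := fun i => by
    simpa using (tendsto_const_nhds (x := A.norm (N (Fin.succ i)) (γ i))).add (h i)
  have t2 : ∀ i, Tendsto (fun t => A.norm (N (Fin.succ i)) (γ' i) + e' i t) (𝓝[>] 0)
      (𝓝 (A.norm (N (Fin.succ i)) (γ' i))) := fun i => by
    simpa using (tendsto_const_nhds (x := A.norm (N (Fin.succ i)) (γ' i))).add (h' i)
  have t3 : ∀ i, Tendsto (fun t => A.norm (N (Fin.succ i)) (γ i - γ' i) + (e i t + e' i t)) (𝓝[>] 0)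
      (𝓝 (A.norm (N (Fin.succ i)) (γ i - γ' i))) := fun i => by
    simpa using (tendsto_const_nhds (x := A.norm (N (Fin.succ i)) (γ i - γ' i))).add
      ((h i).add (h' i))
  have hlim : Tendsto (fun t => C * (A.norm (N 0) (lam - lam') *
      ∏ i, (A.norm (N (Fin.succ i)) (γ i) + e i t) + A.norm (N 0) lam' *
        ∑ i, (A.norm (N (Fin.succ i)) (γ i - γ' i) + (e i t + e' i t)) *
          ∏ m ∈ Finset.univ.erase i, ((A.norm (N (Fin.succ m)) (γ m) + e m t) +
            (A.norm (N (Fin.succ m)) (γ' m) + e' m t)))) (𝓝[>] 0)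
      (𝓝 (C * (A.norm (N 0) (lam - lam') * ∏ i, A.norm (N (Fin.succ i)) (γ i) +
            A.norm (N 0) lam' * ∑ i, A.norm (N (Fin.succ i)) (γ i - γ' i) *
              ∏ m ∈ Finset.univ.erase i, (A.norm (N (Fin.succ m)) (γ m) +
                A.norm (N (Fin.succ m)) (γ' m))))) := by
    have hp : ∀ i, Tendsto (fun t => ∏ m ∈ Finset.univ.erase i,
        ((A.norm (N (Fin.succ m)) (γ m) + e m t) + (A.norm (N (Fin.succ m)) (γ' m) + e' m t)))
        (𝓝[>] 0) (𝓝 (∏ m ∈ Finset.univ.erase i, (A.norm (N (Fin.succ m)) (γ m) +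
                A.norm (N (Fin.succ m)) (γ' m)))) := fun i =>
      ENNReal.tendsto_finsetProd_of_ne_top _ (fun m _ => (t1 m).add (t2 m)) fun m _ =>
        ENNReal.add_ne_top.2 ⟨(hγ m).ne, (hγ' m).ne⟩
    refine ENNReal.Tendsto.const_mul (Tendsto.add (ENNReal.Tendsto.const_mul ?_ (Or.inr hsub.ne))
      (ENNReal.Tendsto.const_mul (tendsto_finsetSum _ fun i _ =>
        ENNReal.Tendsto.mul (t3 i) (Or.inr ?_) (hp i) (Or.inr (hsub' i).ne)) (Or.inr hlam'.ne)))
          (Or.inr hC)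
    · exact ENNReal.tendsto_finsetProd_of_ne_top _ (fun i _ => t1 i) fun i _ => (hγ i).ne
    · exact ENNReal.prod_ne_top fun m _ => ENNReal.add_ne_top.2 ⟨(hγ m).ne, (hγ' m).ne⟩
  -- The estimate holds along the approximations with norms enlarged by the errors `e` and `e'`,
  -- which vanish in the limit.
  refine le_of_tendsto_of_tendsto (hL.sub hL').enorm hlim ?_
  filter_upwards [hγr, hγr', eventually_all.2 fun i => (t1 i).eventually (gt_mem_nhds (hγ i)),
    eventually_all.2 fun i => (t2 i).eventually (gt_mem_nhds (hγ' i))] with t a1 a2 b1 b2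
  have c1 : ∀ i, A.norm (N (Fin.succ i)) (γr t i) ≤ A.norm (N (Fin.succ i)) (γ i) + e i t :=
    fun i => hnear (hN.gauge _) _ _
  have c2 : ∀ i, A.norm (N (Fin.succ i)) (γr' t i) ≤ A.norm (N (Fin.succ i)) (γ' i) + e' i t :=
    fun i => hnear (hN.gauge _) _ _
  refine (hb _ _ _ _ hlam hlam' (fun i => (c1 i).trans_lt (b1 i)) a1
    (fun i => (c2 i).trans_lt (b2 i)) a2).trans ?_
  gcongr with i _ i
  · exact c1 i
  · have : γr t i - γr' t i = (γ i - γ' i) + ((γr t i - γ i) - (γr' t i - γ' i)) := by abel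
    rw [this]
    exact (A.norm_add_le (hN.gauge _) _ _).trans (by gcongr; exact A.norm_sub_le (hN.gauge _) _ _)
  · exact c1 _
  · exact c2 _

end Limits

end DistJacobian

namespace DistJacobian

/-! ### Hölder forms -/

section HolderForms

/-- Points at distance at most `1` keep their Hölder constant, points further apart are compared
through the supremum with constant `2`; together with the supremum itself this makes `3`. -/
theorem holderNorm_le_of_le {n : ℕ} {α α' : NNReal} (hα : α' ≤ α)
    (D : Set (EuclideanSpace ℝ (Fin n))) (f : EuclideanSpace ℝ (Fin n) → ℝ) :
    holderNorm α' D f ≤ 3 * holderNorm α D f := by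
  rcases eq_or_ne (holderNorm α D f) ⊤ with h | h
  · rw [h, ENNReal.mul_top (by norm_num)]
    exact le_top
  have h' := h.lt_top
  set a := (holderNorm α D f).toReal
  have ha : 0 ≤ a := ENNReal.toReal_nonneg
  refine (holderNorm_le (A := a) (B := 2 * a) ha (by positivity)
    (fun x hx => abs_le_of_holderNorm h' hx) fun x hx y hy => ?_).trans ?_
  · rcases le_or_gt ‖x - y‖ 1 with hle | hgt
    · refine (abs_sub_le_of_holderNorm h' hx hy).trans ?_
      have h1 : ‖x - y‖ ^ (α : ℝ) ≤ ‖x - y‖ ^ (α' : ℝ) := by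
        rcases eq_or_lt_of_le (norm_nonneg (x - y)) with h0 | hpos
        · rcases eq_or_lt_of_le α'.coe_nonneg with h2 | h2
          · rw [← h2, Real.rpow_zero]
            exact Real.rpow_le_one (norm_nonneg _) hle α.coe_nonneg
          · have h3 : (α' : ℝ) ≤ α := by exact_mod_cast hα
            rw [← h0, Real.zero_rpow h2.ne', Real.zero_rpow (h2.trans_le h3).ne']
        · exact Real.rpow_le_rpow_of_exponent_ge hpos hle (by exact_mod_cast hα)
      have h2 : 0 ≤ ‖x - y‖ ^ (α' : ℝ) := by positivity
      nlinarith [mul_le_mul_of_nonneg_left h1 ha, mul_nonneg ha h2]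
    · have h1 : 1 ≤ ‖x - y‖ ^ (α' : ℝ) := Real.one_le_rpow hgt.le α'.coe_nonneg
      have h2 := abs_sub (f x) (f y)
      nlinarith [abs_le_of_holderNorm h' hx, abs_le_of_holderNorm h' hy,
        mul_le_mul_of_nonneg_left h1 ha]
  · have e : a + 2 * a = 3 * a := by ring
    rw [e, ENNReal.ofReal_mul (by norm_num), ENNReal.ofReal_toReal h]
    simp

variable {n : ℕ} {H : Type*} [TopologicalSpace H]
  {I : ModelWithCorners ℝ (EuclideanSpace ℝ (Fin n)) H}
  {M : Type*} [TopologicalSpace M] [ChartedSpace H M]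

theorem GoodCover.norm_holderNorm_le_of_le (A : GoodCover I M) {α α' : NNReal} (hα : α' ≤ α) {m : ℕ}
    (γ : Form I M m) : A.norm (holderNorm α') γ ≤ 3 * A.norm (holderNorm α) γ := by
  unfold GoodCover.norm
  simp only [Finset.mul_sum]
  exact Finset.sum_le_sum fun i _ => Finset.sum_le_sum fun s _ => holderNorm_le_of_le hα _ _

/-- The condition on the exponents is open, so all `β i` can be multiplied by some `θ < 1`. This
makes room for averages, which converge only in weaker Hölder norms. -/
theorem exists_smaller_exponents {k : ℕ} {α : NNReal} {β : Fin k → NNReal}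
    (hβ : ∀ i, 0 < β i) (h : (k : NNReal) < α + ∑ i, β i) :
    ∃ β' : Fin k → NNReal, (∀ i, 0 < β' i ∧ β' i < β i) ∧ (k : NNReal) < α + ∑ i, β' i := by
  have hc : Continuous fun θ : NNReal => α + ∑ i, θ * β i := by fun_prop
  have h1 : ∀ᶠ θ in 𝓝[<] (1 : NNReal), (k : NNReal) < α + ∑ i, θ * β i :=
    nhdsWithin_le_nhds (hc.tendsto 1 (lt_mem_nhds (by simpa using h)))
  have : (𝓝[<] (1 : NNReal)).NeBot := nhdsLT_neBot_of_exists_lt ⟨0, zero_lt_one⟩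
  obtain ⟨θ, hθ, h0, hlt⟩ := (h1.and (Ioo_mem_nhdsLT (zero_lt_one (α := NNReal)))).exists
  exact ⟨fun i => θ * β i, fun i => ⟨mul_pos h0 (hβ i), mul_lt_of_lt_one_left (hβ i) hlt⟩, hθ⟩

variable {k ℓ : ℕ} {d : Fin k → ℕ} (hdeg : ℓ + ∑ i, (d i + 1) = n)

/-- The norms in the Hölder estimates. -/
noncomputable def holderNorms (n : ℕ) (α : NNReal) (β : Fin k → NNReal) :
    Fin (k + 1) → Set (EuclideanSpace ℝ (Fin n)) → (EuclideanSpace ℝ (Fin n) → ℝ) → ENNReal :=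
  fun s => holderNorm ((Fin.cons α β : Fin (k + 1) → NNReal) s)

theorem isIntegralBound_holderNorms {R : Set (EuclideanSpace ℝ (Fin n))} (hR : IsModelRange R)
    {α : NNReal} {β : Fin k → NNReal} (hα0 : 0 < α) (hα1 : α ≤ 1) (hβ : ∀ i, 0 < β i ∧ β i ≤ 1)
    (h : (k : NNReal) < α + ∑ i, β i) : IsIntegralBound R (holderNorms n α β) := by
  refine isIntegralBound_holderNorm hR (fun s => ?_) (fun s => ?_) ?_
  · exact Fin.cases hα0 (fun i => (hβ i).1) s
  · exact Fin.cases hα1 (fun i => (hβ i).2) s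
  · rw [Fin.sum_univ_succ]
    exact_mod_cast h

variable [IsManifold I ∞ M] [CompactSpace M] [T2Space M]
  {o : ManifoldOrientation I M} {A : GoodCover I M} {ι : Type*} [Fintype ι]

theorem FormLocalization.tendsto_norm_holderNorm_regularize_sub
    (F : FormLocalization o A (range I) ι) {φ : EuclideanSpace ℝ (Fin n) → ℝ}
    (hφ : IsKernel (range I) φ) {β β' : NNReal} (hβ1 : β ≤ 1) (hβ : β' < β) {m : ℕ}
    {γ : Form I M m} (hγ : γ.HasCoeffs (MemHolderSpace β)) :
    Tendsto (fun t => A.norm (holderNorm β') (F.regularize φ γ t - γ)) (𝓝[>] 0) (𝓝 0) := by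
  have hcut := fun j s => F.cut_lt_top (isGauge_holderNorm hβ1) (hγ.norm_lt_top A) j s
  obtain ⟨ρ, hρ⟩ := F.exists_radius
  refine F.tendsto_norm_regularize_sub (isGauge_holderNorm (hβ.le.trans hβ1)) fun j s =>
    tendsto_holderNorm_mol_sub hφ hβ (hcut j s) ?_
  exact (integrable_of_holderNorm (pos_of_gt hβ) I.isClosed_range (hcut j s)
    (fun x hx => F.cut_eq_zero j s γ hx) fun x hx => indicator_of_notMem (hρ j x hx) _).locallyIntegrable

theorem FormLocalization.regularize_hasCoeffs_of_holder
    (F : FormLocalization o A (range I) ι) {φ : EuclideanSpace ℝ (Fin n) → ℝ}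
    (hφ : IsKernel (range I) φ) {β : NNReal} (hβ0 : 0 < β) (hβ1 : β ≤ 1) {m : ℕ}
    {γ : Form I M m} (hγ : γ.HasCoeffs (MemHolderSpace β)) {t : ℝ} (ht : 0 < t) :
    (F.regularize φ γ t).HasCoeffs (MemHolderSpace 1) := by
  have hcut := fun j s => F.cut_lt_top (isGauge_holderNorm hβ1) (hγ.norm_lt_top A) j s
  obtain ⟨ρ, hρ⟩ := F.exists_radius
  exact F.regularize_hasCoeffs subset_rfl hφ (fun j s => (integrable_of_holderNorm hβ0
    I.isClosed_range (hcut j s) (fun x hx => F.cut_eq_zero j s γ hx)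
      fun x hx => indicator_of_notMem (hρ j x hx) _).locallyIntegrable) ht

/-- The generalized integral of Hölder forms is the limit along one family of approximations. -/
theorem FormLocalization.isHolderIntegral_iff (F : FormLocalization o A (range I) ι)
    (hI : IsModelRange (range I)) {φ : EuclideanSpace ℝ (Fin n) → ℝ} (hφ : IsKernel (range I) φ)
    {α : NNReal} {β : Fin k → NNReal} (hα0 : 0 < α) (hα1 : α ≤ 1) (hβ : ∀ i, 0 < β i ∧ β i ≤ 1)
    (hsum : (k : NNReal) < α + ∑ i, β i) {lam : Form I M ℓ} {γ : ∀ i, Form I M (d i)}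
    (hlam : lam.HasCoeffs (MemHolderSpace α)) (hγ : ∀ i, (γ i).HasCoeffs (MemHolderSpace (β i)))
    {L : ℝ} : IsHolderIntegral o A hdeg α β lam γ L ↔
      Tendsto (fun t => formIntegral o (wedgeD hdeg lam fun i => F.regularize φ (γ i) t))
        (𝓝[>] 0) (𝓝 L) := by
  have hreg : ∀ t > 0, ∀ i, (F.regularize φ (γ i) t).HasCoeffs (MemHolderSpace 1) := fun t ht i =>
    F.regularize_hasCoeffs_of_holder hφ (hβ i).1 (hβ i).2 (hγ i) ht
  constructor
  · intro h
    -- The averages form an admissible family for exponents strictly below `β`.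
    obtain ⟨β', hβ', hsum'⟩ := exists_smaller_exponents (fun i => (hβ i).1) hsum
    refine h α β' hα0 le_rfl (fun i => ⟨(hβ' i).1, (hβ' i).2.le⟩) hsum' (fun _ => lam)
      (fun t i => F.regularize φ (γ i) t) (fun _ _ => hlam) hreg ?_ fun i =>
        F.tendsto_norm_holderNorm_regularize_sub hφ (hβ i).2 (hβ' i).2 (hγ i)
    simp only [sub_self, A.norm_zero (isGauge_holderNorm hα1)]
    exact tendsto_const_nhds
  · intro hL α' β' hα'0 hα' hβ' hsum' lamε γε _ hγε hlamε hγε'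
    -- The given family converges for `β'`, which may equal `β`, where the averages need not
    -- converge. Below `β'` both families converge and can be compared.
    obtain ⟨β'', hβ'', hsum''⟩ := exists_smaller_exponents (fun i => (hβ' i).1) hsum'
    have hN := isIntegralBound_holderNorms hI hα'0 (hα'.trans hα1) (fun i =>
      ⟨(hβ'' i).1, (hβ'' i).2.le.trans ((hβ' i).2.trans (hβ i).2)⟩) hsum''
    have hlt : ∀ {m : ℕ} {a b : NNReal} {η : Form I M m}, b ≤ a →
        η.HasCoeffs (MemHolderSpace a) → A.norm (holderNorm b) η < ⊤ := fun hba hη =>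
      (A.norm_holderNorm_le_of_le hba _).trans_lt
        (ENNReal.mul_lt_top (by norm_num) (hη.norm_lt_top A))
    refine F.tendsto_formIntegral_of_reference hdeg subset_rfl hI.isClosed hI.convex hN
      (lam := lam) (γ := γ) (hlt hα' hlam)
      (fun i => hlt ((hβ'' i).2.le.trans (hβ' i).2) (hγ i)) ?_ (fun i => ?_) hL ?_ hlamε fun i => ?_
    · filter_upwards [self_mem_nhdsWithin] with t ht i
      exact (hreg t ht i).norm_lt_top A
    · exact F.tendsto_norm_holderNorm_regularize_sub hφ (hβ i).2
        ((hβ'' i).2.trans_le (hβ' i).2) (hγ i)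
    · filter_upwards [self_mem_nhdsWithin] with t ht i
      exact (hγε t ht i).norm_lt_top A
    · refine tendsto_of_tendsto_of_tendsto_of_le_of_le tendsto_const_nhds
        (h := fun t => 3 * A.norm (holderNorm (β' i)) (γε t i - γ i)) ?_ (fun _ => zero_le)
        fun t => A.norm_holderNorm_le_of_le (hβ'' i).2.le _
      simpa using ENNReal.Tendsto.const_mul (hγε' i) (Or.inr (by norm_num : (3 : ENNReal) ≠ ⊤))

theorem FormLocalization.existsUnique_isHolderIntegral (F : FormLocalization o A (range I) ι)
    (hI : IsModelRange (range I)) {φ : EuclideanSpace ℝ (Fin n) → ℝ} (hφ : IsKernel (range I) φ)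
    {α : NNReal} {β : Fin k → NNReal} (hα0 : 0 < α) (hα1 : α ≤ 1) (hβ : ∀ i, 0 < β i ∧ β i ≤ 1)
    (hsum : (k : NNReal) < α + ∑ i, β i) {lam : Form I M ℓ} {γ : ∀ i, Form I M (d i)}
    (hlam : lam.HasCoeffs (MemHolderSpace α)) (hγ : ∀ i, (γ i).HasCoeffs (MemHolderSpace (β i))) :
    ∃! L : ℝ, IsHolderIntegral o A hdeg α β lam γ L := by
  simp only [F.isHolderIntegral_iff hdeg hI hφ hα0 hα1 hβ hsum hlam hγ]
  obtain ⟨β', hβ', hsum'⟩ := exists_smaller_exponents (fun i => (hβ i).1) hsum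
  have hN := isIntegralBound_holderNorms hI hα0 hα1 (fun i =>
    ⟨(hβ' i).1, (hβ' i).2.le.trans (hβ i).2⟩) hsum'
  obtain ⟨L, hL⟩ := F.exists_tendsto_formIntegral hdeg subset_rfl hI.isClosed hI.convex hN
    (lam := lam) (γ := γ) (γr := fun t i => F.regularize φ (γ i) t) (hlam.norm_lt_top A)
    (fun i => (A.norm_holderNorm_le_of_le (hβ' i).2.le _).trans_lt
        (ENNReal.mul_lt_top (by norm_num) ((hγ i).norm_lt_top A)))
    (by
      filter_upwards [self_mem_nhdsWithin] with t ht i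
      exact (F.regularize_hasCoeffs_of_holder hφ (hβ i).1 (hβ i).2 (hγ i) ht).norm_lt_top A)
    fun i => F.tendsto_norm_holderNorm_regularize_sub hφ (hβ i).2 (hβ' i).2 (hγ i)
  exact ⟨L, hL, fun L' hL' => tendsto_nhds_unique hL' hL⟩

/-- In the first product one factor is separated, which needs `k ≥ 1`; the remaining `k - 1`
factors, and those of the other products, are bounded by the total sum. -/
theorem sum_mul_prod_le {a b : ENNReal} (hk : 1 ≤ k) (g g' e : Fin k → ENNReal) :
    a * ∏ i, g i + b * ∑ i, e i * ∏ m ∈ Finset.univ.erase i, (g m + g' m) ≤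
      (a * ∑ i, g i + b * ∑ i, e i) * (∑ i, g i + ∑ i, g' i) ^ (k - 1) := by
  have hle : ∀ m, g m + g' m ≤ ∑ i, g i + ∑ i, g' i := fun m =>
    add_le_add (Finset.single_le_sum (f := g) (fun _ _ => zero_le) (Finset.mem_univ m))
      (Finset.single_le_sum (f := g') (fun _ _ => zero_le) (Finset.mem_univ m))
  have hp : ∀ i : Fin k, ∏ m ∈ Finset.univ.erase i, (g m + g' m) ≤
      (∑ i, g i + ∑ i, g' i) ^ (k - 1) := fun i => by
    have := Finset.prod_le_pow_card (Finset.univ.erase i) (fun m => g m + g' m) _ fun m _ => hle m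
    rwa [Finset.card_erase_of_mem (Finset.mem_univ i), Finset.card_univ, Fintype.card_fin] at this
  rw [add_mul, mul_assoc a, mul_assoc b, Finset.sum_mul Finset.univ e]
  have i0 : Fin k := ⟨0, hk⟩
  gcongr a * ?_ + b * ∑ i, e i * ?_ with i _
  · rw [← Finset.mul_prod_erase _ g (Finset.mem_univ i0)]
    refine mul_le_mul' ?_ ?_
    · exact Finset.single_le_sum (f := g) (fun _ _ => zero_le) (Finset.mem_univ i0)
    · exact (Finset.prod_le_prod' fun m _ => le_self_add).trans (hp i0)
  · exact hp i

/-- The estimate is first obtained for exponents below `β`, for which the averages converge. The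
right-hand side has degree `k` in the norms of `γ`, `γ'` and their difference, so returning to `β`
costs `3 ^ k`. -/
theorem FormLocalization.exists_isHolderIntegral_sub_le (F : FormLocalization o A (range I) ι)
    (hI : IsModelRange (range I)) {φ : EuclideanSpace ℝ (Fin n) → ℝ} (hφ : IsKernel (range I) φ)
    (hk : 1 ≤ k) {α β : NNReal} (hα0 : 0 < α) (hα1 : α ≤ 1) (hβ0 : 0 < β) (hβ1 : β ≤ 1)
    (hsum : (k : NNReal) < α + k * β) :
    ∃ C : NNReal, ∀ (lam lam' : Form I M ℓ) (γ γ' : ∀ i, Form I M (d i)) (L L' : ℝ),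
      lam.HasCoeffs (MemHolderSpace α) → lam'.HasCoeffs (MemHolderSpace α) →
      (∀ i, (γ i).HasCoeffs (MemHolderSpace β)) → (∀ i, (γ' i).HasCoeffs (MemHolderSpace β)) →
      IsHolderIntegral o A hdeg α (fun _ => β) lam γ L →
      IsHolderIntegral o A hdeg α (fun _ => β) lam' γ' L' →
      ENNReal.ofReal |L - L'| ≤
        C * (A.norm (holderNorm α) (lam - lam') * (∑ i, A.norm (holderNorm β) (γ i)) +
            A.norm (holderNorm α) lam' * (∑ i, A.norm (holderNorm β) (γ i - γ' i))) *
          ((∑ i, A.norm (holderNorm β) (γ i)) + ∑ i, A.norm (holderNorm β) (γ' i)) ^ (k - 1) := by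
  have hsum1 : (k : NNReal) < α + ∑ _i : Fin k, β := by simpa using hsum
  obtain ⟨β', hβ', hsum'⟩ := exists_smaller_exponents (fun _ => hβ0) hsum1
  have hN := isIntegralBound_holderNorms hI hα0 hα1 (fun i =>
    ⟨(hβ' i).1, (hβ' i).2.le.trans hβ1⟩) hsum'
  obtain ⟨C, hC, hb⟩ := F.exists_enorm_limit_sub_le hdeg subset_rfl hI.isClosed hI.convex hN
  refine ⟨C.toNNReal * 3 ^ k, fun lam lam' γ γ' L L' hlam hlam' hγ hγ' hL hL' => ?_⟩
  rw [F.isHolderIntegral_iff hdeg hI hφ hα0 hα1 (fun _ => ⟨hβ0, hβ1⟩) hsum1 hlam hγ] at hL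
  rw [F.isHolderIntegral_iff hdeg hI hφ hα0 hα1 (fun _ => ⟨hβ0, hβ1⟩) hsum1 hlam' hγ'] at hL'
  have hle : ∀ i (η : Form I M (d i)), A.norm (holderNorm (β' i)) η ≤ 3 * A.norm (holderNorm β) η :=
    fun i η => A.norm_holderNorm_le_of_le (hβ' i).2.le η
  have hfin : ∀ i (η : Form I M (d i)), η.HasCoeffs (MemHolderSpace β) →
      A.norm (holderNorm (β' i)) η < ⊤ := fun i η hη =>
    (hle i η).trans_lt (ENNReal.mul_lt_top (by norm_num) (hη.norm_lt_top A))
  have hreg : ∀ γ : ∀ i, Form I M (d i), (∀ i, (γ i).HasCoeffs (MemHolderSpace β)) →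
      ∀ᶠ t in 𝓝[>] (0 : ℝ), ∀ i, A.norm (holderNorm 1) (F.regularize φ (γ i) t) < ⊤ := by
    intro γ hγ
    filter_upwards [self_mem_nhdsWithin] with t ht i
    exact (F.regularize_hasCoeffs_of_holder hφ hβ0 hβ1 (hγ i) ht).norm_lt_top A
  have h1 := hb lam lam' γ γ' (fun t i => F.regularize φ (γ i) t)
    (fun t i => F.regularize φ (γ' i) t) L L' (hlam.norm_lt_top A) (hlam'.norm_lt_top A)
    (fun i => hfin i _ (hγ i)) (fun i => hfin i _ (hγ' i)) (hreg γ hγ) (hreg γ' hγ')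
    (fun i => F.tendsto_norm_holderNorm_regularize_sub hφ hβ1 (hβ' i).2 (hγ i))
    (fun i => F.tendsto_norm_holderNorm_regularize_sub hφ hβ1 (hβ' i).2 (hγ' i)) hL hL'
  rw [Real.enorm_eq_ofReal_abs] at h1
  refine h1.trans ((mul_le_mul_right (sum_mul_prod_le hk _ _ _) C).trans ?_)
  have h3 : (3 : ENNReal) ^ k = 3 * 3 ^ (k - 1) := by rw [← pow_succ', Nat.sub_add_cancel hk]
  calc C * ((A.norm (holderNorm α) (lam - lam') * (∑ i, A.norm (holderNorm (β' i)) (γ i)) +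
            A.norm (holderNorm α) lam' * (∑ i, A.norm (holderNorm (β' i)) (γ i - γ' i))) *
          ((∑ i, A.norm (holderNorm (β' i)) (γ i)) +
            ∑ i, A.norm (holderNorm (β' i)) (γ' i)) ^ (k - 1))
      ≤ C * ((A.norm (holderNorm α) (lam - lam') * (∑ i, 3 * A.norm (holderNorm β) (γ i)) +
            A.norm (holderNorm α) lam' * (∑ i, 3 * A.norm (holderNorm β) (γ i - γ' i))) *
          ((∑ i, 3 * A.norm (holderNorm β) (γ i)) +
            ∑ i, 3 * A.norm (holderNorm β) (γ' i)) ^ (k - 1)) := by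
        gcongr <;> exact hle _ _
    _ = _ := by
        simp only [← Finset.mul_sum, ← mul_add, mul_pow, ENNReal.coe_mul, ENNReal.coe_toNNReal hC,
          ENNReal.coe_pow, ENNReal.coe_ofNat, h3]
        ring

end HolderForms

/-! ### Sobolev forms -/

section SobolevForms

variable {n : ℕ} {H : Type*} [TopologicalSpace H]
  {I : ModelWithCorners ℝ (EuclideanSpace ℝ (Fin n)) H}
  {M : Type*} [TopologicalSpace M] [ChartedSpace H M]
  {k ℓ : ℕ} {d : Fin k → ℕ} (hdeg : ℓ + ∑ i, (d i + 1) = n)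

/-- The norms in the Sobolev estimates. -/
noncomputable def sobolevNorms (n : ℕ) (q : ℝ) (p : Fin k → ℝ) :
    Fin (k + 1) → Set (EuclideanSpace ℝ (Fin n)) → (EuclideanSpace ℝ (Fin n) → ℝ) → ENNReal :=
  fun s => sobolevNorm' (1 - 1 / (Fin.cons q p : Fin (k + 1) → ℝ) s)
    ((Fin.cons q p : Fin (k + 1) → ℝ) s)

theorem isIntegralBound_sobolevNorms (hn : 0 < n) {q : ℝ} {p : Fin k → ℝ} (hq : 1 < q)
    (hp : ∀ i, 1 < p i) (h : 1 / q + ∑ i, 1 / p i = 1) :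
    IsIntegralBound univ (sobolevNorms n q p) := by
  refine isIntegralBound_sobolevNorm' hn (fun s => ?_) ?_
  · exact Fin.cases hq hp s
  · rw [Fin.sum_univ_succ]
    exact h

variable [IsManifold I ∞ M] [CompactSpace M] [T2Space M]
  {o : ManifoldOrientation I M} {A : GoodCover I M} {ι : Type*} [Fintype ι]

/-- All forms under consideration have measurable coefficients, so the auxiliary norm used as a
gauge measures the same convergence as the actual one. -/
theorem GoodCover.norm_sobolevNorm'_sub (A : GoodCover I M) {s p : ℝ} {m : ℕ} {γ γ' : Form I M m}
    (h : γ.HasCoeffs fun D f => AEStronglyMeasurable f (volume.restrict D))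
    (h' : γ'.HasCoeffs fun D f => AEStronglyMeasurable f (volume.restrict D)) :
    A.norm (sobolevNorm' s p) (γ - γ') = A.norm (sobolevNorm s p) (γ - γ') :=
  Finset.sum_congr rfl fun i _ => Finset.sum_congr rfl fun b _ =>
    if_pos ((h (A.chart i) b).sub (h' (A.chart i) b))

theorem Form.HasCoeffs.aestronglyMeasurable_of_holder {m : ℕ} {γ : Form I M m}
    (h : γ.HasCoeffs (MemHolderSpace 1)) :
    γ.HasCoeffs fun D f => AEStronglyMeasurable f (volume.restrict D) := fun c s =>
  (continuousOn_of_holderNorm one_pos (h c s)).aestronglyMeasurable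
    (c.measurableSet_image I.isClosed_range)

theorem Form.HasCoeffs.norm_sobolevNorm'_lt_top {m : ℕ} {γ : Form I M m} {s p : ℝ}
    (h : γ.HasCoeffs (MemSobolevSpace s p)) (A : GoodCover I M) :
    A.norm (sobolevNorm' s p) γ < ⊤ :=
  Form.HasCoeffs.norm_lt_top (fun c b => sobolevNorm'_lt_top.2 (h c b)) A

/-- The generalized integral of Sobolev forms is the limit along one family of approximations. -/
theorem FormLocalization.existsUnique_isSobolevIntegral (F : FormLocalization o A univ ι)
    {φ : EuclideanSpace ℝ (Fin n) → ℝ} (hφ : IsKernel univ φ) (hn : 0 < n)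
    {q : ℝ} {p : Fin k → ℝ} (hq : 1 < q) (hp : ∀ i, 1 < p i) (hsum : 1 / q + ∑ i, 1 / p i = 1)
    {lam : Form I M ℓ} {γ : ∀ i, Form I M (d i)}
    (hlam : lam.HasCoeffs (MemSobolevSpace (1 - 1 / q) q))
    (hγ : ∀ i, (γ i).HasCoeffs (MemSobolevSpace (1 - 1 / p i) (p i))) :
    ∃! L : ℝ, IsSobolevIntegral o A hdeg q p lam γ L := by
  have hN := isIntegralBound_sobolevNorms hn hq hp hsum
  have hg : ∀ i, IsGauge (sobolevNorm' (n := n) (1 - 1 / p i) (p i)) := fun i => hN.gauge i.succ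
  obtain ⟨ρ, hρ⟩ := F.exists_radius
  have hcut := fun i j b => F.cut_lt_top (hg i) ((hγ i).norm_sobolevNorm'_lt_top A) j b
  have hs : ∀ i, 0 < 1 - 1 / p i := fun i => by
    have := (div_lt_one (by linarith [hp i])).2 (hp i)
    linarith
  have hreg : ∀ t > 0, ∀ i, (F.regularize φ (γ i) t).HasCoeffs (MemHolderSpace 1) := fun t ht i =>
    F.regularize_hasCoeffs (subset_univ _) hφ (fun j s => (integrable_of_sobolevNorm' (hp i).le
      (fun x hx => indicator_of_notMem (hρ j x hx) _) (hcut i j s)).locallyIntegrable) ht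
  have hreg' : ∀ᶠ t in 𝓝[>] (0 : ℝ), ∀ i,
      A.norm (holderNorm 1) (F.regularize φ (γ i) t) < ⊤ := by
    filter_upwards [self_mem_nhdsWithin] with t ht i
    exact (hreg t ht i).norm_lt_top A
  -- Averages converge in the Sobolev norm itself, so no exponent is lost; there would be no room
  -- for that at the critical sum.
  have hlim : ∀ i, Tendsto (fun t => A.norm (sobolevNorm' (1 - 1 / p i) (p i))
      (F.regularize φ (γ i) t - γ i)) (𝓝[>] 0) (𝓝 0) := fun i =>
    F.tendsto_norm_regularize_sub (hg i) fun j s =>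
      tendsto_sobolevNorm'_mol_sub hφ (hs i) (hp i).le (hcut i j s)
  obtain ⟨L, hL⟩ := F.exists_tendsto_formIntegral hdeg (subset_univ _) isClosed_univ convex_univ hN
    (lam := lam) (γ := γ) (γr := fun t i => F.regularize φ (γ i) t)
    (hlam.norm_sobolevNorm'_lt_top A) (fun i => (hγ i).norm_sobolevNorm'_lt_top A) hreg' hlim
  have hγm : ∀ i, (γ i).HasCoeffs fun D f => AEStronglyMeasurable f (volume.restrict D) :=
    fun i c s => (hγ i c s).1
  refine ⟨L, fun lamε γε hlamε hγε h h' => ?_, fun L' hL' => tendsto_nhds_unique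
    (hL' (fun _ => lam) (fun t i => F.regularize φ (γ i) t) (fun _ _ => hlam) hreg ?_ fun i => ?_) hL⟩
  · refine F.tendsto_formIntegral_of_reference hdeg (subset_univ _) isClosed_univ convex_univ hN
      (lam := lam) (γ := γ) (hlam.norm_sobolevNorm'_lt_top A)
      (fun i => (hγ i).norm_sobolevNorm'_lt_top A) hreg' hlim hL ?_ (h.congr' ?_)
      fun i => (h' i).congr' ?_
    · filter_upwards [self_mem_nhdsWithin] with t ht i
      exact (hγε t ht i).norm_lt_top A
    · filter_upwards [self_mem_nhdsWithin] with t ht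
      exact (A.norm_sobolevNorm'_sub (fun c s => (hlamε t ht c s).1) fun c s => (hlam c s).1).symm
    · filter_upwards [self_mem_nhdsWithin] with t ht
      exact (A.norm_sobolevNorm'_sub (hγε t ht i).aestronglyMeasurable_of_holder (hγm i)).symm
  · have h0 : A.norm (sobolevNorm (1 - 1 / q) q) (lam - lam) = 0 := by
      rw [← A.norm_sobolevNorm'_sub (fun c s => (hlam c s).1) fun c s => (hlam c s).1, sub_self]
      exact A.norm_zero (hN.gauge 0)
    simp only [h0]
    exact tendsto_const_nhds
  · refine (hlim i).congr' ?_
    filter_upwards [self_mem_nhdsWithin] with t ht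
    exact A.norm_sobolevNorm'_sub (hreg t ht i).aestronglyMeasurable_of_holder (hγm i)

end SobolevForms

end DistJacobian

/-! ### The theorem: existence, uniqueness and the difference estimate -/

theorem theoremT34 {n : ℕ} {H : Type*} [TopologicalSpace H]
    (I : ModelWithCorners ℝ (EuclideanSpace ℝ (Fin n)) H) (hI : DistJacobian.IsBoundaryModel I)
    {M : Type*} [TopologicalSpace M] [ChartedSpace H M] [IsManifold I ∞ M]
    [CompactSpace M] [T2Space M]
    (o : DistJacobian.ManifoldOrientation I M) (A : DistJacobian.GoodCover I M)
    {k ℓ : ℕ} (hk : 1 ≤ k) {d : Fin k → ℕ} (hdeg : ℓ + ∑ i, (d i + 1) = n) :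
    -- Hölder forms, with or without boundary: the integral is well defined
    (∀ (α : NNReal) (β : Fin k → NNReal), 0 < α → α ≤ 1 → (∀ i, 0 < β i ∧ β i ≤ 1) →
      (k : NNReal) < α + ∑ i, β i →
      ∀ (lam : DistJacobian.Form I M ℓ) (γ : ∀ i, DistJacobian.Form I M (d i)),
        lam.HasCoeffs (DistJacobian.MemHolderSpace α) →
        (∀ i, (γ i).HasCoeffs (DistJacobian.MemHolderSpace (β i))) →
        ∃! L : ℝ, DistJacobian.IsHolderIntegral o A hdeg α β lam γ L) ∧
    -- Hölder forms: the multilinear Lipschitz estimate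
    (∀ α β : NNReal, 0 < α → α ≤ 1 → 0 < β → β ≤ 1 → (k : NNReal) < α + k * β →
      ∃ C : NNReal, ∀ (lam lam' : DistJacobian.Form I M ℓ)
        (γ γ' : ∀ i, DistJacobian.Form I M (d i)) (L L' : ℝ),
        lam.HasCoeffs (DistJacobian.MemHolderSpace α) →
        lam'.HasCoeffs (DistJacobian.MemHolderSpace α) →
        (∀ i, (γ i).HasCoeffs (DistJacobian.MemHolderSpace β)) →
        (∀ i, (γ' i).HasCoeffs (DistJacobian.MemHolderSpace β)) →
        DistJacobian.IsHolderIntegral o A hdeg α (fun _ => β) lam γ L →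
        DistJacobian.IsHolderIntegral o A hdeg α (fun _ => β) lam' γ' L' →
        ENNReal.ofReal |L - L'| ≤
          C * (A.norm (DistJacobian.holderNorm α) (lam - lam') *
                (∑ i, A.norm (DistJacobian.holderNorm β) (γ i)) +
              A.norm (DistJacobian.holderNorm α) lam' *
                (∑ i, A.norm (DistJacobian.holderNorm β) (γ i - γ' i))) *
            ((∑ i, A.norm (DistJacobian.holderNorm β) (γ i)) +
              ∑ i, A.norm (DistJacobian.holderNorm β) (γ' i)) ^ (k - 1)) ∧
    -- fractional Sobolev forms on closed manifolds: the integral is well defined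
    (BoundarylessManifold I M →
      ∀ (q : ℝ) (p : Fin k → ℝ), 1 < q → (∀ i, 1 < p i) → 1 / q + ∑ i, 1 / p i = 1 →
      ∀ (lam : DistJacobian.Form I M ℓ) (γ : ∀ i, DistJacobian.Form I M (d i)),
        lam.HasCoeffs (DistJacobian.MemSobolevSpace (1 - 1 / q) q) →
        (∀ i, (γ i).HasCoeffs (DistJacobian.MemSobolevSpace (1 - 1 / p i) (p i))) →
        ∃! L : ℝ, DistJacobian.IsSobolevIntegral o A hdeg q p lam γ L) := by
  have hR : DistJacobian.IsModelRange (range I) := hI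
  obtain ⟨φ, hφ⟩ := hR.exists_isKernel
  -- For Hölder forms the domain is the range of the model, so a boundary is allowed.
  obtain ⟨ι, _, ⟨F⟩⟩ := DistJacobian.exists_localization hR.isClosed hR.convex o A
    hR.isClosed.measurableSet DistJacobian.isLocalRange_range
  refine ⟨fun α β hα0 hα1 hβ hsum lam γ hlam hγ =>
      F.existsUnique_isHolderIntegral hdeg hR hφ hα0 hα1 hβ hsum hlam hγ,
    fun α β hα0 hα1 hβ0 hβ1 hsum =>
      F.exists_isHolderIntegral_sub_le hdeg hR hφ hk hα0 hα1 hβ0 hβ1 hsum,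
    fun _ q p hq hp hsum lam γ hlam hγ => ?_⟩
  obtain ⟨φ', hφ'⟩ := DistJacobian.exists_isKernel_univ (n := n)
  -- Without boundary, the forms are localized once more, now in the whole space.
  obtain ⟨ι', _, ⟨F'⟩⟩ := DistJacobian.exists_localization hR.isClosed hR.convex o A
    MeasurableSet.univ DistJacobian.isLocalRange_univ
  -- Since `k ≥ 1`, some `dγ_i` is present and has degree at least one. Positive dimension is needed
  -- for polar coordinates in the Gagliardo kernel estimate.
  have hn : 0 < n := by
    have h1 : d ⟨0, hk⟩ + 1 ≤ ∑ i, (d i + 1) :=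
      Finset.single_le_sum (f := fun i => d i + 1) (fun _ _ => Nat.zero_le _) (Finset.mem_univ _)
    omega
  exact F'.existsUnique_isSobolevIntegral hdeg hφ' hn hq hp hsum hlam hγ
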